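/- Let $p\ge 2$ be an integer and let $a_1,\dots,a_p\in\mathbb R$ satisfy $a_{k\ell}:=\sum_{j=k}^{\ell}a_j>-1$ for all $1\le k\le \ell\le p$; put $a_{k,k-1}:=0$. Let $A_1,\dots,A_{p+1}$ be determined by $A_{j+1}-A_j=(p+1)a_j$ $(1\le j\le p)$ and $\sum_{j=1}^{p+1}A_j=0$. All powers are principal, $\mathbb H^{\pm}=\{\zeta\in\mathbb C:\pm\operatorname{Im}\zeta>0\}$, $\Delta_\zeta=\zeta\frac{d}{d\zeta}$, and $\sigma_j\in\{0,1\}$ is $(j+1)\bmod 2$. **Construction.** For $1\le j\le p+1$ and $\zeta\in\mathbb C\setminus(-\infty,0]$ let $$g_j^{(\pm)}(\zeta)=\frac{c_j}{2\pi i}\int_L\frac{\prod_{\ell=1}^{j}\Gamma(s+a_{\ell,j-1})}{\prod_{\ell=j}^{p}\Gamma(1+a_{j\ell}-s)}\,e^{\pm i\pi s\sigma_j}\,\zeta^{-s}\,ds,\qquad c_j=(2\pi i)^{p+1-j}\sqrt{\frac{p+1}{(2\pi)^p}},$$ where $L$ is a loop $-\infty-ih\to R-ih\to R+ih\to-\infty+ih$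 with $h>0$ and $R>0$, $R>-a_{k\ell}$ for all $1\le k\le\ell\le p$ (so that all singularities of the integrands lie to the left of $L$). Let $$\mathbb G^{(\pm)}(\zeta)=\Big[(\Delta_\zeta-a_{1,k-1})^{j-1}g_k^{(\pm)}(\zeta)\Big]_{j,k=1}^{p+1},\qquad \mathbb G=\mathbb G^{(\pm)}\text{ on }\mathbb H^{\pm}.$$ For $s\in\{1,2\}$ and $2\times2$ matrices $B_m$ write $\mathcal D_s[B_m]$ for the block diagonal $(p+1)\times(p+1)$ matrix which has the block $B_m$ on the index pair $(m,m+1)$ for every $1\le m\le p$ with $m\equiv s\bmod 2$, and $1$ at the remaining diagonal positions. Define $G^{(p)}(\zeta)=\mathbb G(\zeta)T(\zeta)$ with $$T(\zeta)=\begin{cases} I,&\arg\zeta\in(-\frac{3\pi}4,-\frac{\pi}4)\cup(\frac{\pi}4,\frac{3\pi}4),\\ \mathcal D_2\begin{bmatrix}1&0\\ \zeta^{-a_m}e^{i\pi a_m}&1\end{bmatrix},&\arg\zeta\in(\frac{3\pi}4,\pi),\\ \mathcal D_1\begin{bmatrix}1&0\\ -\zeta^{-a_m}&1\end{bmatrix},&\arg\zeta\in(0,\frac{\pi}4),\\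 \mathcal D_2\begin{bmatrix}1&0\\ -\zeta^{-a_m}e^{-i\pi a_m}&1\end{bmatrix},&\arg\zeta\in(-\pi,-\frac{3\pi}4),\\ \mathcal D_1\begin{bmatrix}1&0\\ \zeta^{-a_m}&1\end{bmatrix},&\arg\zeta\in(-\frac{\pi}4,0).\end{cases}$$ **Theorem.** The integrals defining $g_j^{(\pm)}(\zeta)$ converge absolutely, the $g_j^{(\pm)}$ are analytic in $\mathbb C\setminus(-\infty,0]$, and $G=G^{(p)}$ has the following properties. 1. $G$ is analytic in $\mathbb C$ minus the rays $\mathfrak r_0=\mathbb R_+$, $\mathfrak r_{1,2}=e^{\pm i\pi/4}\mathbb R_+$, $\mathfrak r_{3,4}=e^{\pm 3i\pi/4}\mathbb R_+$, $\mathfrak r_5=-\mathbb R_+$ (all containing $0$). 2. With all rays oriented from $0$ to $\infty$, at every point $\zeta\neq0$ of $\mathfrak r_\ell$ the boundary values $G_+$ (from the left) and $G_-$ (from the right) exist and $G_+(\zeta)=G_-(\zeta)J_\ell(\zeta)$, where $$J_0=\mathcal D_1\begin{bmatrix}0&\zeta^{a_m}\\-\zeta^{-a_m}&0\end{bmatrix},\quad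 J_1=J_2=\mathcal D_1\begin{bmatrix}1&0\\ \zeta^{-a_m}&1\end{bmatrix},\quad J_{3,4}=\mathcal D_2\begin{bmatrix}1&0\\ \zeta^{-a_m}e^{\pm i\pi a_m}&1\end{bmatrix},\quad J_5=\mathcal D_2\begin{bmatrix}0&(-\zeta)^{a_m}\\-(-\zeta)^{-a_m}&0\end{bmatrix}.$$ 3. As $\zeta\to0$ with $\frac{\pi}4<|\arg\zeta|<\frac{3\pi}4$, the first column of $G$ is $\mathcal O(1)$, and for $1\le\ell\le p$ the norm of the column $\ell+1$ is of the same order (bounded above and below by positive constant multiples) as the modulus of the iterated Cauchy transform $$\mathcal C_{\ell+1}(\zeta)=\int_0^1\!\!\cdots\!\int_0^1\Big(\prod_{j=1}^{\ell-1}\frac{x_j^{a_j}}{x_j+x_{j+1}}\Big)\frac{x_\ell^{a_\ell}}{x_\ell+(-1)^{\ell}\zeta}\,dx_1\cdots dx_\ell .$$ 4. As $\zeta\to\infty$ in $\mathbb H^{\pm}$ off the rays, uniformly, $$G(\zeta)=\zeta^{-\frac{\lambda}{2(p+1)}}\,U^{\pm}\Big(I+\mathcal O\big(\zeta^{-\frac1{p+1}}\big)\Big)\zeta^{\frac{A}{p+1}}\exp\!\Big[-(p+1)\zeta^{\frac1{p+1}}\Omega_{\pm}\Big],$$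 where $\lambda=\mathrm{diag}(p,p-2,\dots,-p)$, $A=\mathrm{diag}(A_1,\dots,A_{p+1})$, $\omega=e^{i\frac{\pi}{2}\frac{p}{p+1}}$, and, with $q_k=p-2\lfloor\frac{k-1}{2}\rfloor$, $$\Omega_\pm=\mathrm{diag}\Big(\omega^{\pm(-1)^{k-1}\frac2p q_k}\Big)_{k=1}^{p+1},\qquad U^-=U^+\,\mathcal D_1\begin{bmatrix}0&-1\\1&0\end{bmatrix},$$ $$U^+_{jk}=\epsilon_{jk}\;\omega^{(-1)^kq_k}\;\omega^{(-1)^{k-1}\frac2pq_k(j-1)}\;\omega^{(-1)^{k-1}\frac2p\sum_{m=2\lfloor (k-1)/2\rfloor+2}^{p+1}A_m},\qquad \epsilon_{jk}=\begin{cases}(-1)^{j+k-1},&p\text{ odd},\\(-1)^{j-1},&p\text{ even}.\end{cases}$$ -/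

import Mathlib

open Filter Topology Asymptotics MeasureTheory

noncomputable section

namespace CauchyChain

/-! ### Parameters and Mellin-Barnes functions

Indices `j, k, l, m` in this file are the one-based indices of the mathematics, except that a row or
column `i : Fin (p + 1)` of a matrix is zero-based (its one-based index is `i + 1`). -/

/-- `a_{k l} = a_k + ... + a_l`; it is `0` if `l < k`, in particular `a_{k, k-1} = 0`. -/
def partialSum (a : ℕ → ℝ) (k l : ℕ) : ℝ := ∑ m ∈ Finset.Icc k l, a m

/-- The integral of `f` along the loop that comes from `-∞ - i h`, runs to `R - i h`, goes up to
`R + i h` and returns to `-∞ + i h`; the half-strip `Re s < R`, `|Im s| < h` lies to its left. -/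
def loopIntegral (R h : ℝ) (f : ℂ → ℂ) : ℂ :=
  (∫ x in Set.Iic R, f (x - h * Complex.I))
    + (∫ y in (-h)..h, f (R + y * Complex.I)) * Complex.I
    - ∫ x in Set.Iic R, f (x + h * Complex.I)

/-- The three integrals in `loopIntegral R h f` converge absolutely. -/
def LoopIntegrable (R h : ℝ) (f : ℂ → ℂ) : Prop :=
  IntegrableOn (fun x : ℝ => f (x - h * Complex.I)) (Set.Iic R) ∧
    IntervalIntegrable (fun y : ℝ => f (R + y * Complex.I)) volume (-h) h ∧
    IntegrableOn (fun x : ℝ => f (x + h * Complex.I)) (Set.Iic R)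

/-- The integrand of `g_j^{(±)}(ζ)`, with `ε = 1` for `+` and `ε = -1` for `-`. -/
def kernel (p : ℕ) (a : ℕ → ℝ) (j : ℕ) (ε : ℝ) (ζ s : ℂ) : ℂ :=
  (∏ l ∈ Finset.Icc 1 j, Complex.Gamma (s + partialSum a l (j - 1))) /
      (∏ l ∈ Finset.Icc j p, Complex.Gamma (1 + partialSum a j l - s)) *
    Complex.exp (ε * Complex.I * Real.pi * s * ((j + 1) % 2 : ℕ)) * ζ ^ (-s)

/-- `c_j = (2 π i)^{p+1-j} √((p+1) / (2π)^p)`. -/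
def normConst (p j : ℕ) : ℂ :=
  (2 * Real.pi * Complex.I) ^ (p + 1 - j) * (Real.sqrt ((p + 1) / (2 * Real.pi) ^ p) : ℝ)

/-- The function `g_j^{(±)}`, with contour `L` the loop with parameters `R, h`. -/
def gFun (p : ℕ) (a : ℕ → ℝ) (R h : ℝ) (j : ℕ) (ε : ℝ) (ζ : ℂ) : ℂ :=
  normConst p j / (2 * Real.pi * Complex.I) * loopIntegral R h (kernel p a j ε ζ)

/-- The operator `Δ_ζ - c`, where `Δ_ζ = ζ d/dζ`. -/
def eulerOp (c : ℂ) (f : ℂ → ℂ) : ℂ → ℂ := fun ζ => ζ * deriv f ζ - c * f ζ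

/-- The matrix `𝔾^{(±)}(ζ)` with `(j, k)` entry `(Δ_ζ - a_{1,k-1})^{j-1} g_k^{(±)}(ζ)`. -/
def bareMatrixPM (p : ℕ) (a : ℕ → ℝ) (R h ε : ℝ) (ζ : ℂ) :
    Matrix (Fin (p + 1)) (Fin (p + 1)) ℂ :=
  Matrix.of fun i k =>
    ((eulerOp (partialSum a 1 k))^[(i : ℕ)] (gFun p a R h (k + 1) ε)) ζ

/-- `𝔾 = 𝔾^{(+)}` in the upper and `𝔾 = 𝔾^{(-)}` in the lower half plane. -/
def bareMatrix (p : ℕ) (a : ℕ → ℝ) (R h : ℝ) (ζ : ℂ) : Matrix (Fin (p + 1)) (Fin (p + 1)) ℂ :=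
  if 0 < ζ.im then bareMatrixPM p a R h 1 ζ else bareMatrixPM p a R h (-1) ζ

/-! ### Direct sums of blocks -/

/-- `m` is the first (one-based) index of one of the 2 x 2 blocks on the index pairs `(m, m + 1)`,
`1 ≤ m ≤ p`, `m ≡ s mod 2`. -/
def IsBlockStart (p s m : ℕ) : Prop := m % 2 = s % 2 ∧ 1 ≤ m ∧ m ≤ p

instance (p s m : ℕ) : Decidable (IsBlockStart p s m) := by
  unfold IsBlockStart; infer_instance

/-- The block diagonal matrix of size `p + 1` with the 2 x 2 block `B m` on the index pair
`(m, m + 1)` for all `1 ≤ m ≤ p` with `m ≡ s mod 2`, and with `1` at the remaining indices. So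
`s = 1` gives `B 1 ⊕ B 3 ⊕ ...` (followed by `⊕ 1` if `p` is even), and `s = 2` gives
`1 ⊕ B 2 ⊕ B 4 ⊕ ...` (followed by `⊕ 1` if `p` is odd). -/
def blockSum (p s : ℕ) (B : ℕ → Matrix (Fin 2) (Fin 2) ℂ) :
    Matrix (Fin (p + 1)) (Fin (p + 1)) ℂ :=
  Matrix.of fun i k =>
    let m : ℕ := i + 1
    let n : ℕ := k + 1
    if IsBlockStart p s m ∧ n = m then B m 0 0
    else if IsBlockStart p s m ∧ n = m + 1 then B m 0 1
    else if IsBlockStart p s n ∧ m = n + 1 then B n 1 0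
    else if IsBlockStart p s (m - 1) ∧ n = m then B (m - 1) 1 1
    else if n = m then 1 else 0

/-! ### The piecewise defined matrix function -/

/-- The triangular factor that multiplies `𝔾(ζ)`, by the sector in which `ζ` lies (on the six rays,
which belong to no sector, the value is the irrelevant `1`). -/
def sectorFactor (p : ℕ) (a : ℕ → ℝ) (ζ : ℂ) : Matrix (Fin (p + 1)) (Fin (p + 1)) ℂ :=
  let θ := Complex.arg ζ
  if 3 * Real.pi / 4 < θ ∧ θ < Real.pi then
    blockSum p 2 fun m => !![1, 0; ζ ^ (-(a m : ℂ)) * Complex.exp (Complex.I * Real.pi * a m), 1]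
  else if 0 < θ ∧ θ < Real.pi / 4 then
    blockSum p 1 fun m => !![1, 0; -ζ ^ (-(a m : ℂ)), 1]
  else if -Real.pi < θ ∧ θ < -(3 * Real.pi / 4) then
    blockSum p 2 fun m =>
      !![1, 0; -(ζ ^ (-(a m : ℂ)) * Complex.exp (-(Complex.I * Real.pi * a m))), 1]
  else if -(Real.pi / 4) < θ ∧ θ < 0 then
    blockSum p 1 fun m => !![1, 0; ζ ^ (-(a m : ℂ)), 1]
  else 1

/-- The matrix function `G^{(p)}`. -/
def bareParametrix (p : ℕ) (a : ℕ → ℝ) (R h : ℝ) (ζ : ℂ) :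
    Matrix (Fin (p + 1)) (Fin (p + 1)) ℂ :=
  bareMatrix p a R h ζ * sectorFactor p a ζ

/-! ### The Riemann-Hilbert problem -/

/-- The angles of the rays `𝔯_0, ..., 𝔯_5`. -/
def rayAngle : Fin 6 → ℝ :=
  ![0, Real.pi / 4, -(Real.pi / 4), 3 * Real.pi / 4, -(3 * Real.pi / 4), Real.pi]

/-- The unit vector that spans the ray `𝔯_l`, which is oriented from `0` to `∞`. -/
def rayDir (l : Fin 6) : ℂ := Complex.exp (rayAngle l * Complex.I)

/-- The union of the six closed rays. -/
def jumpContour : Set ℂ := {ζ | ∃ l : Fin 6, ∃ t : ℝ, 0 ≤ t ∧ ζ = t * rayDir l}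

/-- The jump matrices `J_0, ..., J_5`. -/
def jumpMatrix (p : ℕ) (a : ℕ → ℝ) (l : Fin 6) (ζ : ℂ) : Matrix (Fin (p + 1)) (Fin (p + 1)) ℂ :=
  let lower : Matrix (Fin (p + 1)) (Fin (p + 1)) ℂ :=
    blockSum p 1 fun m => !![1, 0; ζ ^ (-(a m : ℂ)), 1]
  ![blockSum p 1 fun m => !![0, ζ ^ (a m : ℂ); -ζ ^ (-(a m : ℂ)), 0],
    lower,
    lower,
    blockSum p 2 fun m => !![1, 0; ζ ^ (-(a m : ℂ)) * Complex.exp (Complex.I * Real.pi * a m), 1],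
    blockSum p 2 fun m =>
      !![1, 0; ζ ^ (-(a m : ℂ)) * Complex.exp (-(Complex.I * Real.pi * a m)), 1],
    blockSum p 2 fun m => !![0, (-ζ) ^ (a m : ℂ); -(-ζ) ^ (-(a m : ℂ)), 0]] l

/-- On the open ray spanned by `d`, oriented from `0` to `∞`, the function `G` has boundary values
`Gplus` from the left and `Gminus` from the right side, and `Gplus = Gminus * J`. -/
def HasJump {n : ℕ} (G : ℂ → Matrix (Fin n) (Fin n) ℂ) (d : ℂ)
    (J : ℂ → Matrix (Fin n) (Fin n) ℂ) : Prop :=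
  ∀ t : ℝ, 0 < t → ∃ Gplus Gminus : Matrix (Fin n) (Fin n) ℂ,
    Tendsto G (𝓝[{z | 0 < (z * (starRingEnd ℂ) d).im}] (t * d)) (𝓝 Gplus) ∧
    Tendsto G (𝓝[{z | (z * (starRingEnd ℂ) d).im < 0}] (t * d)) (𝓝 Gminus) ∧
    Gplus = Gminus * J (t * d)

/-- The iterated Cauchy transforms on the positive axis: `stieltjes a 0 = 1` and
`stieltjes a l y = ∫_0^1 x^{a_l} (stieltjes a (l-1) x) / (x + y) dx`. -/
def stieltjes (a : ℕ → ℝ) : ℕ → ℝ → ℝ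
  | 0, _ => 1
  | l + 1, y => ∫ x in (0 : ℝ)..1, x ^ a (l + 1) * stieltjes a l x / (x + y)

/-- The iterated Cauchy transform
`𝒞_{l+1}(z) = ∫_0^1 ⋯ ∫_0^1 (∏_{j<l} x_j^{a_j} / (x_j + x_{j+1})) x_l^{a_l} / (x_l + (-1)^l z) dx`
for `l ≥ 1`; its cut is on the positive axis for odd and on the negative axis for even `l`. -/
def cauchyTransform (a : ℕ → ℝ) (l : ℕ) (z : ℂ) : ℂ :=
  ∫ x in (0 : ℝ)..1, ((x ^ a l * stieltjes a (l - 1) x : ℝ) : ℂ) / (x + (-1) ^ l * z)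

/-- The union of the open sectors at the top and at the bottom. -/
def topBottom : Set ℂ :=
  {ζ | Real.pi / 4 < |Complex.arg ζ| ∧ |Complex.arg ζ| < 3 * Real.pi / 4}

/-- `ω = exp(i π p / (2 (p + 1)))`. All powers of it are principal. -/
def omega (p : ℕ) : ℂ := Complex.exp (Complex.I * (Real.pi / 2) * (p / (p + 1)))

/-- The matrix `U^+`. For the zero-based column `k`, the number `⌊k / 2⌋` is `⌊(k' - 1) / 2⌋` with
the one-based `k' = k + 1`, and the last factor is the diagonal entry with number `k'` of
`⊕_m ω^{(2/p) (A_{2m} + ... + A_{p+1}) σ_3}`, followed by `⊕ 1` if `p` is even. -/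
def matrixUplus (p : ℕ) (A : ℕ → ℝ) : Matrix (Fin (p + 1)) (Fin (p + 1)) ℂ :=
  Matrix.of fun i k =>
    let q : ℂ := p - 2 * (((k : ℕ) / 2 : ℕ) : ℂ)
    (if p % 2 = 1 then (-1) ^ ((k : ℕ) + i + 1) else (-1) ^ (i : ℕ)) *
      omega p ^ ((-1) ^ ((k : ℕ) + 1) * q) *
      omega p ^ ((-1) ^ (k : ℕ) * (2 / p) * q * (i : ℕ)) *
      omega p ^ ((-1) ^ (k : ℕ) * (2 / p) *
        ((∑ m ∈ Finset.Icc (2 * ((k : ℕ) / 2) + 2) (p + 1), A m : ℝ) : ℂ))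

/-- `U^+` for `ε = 1`, and `U^- = U^+ ((-i σ_2) ⊕ (-i σ_2) ⊕ ...)` for `ε = -1`. -/
def matrixU (p : ℕ) (A : ℕ → ℝ) (ε : ℝ) : Matrix (Fin (p + 1)) (Fin (p + 1)) ℂ :=
  if 0 < ε then matrixUplus p A
  else matrixUplus p A * blockSum p 1 fun _ => !![0, -1; 1, 0]

/-- The diagonal entries of `Ω_±`, that is of `⊕_k ω^{± (2/p) (p - 2k) σ_3}`, followed by `⊕ 1` if
`p` is even. -/
def omegaDiag (p : ℕ) (ε : ℝ) (k : Fin (p + 1)) : ℂ :=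
  omega p ^ (ε * (-1) ^ (k : ℕ) * (2 / p) * (p - 2 * (((k : ℕ) / 2 : ℕ) : ℂ)))

/-- The open upper (`ε = 1`) or lower (`ε = -1`) half plane without the rays, near `∞`. -/
def atInfinity (ε : ℝ) : Filter ℂ :=
  Bornology.cobounded ℂ ⊓ 𝓟 ({ζ : ℂ | 0 < ε * ζ.im} \ jumpContour)

/-- The asymptotics at infinity in the half plane given by `ε`,
`G = ζ^{-λ/(2(p+1))} U (I + O(ζ^{-1/(p+1)})) ζ^{A/(p+1)} exp(-(p+1) ζ^{1/(p+1)} Ω)`,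
with `λ = diag(p, p-2, ..., -p)`. -/
def HasAsymptotics (p : ℕ) (A : ℕ → ℝ) (G : ℂ → Matrix (Fin (p + 1)) (Fin (p + 1)) ℂ)
    (ε : ℝ) : Prop :=
  ∃ E : ℂ → Matrix (Fin (p + 1)) (Fin (p + 1)) ℂ,
    (∀ i k, (fun ζ => E ζ i k) =O[atInfinity ε] fun ζ => ‖ζ‖ ^ (-(1 / ((p : ℝ) + 1)))) ∧
    ∀ᶠ ζ in atInfinity ε,
      G ζ =
        Matrix.diagonal (fun i : Fin (p + 1) => ζ ^ (-((p : ℂ) - 2 * (i : ℕ)) / (2 * (p + 1)))) *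
          matrixU p A ε * (1 + E ζ) *
          Matrix.diagonal (fun k : Fin (p + 1) => ζ ^ ((A (k + 1) : ℂ) / (p + 1))) *
          Matrix.diagonal (fun k : Fin (p + 1) =>
            Complex.exp (-(p + 1) * ζ ^ (1 / ((p : ℂ) + 1)) * omegaDiag p ε k))

/-- `G` solves the Riemann-Hilbert problem of the bare parametrix. -/
structure IsBareSolution (p : ℕ) (a A : ℕ → ℝ)
    (G : ℂ → Matrix (Fin (p + 1)) (Fin (p + 1)) ℂ) : Prop where
  analytic : ∀ i k, DifferentiableOn ℂ (fun ζ => G ζ i k) jumpContourᶜ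
  jump : ∀ l : Fin 6, HasJump G (rayDir l) (jumpMatrix p a l)
  zero_first : (fun ζ => (G ζ).col 0) =O[𝓝[topBottom] 0] fun _ => (1 : ℝ)
  zero_other : ∀ k : Fin (p + 1), k ≠ 0 →
    (fun ζ => (G ζ).col k) =Θ[𝓝[topBottom] 0] cauchyTransform a k
  infinity_plus : HasAsymptotics p A G 1
  infinity_minus : HasAsymptotics p A G (-1)

end CauchyChain

end

/-! Put w = log ζ, N = p + 1 and b_l = -a_{1,l}. After the translation u = s + a_{1,k} every entry
of the matrix is an exponential times `meijer N b i j`, an entire function of w: a loop integral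
whose kernel has the factors Γ(u + b_l), l < j, in the numerator and 1/Γ(1 - b_l - u), j ≤ l < N,
besides. The operator Δ_ζ - a_{1,k} acts on the entry as d/dw acts on `meijer`. Analyticity is thus
immediate, and all other properties are read off from these entire functions.

Jumps. Euler's reflection formula trades the reciprocal factor with index j for a numerator factor
times a sine, and the two exponentials of the sine translate w by ±πi. So the function with index j
is a combination of two translates of the one with index j + 1 (`meijer_step`); for j = 0 the
integrand is entire and the function vanishes (`meijer_zero`). Read at arg ζ = 0 and arg ζ = ±π,
these relations are the jumps on the real axis (`sectorMatrix_jump_right`,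
`sectorMatrix_jump_left`). On the oblique rays a triangular factor is merely switched on or off.

Infinity. Iterating `meijer_step` reduces everything to j = N. By Stirling's formula, ∏ Γ(u + b_l)
agrees up to a relative error O(u^{-2}) with a combination of two kernels N^{-Nu} Γ(Nu + γ)
(`prod_Gamma_compare`), whose loop integrals are explicit multiples of e^{γ w/N} exp(-N e^{w/N})
(`loop_modelKernel`). The remainder is integrated in absolute value over a loop scaled by e^{Re w/N}
through the saddle point e^{iφ}, where Im w = Nφ. This loses half an order compared with a Gaussian
estimate, which is why the comparison must reach second order. Good loops are used only for φ = 0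
and π/2 < φ < π; a Phragmén-Lindelöf argument fills the strips between such lines and gives |Im w| ≤
Nπ - π/2 (`leadingAsymp_inner`). The linear relation coming from j = 0 then reaches the lines Im w =
±(Nπ + π/2) (`leadingAsymp_outer`), which leaves a margin around |Im w| ≤ Nπ for Cauchy's estimates
of derivatives. Among several translates of w the one farthest from the real axis dominates. Near
the positive or negative ζ-axis two translates become comparable, and the triangular factors of T
are exactly what removes the competitor (`entry_asymp_even_right`, `entry_asymp_odd_left`). The
resulting coefficient matrix is a Vandermonde matrix up to column factors, so it is invertible and
the error can be moved to its right.

Origin. Pushing the loop past the rightmost pole u = -min b_l of the kernel yields the leading power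
of ζ, the order of the pole yields the power of log ζ, and the conditions a_{kl} > -1 keep the top
coefficient from vanishing (`poleFactor_ne_zero`). The order of the iterated Cauchy transforms
satisfies a recursion (`stieltjesOrder`) which is solved by the same minimum and the same
multiplicity (`exists_zeroExp_add_eq`, `card_zeroLog`). -/

noncomputable section
namespace CauchyChain

/-! ### Loop integrals of kernels that decay to the left -/

/-- The loop integral with different heights `h₁` below and `h₂` above the real axis. -/
def loop (R h₁ h₂ : ℝ) (f : ℂ → ℂ) : ℂ :=
  (∫ x in Set.Iic R, f (x - h₁ * Complex.I))
    + (∫ y in (-h₁)..h₂, f (R + y * Complex.I)) * Complex.I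
    - ∫ x in Set.Iic R, f (x + h₂ * Complex.I)

lemma loopIntegral_eq_loop (R h : ℝ) (f : ℂ → ℂ) : loopIntegral R h f = loop R h h f := rfl

/-- If `f` is holomorphic in a half strip and decays exponentially to the left, its loop integral
vanishes. -/
lemma loop_eq_zero {f : ℂ → ℂ} {R h₁ h₂ C : ℝ} (hh : -h₁ ≤ h₂)
    (hd : ∀ s : ℂ, s.re ≤ R → -h₁ ≤ s.im → s.im ≤ h₂ → DifferentiableAt ℂ f s)
    (hC : ∀ s : ℂ, s.re ≤ R → -h₁ ≤ s.im → s.im ≤ h₂ → ‖f s‖ ≤ C * Real.exp s.re) :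
    loop R h₁ h₂ f = 0 := by
  have hcont : ∀ y : ℝ, -h₁ ≤ y → y ≤ h₂ →
      ContinuousOn (fun x : ℝ => f (x + y * Complex.I)) (Set.Iic R) := fun y h1 h2 x hx => by
    have : ContinuousAt f (x + y * Complex.I) :=
      (hd _ (by simpa using hx) (by simpa using h1) (by simpa using h2)).continuousAt
    exact (ContinuousAt.comp (f := fun x : ℝ => (x : ℂ) + y * Complex.I) this
      (by fun_prop)).continuousWithinAt
  have hint : ∀ y : ℝ, -h₁ ≤ y → y ≤ h₂ →
      IntegrableOn (fun x : ℝ => f (x + y * Complex.I)) (Set.Iic R) := fun y h1 h2 => by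
    refine Integrable.mono' ((integrableOn_exp_Iic R).const_mul C)
      ((hcont y h1 h2).aestronglyMeasurable measurableSet_Iic) ?_
    refine (ae_restrict_mem measurableSet_Iic).mono fun x hx => ?_
    simpa using hC (x + y * Complex.I) (by simpa using hx) (by simpa using h1) (by simpa using h2)
  have hlim : ∀ y : ℝ, -h₁ ≤ y → y ≤ h₂ → Tendsto (fun X : ℝ => ∫ x in X..R,
      f (x + y * Complex.I)) atBot (𝓝 (∫ x in Set.Iic R, f (x + y * Complex.I))) := fun y h1 h2 =>
    intervalIntegral_tendsto_integral_Iic R (hint y h1 h2) tendsto_id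
  have hleft : Tendsto (fun X : ℝ => ∫ y in (-h₁)..h₂, f (X + y * Complex.I)) atBot (𝓝 0) := by
    have : Tendsto (fun X : ℝ => C * Real.exp X * |h₂ - -h₁|) atBot (𝓝 0) := by
      simpa using (Real.tendsto_exp_atBot.const_mul C).mul_const (|h₂ - -h₁|)
    refine squeeze_zero_norm' ?_ this
    filter_upwards [eventually_le_atBot R] with X hX
    refine intervalIntegral.norm_integral_le_of_norm_le_const fun y hy => ?_
    rw [Set.uIoc_of_le hh] at hy
    simpa using hC (X + y * Complex.I) (by simpa using hX) (by simpa using hy.1.le)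
      (by simpa using hy.2)
  have hrect : ∀ᶠ X : ℝ in atBot, (∫ x in X..R, f (x + (-h₁ : ℝ) * Complex.I))
      - (∫ x in X..R, f (x + h₂ * Complex.I))
      + Complex.I * (∫ y in (-h₁)..h₂, f (R + y * Complex.I))
      - Complex.I * (∫ y in (-h₁)..h₂, f (X + y * Complex.I)) = 0 := by
    filter_upwards [eventually_le_atBot R] with X hX
    have := Complex.integral_boundary_rect_eq_zero_of_differentiableOn f ⟨X, -h₁⟩ ⟨R, h₂⟩
      (fun s hs => by
        rw [Complex.mem_reProdIm, Set.uIcc_of_le hX, Set.uIcc_of_le hh] at hs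
        exact (hd s hs.1.2 hs.2.1 hs.2.2).differentiableWithinAt)
    simpa using this
  have := (((hlim (-h₁) le_rfl hh).sub (hlim h₂ hh le_rfl)).add_const
    (Complex.I * (∫ y in (-h₁)..h₂, f (R + y * Complex.I)))).sub (hleft.const_mul Complex.I)
  have h0 := tendsto_nhds_unique (this.congr' hrect) tendsto_const_nhds
  have e : (fun x : ℝ => f (x - h₁ * Complex.I)) =
      fun x : ℝ => f (x + (-h₁ : ℝ) * Complex.I) := by ext x; push_cast; ring_nf
  unfold loop
  rw [e]
  linear_combination h0

/-- Kernels that are holomorphic off the ray `(-∞, R₀]` and decay faster than every exponential to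
the left, off the real axis. -/
structure IsHankel (R₀ : ℝ) (k : ℂ → ℂ) : Prop where
  diff : ∀ s : ℂ, (R₀ < s.re ∨ s.im ≠ 0) → DifferentiableAt ℂ k s
  decay : ∀ η H R M : ℝ, 0 < η → ∃ C : ℝ, 0 ≤ C ∧ ∀ s : ℂ, η ≤ |s.im| → |s.im| ≤ H → s.re ≤ R →
    ‖k s‖ ≤ C * Real.exp (M * s.re)

namespace IsHankel

variable {R₀ : ℝ} {k k₁ k₂ : ℂ → ℂ}

lemma mono {R₁ : ℝ} (hk : IsHankel R₀ k) (h : R₀ ≤ R₁) : IsHankel R₁ k :=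
  ⟨fun s hs => hk.diff s (hs.imp (fun h' => h.trans_lt h') id), hk.decay⟩

lemma add (h₁ : IsHankel R₀ k₁) (h₂ : IsHankel R₀ k₂) : IsHankel R₀ fun s => k₁ s + k₂ s := by
  refine ⟨fun s hs => (h₁.diff s hs).add (h₂.diff s hs), fun η H R M hη => ?_⟩
  obtain ⟨C₁, h0, hC₁⟩ := h₁.decay η H R M hη
  obtain ⟨C₂, h0', hC₂⟩ := h₂.decay η H R M hη
  refine ⟨C₁ + C₂, by positivity, fun s h1 h2 h3 => (norm_add_le _ _).trans ?_⟩
  rw [add_mul]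
  exact add_le_add (hC₁ s h1 h2 h3) (hC₂ s h1 h2 h3)

/-- Multiplication by an entire function of exponential growth to the left. -/
lemma mul_entire (hk : IsHankel R₀ k) {m : ℂ → ℂ} (hm : Differentiable ℂ m)
    (hg : ∀ H R : ℝ, ∃ C M : ℝ, ∀ s : ℂ, |s.im| ≤ H → s.re ≤ R → ‖m s‖ ≤ C * Real.exp (M * s.re)) :
    IsHankel R₀ fun s => k s * m s := by
  refine ⟨fun s hs => (hk.diff s hs).mul (hm s), fun η H R M hη => ?_⟩
  obtain ⟨C₁, M₁, h₁⟩ := hg H R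
  obtain ⟨C₂, h0, h₂⟩ := hk.decay η H R (M - M₁) hη
  refine ⟨C₂ * |C₁|, by positivity, fun s h1 h2 h3 => ?_⟩
  rw [norm_mul]
  calc ‖k s‖ * ‖m s‖ ≤ (C₂ * Real.exp ((M - M₁) * s.re)) * (|C₁| * Real.exp (M₁ * s.re)) := by
        gcongr
        · exact h₂ s h1 h2 h3
        · exact (h₁ s h2 h3).trans (by gcongr; exact le_abs_self _)
    _ = C₂ * |C₁| * Real.exp (M * s.re) := by
        rw [mul_mul_mul_comm, ← Real.exp_add]; ring_nf

lemma const_mul (hk : IsHankel R₀ k) (c : ℂ) : IsHankel R₀ fun s => c * k s := by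
  simpa only [mul_comm] using hk.mul_entire (m := fun _ => c) (differentiable_const c)
    fun H R => ⟨‖c‖, 0, fun s _ _ => by simp⟩

lemma sub (h₁ : IsHankel R₀ k₁) (h₂ : IsHankel R₀ k₂) : IsHankel R₀ fun s => k₁ s - k₂ s := by
  simpa [sub_eq_add_neg] using h₁.add (h₂.const_mul (-1))

/-- In a horizontal strip this factor grows at most exponentially to the left, and the decay of the
kernel is required for every rate M, so no w is excluded. Loop integrals are therefore entire
functions of the logarithm w, with no restriction on Im w. -/
lemma mul_exp (hk : IsHankel R₀ k) (w : ℂ) :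
    IsHankel R₀ fun s => k s * Complex.exp (-(s * w)) := by
  refine hk.mul_entire (by fun_prop) fun H R => ⟨Real.exp (|H| * |w.im|), -w.re, fun s h1 _ => ?_⟩
  rw [Complex.norm_exp, ← Real.exp_add]
  refine Real.exp_le_exp.2 ?_
  have : s.im * w.im ≤ |H| * |w.im| := (le_abs_self _).trans (by
    rw [abs_mul]
    exact mul_le_mul_of_nonneg_right (h1.trans (le_abs_self _)) (abs_nonneg _))
  simp only [Complex.neg_re, Complex.mul_re]
  linarith

lemma mul_id (hk : IsHankel R₀ k) : IsHankel R₀ fun s => k s * s := by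
  refine hk.mul_entire differentiable_id fun H R =>
    -- For Re s ≤ R one has |Re s| ≤ 2|R| - Re s whatever the sign of Re s; then x + 1 ≤ e^x turns
    -- the linear bound of |s| into an exponential one.
    ⟨Real.exp (|H| + 2 * |R|), -1, fun s h1 h2 => ?_⟩
  rw [← Real.exp_add]
  have h3 := Complex.norm_le_abs_re_add_abs_im s
  have h4 : |s.re| ≤ 2 * |R| - s.re := abs_le.2 ⟨by linarith [abs_nonneg R],
    by linarith [le_abs_self R]⟩
  have h5 := Real.add_one_le_exp (|H| + 2 * |R| + -1 * s.re)
  have := le_abs_self H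
  linarith

lemma mul_pow (hk : IsHankel R₀ k) (n : ℕ) : IsHankel R₀ fun s => k s * s ^ n := by
  induction n with
  | zero => simpa using hk
  | succ n ih => simpa only [pow_succ, mul_assoc] using ih.mul_id

lemma comp_add (hk : IsHankel R₀ k) (c : ℝ) : IsHankel (R₀ - c) fun s => k (s + c) := by
  refine ⟨fun s hs => ?_, fun η H R M hη => ?_⟩
  · have := hk.diff (s + c) (by simpa [sub_lt_iff_lt_add] using hs)
    exact this.comp s (by fun_prop)
  · obtain ⟨C, h0, hC⟩ := hk.decay η H (R + c) M hη
    refine ⟨C * Real.exp (M * c), by positivity, fun s h1 h2 h3 => ?_⟩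
    refine (hC (s + c) (by simpa using h1) (by simpa using h2) (by simpa using h3)).trans_eq ?_
    rw [mul_assoc, ← Real.exp_add]; simp; ring_nf; simp

lemma continuous_horizontal (hk : IsHankel R₀ k) {y : ℝ} (hy : y ≠ 0) :
    Continuous fun x : ℝ => k (x + y * Complex.I) := by
  refine continuous_iff_continuousAt.2 fun x => ?_
  have : ContinuousAt k (x + y * Complex.I) := (hk.diff _ (Or.inr (by simpa using hy))).continuousAt
  exact ContinuousAt.comp (f := fun x : ℝ => (x : ℂ) + y * Complex.I) this (by fun_prop)

lemma continuous_vertical (hk : IsHankel R₀ k) {R : ℝ} (hR : R₀ < R) :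
    Continuous fun y : ℝ => k (R + y * Complex.I) := by
  refine continuous_iff_continuousAt.2 fun y => ?_
  have : ContinuousAt k (R + y * Complex.I) := (hk.diff _ (Or.inl (by simpa using hR))).continuousAt
  exact ContinuousAt.comp (f := fun y : ℝ => (R : ℂ) + y * Complex.I) this (by fun_prop)

lemma integrableOn_horizontal (hk : IsHankel R₀ k) {y : ℝ} (hy : y ≠ 0) (R : ℝ) :
    IntegrableOn (fun x : ℝ => k (x + y * Complex.I)) (Set.Iic R) := by
  obtain ⟨C, h0, hC⟩ := hk.decay |y| |y| R 1 (abs_pos.2 hy)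
  refine Integrable.mono' ((integrableOn_exp_Iic R).const_mul C)
    ((hk.continuous_horizontal hy).aestronglyMeasurable) ?_
  refine (ae_restrict_mem measurableSet_Iic).mono fun x hx => ?_
  simpa using hC (x + y * Complex.I) (by simp) (by simp) (by simpa using hx)

lemma integrableOn_horizontal_sub (hk : IsHankel R₀ k) {h : ℝ} (hh : 0 < h) (R : ℝ) :
    IntegrableOn (fun x : ℝ => k (x - h * Complex.I)) (Set.Iic R) := by
  have := hk.integrableOn_horizontal (y := -h) (by simpa using hh.ne') R
  simpa [sub_eq_add_neg] using this

lemma loopIntegrable (hk : IsHankel R₀ k) {R h : ℝ} (hR : R₀ < R) (hh : 0 < h) :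
    LoopIntegrable R h k :=
  ⟨hk.integrableOn_horizontal_sub hh R, (hk.continuous_vertical hR).intervalIntegrable _ _,
    hk.integrableOn_horizontal hh.ne' R⟩

end IsHankel

/-! ### Linearity and changes of variable in loop integrals -/

section LoopAlgebra

variable {R₀ R h₁ h₂ : ℝ} {k k₁ k₂ : ℂ → ℂ}

lemma loop_add (hk₁ : IsHankel R₀ k₁) (hk₂ : IsHankel R₀ k₂) (hR : R₀ < R) (h1 : 0 < h₁)
    (h2 : 0 < h₂) :
    loop R h₁ h₂ (fun s => k₁ s + k₂ s) = loop R h₁ h₂ k₁ + loop R h₁ h₂ k₂ := by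
  unfold loop
  rw [integral_add (hk₁.integrableOn_horizontal_sub h1 R) (hk₂.integrableOn_horizontal_sub h1 R),
    integral_add (hk₁.integrableOn_horizontal h2.ne' R) (hk₂.integrableOn_horizontal h2.ne' R),
    intervalIntegral.integral_add ((hk₁.continuous_vertical hR).intervalIntegrable _ _)
      ((hk₂.continuous_vertical hR).intervalIntegrable _ _)]
  ring

lemma loop_const_mul (c : ℂ) : loop R h₁ h₂ (fun s => c * k s) = c * loop R h₁ h₂ k := by
  unfold loop
  rw [integral_const_mul, integral_const_mul, intervalIntegral.integral_const_mul]
  ring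

lemma loop_sub (hk₁ : IsHankel R₀ k₁) (hk₂ : IsHankel R₀ k₂) (hR : R₀ < R) (h1 : 0 < h₁)
    (h2 : 0 < h₂) :
    loop R h₁ h₂ (fun s => k₁ s - k₂ s) = loop R h₁ h₂ k₁ - loop R h₁ h₂ k₂ := by
  have := loop_add hk₁ (hk₂.const_mul (-1)) hR h1 h2
  rw [loop_const_mul] at this
  simpa [sub_eq_add_neg] using this

/-- Only the values off the real axis matter. -/
lemma loop_congr (h : ∀ s : ℂ, s.im ≠ 0 → k₁ s = k₂ s) (h1 : 0 < h₁) (h2 : 0 < h₂) :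
    loop R h₁ h₂ k₁ = loop R h₁ h₂ k₂ := by
  unfold loop
  congr 1
  · congr 1
    · congr 1; ext x; exact h _ (by simpa using h1.ne')
    · congr 1
      refine intervalIntegral.integral_congr_ae ?_
      -- The vertical side meets the real axis in one point, a null set.
      have : ∀ᵐ y : ℝ, y ≠ 0 := by simp [ae_iff]
      filter_upwards [this] with y hy _ using h _ (by simpa using hy)
  · congr 1; ext x; exact h _ (by simpa using h2.ne')

lemma loop_comp_add (c : ℝ) : loop R h₁ h₂ (fun s => k (s + c)) = loop (R + c) h₁ h₂ k := by
  have e : ∀ g : ℝ → ℂ, ∫ x in Set.Iic R, g (x + c) = ∫ x in Set.Iic (R + c), g x := fun g => by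
    have := (measurePreserving_add_right volume c).setIntegral_preimage_emb
      (measurableEmbedding_addRight c) g (Set.Iic (R + c))
    rw [← this]; congr 2; ext x; simp
  unfold loop
  rw [← e, ← e]
  push_cast
  congr 1
  · congr 1
    · congr 1; ext x; congr 1; ring
    · congr 2; ext x; congr 1; ring
  · congr 1; ext x; congr 1; ring

/-- Change of scale. -/
lemma loop_scale {a : ℝ} (ha : 0 < a) :
    loop (a * R) (a * h₁) (a * h₂) k = a * loop R h₁ h₂ (fun s => k (a * s)) := by
  have e : ∀ g : ℝ → ℂ, ∫ x in Set.Iic (a * R), g x = a * ∫ x in Set.Iic R, g (a * x) := fun g => by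
    have h3 := integral_comp_mul_left_Ioi (fun x => g (-x)) (-R) ha
    have h4 := integral_comp_neg_Iic (a * R) (fun x => g (-x))
    have h5 := integral_comp_neg_Iic R (fun x => g (a * -x))
    simp only [neg_neg] at h4 h5
    rw [mul_neg] at h3
    simp only [mul_neg] at h5
    rw [h4, h5, h3, Complex.real_smul]
    push_cast
    rw [mul_inv_cancel_left₀ (by exact_mod_cast ha.ne')]
  have e2 : (∫ y in (-(a * h₁))..(a * h₂), k ((a * R : ℝ) + y * Complex.I)) =
      a * ∫ y in (-h₁)..h₂, k ((a * R : ℝ) + (a * y : ℝ) * Complex.I) := by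
    have h5 := intervalIntegral.smul_integral_comp_mul_left (a := -h₁) (b := h₂)
      (fun y : ℝ => k ((a * R : ℝ) + y * Complex.I)) a
    rw [mul_neg] at h5
    rw [← h5, Complex.real_smul]
  unfold loop
  rw [e, e, e2]
  push_cast
  have e3 : ∀ x y : ℝ, (a * x + a * y * Complex.I : ℂ) = a * (x + y * Complex.I) := by intros; ring
  have e4 : ∀ x y : ℝ, (a * x - a * y * Complex.I : ℂ) = a * (x - y * Complex.I) := by intros; ring
  simp only [e3, e4]
  ring

end LoopAlgebra

/-! ### Independence of the loop, and holomorphic dependence on the parameter -/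

section LoopIndep

variable {R₀ R R' h₁ h₂ h₁' h₂' : ℝ} {k : ℂ → ℂ}

lemma loop_upper_le (hk : IsHankel R₀ k) (hR : R₀ < R) (h2 : 0 < h₂) (h : h₂ ≤ h₂') :
    loop R h₁ h₂' k = loop R h₁ h₂ k := by
  obtain ⟨C, -, hC⟩ := hk.decay h₂ h₂' R 1 h2
  -- The first height is measured downwards, so the value -h₂ describes the loop around the half
  -- strip h₂ ≤ Im s ≤ h₂', which stays off the singular ray.
  have hz : loop R (-h₂) h₂' k = 0 := by
    refine loop_eq_zero (C := C) (by simpa using h)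
      (fun s _ h3 _ => hk.diff s (Or.inr (by linarith : 0 < s.im).ne')) fun s h3 h4 h5 => ?_
    have h6 : |s.im| = s.im := abs_of_pos (by linarith)
    simpa using hC s (by linarith) (by linarith) h3
  have hv : ∀ a b : ℝ, IntervalIntegrable (fun y : ℝ => k (R + y * Complex.I)) volume a b :=
    fun a b => (hk.continuous_vertical hR).intervalIntegrable _ _
  have := intervalIntegral.integral_add_adjacent_intervals (hv (-h₁) h₂) (hv h₂ h₂')
  unfold loop at hz ⊢
  rw [← this]
  simp only [neg_neg, Complex.ofReal_neg, neg_mul, sub_neg_eq_add] at hz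
  linear_combination hz

lemma loop_lower_le (hk : IsHankel R₀ k) (hR : R₀ < R) (h1 : 0 < h₁) (h : h₁ ≤ h₁') :
    loop R h₁' h₂ k = loop R h₁ h₂ k := by
  obtain ⟨C, -, hC⟩ := hk.decay h₁ h₁' R 1 h1
  have hz : loop R h₁' (-h₁) k = 0 := by
    refine loop_eq_zero (C := C) (by simpa using h)
      (fun s _ _ h3 => hk.diff s (Or.inr (by linarith : s.im < 0).ne)) fun s h3 h4 h5 => ?_
    have h6 : |s.im| = -s.im := abs_of_neg (by linarith)
    simpa using hC s (by linarith) (by linarith) h3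
  have hv : ∀ a b : ℝ, IntervalIntegrable (fun y : ℝ => k (R + y * Complex.I)) volume a b :=
    fun a b => (hk.continuous_vertical hR).intervalIntegrable _ _
  have := intervalIntegral.integral_add_adjacent_intervals (hv (-h₁') (-h₁)) (hv (-h₁) h₂)
  unfold loop at hz ⊢
  rw [← this]
  simp only [Complex.ofReal_neg, neg_mul, ← sub_eq_add_neg] at hz
  linear_combination hz

/-- The two loops differ by the boundary of a rectangle to the right of R₀, where the kernel is
holomorphic also on the real axis. -/
lemma loop_right (hk : IsHankel R₀ k) (hR : R₀ < R) (hR' : R₀ < R') (h1 : 0 < h₁) (h2 : 0 < h₂) :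
    loop R' h₁ h₂ k = loop R h₁ h₂ k := by
  have hrect := Complex.integral_boundary_rect_eq_zero_of_differentiableOn k ⟨R, -h₁⟩ ⟨R', h₂⟩
    (fun s hs => by
      rw [Complex.mem_reProdIm] at hs
      refine (hk.diff s (Or.inl ?_)).differentiableWithinAt
      exact (lt_min hR hR').trans_le hs.1.1)
  have ha := intervalIntegral.integral_Iic_sub_Iic (hk.integrableOn_horizontal_sub h1 R)
    (hk.integrableOn_horizontal_sub h1 R')
  have hb := intervalIntegral.integral_Iic_sub_Iic (hk.integrableOn_horizontal h2.ne' R)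
    (hk.integrableOn_horizontal h2.ne' R')
  simp only [Complex.ofReal_neg, neg_mul, ← sub_eq_add_neg, smul_eq_mul] at hrect
  unfold loop
  linear_combination ha - hb + hrect

/-- The loop integral does not depend on the loop. -/
lemma loop_indep (hk : IsHankel R₀ k) (hR : R₀ < R) (hR' : R₀ < R') (h1 : 0 < h₁) (h2 : 0 < h₂)
    (h1' : 0 < h₁') (h2' : 0 < h₂') : loop R h₁ h₂ k = loop R' h₁' h₂' k := by
  rw [← loop_right hk hR hR' h1 h2]
  have hu : ∀ a b c : ℝ, 0 < b → 0 < c → loop R' a b k = loop R' a c k := fun a b c hb hc => by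
    rcases le_total b c with h | h
    · exact (loop_upper_le hk hR' hb h).symm
    · exact loop_upper_le hk hR' hc h
  have hl : ∀ a b c : ℝ, 0 < b → 0 < c → loop R' b a k = loop R' c a k := fun a b c hb hc => by
    rcases le_total b c with h | h
    · exact (loop_lower_le hk hR' hb h).symm
    · exact loop_lower_le hk hR' hc h
  rw [hu _ _ _ h2 h2', hl _ _ _ h1 h1']

/-- Loop integrals of `k s * exp (-s w)` are differentiable in `w`. -/
lemma hasDerivAt_loop (hk : IsHankel R₀ k) (hR : R₀ < R) (h1 : 0 < h₁) (h2 : 0 < h₂) (w : ℂ) :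
    HasDerivAt (fun w => loop R h₁ h₂ fun s => k s * Complex.exp (-(s * w)))
      (loop R h₁ h₂ fun s => k s * (-s) * Complex.exp (-(s * w))) w := by
  have hder : ∀ s z : ℂ, HasDerivAt (fun w => k s * Complex.exp (-(s * w)))
      (k s * (-s) * Complex.exp (-(s * z))) z := fun s z => by
    have h3 : HasDerivAt (fun w => -(s * w)) (-s) z := by
      simpa using (hasDerivAt_id z).const_mul (-s)
    exact (h3.cexp.const_mul (k s)).congr_deriv (by ring)
  have hneg : IsHankel R₀ fun s => k s * (-s) := by
    simpa using hk.mul_id.const_mul (-1)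
  -- Dominating function, uniform for |z - w| < 1: the exponential costs the rate |w| + 1, and the
  -- factor |s| ≤ e^{|s|} one more.
  have hbd : ∀ s z : ℂ, z ∈ Metric.ball w 1 →
      ‖k s * (-s) * Complex.exp (-(s * z))‖ ≤ ‖k s‖ * Real.exp ((‖w‖ + 2) * ‖s‖) := fun s z hz => by
    have hz' : ‖z‖ ≤ ‖w‖ + 1 := by
      have h3 := norm_sub_norm_le z w
      rw [Metric.mem_ball, dist_eq_norm] at hz
      linarith
    have h4 : ‖Complex.exp (-(s * z))‖ ≤ Real.exp ((‖w‖ + 1) * ‖s‖) := by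
      refine (Complex.norm_exp_le_exp_norm _).trans (Real.exp_le_exp.2 ?_)
      rw [norm_neg, norm_mul, mul_comm]
      gcongr
    rw [norm_mul, norm_mul, norm_neg, mul_assoc]
    gcongr
    have h5 : ‖s‖ ≤ Real.exp ‖s‖ := by linarith [Real.add_one_le_exp ‖s‖]
    calc ‖s‖ * ‖Complex.exp (-(s * z))‖ ≤ Real.exp ‖s‖ * Real.exp ((‖w‖ + 1) * ‖s‖) := by gcongr
      _ = _ := by rw [← Real.exp_add]; ring_nf
  have hor : ∀ y : ℝ, y ≠ 0 → HasDerivAt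
      (fun w => ∫ x in Set.Iic R, k (x + y * Complex.I) * Complex.exp (-((x + y * Complex.I) * w)))
      (∫ x in Set.Iic R, k (x + y * Complex.I) * (-(x + y * Complex.I)) *
        Complex.exp (-((x + y * Complex.I) * w))) w := fun y hy => by
    -- This rate exceeds the growth |w| + 2 of the dominating factor by one, which leaves the
    -- integrable function e^x.
    obtain ⟨C, h0, hC⟩ := hk.decay |y| |y| R (‖w‖ + 2 + 1) (abs_pos.2 hy)
    refine (hasDerivAt_integral_of_dominated_loc_of_deriv_le (s := Metric.ball w 1)
      (F := fun w (x : ℝ) => k (x + y * Complex.I) * Complex.exp (-((x + y * Complex.I) * w)))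
      (F' := fun w (x : ℝ) => k (x + y * Complex.I) * (-(x + y * Complex.I)) *
        Complex.exp (-((x + y * Complex.I) * w)))
      (bound := fun x => C * Real.exp ((‖w‖ + 2) * (2 * |R| + |y|)) * Real.exp x)
      (Metric.ball_mem_nhds w one_pos) ?_ ((hk.mul_exp w).integrableOn_horizontal hy R) ?_ ?_ ?_
      ?_).2
    · exact Eventually.of_forall fun z =>
        ((hk.mul_exp z).continuous_horizontal hy).aestronglyMeasurable
    · exact ((hneg.mul_exp w).continuous_horizontal hy).aestronglyMeasurable
    · refine (ae_restrict_mem measurableSet_Iic).mono fun x hx z hz => (hbd _ z hz).trans ?_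
      have hx' : x ≤ R := hx
      have h3 : ‖(x : ℂ) + y * Complex.I‖ ≤ 2 * |R| - x + |y| := by
        have h3 := Complex.norm_le_abs_re_add_abs_im ((x : ℂ) + y * Complex.I)
        have h4 : |x| ≤ 2 * |R| - x := abs_le.2 ⟨by linarith [abs_nonneg R],
          by linarith [le_abs_self R]⟩
        simp only [Complex.add_re, Complex.ofReal_re, Complex.mul_re, Complex.I_re, mul_zero,
          Complex.ofReal_im, Complex.I_im, mul_one, sub_self, add_zero, Complex.add_im,
          Complex.mul_im, zero_add] at h3
        linarith
      have h4 := hC (x + y * Complex.I) (by simp) (by simp) (by simpa using hx)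
      calc _ ≤ (C * Real.exp ((‖w‖ + 2 + 1) * x)) *
            Real.exp ((‖w‖ + 2) * (2 * |R| - x + |y|)) := by
            gcongr
            simpa using h4
        _ = _ := by
            rw [mul_assoc, mul_assoc, ← Real.exp_add, ← Real.exp_add]
            ring_nf
    · exact (integrableOn_exp_Iic R).const_mul _
    · exact Eventually.of_forall fun x z _ => hder _ z
  have ver : HasDerivAt
      (fun w => ∫ y in (-h₁)..h₂, k (R + y * Complex.I) * Complex.exp (-((R + y * Complex.I) * w)))
      (∫ y in (-h₁)..h₂, k (R + y * Complex.I) * (-(R + y * Complex.I)) *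
        Complex.exp (-((R + y * Complex.I) * w))) w := by
    refine (intervalIntegral.hasDerivAt_integral_of_dominated_loc_of_deriv_le
      (s := Metric.ball w 1)
      (F := fun w (y : ℝ) => k (R + y * Complex.I) * Complex.exp (-((R + y * Complex.I) * w)))
      (F' := fun w (y : ℝ) => k (R + y * Complex.I) * (-(R + y * Complex.I)) *
        Complex.exp (-((R + y * Complex.I) * w)))
      (bound := fun y : ℝ => ‖k (R + y * Complex.I)‖ *
        Real.exp ((‖w‖ + 2) * ‖(R + y * Complex.I : ℂ)‖))
      (Metric.ball_mem_nhds w one_pos) ?_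
      (((hk.mul_exp w).continuous_vertical hR).intervalIntegrable _ _) ?_ ?_ ?_ ?_).2
    · exact Eventually.of_forall fun z =>
        ((hk.mul_exp z).continuous_vertical hR).aestronglyMeasurable
    · exact ((hneg.mul_exp w).continuous_vertical hR).aestronglyMeasurable
    · exact Eventually.of_forall fun y _ z hz => hbd _ z hz
    · refine Continuous.intervalIntegrable ?_ _ _
      exact (hk.continuous_vertical hR).norm.mul (by fun_prop)
    · exact Eventually.of_forall fun x _ z _ => hder _ z
  have h3 := hor (-h₁) (by simpa using h1.ne')
  simp only [Complex.ofReal_neg, neg_mul, ← sub_eq_add_neg] at h3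
  exact (h3.add (ver.mul_const Complex.I)).sub (by simpa using hor h₂ h2.ne')

/-- Conjugation maps a loop with equal heights to itself with the orientation reversed, hence the
sign. The sign is later cancelled by that of the factor 1/(2πi). -/
lemma loop_conj (k : ℂ → ℂ) : starRingEnd ℂ (loop R h₁ h₁ k) =
    -loop R h₁ h₁ fun s => starRingEnd ℂ (k (starRingEnd ℂ s)) := by
  have h3 := intervalIntegral.integral_comp_neg (a := -h₁) (b := h₁)
    (fun y : ℝ => starRingEnd ℂ (k (R + y * Complex.I)))
  simp only [Complex.ofReal_neg, neg_mul, ← sub_eq_add_neg, neg_neg] at h3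
  unfold loop
  rw [map_sub, map_add, map_mul, ← integral_conj, ← integral_conj,
    ← intervalIntegral.intervalIntegral_conj]
  simp only [map_sub, map_add, map_mul, Complex.conj_ofReal, Complex.conj_I, mul_neg,
    sub_neg_eq_add, ← sub_eq_add_neg, h3]
  ring

end LoopIndep
end CauchyChain
end

noncomputable section
namespace CauchyChain

/-! ### Decay of the gamma function to the left -/

/-- A function that gains a factor `exp (-M)` with each unit step to the left decays like
`exp (M * re)`. -/
lemma exists_exp_bound_of_step {f : ℂ → ℂ} {S : Set ℂ} {M : ℝ} (K R : ℝ) (hKR : 1 - K ≤ R)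
    (hS : ∀ s ∈ S, s + 1 ∈ S)
    (hstep : ∀ s ∈ S, s.re ≤ -K → ‖f s‖ ≤ Real.exp (-M) * ‖f (s + 1)‖)
    (hb : ∃ C, ∀ s ∈ S, -K ≤ s.re → s.re ≤ R → ‖f s‖ ≤ C) :
    ∃ C : ℝ, 0 ≤ C ∧ ∀ s ∈ S, s.re ≤ R → ‖f s‖ ≤ C * Real.exp (M * s.re) := by
  obtain ⟨C, hC⟩ := hb
  have hm : ∀ x : ℝ, -K ≤ x → x ≤ R → -(|M| * (|K| + |R|)) ≤ M * x := fun x h1 h2 => by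
    have h3 : |x| ≤ |K| + |R| := abs_le.2 ⟨by linarith [le_abs_self K, abs_nonneg R],
      by linarith [le_abs_self R, abs_nonneg K]⟩
    have h4 : |M * x| ≤ |M| * (|K| + |R|) := by rw [abs_mul]; gcongr
    linarith [neg_abs_le (M * x)]
  refine ⟨|C| * Real.exp (|M| * (|K| + |R|)), by positivity, ?_⟩
  -- The number n counts unit steps back to the strip -K ≤ Re s ≤ R. A step is made only from Re s ≤
  -- -K, so the hypothesis 1 - K ≤ R prevents overshooting.
  have key : ∀ n : ℕ, ∀ s ∈ S, s.re ≤ R → -K - n ≤ s.re →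
      ‖f s‖ ≤ |C| * Real.exp (|M| * (|K| + |R|)) * Real.exp (M * s.re) := by
    intro n
    induction n with
    | zero =>
      intro s hs h1 h2
      have h2' : -K ≤ s.re := by simpa using h2
      rw [mul_assoc, ← Real.exp_add]
      have h4 : 1 ≤ Real.exp (|M| * (|K| + |R|) + M * s.re) :=
        Real.one_le_exp (by linarith [hm s.re h2' h1])
      calc ‖f s‖ ≤ |C| := (hC s hs h2' h1).trans (le_abs_self _)
        _ ≤ _ := le_mul_of_one_le_right (abs_nonneg _) h4
    | succ n ih =>
      intro s hs h1 h2
      by_cases h3 : s.re ≤ -K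
      · have h4 := ih (s + 1) (hS s hs) (by simp; linarith) (by push_cast at h2; simp; linarith)
        refine (hstep s hs h3).trans ?_
        calc Real.exp (-M) * ‖f (s + 1)‖ ≤ Real.exp (-M) *
              (|C| * Real.exp (|M| * (|K| + |R|)) * Real.exp (M * (s + 1).re)) := by gcongr
          _ = |C| * Real.exp (|M| * (|K| + |R|)) * (Real.exp (-M) * Real.exp (M * (s + 1).re)) := by
              ring
          _ = _ := by
              rw [← Real.exp_add]; congr 2; simp; ring
      · exact ih s hs h1 (by push_cast at h2 ⊢; linarith [Nat.cast_nonneg (α := ℝ) n])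
  intro s hs h1
  obtain ⟨n, hn⟩ := exists_nat_ge (-K - s.re)
  exact key n s hs h1 (by linarith)

lemma exp_le_norm_of_re_le {s : ℂ} {M : ℝ} (h : s.re ≤ -Real.exp M) : Real.exp M ≤ ‖s‖ := by
  have := Complex.abs_re_le_norm s
  have h2 := neg_abs_le s.re
  linarith

lemma isCompact_strip (a b c d : ℝ) :
    IsCompact {s : ℂ | (a ≤ s.re ∧ s.re ≤ b) ∧ c ≤ |s.im| ∧ |s.im| ≤ d} := by
  refine Metric.isCompact_of_isClosed_isBounded ?_ ?_
  · refine (IsClosed.inter ?_ ?_).inter (IsClosed.inter ?_ ?_)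
    · exact isClosed_le continuous_const Complex.continuous_re
    · exact isClosed_le Complex.continuous_re continuous_const
    · exact isClosed_le continuous_const Complex.continuous_im.abs
    · exact isClosed_le Complex.continuous_im.abs continuous_const
  · refine (Metric.isBounded_closedBall (x := (0 : ℂ)) (r := |a| + |b| + |d|)).subset
      fun s hs => ?_
    rw [mem_closedBall_zero_iff]
    have h1 := Complex.norm_le_abs_re_add_abs_im s
    have h3 : |s.re| ≤ |a| + |b| := abs_le.2
      ⟨by linarith [neg_abs_le a, abs_nonneg b, hs.1.1], by linarith [le_abs_self b, abs_nonneg a, hs.1.2]⟩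
    linarith [hs.2.2, le_abs_self d]

lemma differentiableAt_Gamma_of_pos {s : ℂ} (hs : 0 < s.re ∨ s.im ≠ 0) :
    DifferentiableAt ℂ Complex.Gamma s := by
  refine Complex.differentiableAt_Gamma s fun m hm => ?_
  rcases hs with hs | hs
  · rw [hm] at hs
    simp only [Complex.neg_re, Complex.natCast_re, Left.neg_pos_iff] at hs
    exact absurd hs (not_lt.2 (Nat.cast_nonneg m))
  · rw [hm] at hs; simp at hs

/-- Since Γ(s) = Γ(s + 1)/s and |s| ≥ e^M for Re s ≤ -e^M, each unit step to the left gains the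
factor e^{-M}. In the remaining compact set the condition |Im s| ≥ η > 0 excludes the poles. -/
lemma isHankel_Gamma : IsHankel 0 Complex.Gamma := by
  refine ⟨fun s hs => differentiableAt_Gamma_of_pos hs, fun η H R M hη => ?_⟩
  have hstep : ∀ s ∈ {s : ℂ | η ≤ |s.im| ∧ |s.im| ≤ H}, s.re ≤ -Real.exp M →
      ‖Complex.Gamma s‖ ≤ Real.exp (-M) * ‖Complex.Gamma (s + 1)‖ := fun s hs h => by
    have h1 := exp_le_norm_of_re_le h
    have h2 : s ≠ 0 := by
      rintro rfl
      simp only [norm_zero] at h1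
      exact absurd h1 (not_le.2 (Real.exp_pos M))
    rw [Complex.Gamma_add_one s h2, norm_mul, Real.exp_neg, ← mul_assoc]
    refine le_mul_of_one_le_left (norm_nonneg _) ?_
    rw [inv_mul_eq_div, one_le_div (Real.exp_pos _)]
    exact h1
  obtain ⟨C₀, hC₀⟩ := (isCompact_strip (-Real.exp M) (|R| + 1) η H).exists_bound_of_continuousOn
    (f := Complex.Gamma) (fun s hs => (differentiableAt_Gamma_of_pos (Or.inr
      (abs_pos.1 (hη.trans_le hs.2.1)))).continuousAt.continuousWithinAt)
  obtain ⟨C, h0, hC⟩ := exists_exp_bound_of_step (Real.exp M) (|R| + 1)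
    (by linarith [Real.exp_pos M, abs_nonneg R]) (fun s hs => by simpa using hs) hstep
    ⟨C₀, fun s hs h1 h2 => hC₀ s ⟨⟨h1, h2⟩, hs⟩⟩
  exact ⟨C, h0, fun s h1 h2 h3 => hC s ⟨h1, h2⟩ (by linarith [le_abs_self R])⟩

lemma differentiable_inv_Gamma_one_sub (b : ℝ) :
    Differentiable ℂ fun u : ℂ => (Complex.Gamma (1 - b - u))⁻¹ := by
  have := Complex.differentiable_one_div_Gamma
  exact this.comp (by fun_prop : Differentiable ℂ fun u : ℂ => 1 - (b : ℂ) - u)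

/-- The same stepping argument applied to the entire function 1/Γ, so no distance from the real axis
is needed. -/
lemma inv_Gamma_one_sub_bound (b H R M : ℝ) : ∃ C : ℝ, 0 ≤ C ∧ ∀ s : ℂ, |s.im| ≤ H → s.re ≤ R →
    ‖(Complex.Gamma (1 - b - s))⁻¹‖ ≤ C * Real.exp (M * s.re) := by
  have hstep : ∀ s ∈ {s : ℂ | |s.im| ≤ H}, s.re ≤ -(Real.exp M + |b|) →
      ‖(Complex.Gamma (1 - b - s))⁻¹‖ ≤
        Real.exp (-M) * ‖(Complex.Gamma (1 - b - (s + 1)))⁻¹‖ := fun s hs h => by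
    have h1 : Real.exp M ≤ ‖(b + s : ℂ)‖ := exp_le_norm_of_re_le (by
      simp; linarith [le_abs_self b])
    have h2 : -(b : ℂ) - s ≠ 0 := by
      intro h2
      have h3 : (b + s : ℂ) = 0 := by linear_combination -h2
      simp only [h3, norm_zero] at h1
      exact absurd h1 (not_le.2 (Real.exp_pos M))
    have h3 : (1 - b - s : ℂ) = (-b - s) + 1 := by ring
    have h4 : (1 - b - (s + 1) : ℂ) = -b - s := by ring
    have h5 : ‖(-b - s : ℂ)‖ = ‖(b + s : ℂ)‖ := by rw [← norm_neg]; congr 1; ring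
    rw [h3, h4, Complex.Gamma_add_one _ h2, mul_inv, norm_mul, norm_inv, h5, Real.exp_neg]
    gcongr
  have hs : IsCompact {s : ℂ | (-(Real.exp M + |b|) ≤ s.re ∧ s.re ≤ |R| + 1) ∧
      0 ≤ |s.im| ∧ |s.im| ≤ H} := isCompact_strip _ _ _ _
  obtain ⟨C₀, hC₀⟩ := hs.exists_bound_of_continuousOn
    ((differentiable_inv_Gamma_one_sub b).continuous.continuousOn)
  obtain ⟨C, h0, hC⟩ := exists_exp_bound_of_step (f := fun s : ℂ => (Complex.Gamma (1 - b - s))⁻¹)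
    (Real.exp M + |b|) (|R| + 1)
    (by linarith [Real.exp_pos M, abs_nonneg R, abs_nonneg b]) (fun s hs => by simpa using hs)
    hstep ⟨C₀, fun s hs h1 h2 => hC₀ s ⟨⟨h1, h2⟩, abs_nonneg _, hs⟩⟩
  exact ⟨C, h0, fun s h2 h3 => hC s h2 (by linarith [le_abs_self R])⟩

lemma IsHankel.mul {R₀ : ℝ} {k₁ k₂ : ℂ → ℂ} (h₁ : IsHankel R₀ k₁) (h₂ : IsHankel R₀ k₂) :
    IsHankel R₀ fun s => k₁ s * k₂ s := by
  refine ⟨fun s hs => (h₁.diff s hs).mul (h₂.diff s hs), fun η H R M hη => ?_⟩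
  obtain ⟨C₁, h0, hC₁⟩ := h₁.decay η H R M hη
  obtain ⟨C₂, h0', hC₂⟩ := h₂.decay η H R 0 hη
  refine ⟨C₁ * C₂, by positivity, fun s h1 h2 h3 => ?_⟩
  rw [norm_mul]
  calc ‖k₁ s‖ * ‖k₂ s‖ ≤ (C₁ * Real.exp (M * s.re)) * (C₂ * Real.exp (0 * s.re)) := by
        gcongr
        · exact hC₁ s h1 h2 h3
        · exact hC₂ s h1 h2 h3
    _ = _ := by simp; ring

/-! ### The Meijer functions -/

/-- The Mellin-Barnes kernel with gamma factors `b 0, ..., b (j-1)` in the numerator. -/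
def hankelKernel (N : ℕ) (b : ℕ → ℝ) (j : ℕ) (u : ℂ) : ℂ :=
  (∏ l ∈ Finset.range j, Complex.Gamma (u + b l)) *
    ∏ l ∈ Finset.Ico j N, (Complex.Gamma (1 - b l - u))⁻¹

lemma isHankel_Gamma_add {b R₀ : ℝ} (h : -b ≤ R₀) :
    IsHankel R₀ fun u => Complex.Gamma (u + b) :=
  (isHankel_Gamma.comp_add b).mono (by simpa using h)

lemma isHankel_prod_Gamma {b : ℕ → ℝ} {R₀ : ℝ} {j : ℕ} (hj : 1 ≤ j)
    (h : ∀ l < j, -b l ≤ R₀) :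
    IsHankel R₀ fun u => ∏ l ∈ Finset.range j, Complex.Gamma (u + b l) := by
  induction j, hj using Nat.le_induction with
  | base => simpa using isHankel_Gamma_add (h 0 one_pos)
  | succ j hj ih =>
    simp only [Finset.prod_range_succ]
    exact (ih fun l hl => h l (hl.trans j.lt_succ_self)).mul
      (isHankel_Gamma_add (h j j.lt_succ_self))

/-- The numerator supplies both the singular ray and the decay; the reciprocal factors are entire
and bounded to the left in horizontal strips, so they only multiply the bound. -/
lemma isHankel_hankelKernel {N : ℕ} {b : ℕ → ℝ} {R₀ : ℝ} {j : ℕ} (hj : 1 ≤ j)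
    (h : ∀ l < j, -b l ≤ R₀) : IsHankel R₀ (hankelKernel N b j) := by
  have key : ∀ (s : Finset ℕ), IsHankel R₀ fun u : ℂ => (∏ l ∈ Finset.range j,
      Complex.Gamma (u + b l)) * ∏ l ∈ s, (Complex.Gamma (1 - b l - u))⁻¹ := fun s => by
    induction s using Finset.induction_on with
    | empty => simpa using isHankel_prod_Gamma hj h
    | insert a s ha ih =>
      have := ih.mul_entire (differentiable_inv_Gamma_one_sub (b a)) fun H R => by
        obtain ⟨C, -, hC⟩ := inv_Gamma_one_sub_bound (b a) H R 0
        exact ⟨C, 0, hC⟩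
      convert this using 2 with u
      rw [Finset.prod_insert ha]
      ring
  exact key _

/-- Without numerator factors the decay holds across the real axis as well; this lets the loop be
contracted to the left in `meijer_zero`. -/
lemma exists_bound_hankelKernel_zero {N : ℕ} (hN : 1 ≤ N) (b : ℕ → ℝ) (H R M : ℝ) :
    ∃ C : ℝ, 0 ≤ C ∧ ∀ s : ℂ, |s.im| ≤ H → s.re ≤ R →
      ‖hankelKernel N b 0 s‖ ≤ C * Real.exp (M * s.re) := by
  induction N, hN using Nat.le_induction with
  | base =>
    obtain ⟨C, h0, hC⟩ := inv_Gamma_one_sub_bound (b 0) H R M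
    exact ⟨C, h0, fun s h1 h2 => by simpa [hankelKernel] using hC s h1 h2⟩
  | succ n hn ih =>
    obtain ⟨C, h0, hC⟩ := ih
    obtain ⟨C', h0', hC'⟩ := inv_Gamma_one_sub_bound (b n) H R 0
    refine ⟨C * C', by positivity, fun s h1 h2 => ?_⟩
    have h3 : hankelKernel (n + 1) b 0 s =
        hankelKernel n b 0 s * (Complex.Gamma (1 - b n - s))⁻¹ := by
      simp [hankelKernel, Finset.prod_range_succ, mul_comm]
    rw [h3, norm_mul]
    calc _ ≤ (C * Real.exp (M * s.re)) * (C' * Real.exp (0 * s.re)) := by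
          gcongr
          · exact hC s h1 h2
          · exact hC' s h1 h2
      _ = _ := by simp; ring

/-- A bound for the exponents. -/
def radius (N : ℕ) (b : ℕ → ℝ) : ℝ := ∑ l ∈ Finset.range N, |b l|

lemma neg_le_radius {N : ℕ} (b : ℕ → ℝ) {l : ℕ} (hl : l < N) : -b l ≤ radius N b :=
  (neg_le_abs _).trans (Finset.single_le_sum (f := fun l => |b l|) (fun _ _ => abs_nonneg _)
    (Finset.mem_range.2 hl))

lemma radius_nonneg (N : ℕ) (b : ℕ → ℝ) : 0 ≤ radius N b :=
  Finset.sum_nonneg fun _ _ => abs_nonneg _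

/-- The `i`-th derivative of the Meijer function with `j` numerator factors, as a function of the
logarithm `w` of the variable. -/
def meijer (N : ℕ) (b : ℕ → ℝ) (i j : ℕ) (w : ℂ) : ℂ :=
  (2 * Real.pi * Complex.I)⁻¹ * loop (radius N b + 1) 1 1
    (fun u => hankelKernel N b j u * (-u) ^ i * Complex.exp (-(u * w)))

section Meijer

variable {N : ℕ} {b : ℕ → ℝ} {i j : ℕ}

lemma isHankel_kernel_mul_pow {R₀ : ℝ} (hj : 1 ≤ j) (h : ∀ l < j, -b l ≤ R₀) (i : ℕ) :
    IsHankel R₀ fun u => hankelKernel N b j u * (-u) ^ i := by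
  have := ((isHankel_hankelKernel (N := N) hj h).mul_pow i).const_mul ((-1) ^ i)
  convert this using 2 with u
  rw [neg_pow]
  ring

lemma meijer_eq_loop {R₀ R h₁ h₂ : ℝ} (hj : 1 ≤ j) (hjN : j ≤ N) (h : ∀ l < j, -b l ≤ R₀)
    (hR : R₀ < R) (h1 : 0 < h₁) (h2 : 0 < h₂) (w : ℂ) :
    meijer N b i j w = (2 * Real.pi * Complex.I)⁻¹ * loop R h₁ h₂
      (fun u => hankelKernel N b j u * (-u) ^ i * Complex.exp (-(u * w))) := by
  have hk : ∀ R₁, R₀ ≤ R₁ → IsHankel R₁ fun u => hankelKernel N b j u * (-u) ^ i *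
      Complex.exp (-(u * w)) := fun R₁ h3 =>
    (isHankel_kernel_mul_pow (N := N) hj (fun l hl => (h l hl).trans h3) i).mul_exp w
  have hk2 : IsHankel (radius N b) fun u => hankelKernel N b j u * (-u) ^ i *
      Complex.exp (-(u * w)) :=
    (isHankel_kernel_mul_pow (N := N) hj (fun l hl => neg_le_radius b (hl.trans_le hjN)) i).mul_exp w
  unfold meijer
  congr 1
  set R' := max (radius N b) R + 1 with hR'
  have e1 : radius N b < R' := by rw [hR']; linarith [le_max_left (radius N b) R]
  have e2 : R₀ < R' := by rw [hR']; linarith [le_max_right (radius N b) R]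
  rw [loop_indep hk2 (lt_add_one _) e1 one_pos one_pos one_pos one_pos,
    loop_indep (hk R₀ le_rfl) hR e2 h1 h2 one_pos one_pos]

lemma hasDerivAt_meijer (hj : 1 ≤ j) (hjN : j ≤ N) (i : ℕ) (w : ℂ) :
    HasDerivAt (meijer N b i j) (meijer N b (i + 1) j w) w := by
  have hk := isHankel_kernel_mul_pow (N := N) (b := b) hj
    (fun l hl => neg_le_radius b (hl.trans_le hjN)) i
  have := (hasDerivAt_loop hk (lt_add_one _) one_pos one_pos w).const_mul
    ((2 * Real.pi * Complex.I)⁻¹)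
  have e : ∀ u : ℂ, hankelKernel N b j u * (-u) ^ (i + 1) = hankelKernel N b j u * (-u) ^ i * -u :=
    fun u => by ring
  unfold meijer
  simp only [e]
  exact this

/-- Euler's reflection formula, solved for the reciprocal factor. Off the real axis neither gamma
factor has a pole and the sine does not vanish. -/
lemma sin_mul_Gamma {x : ℂ} (hx : x.im ≠ 0) :
    (Complex.Gamma (1 - x))⁻¹ = Complex.Gamma x * (Complex.sin (Real.pi * x) / Real.pi) := by
  have h1 : ∀ z : ℂ, z.im ≠ 0 → Complex.Gamma z ≠ 0 := fun z hz =>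
    Complex.Gamma_ne_zero fun m hm => hz (by rw [hm]; simp)
  have h2 := Complex.Gamma_mul_Gamma_one_sub x
  have h3 : Complex.Gamma x * Complex.Gamma (1 - x) ≠ 0 :=
    mul_ne_zero (h1 x hx) (h1 _ (by simpa using hx))
  have h4 : Complex.sin (Real.pi * x) ≠ 0 := fun h => by
    rw [h2, h, div_zero] at h3; exact h3 rfl
  have h5 : (Real.pi : ℂ) ≠ 0 := by exact_mod_cast Real.pi_ne_zero
  refine inv_eq_of_mul_eq_one_right ?_
  rw [← mul_assoc, mul_comm (Complex.Gamma (1 - x)), h2]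
  field_simp

/-- The reflection formula moves the factor with index j to the numerator at the price of sin π(u +
b_j)/π. The two exponentials e^{±πiu} of the sine are written as factors exp(-u · (∓πi)), that is,
as translations of w. -/
lemma hankelKernel_step (hj : j < N) {u : ℂ} (hu : u.im ≠ 0) :
    hankelKernel N b j u = hankelKernel N b (j + 1) u *
      ((Complex.exp (Complex.I * Real.pi * b j) * Complex.exp (-(u * (-(Real.pi * Complex.I)))) -
        Complex.exp (-(Complex.I * Real.pi * b j)) * Complex.exp (-(u * (Real.pi * Complex.I)))) /
        (2 * Real.pi * Complex.I)) := by
  have h1 := sin_mul_Gamma (x := u + b j) (by simpa using hu)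
  have h2 : (1 - (u + b j) : ℂ) = 1 - b j - u := by ring
  rw [h2] at h1
  have h5 : (Real.pi : ℂ) ≠ 0 := by exact_mod_cast Real.pi_ne_zero
  unfold hankelKernel
  rw [Finset.prod_range_succ, ← Finset.prod_Ioo_mul_eq_prod_Ico hj, h1, ← Complex.exp_add,
    ← Complex.exp_add, Complex.sin]
  have h3 : Finset.Ioo j N = Finset.Ico (j + 1) N := by ext; simp
  rw [h3]
  have e1 : Complex.I * Real.pi * b j + -(u * (-(Real.pi * Complex.I))) =
    Real.pi * (u + b j) * Complex.I := by ring
  have e2 : -(Complex.I * Real.pi * b j) + -(u * (Real.pi * Complex.I)) =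
    -(Real.pi * (u + b j)) * Complex.I := by ring
  rw [e1, e2]
  generalize Complex.exp (Real.pi * (u + b j) * Complex.I) = A
  generalize Complex.exp (-(Real.pi * (u + b j)) * Complex.I) = B
  generalize ∏ l ∈ Finset.Ico (j + 1) N, (Complex.Gamma (1 - b l - u))⁻¹ = P
  generalize ∏ l ∈ Finset.range j, Complex.Gamma (u + b l) = Q
  generalize Complex.Gamma (u + b j) = g
  field_simp
  linear_combination Q * P * g * (B - A) * Complex.I_sq

/-- The three term relation between Meijer functions with adjacent `j`. -/
lemma meijer_step (hj : j < N) (i : ℕ) (w : ℂ) :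
    meijer N b i j w = (Complex.exp (Complex.I * Real.pi * b j) *
        meijer N b i (j + 1) (w - Real.pi * Complex.I) -
      Complex.exp (-(Complex.I * Real.pi * b j)) *
        meijer N b i (j + 1) (w + Real.pi * Complex.I)) / (2 * Real.pi * Complex.I) := by
  have hk : ∀ z : ℂ, IsHankel (radius N b) fun u => hankelKernel N b (j + 1) u * (-u) ^ i *
      Complex.exp (-(u * z)) := fun z =>
    (isHankel_kernel_mul_pow (by omega) (fun l hl => neg_le_radius b (by omega)) i).mul_exp z
  have e := loop_congr (R := radius N b + 1) (h₁ := 1) (h₂ := 1)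
    (k₁ := fun u => hankelKernel N b j u * (-u) ^ i * Complex.exp (-(u * w)))
    (k₂ := fun u => Complex.exp (Complex.I * Real.pi * b j) / (2 * Real.pi * Complex.I) *
        (hankelKernel N b (j + 1) u * (-u) ^ i * Complex.exp (-(u * (w - Real.pi * Complex.I)))) -
      Complex.exp (-(Complex.I * Real.pi * b j)) / (2 * Real.pi * Complex.I) *
        (hankelKernel N b (j + 1) u * (-u) ^ i * Complex.exp (-(u * (w + Real.pi * Complex.I)))))
    (fun u hu => by
      have e1 : -(u * (w - Real.pi * Complex.I)) = -(u * w) + -(u * -(Real.pi * Complex.I)) := by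
        ring
      have e2 : -(u * (w + Real.pi * Complex.I)) = -(u * w) + -(u * (Real.pi * Complex.I)) := by
        ring
      rw [hankelKernel_step hj hu, e1, e2, Complex.exp_add, Complex.exp_add]
      ring) one_pos one_pos
  unfold meijer
  rw [e, loop_sub ((hk _).const_mul _) ((hk _).const_mul _) (lt_add_one _) one_pos one_pos,
    loop_const_mul, loop_const_mul]
  ring

/-- The integrand has no singularity inside the loop. Combined with the three term relation this
gives a linear relation between N + 1 translates of `meijer N b i N`, which stands in for the
differential equation of order N. -/
lemma meijer_zero (hN : 1 ≤ N) (i : ℕ) (w : ℂ) : meijer N b i 0 w = 0 := by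
  -- The rate consists of i against the power of |s|, Re w against exp(-s w), and one unit that
  -- remains as the required decay.
  obtain ⟨C, h0, hC⟩ := exists_bound_hankelKernel_zero hN b 1 (radius N b + 1) (i + w.re + 1)
  unfold meijer
  have hd : Differentiable ℂ (hankelKernel N b 0) := by
    have : hankelKernel N b 0 = fun u : ℂ => ∏ l ∈ Finset.Ico 0 N, (Complex.Gamma (1 - b l - u))⁻¹ := by
      ext u; simp [hankelKernel]
    rw [this]
    exact Differentiable.fun_finsetProd fun l _ => differentiable_inv_Gamma_one_sub (b l)
  rw [loop_eq_zero (C := C * Real.exp (i * (1 + 2 * (radius N b + 1)) + |w.im|)) (by norm_num)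
    (fun s _ _ _ => by
      have : Differentiable ℂ fun u => hankelKernel N b 0 u * (-u) ^ i * Complex.exp (-(u * w)) := by
        fun_prop
      exact this s), mul_zero]
  intro s h1 h2 h3
  have h4 : |s.im| ≤ 1 := abs_le.2 ⟨h2, h3⟩
  have h5 := radius_nonneg N b
  have h6 : ‖s‖ ≤ Real.exp ((1 + 2 * (radius N b + 1)) - s.re) := by
    have h6 := Complex.norm_le_abs_re_add_abs_im s
    have h7 : |s.re| ≤ 2 * (radius N b + 1) - s.re := abs_le.2 ⟨by linarith, by linarith⟩
    have h8 := Real.add_one_le_exp (1 + 2 * (radius N b + 1) - s.re)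
    linarith
  have h7 : ‖Complex.exp (-(s * w))‖ ≤ Real.exp (|w.im| - s.re * w.re) := by
    rw [Complex.norm_exp]
    refine Real.exp_le_exp.2 ?_
    have : s.im * w.im ≤ 1 * |w.im| := (le_abs_self _).trans (by
      rw [abs_mul]; exact mul_le_mul_of_nonneg_right h4 (abs_nonneg _))
    simp only [Complex.neg_re, Complex.mul_re]
    linarith
  rw [norm_mul, norm_mul, norm_pow, norm_neg]
  calc _ ≤ (C * Real.exp ((i + w.re + 1) * s.re)) *
        Real.exp ((1 + 2 * (radius N b + 1)) - s.re) ^ i * Real.exp (|w.im| - s.re * w.re) := by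
        gcongr
        exact hC s h4 h1
    _ = _ := by
        rw [← Real.exp_nat_mul, mul_assoc, mul_assoc, mul_assoc, ← Real.exp_add, ← Real.exp_add,
          ← Real.exp_add]
        congr 2
        ring

lemma hankelKernel_conj (N : ℕ) (b : ℕ → ℝ) (j : ℕ) (u : ℂ) :
    hankelKernel N b j (starRingEnd ℂ u) = starRingEnd ℂ (hankelKernel N b j u) := by
  simp [hankelKernel, map_prod, ← Complex.Gamma_conj]

lemma meijer_conj (N : ℕ) (b : ℕ → ℝ) (i j : ℕ) (w : ℂ) :
    meijer N b i j (starRingEnd ℂ w) = starRingEnd ℂ (meijer N b i j w) := by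
  have h2 : (fun u => starRingEnd ℂ (hankelKernel N b j (starRingEnd ℂ u) *
      (-(starRingEnd ℂ u)) ^ i * Complex.exp (-(starRingEnd ℂ u * w)))) =
      fun u => hankelKernel N b j u * (-u) ^ i * Complex.exp (-(u * starRingEnd ℂ w)) := by
    ext u
    simp [hankelKernel_conj, ← Complex.exp_conj]
  have h3 := loop_conj (R := radius N b + 1) (h₁ := 1)
    (fun u => hankelKernel N b j u * (-u) ^ i * Complex.exp (-(u * w)))
  unfold meijer
  rw [map_mul, h3, h2]
  rw [map_inv₀, map_mul, map_mul, Complex.conj_ofReal, Complex.conj_I, map_ofNat]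
  ring

end Meijer
end CauchyChain
end

noncomputable section
namespace CauchyChain

/-! ### Stirling's formula off the negative axis -/

/-- By the mean value theorem the increment of arctan over [x/d, (x+1)/d] is d/(d² + y²) for some y
between x and x + 1, and for d ≥ 1 one has d² + y² ≤ 3(x² + d²). Sums of the left side then
telescope. -/
lemma inv_add_sq_le_arctan {x d : ℝ} (hd : 1 ≤ d) :
    1 / (x ^ 2 + d ^ 2) ≤ 3 / d * (Real.arctan ((x + 1) / d) - Real.arctan (x / d)) := by
  have hd0 : 0 < d := by linarith
  have hlt : x / d < (x + 1) / d := by gcongr; linarith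
  obtain ⟨c, hc, he⟩ := exists_deriv_eq_slope Real.arctan hlt Real.continuous_arctan.continuousOn
    Real.differentiable_arctan.differentiableOn
  have hc1 : (c * d) ^ 2 ≤ 2 * x ^ 2 + 2 := by
    have h1 : x < c * d := (div_lt_iff₀ hd0).1 hc.1
    have h2 : c * d < x + 1 := (lt_div_iff₀ hd0).1 hc.2
    nlinarith [sq_nonneg (c * d - x - 1), sq_nonneg (x - 1), sq_nonneg (x + 1)]
  have h3 : (x + 1) / d - x / d = 1 / d := by ring
  rw [h3, Real.deriv_arctan, eq_div_iff (by positivity)] at he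
  rw [← he]
  have h4 : 3 / d * (1 / (1 + c ^ 2) * (1 / d)) = 3 / (d ^ 2 + (c * d) ^ 2) := by
    field_simp
  change _ ≤ 3 / d * (1 / (1 + c ^ 2) * (1 / d))
  rw [h4, div_le_div_iff₀ (by positivity) (by positivity)]
  nlinarith

lemma sum_inv_add_sq_le {x d : ℝ} (hd : 1 ≤ d) (n : ℕ) :
    ∑ k ∈ Finset.range n, 1 / ((x + k) ^ 2 + d ^ 2) ≤ 3 * Real.pi / d := by
  have hd0 : 0 < d := by linarith
  have h1 : ∀ m : ℕ, ∑ k ∈ Finset.range m, 1 / ((x + k) ^ 2 + d ^ 2) ≤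
      3 / d * (Real.arctan ((x + m) / d) - Real.arctan (x / d)) := fun m => by
    induction m with
    | zero => simp
    | succ m ih =>
      rw [Finset.sum_range_succ]
      have := inv_add_sq_le_arctan (x := x + m) hd
      have e : x + ((m + 1 : ℕ) : ℝ) = x + m + 1 := by push_cast; ring
      rw [e]
      linarith
  refine (h1 n).trans ?_
  have h2 := Real.arctan_lt_pi_div_two ((x + n) / d)
  have h3 := Real.neg_pi_div_two_lt_arctan (x / d)
  have h4 : 3 * Real.pi / d = 3 / d * Real.pi := by ring
  rw [h4]
  gcongr
  linarith

/-- `u` is at distance at least `d` from the negative axis, in a quantified sense. -/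
def FarFromCut (d : ℝ) (u : ℂ) : Prop := d ≤ u.re ∨ d ≤ |u.im|

lemma FarFromCut.le_norm {d : ℝ} {u : ℂ} (h : FarFromCut d u) : d ≤ ‖u‖ := by
  rcases h with h | h
  · exact h.trans (Complex.re_le_norm u)
  · exact h.trans (Complex.abs_im_le_norm u)

lemma FarFromCut.add_nat {d : ℝ} {u : ℂ} (h : FarFromCut d u) (n : ℕ) : FarFromCut d (u + n) := by
  rcases h with h | h
  · left; simp; linarith [Nat.cast_nonneg (α := ℝ) n]
  · right; simpa using h

lemma FarFromCut.mem_slitPlane {d : ℝ} {u : ℂ} (hd : 0 < d) (h : FarFromCut d u) :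
    u ∈ Complex.slitPlane := by
  rcases h with h | h
  · exact Or.inl (hd.trans_le h)
  · exact Or.inr (abs_pos.1 (hd.trans_le h))

/-- One factor 1/|u + k| is at most 1/d; the remaining squares are summed by the arctangent
comparison, which contributes the second 1/d. -/
lemma sum_inv_norm_cube_le {d : ℝ} (hd : 1 ≤ d) {u : ℂ} (hu : FarFromCut d u) (n : ℕ) :
    ∑ k ∈ Finset.range n, 1 / ‖u + k‖ ^ 3 ≤ 3 * Real.pi / d ^ 2 := by
  have hd0 : 0 < d := by linarith
  -- If Re u ≥ d, then (d + k)² ≥ k² + d² and x = 0 serves; if |Im u| ≥ d, take x = Re u.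
  obtain ⟨x, hx⟩ : ∃ x : ℝ, ∀ k : ℕ, (x + k) ^ 2 + d ^ 2 ≤ ‖u + k‖ ^ 2 := by
    have e : ∀ k : ℕ, ‖u + k‖ ^ 2 = (u.re + k) ^ 2 + u.im ^ 2 := fun k => by
      rw [← Complex.normSq_eq_norm_sq, Complex.normSq_apply]; simp; ring
    rcases hu with h | h
    · refine ⟨0, fun k => ?_⟩
      rw [e]
      have : (0 : ℝ) ≤ k := Nat.cast_nonneg k
      nlinarith [sq_nonneg u.im, mul_nonneg hd0.le this]
    · refine ⟨u.re, fun k => ?_⟩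
      rw [e, ← sq_abs u.im]
      gcongr
  calc ∑ k ∈ Finset.range n, 1 / ‖u + k‖ ^ 3
      ≤ ∑ k ∈ Finset.range n, 1 / d * (1 / ((x + k) ^ 2 + d ^ 2)) := by
        refine Finset.sum_le_sum fun k _ => ?_
        rw [one_div_mul_one_div]
        refine one_div_le_one_div_of_le (by positivity) ?_
        have := mul_le_mul (hu.add_nat k).le_norm (hx k) (by positivity) (norm_nonneg _)
        exact this.trans_eq (by ring)
    _ ≤ 1 / d * (3 * Real.pi / d) := by
        rw [← Finset.mul_sum]
        exact mul_le_mul_of_nonneg_left (sum_inv_add_sq_le hd n) (by positivity)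
    _ = _ := by field_simp

/-- The imaginary part of 1 + 1/u has the sign opposite to that of u, so the two arguments partly
cancel and their sum stays in the principal range. -/
lemma log_add_one {u : ℂ} (hu : u ∈ Complex.slitPlane) (h2 : 2 ≤ ‖u‖) :
    Complex.log (u + 1) = Complex.log u + Complex.log (1 + 1 / u) := by
  have hu0 : u ≠ 0 := Complex.slitPlane_ne_zero hu
  have hn : ‖1 / u‖ ≤ 1 / 2 := by
    rw [norm_div, norm_one]; exact one_div_le_one_div_of_le (by norm_num) h2
  have hre : 0 < (1 + 1 / u).re := by
    have h3 := (abs_le.1 ((Complex.abs_re_le_norm (1 / u)).trans hn)).1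
    rw [Complex.add_re, Complex.one_re]
    linarith
  have h1 : (1 + 1 / u : ℂ) ≠ 0 := fun h => by rw [h] at hre; simp at hre
  have e : u + 1 = u * (1 + 1 / u) := by field_simp
  have him : (1 + 1 / u).im = -u.im / Complex.normSq u := by simp [Complex.inv_im]
  have hns : 0 < Complex.normSq u := Complex.normSq_pos.2 hu0
  have hlt := Complex.abs_arg_lt_pi_div_two_iff.2 (Or.inl hre)
  rw [abs_lt] at hlt
  rw [e, Complex.log_mul_eq_add_log_iff hu0 h1]
  have hpi := Real.pi_pos
  rcases lt_trichotomy u.im 0 with h | h | h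
  · have h3 : 0 ≤ (1 + 1 / u).arg := Complex.arg_nonneg_iff.2 (by rw [him]; exact div_nonneg (by linarith) hns.le)
    have h4 : u.arg < 0 := Complex.arg_neg_iff.2 h
    constructor <;> linarith [Complex.neg_pi_lt_arg u]
  · have h3 : 0 < u.re := by
      rcases hu with h' | h'
      · exact h'
      · exact absurd h h'
    have h4 : u.arg = 0 := Complex.arg_eq_zero_iff.2 ⟨h3.le, h⟩
    rw [h4]
    constructor <;> linarith
  · have h3 : (1 + 1 / u).arg < 0 := Complex.arg_neg_iff.2 (by
      rw [him]; exact div_neg_of_neg_of_pos (by linarith) hns)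
    have h4 : 0 ≤ u.arg := Complex.arg_nonneg_iff.2 h.le
    constructor <;> linarith [Complex.arg_le_pi u]

/-- The second coefficient of Stirling's series. -/
def stirlingCoeff (b : ℝ) : ℝ := -b ^ 2 / 2 + b / 2 - 1 / 12

/-- The exponent in Stirling's formula for `Γ(u + b)`. -/
def stirlingExp (b : ℝ) (u : ℂ) : ℂ := u * Complex.log u - u + (b - 1 / 2) * Complex.log u

/-- The logarithm of the ratio of consecutive values of the normalized gamma function. -/
def stirlingStep (b : ℝ) (u : ℂ) : ℂ :=
  Complex.log (1 + b / u) - (u + b + 1 / 2) * Complex.log (1 + 1 / u) + 1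
    + (stirlingCoeff b / (u + 1) - stirlingCoeff b / u)

lemma norm_log_sub_two {z : ℂ} (hz : ‖z‖ ≤ 1 / 2) :
    ‖Complex.log (1 + z) - (z - z ^ 2 / 2)‖ ≤ ‖z‖ ^ 3 := by
  have h := Complex.norm_log_sub_logTaylor_le 2 (z := z) (by linarith)
  have e : Complex.logTaylor (2 + 1) z = z - z ^ 2 / 2 := by
    simp [Complex.logTaylor, Finset.sum_range_succ]; ring
  rw [e] at h
  refine h.trans ?_
  have h1 : (1 - ‖z‖)⁻¹ ≤ 2 := by
    rw [inv_le_comm₀ (by linarith) (by norm_num)]; linarith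
  push_cast
  have : 0 ≤ ‖z‖ ^ 3 := by positivity
  have h3 : ‖z‖ ^ (2 + 1) * (1 - ‖z‖)⁻¹ ≤ ‖z‖ ^ 3 * 2 := by gcongr
  linarith [div_le_div_of_nonneg_right h3 (by norm_num : (0 : ℝ) ≤ 2 + 1)]

lemma norm_log_sub_three {z : ℂ} (hz : ‖z‖ ≤ 1 / 2) :
    ‖Complex.log (1 + z) - (z - z ^ 2 / 2 + z ^ 3 / 3)‖ ≤ ‖z‖ ^ 4 := by
  have h := Complex.norm_log_sub_logTaylor_le 3 (z := z) (by linarith)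
  have e : Complex.logTaylor (3 + 1) z = z - z ^ 2 / 2 + z ^ 3 / 3 := by
    simp [Complex.logTaylor, Finset.sum_range_succ]; ring
  rw [e] at h
  refine h.trans ?_
  have h1 : (1 - ‖z‖)⁻¹ ≤ 2 := by
    rw [inv_le_comm₀ (by linarith) (by norm_num)]; linarith
  push_cast
  have : 0 ≤ ‖z‖ ^ 4 := by positivity
  have h3 : ‖z‖ ^ (3 + 1) * (1 - ‖z‖)⁻¹ ≤ ‖z‖ ^ 4 * 2 := by gcongr
  linarith [div_le_div_of_nonneg_right h3 (by norm_num : (0 : ℝ) ≤ 3 + 1)]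

/-- In the expansion in 1/u the constant and the first order terms cancel by themselves, and
`stirlingCoeff b` is chosen to cancel the second order term. Cubic decay is what makes the sum over
u + k of order d^{-2}. -/
lemma norm_stirlingStep_le (b : ℝ) : ∃ C : ℝ, 0 ≤ C ∧ ∀ u : ℂ, 2 + 2 * |b| ≤ ‖u‖ →
    ‖stirlingStep b u‖ ≤ C * (1 / ‖u‖ ^ 3) := by
  refine ⟨|b| ^ 3 + (2 + |b|) + (2 + |b|) + 2 * |stirlingCoeff b|, by positivity, fun u hu => ?_⟩
  have hb := abs_nonneg b
  have hu2 : 2 ≤ ‖u‖ := by linarith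
  have hpos : 0 < ‖u‖ := by linarith
  have hu0 : u ≠ 0 := norm_pos_iff.1 hpos
  have hu1 : u + 1 ≠ 0 := fun h => by
    have : u = -1 := by linear_combination h
    rw [this] at hu2; norm_num at hu2
  set z : ℂ := 1 / u with hz
  have hzn : ‖z‖ = 1 / ‖u‖ := by rw [hz, norm_div, norm_one]
  have hz2 : ‖z‖ ≤ 1 / 2 := by rw [hzn]; exact one_div_le_one_div_of_le (by norm_num) hu2
  have hbz : ‖(b : ℂ) / u‖ ≤ 1 / 2 := by
    rw [norm_div, Complex.norm_real, Real.norm_eq_abs, div_le_div_iff₀ hpos (by norm_num)]; linarith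
  have h1 := norm_log_sub_two hbz
  have h2 := norm_log_sub_three hz2
  set A := Complex.log (1 + b / u) - (b / u - (b / u) ^ 2 / 2) with hA
  set B := Complex.log (1 + z) - (z - z ^ 2 / 2 + z ^ 3 / 3) with hB
  have e : stirlingStep b u = A - (u + b + 1 / 2) * B + (b + 1 / 2) * (-1 / 3) * z ^ 3
      + stirlingCoeff b * (z ^ 3 * (u / (u + 1))) := by
    have hL : Complex.log (1 + b / u) = A + (b / u - (b / u) ^ 2 / 2) := by rw [hA]; ring
    have hL2 : Complex.log (1 + 1 / u) = B + (z - z ^ 2 / 2 + z ^ 3 / 3) := by rw [hB]; ring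
    rw [stirlingStep, hL, hL2, hz]
    simp only [stirlingCoeff]
    push_cast
    field_simp
    ring
  have hz3 : ‖z‖ ^ 3 = 1 / ‖u‖ ^ 3 := by rw [hzn]; ring
  have n1 : ‖A‖ ≤ |b| ^ 3 * (1 / ‖u‖ ^ 3) := by
    refine h1.trans_eq ?_
    rw [norm_div, Complex.norm_real, Real.norm_eq_abs]; ring
  have n2 : ‖(u + b + 1 / 2) * B‖ ≤ (2 + |b|) * (1 / ‖u‖ ^ 3) := by
    rw [norm_mul]
    have h3 : ‖u + b + 1 / 2‖ ≤ (2 + |b|) * ‖u‖ := by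
      have h4 : ‖u + b + 1 / 2‖ ≤ ‖u‖ + |b| + 1 / 2 := by
        refine (norm_add_le _ _).trans (add_le_add ((norm_add_le _ _).trans ?_) (by norm_num))
        simp
      nlinarith
    calc _ ≤ ((2 + |b|) * ‖u‖) * ‖z‖ ^ 4 := by gcongr
      _ = _ := by rw [hzn]; field_simp
  have n3 : ‖((b : ℂ) + 1 / 2) * (-1 / 3) * z ^ 3‖ ≤ (2 + |b|) * (1 / ‖u‖ ^ 3) := by
    rw [norm_mul, norm_pow, hz3]
    gcongr
    rw [norm_mul]
    have h4 : ‖(b : ℂ) + 1 / 2‖ ≤ |b| + 1 / 2 := by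
      refine (norm_add_le _ _).trans (add_le_add (by simp) (by norm_num))
    have h5 : ‖(-1 / 3 : ℂ)‖ = 1 / 3 := by norm_num
    rw [h5]; linarith
  have n4 : ‖(stirlingCoeff b : ℂ) * (z ^ 3 * (u / (u + 1)))‖ ≤
      2 * |stirlingCoeff b| * (1 / ‖u‖ ^ 3) := by
    have h3 : ‖u / (u + 1)‖ ≤ 2 := by
      rw [norm_div, div_le_iff₀ (norm_pos_iff.2 hu1)]
      have := norm_sub_norm_le u (-1)
      rw [sub_neg_eq_add, norm_neg, norm_one] at this
      linarith
    rw [norm_mul, norm_mul, norm_pow, hz3, Complex.norm_real, Real.norm_eq_abs]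
    calc _ ≤ |stirlingCoeff b| * (1 / ‖u‖ ^ 3 * 2) := by gcongr
      _ = _ := by ring
  rw [e]
  refine (norm_add_le _ _).trans ((add_le_add ((norm_add_le _ _).trans (add_le_add
    ((norm_sub_le _ _).trans (add_le_add n1 n2)) n3)) n4).trans_eq ?_)
  ring

/-- The gamma function divided by the main terms of Stirling's formula. -/
def normGamma (b : ℝ) (u : ℂ) : ℂ :=
  Complex.Gamma (u + b) * Complex.exp (-stirlingExp b u + stirlingCoeff b / u)

lemma normGamma_add_one {b : ℝ} {u : ℂ} (hu : u ∈ Complex.slitPlane) (h2 : 2 + 2 * |b| ≤ ‖u‖) :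
    normGamma b (u + 1) = normGamma b u * Complex.exp (stirlingStep b u) := by
  have hb := abs_nonneg b
  have hu0 : u ≠ 0 := Complex.slitPlane_ne_zero hu
  have hub : u + b ≠ 0 := fun h => by
    have h3 : u = -b := by linear_combination h
    rw [h3, norm_neg, Complex.norm_real, Real.norm_eq_abs] at h2
    linarith
  have h3 : (u + b : ℂ) = Complex.exp (Complex.log u + Complex.log (1 + b / u)) := by
    have h4 : (1 + b / u : ℂ) ≠ 0 := fun h => hub (by field_simp at h; simpa using h)
    rw [Complex.exp_add, Complex.exp_log hu0, Complex.exp_log h4]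
    field_simp
  have h4 : Complex.Gamma (u + 1 + b) = (u + b) * Complex.Gamma (u + b) := by
    rw [← Complex.Gamma_add_one _ hub]; ring_nf
  have h5 := log_add_one hu (by linarith)
  unfold normGamma
  rw [h4]
  nth_rewrite 1 [h3]
  rw [mul_comm (Complex.exp _) (Complex.Gamma _), mul_assoc, mul_assoc, ← Complex.exp_add,
    ← Complex.exp_add]
  congr 2
  rw [stirlingExp, stirlingExp, stirlingStep, h5]
  ring

lemma Gamma_add_nat_succ {s : ℂ} (hs : ∀ m : ℕ, s ≠ -m) (n : ℕ) :
    Complex.Gamma (s + n + 1) = Complex.Gamma s * ∏ j ∈ Finset.range (n + 1), (s + j) := by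
  have h : ∀ m : ℕ, s + m ≠ 0 := fun m hm => hs m (by linear_combination hm)
  induction n with
  | zero => simpa [mul_comm] using Complex.Gamma_add_one s (by simpa using h 0)
  | succ n ih =>
    rw [Complex.Gamma_add_one _ (h _), Finset.prod_range_succ]
    have e : s + ((n + 1 : ℕ) : ℂ) = s + n + 1 := by push_cast; ring
    rw [e, ih]
    ring

/-- Only a pointwise limit along u + n is needed here: Euler's limit formula for Γ reduces it to
Stirling's formula for n!, and the uniformity in u comes afterwards from the series of steps. -/
lemma tendsto_normGamma {b : ℝ} {u : ℂ} (hu : ∀ m : ℕ, u + b ≠ -m) :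
    Tendsto (fun n : ℕ => normGamma b (u + n)) atTop (𝓝 (Real.sqrt (2 * Real.pi) : ℝ)) := by
  set s : ℂ := u + b with hs
  have hΓ : Complex.Gamma s ≠ 0 := Complex.Gamma_ne_zero hu
  have t1 : Tendsto (fun n : ℕ => Complex.Gamma s / Complex.GammaSeq s n) atTop (𝓝 1) := by
    have := (tendsto_const_nhds (x := Complex.Gamma s)).div (Complex.GammaSeq_tendsto_Gamma s) hΓ
    rwa [div_self hΓ] at this
  have t2 : Tendsto (fun n : ℕ => ((Stirling.stirlingSeq n : ℝ) : ℂ)) atTop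
      (𝓝 (Real.sqrt Real.pi : ℝ)) :=
    (Complex.continuous_ofReal.tendsto _).comp Stirling.tendsto_stirlingSeq_sqrt_pi
  have t0 : Tendsto (fun n : ℕ => (n : ℂ)⁻¹) atTop (𝓝 0) := tendsto_inv_atTop_nhds_zero_nat
  have t0' : Tendsto (fun n : ℕ => (u + 1) / (n : ℂ)) atTop (𝓝 0) := by
    simpa [div_eq_mul_inv] using t0.const_mul (u + 1)
  have t3 : Tendsto (fun n : ℕ => (n : ℂ) * Complex.log (1 + (u + 1) / n)) atTop (𝓝 (u + 1)) := by
    refine Complex.tendsto_nat_mul_log_one_add_of_tendsto ?_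
    refine tendsto_const_nhds.congr' ?_
    filter_upwards [eventually_ne_atTop 0] with n hn
    have : (n : ℂ) ≠ 0 := Nat.cast_ne_zero.2 hn
    field_simp
  have t4 : Tendsto (fun n : ℕ => Complex.log (1 + (u + 1) / n)) atTop (𝓝 0) := by
    have := t3.mul t0
    rw [mul_zero] at this
    refine this.congr' ?_
    filter_upwards [eventually_ne_atTop 0] with n hn
    have : (n : ℂ) ≠ 0 := Nat.cast_ne_zero.2 hn
    field_simp
  have t5 : Tendsto (fun n : ℕ => (stirlingCoeff b : ℂ) / (u + n + 1)) atTop (𝓝 0) := by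
    have h1 : Tendsto (fun n : ℕ => (n : ℂ)⁻¹ * ((u + 1) / n + 1)⁻¹) atTop (𝓝 (0 * (0 + 1)⁻¹)) :=
      t0.mul ((t0'.add_const 1).inv₀ (by simp))
    have := h1.const_mul (stirlingCoeff b : ℂ)
    simp only [zero_mul, mul_zero] at this
    refine this.congr' ?_
    filter_upwards [eventually_ne_atTop 0] with n hn
    have : (n : ℂ) ≠ 0 := Nat.cast_ne_zero.2 hn
    rw [← mul_inv, div_eq_mul_inv]
    congr 2
    field_simp
    ring
  have t6 : Tendsto (fun n : ℕ => Complex.exp ((u + 1) - n * Complex.log (1 + (u + 1) / n)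
      - (u + 1 + (b - 1 / 2)) * Complex.log (1 + (u + 1) / n) + stirlingCoeff b / (u + n + 1)))
      atTop (𝓝 1) := by
    have := ((((tendsto_const_nhds (x := u + 1)).sub t3).sub
      (t4.const_mul (u + 1 + (b - 1 / 2)))).add t5).cexp
    simpa using this
  have main := ((t1.mul t2).mul_const ((Real.sqrt 2 : ℝ) : ℂ)).mul t6
  rw [one_mul, mul_one, ← Complex.ofReal_mul, mul_comm, ← Real.sqrt_mul (by norm_num)] at main
  -- `GammaSeq s n` contains the n + 1 factors s, …, s + n, so the identities are exact at u + (n +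
  -- 1) and the index is shifted back at the end.
  have key : Tendsto (fun n : ℕ => normGamma b (u + (n + 1 : ℕ))) atTop
      (𝓝 ((Real.sqrt (2 * Real.pi) : ℝ) : ℂ)) := by
    refine main.congr' ?_
    have hne : ∀ᶠ n : ℕ in atTop, (1 + (u + 1) / n : ℂ) ≠ 0 := by
      have := t0'.const_add 1
      rw [add_zero] at this
      exact this.eventually_ne one_ne_zero
    filter_upwards [eventually_ne_atTop 0, hne] with n hn hn1
    have hnC : (n : ℂ) ≠ 0 := Nat.cast_ne_zero.2 hn
    have hnR : (0 : ℝ) < n := Nat.cast_pos.2 (Nat.pos_of_ne_zero hn)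
    have hlog : Complex.log (u + n + 1) = Real.log n + Complex.log (1 + (u + 1) / n) := by
      rw [← Complex.log_ofReal_mul hnR hn1]
      congr 1
      push_cast
      field_simp
      ring
    have hP : ∏ j ∈ Finset.range (n + 1), (s + j) ≠ 0 := Finset.prod_ne_zero_iff.2 fun j _ h =>
      hu j (by linear_combination h)
    have hlogn : Complex.log (n : ℂ) = (Real.log n : ℂ) := by
      rw [← Complex.ofReal_natCast, Complex.ofReal_log hnR.le]
    have hcpow : (n : ℂ) ^ s = Complex.exp (Real.log n * s) := by
      rw [Complex.cpow_def_of_ne_zero hnC, hlogn]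
    have hfact : ((n.factorial : ℝ) : ℂ) = (Stirling.stirlingSeq n : ℝ) * ((Real.sqrt 2 : ℝ) *
        Complex.exp (Real.log n / 2 + n * Real.log n - n)) := by
      have h1 : (n.factorial : ℝ) = Stirling.stirlingSeq n *
          (Real.sqrt (2 * n) * (n / Real.exp 1) ^ n) := by
        rw [Stirling.stirlingSeq, div_mul_cancel₀]
        positivity
      have h2 : Real.sqrt (2 * n) * (n / Real.exp 1) ^ n =
          Real.sqrt 2 * Real.exp (Real.log n / 2 + n * Real.log n - n) := by
        rw [Real.sqrt_mul (by norm_num), mul_assoc, add_sub_assoc, Real.exp_add,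
          Real.sqrt_eq_rpow (n : ℝ), Real.rpow_def_of_pos hnR]
        congr 2
        · ring_nf
        · rw [div_pow, ← Real.exp_nat_mul, mul_one, Real.exp_sub, Real.exp_nat_mul,
            Real.exp_log hnR]
      rw [h1, h2]
      push_cast
      ring
    have hG : Complex.Gamma (u + (n + 1 : ℕ) + b) =
        Complex.Gamma s * ∏ j ∈ Finset.range (n + 1), (s + j) := by
      rw [← Gamma_add_nat_succ hu]
      congr 1
      rw [hs]; push_cast; ring
    have hQ : Complex.Gamma s / Complex.GammaSeq s n * (Complex.exp (Real.log n * s) *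
        (n.factorial : ℝ)) = Complex.Gamma s * ∏ j ∈ Finset.range (n + 1), (s + j) := by
      have hf : (n.factorial : ℂ) ≠ 0 := Nat.cast_ne_zero.2 n.factorial_ne_zero
      have hc : (n : ℂ) ^ s ≠ 0 := by rw [hcpow]; exact Complex.exp_ne_zero _
      rw [Complex.GammaSeq, ← hcpow]
      push_cast
      field_simp
    rw [normGamma, hG, ← hQ, hfact]
    have e : Complex.exp ((u + 1) - n * Complex.log (1 + (u + 1) / n)
      - (u + 1 + (b - 1 / 2)) * Complex.log (1 + (u + 1) / n) + stirlingCoeff b / (u + n + 1)) =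
      Complex.exp (Real.log n * s) * Complex.exp (Real.log n / 2 + n * Real.log n - n) *
      Complex.exp (-stirlingExp b (u + (n + 1 : ℕ)) + stirlingCoeff b / (u + (n + 1 : ℕ))) := by
      rw [← Complex.exp_add, ← Complex.exp_add]
      congr 1
      have e1 : u + ((n + 1 : ℕ) : ℂ) = u + n + 1 := by push_cast; ring
      rw [e1, stirlingExp, hlog, hs]
      ring
    rw [e]
    ring
  exact (tendsto_add_atTop_iff_nat 1).1 key

/-- Stirling's formula to second order, uniformly away from the negative axis. -/
theorem stirling (b : ℝ) : ∃ C r : ℝ, 0 ≤ C ∧ 1 ≤ r ∧ ∀ d : ℝ, r ≤ d → ∀ u : ℂ, FarFromCut d u →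
    ∃ δ : ℂ, ‖δ‖ ≤ C / d ^ 2 ∧ Complex.Gamma (u + b) = (Real.sqrt (2 * Real.pi) : ℝ) *
      Complex.exp (stirlingExp b u - stirlingCoeff b / u + δ) := by
  obtain ⟨C, hC0, hC⟩ := norm_stirlingStep_le b
  have hb := abs_nonneg b
  refine ⟨C * (3 * Real.pi), 2 + 2 * |b|, by positivity, by linarith, fun d hd u hu => ?_⟩
  have hd1 : 1 ≤ d := by linarith
  have hstep : ∀ n : ℕ, ‖stirlingStep b (u + n)‖ ≤ C * (1 / ‖u + n‖ ^ 3) := fun n =>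
    hC _ (hd.trans (hu.add_nat n).le_norm)
  have hsum : ∀ n, ∑ k ∈ Finset.range n, ‖stirlingStep b (u + k)‖ ≤ C * (3 * Real.pi) / d ^ 2 :=
    fun n => by
      refine (Finset.sum_le_sum fun k _ => hstep k).trans ?_
      rw [← Finset.mul_sum, mul_div_assoc]
      exact mul_le_mul_of_nonneg_left (sum_inv_norm_cube_le hd1 hu n) hC0
  have hS : Summable fun k : ℕ => ‖stirlingStep b (u + k)‖ :=
    summable_of_sum_range_le (fun _ => norm_nonneg _) hsum
  have hpole : ∀ m : ℕ, u + b ≠ -m := fun m hm => by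
    have h1 : u = -b - m := by linear_combination hm
    rcases hu with h | h
    · rw [h1] at h
      simp at h
      linarith [neg_abs_le b, Nat.cast_nonneg (α := ℝ) m]
    · rw [h1] at h
      simp at h
      linarith
  -- Telescoping. As n tends to infinity the left side tends to √(2π), so the value at u is √(2π)
  -- times the exponential of minus a convergent series, and that series is the error δ.
  have hprod : ∀ n : ℕ, normGamma b (u + n) =
      normGamma b u * Complex.exp (∑ k ∈ Finset.range n, stirlingStep b (u + k)) := fun n => by
    induction n with
    | zero => simp
    | succ n ih =>
      have e : u + ((n + 1 : ℕ) : ℂ) = u + n + 1 := by push_cast; ring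
      rw [e, normGamma_add_one ((hu.add_nat n).mem_slitPlane (by linarith))
        (hd.trans (hu.add_nat n).le_norm), ih, Finset.sum_range_succ, Complex.exp_add, mul_assoc]
  have hlim := hS.of_norm.hasSum.tendsto_sum_nat
  have h1 : Tendsto (fun n : ℕ => normGamma b (u + n)) atTop
      (𝓝 (normGamma b u * Complex.exp (∑' k : ℕ, stirlingStep b (u + k)))) := by
    simp only [hprod]
    exact (hlim.cexp).const_mul _
  have h2 := tendsto_nhds_unique h1 (tendsto_normGamma hpole)
  refine ⟨-∑' k : ℕ, stirlingStep b (u + k), ?_, ?_⟩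
  · rw [norm_neg]
    exact (norm_tsum_le_tsum_norm hS).trans (hS.tsum_le_of_sum_range_le hsum)
  · rw [← h2, normGamma, mul_assoc, mul_assoc, ← Complex.exp_add, ← Complex.exp_add]
    ring_nf
    simp

end CauchyChain
end

noncomputable section
namespace CauchyChain

/-! ### Rectangles and residues -/

/-- The integral along the boundary of the rectangle `[a, b] × [c, d]`, counterclockwise. -/
def rectIntegral (a b c d : ℝ) (f : ℂ → ℂ) : ℂ :=
  (∫ x in a..b, f (x + c * Complex.I)) - (∫ x in a..b, f (x + d * Complex.I))
    + Complex.I * (∫ y in c..d, f (b + y * Complex.I))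
    - Complex.I * ∫ y in c..d, f (a + y * Complex.I)

section Rect

variable {a b c d : ℝ}

/-- Only the horizontal edges are compared, so poles between the two vertical sides are allowed;
this is the form in which residues are collected. -/
lemma loop_sub_loop {R R' h : ℝ} {R₀ : ℝ} {f : ℂ → ℂ} (hf : IsHankel R₀ f) (hh : 0 < h) :
    loop R' h h f - loop R h h f = rectIntegral R R' (-h) h f := by
  have ha := intervalIntegral.integral_Iic_sub_Iic (hf.integrableOn_horizontal_sub hh R)
    (hf.integrableOn_horizontal_sub hh R')
  have hb := intervalIntegral.integral_Iic_sub_Iic (hf.integrableOn_horizontal hh.ne' R)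
    (hf.integrableOn_horizontal hh.ne' R')
  simp only [loop, rectIntegral, Complex.ofReal_neg, neg_mul, ← sub_eq_add_neg]
  linear_combination ha - hb

/-- The boundary of the rectangle. -/
def rectBoundary (a b c d : ℝ) : Set ℂ :=
  {s | (a ≤ s.re ∧ s.re ≤ b ∧ c ≤ s.im ∧ s.im ≤ d) ∧
    (s.re = a ∨ s.re = b ∨ s.im = c ∨ s.im = d)}

lemma rectIntegral_integrable {f : ℂ → ℂ} (hf : ContinuousOn f (rectBoundary a b c d))
    (hab : a ≤ b) (hcd : c ≤ d) :
    (∀ y, y = c ∨ y = d → IntervalIntegrable (fun x : ℝ => f (x + y * Complex.I)) volume a b) ∧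
    (∀ x, x = a ∨ x = b → IntervalIntegrable (fun y : ℝ => f (x + y * Complex.I)) volume c d) := by
  refine ⟨fun y hy => ContinuousOn.intervalIntegrable ?_,
    fun x hx => ContinuousOn.intervalIntegrable ?_⟩
  · refine hf.comp (f := fun x : ℝ => (x : ℂ) + y * Complex.I) (by fun_prop) fun x hx => ?_
    rw [Set.uIcc_of_le hab] at hx
    rcases hy with rfl | rfl <;> simp [rectBoundary, hx.1, hx.2, hcd]
  · refine hf.comp (f := fun y : ℝ => (x : ℂ) + y * Complex.I) (by fun_prop) fun y hy => ?_
    rw [Set.uIcc_of_le hcd] at hy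
    rcases hx with rfl | rfl <;> simp [rectBoundary, hy.1, hy.2, hab]

lemma rectIntegral_add {f g : ℂ → ℂ} (hf : ContinuousOn f (rectBoundary a b c d))
    (hg : ContinuousOn g (rectBoundary a b c d)) (hab : a ≤ b) (hcd : c ≤ d) :
    rectIntegral a b c d (fun s => f s + g s) = rectIntegral a b c d f + rectIntegral a b c d g := by
  obtain ⟨f1, f2⟩ := rectIntegral_integrable hf hab hcd
  obtain ⟨g1, g2⟩ := rectIntegral_integrable hg hab hcd
  unfold rectIntegral
  rw [intervalIntegral.integral_add (f1 c (Or.inl rfl)) (g1 c (Or.inl rfl)),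
    intervalIntegral.integral_add (f1 d (Or.inr rfl)) (g1 d (Or.inr rfl)),
    intervalIntegral.integral_add (f2 a (Or.inl rfl)) (g2 a (Or.inl rfl)),
    intervalIntegral.integral_add (f2 b (Or.inr rfl)) (g2 b (Or.inr rfl))]
  ring

lemma rectIntegral_const_mul (k : ℂ) (f : ℂ → ℂ) :
    rectIntegral a b c d (fun s => k * f s) = k * rectIntegral a b c d f := by
  simp only [rectIntegral, intervalIntegral.integral_const_mul]
  ring

lemma rectIntegral_congr {f g : ℂ → ℂ} (h : Set.EqOn f g (rectBoundary a b c d))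
    (hab : a ≤ b) (hcd : c ≤ d) : rectIntegral a b c d f = rectIntegral a b c d g := by
  have h1 : ∀ y, y = c ∨ y = d → ∫ x in a..b, f (x + y * Complex.I) =
      ∫ x in a..b, g (x + y * Complex.I) := fun y hy => intervalIntegral.integral_congr fun x hx => by
    rw [Set.uIcc_of_le hab] at hx
    refine h ?_
    rcases hy with rfl | rfl <;> simp [rectBoundary, hx.1, hx.2, hcd]
  have h2 : ∀ x, x = a ∨ x = b → ∫ y in c..d, f (x + y * Complex.I) =
      ∫ y in c..d, g (x + y * Complex.I) := fun x hx => intervalIntegral.integral_congr fun y hy => by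
    rw [Set.uIcc_of_le hcd] at hy
    refine h ?_
    rcases hx with rfl | rfl <;> simp [rectBoundary, hy.1, hy.2, hab]
  unfold rectIntegral
  rw [h1 c (Or.inl rfl), h1 d (Or.inr rfl), h2 a (Or.inl rfl), h2 b (Or.inr rfl)]

lemma rectIntegral_eq_zero {f : ℂ → ℂ} (hab : a ≤ b) (hcd : c ≤ d) {s₀ : ℂ}
    (hc : ∀ s : ℂ, a ≤ s.re → s.re ≤ b → c ≤ s.im → s.im ≤ d → ContinuousAt f s)
    (hd : ∀ s : ℂ, a ≤ s.re → s.re ≤ b → c ≤ s.im → s.im ≤ d → s ≠ s₀ → DifferentiableAt ℂ f s) :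
    rectIntegral a b c d f = 0 := by
  have := Complex.integral_boundary_rect_eq_zero_of_differentiable_on_off_countable f
    ⟨a, c⟩ ⟨b, d⟩ {s₀} (Set.countable_singleton _) (fun s hs => by
      rw [Complex.mem_reProdIm, Set.uIcc_of_le hab, Set.uIcc_of_le hcd] at hs
      exact (hc s hs.1.1 hs.1.2 hs.2.1 hs.2.2).continuousWithinAt) (fun s hs => by
      rw [Set.mem_sdiff, Complex.mem_reProdIm] at hs
      simp only [min_eq_left hab, max_eq_right hab, min_eq_left hcd, max_eq_right hcd] at hs
      exact hd s hs.1.1.1.le hs.1.1.2.le hs.1.2.1.le hs.1.2.2.le hs.2)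
  simpa [rectIntegral] using this

lemma log_sub_log_neg {z : ℂ} (hz : 0 < z.im) :
    Complex.log z - Complex.log (-z) = Real.pi * Complex.I := by
  have h := Complex.arg_neg_eq_arg_sub_pi_of_im_pos hz
  apply Complex.ext
  · simp [Complex.log_re]
  · simp [Complex.log_im, h]

/-- The principal logarithm is a primitive of 1/s on the lower, right and upper sides. The left side
crosses its cut, so log(-s) is used there; passing between the two branches at the two left corners
contributes πi each. -/
lemma rectIntegral_inv (ha : a < 0) (hb : 0 < b) (hc : c < 0) (hd : 0 < d) :
    rectIntegral a b c d (fun s => s⁻¹) = 2 * Real.pi * Complex.I := by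
  have hline : ∀ (p q : ℂ) (x y : ℝ), (∀ t : ℝ, t ∈ Set.uIcc x y → p + t * q ∈ Complex.slitPlane) →
      q * (∫ t in x..y, (p + t * q)⁻¹) = Complex.log (p + y * q) - Complex.log (p + x * q) :=
    fun p q x y h => by
      rw [← intervalIntegral.integral_const_mul]
      refine intervalIntegral.integral_eq_sub_of_hasDerivAt
        (f := fun t : ℝ => Complex.log (p + t * q)) (fun t ht => ?_) ?_
      · have h1 : HasDerivAt (fun t : ℝ => p + t * q) q t := by
          simpa using ((hasDerivAt_id t).ofReal_comp.mul_const q).const_add p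
        have := h1.clog_real (h t ht)
        simpa [div_eq_mul_inv] using this
      · refine ContinuousOn.intervalIntegrable ?_
        refine continuousOn_const.mul (ContinuousOn.inv₀ (by fun_prop) fun t ht => ?_)
        exact Complex.slitPlane_ne_zero (h t ht)
  have h1 := hline (c * Complex.I) 1 a b fun t _ => Or.inr (by simpa using hc.ne)
  have h2 := hline (d * Complex.I) 1 a b fun t _ => Or.inr (by simpa using hd.ne')
  have h3 := hline b Complex.I c d fun t _ => Or.inl (by simpa using hb)
  have h4 := hline (-a) (-Complex.I) c d fun t _ => Or.inl (by simpa using ha)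
  have h5 : ∀ t : ℝ, (-(a : ℂ) + t * -Complex.I)⁻¹ = -(a + t * Complex.I)⁻¹ := fun t => by
    rw [← inv_neg]; congr 1; ring
  have h6 := log_sub_log_neg (z := a + d * Complex.I) (by simpa using hd)
  have h7 := log_sub_log_neg (z := -(a + c * Complex.I)) (by simpa using hc)
  rw [neg_neg] at h7
  simp only [h5, intervalIntegral.integral_neg] at h4
  have e1 : -(a : ℂ) + d * -Complex.I = -(a + d * Complex.I) := by ring
  have e2 : -(a : ℂ) + c * -Complex.I = -(a + c * Complex.I) := by ring
  rw [e1, e2] at h4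
  simp only [mul_one, one_mul, add_comm ((_ : ℂ) * Complex.I)] at h1 h2
  unfold rectIntegral
  linear_combination h1 - h2 + h3 - h4 + h6 + h7

/-- The residue theorem for a simple pole in a rectangle. -/
lemma rectIntegral_div_sub {F : ℂ → ℂ} {s₀ : ℝ} (ha : a < s₀) (hb : s₀ < b) (hc : c < 0) (hd : 0 < d)
    (hF : ∀ s : ℂ, a ≤ s.re → s.re ≤ b → c ≤ s.im → s.im ≤ d → DifferentiableAt ℂ F s) :
    rectIntegral a b c d (fun s => F s * (s - s₀)⁻¹) = 2 * Real.pi * Complex.I * F s₀ := by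
  have hab : a ≤ b := by linarith
  have hcd : c ≤ d := by linarith
  have hs₀ : DifferentiableAt ℂ F s₀ := hF _ (by simpa using ha.le) (by simpa using hb.le)
    (by simpa using hc.le) (by simpa using hd.le)
  have hne : ∀ s ∈ rectBoundary a b c d, s ≠ s₀ := by
    rintro s ⟨-, hs⟩ rfl
    simp only [Complex.ofReal_re, Complex.ofReal_im] at hs
    rcases hs with h | h | h | h <;> linarith
  -- On the boundary F(s)/(s - s₀) is the divided difference `dslope F s₀`, whose singularity is
  -- removable, plus F(s₀)/(s - s₀).
  have h1 : rectIntegral a b c d (dslope F s₀) = 0 := by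
    have hdiff : ∀ s : ℂ, a ≤ s.re → s.re ≤ b → c ≤ s.im → s.im ≤ d → s ≠ s₀ →
        DifferentiableAt ℂ (dslope F s₀) s := fun s h1 h2 h3 h4 hs =>
      (differentiableAt_dslope_of_ne hs).2 (hF s h1 h2 h3 h4)
    refine rectIntegral_eq_zero hab hcd (s₀ := s₀) (fun s h1 h2 h3 h4 => ?_) hdiff
    by_cases hs : s = s₀
    · rw [hs]; exact continuousAt_dslope_same.2 hs₀
    · exact (hdiff s h1 h2 h3 h4 hs).continuousAt
  have h2 : rectIntegral a b c d (fun s => (s - s₀)⁻¹) = 2 * Real.pi * Complex.I := by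
    rw [← rectIntegral_inv (sub_neg.2 ha) (sub_pos.2 hb) hc hd]
    have e1 : ∀ y : ℝ, ∫ x in a..b, ((x : ℂ) + y * Complex.I - s₀)⁻¹ =
        ∫ x in (a - s₀)..(b - s₀), ((x : ℂ) + y * Complex.I)⁻¹ := fun y => by
      rw [← intervalIntegral.integral_comp_sub_right
        (fun x : ℝ => ((x : ℂ) + y * Complex.I)⁻¹) s₀]
      congr 1; ext x; congr 1; push_cast; ring
    unfold rectIntegral
    rw [e1, e1]
    congr 3
    · congr 2; ext y; push_cast; ring
    · ext y; push_cast; ring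
  have e : Set.EqOn (fun s => F s * (s - s₀)⁻¹)
      (fun s => dslope F s₀ s + F s₀ * (s - s₀)⁻¹) (rectBoundary a b c d) := fun s hs => by
    have h3 := sub_ne_zero.2 (hne s hs)
    simp only [dslope_of_ne _ (hne s hs), slope_def_field]
    field_simp
    ring
  have hbd : ∀ s ∈ rectBoundary a b c d, DifferentiableAt ℂ F s := fun s hs =>
    hF s hs.1.1 hs.1.2.1 hs.1.2.2.1 hs.1.2.2.2
  have hcinv : ContinuousOn (fun s : ℂ => (s - s₀)⁻¹) (rectBoundary a b c d) :=
    ContinuousOn.inv₀ (by fun_prop) fun s hs => sub_ne_zero.2 (hne s hs)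
  have hadd := rectIntegral_add (f := dslope F s₀) (g := fun s => F s₀ * (s - s₀)⁻¹)
    (fun s hs => ?_) (continuousOn_const.mul hcinv) hab hcd
  · rw [rectIntegral_congr e hab hcd, hadd, h1, rectIntegral_const_mul, h2]
    ring
  · exact ((differentiableAt_dslope_of_ne (hne s hs)).2 (hbd s hs)).continuousAt.continuousWithinAt

end Rect

/-- A loop integral with right end `R` is `O(exp (-R re w))` to the left. -/
lemma norm_loop_le {R₀ R h : ℝ} {k : ℂ → ℂ} (hk : IsHankel R₀ k) (hh : 0 < h)
    (hv : Continuous fun y : ℝ => k (R + y * Complex.I)) :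
    ∃ C : ℝ, 0 ≤ C ∧ ∀ w : ℂ, w.re ≤ 0 →
      ‖loop R h h fun s => k s * Complex.exp (-(s * w))‖ ≤
        C * Real.exp (h * |w.im|) * Real.exp (-R * w.re) := by
  set I₁ := ∫ x in Set.Iic R, ‖k (x - h * Complex.I)‖
  set I₂ := ∫ y in (-h)..h, ‖k (R + y * Complex.I)‖
  set I₃ := ∫ x in Set.Iic R, ‖k (x + h * Complex.I)‖
  have p1 : 0 ≤ I₁ := integral_nonneg fun _ => norm_nonneg _
  have p2 : 0 ≤ I₂ := intervalIntegral.integral_nonneg (by linarith) fun _ _ => norm_nonneg _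
  have p3 : 0 ≤ I₃ := integral_nonneg fun _ => norm_nonneg _
  refine ⟨I₁ + I₂ + I₃, by positivity, fun w hw => ?_⟩
  set E := Real.exp (h * |w.im|) * Real.exp (-R * w.re) with hE
  have hexp : ∀ s : ℂ, s.re ≤ R → |s.im| ≤ h → ‖k s * Complex.exp (-(s * w))‖ ≤ ‖k s‖ * E :=
    fun s h1 h2 => by
      rw [norm_mul, Complex.norm_exp, hE, ← Real.exp_add]
      gcongr
      have h3 : s.im * w.im ≤ h * |w.im| := (le_abs_self _).trans (by
        rw [abs_mul]; exact mul_le_mul_of_nonneg_right h2 (abs_nonneg _))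
      simp only [Complex.neg_re, Complex.mul_re]
      nlinarith
  have b1 : ‖∫ x in Set.Iic R, k (x - h * Complex.I) * Complex.exp (-((x - h * Complex.I) * w))‖ ≤
      I₁ * E := by
    rw [← integral_mul_const]
    refine norm_integral_le_of_norm_le ((hk.integrableOn_horizontal_sub hh R).norm.mul_const _) ?_
    refine (ae_restrict_mem measurableSet_Iic).mono fun x hx => hexp _ (by simpa using hx) ?_
    simp [abs_of_pos hh]
  have b3 : ‖∫ x in Set.Iic R, k (x + h * Complex.I) * Complex.exp (-((x + h * Complex.I) * w))‖ ≤
      I₃ * E := by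
    rw [← integral_mul_const]
    refine norm_integral_le_of_norm_le ((hk.integrableOn_horizontal hh.ne' R).norm.mul_const _) ?_
    refine (ae_restrict_mem measurableSet_Iic).mono fun x hx => hexp _ (by simpa using hx) ?_
    simp [abs_of_pos hh]
  have b2 : ‖∫ y in (-h)..h, k (R + y * Complex.I) * Complex.exp (-((R + y * Complex.I) * w))‖ ≤
      I₂ * E := by
    rw [← intervalIntegral.integral_mul_const]
    refine intervalIntegral.norm_integral_le_of_norm_le (by linarith) ?_
      ((hv.norm.mul continuous_const).intervalIntegrable _ _)
    refine Eventually.of_forall fun y hy => hexp _ (by simp) ?_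
    simpa using abs_le.2 ⟨hy.1.le, hy.2⟩
  unfold loop
  calc _ ≤ I₁ * E + I₂ * E + I₃ * E := by
        refine (norm_sub_le _ _).trans (add_le_add ((norm_add_le _ _).trans (add_le_add b1 ?_)) b3)
        rw [norm_mul, Complex.norm_I, mul_one]
        exact b2
    _ = _ := by rw [hE]; ring

/-! ### The loop integral of the gamma function -/

/-- Differentiation inserts -s, and sΓ(s) = Γ(s + 1); translating the loop back by 1 produces the
factor e^w. So the integral satisfies L' = -e^w L. -/
lemma loop_Gamma_hasDerivAt (w : ℂ) :
    HasDerivAt (fun w => loop 1 1 1 fun s => Complex.Gamma s * Complex.exp (-(s * w)))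
      (-Complex.exp w * loop 1 1 1 fun s => Complex.Gamma s * Complex.exp (-(s * w))) w := by
  refine (hasDerivAt_loop isHankel_Gamma one_pos one_pos one_pos w).congr_deriv ?_
  have hk := isHankel_Gamma.mul_exp w
  have h1 := loop_congr (R := 1) (h₁ := 1) (h₂ := 1)
    (k₁ := fun s => Complex.Gamma s * (-s) * Complex.exp (-(s * w)))
    (k₂ := fun s => -Complex.exp w *
      (fun s => Complex.Gamma s * Complex.exp (-(s * w))) (s + (1 : ℝ))) (fun s hs => by
      have h0 : s ≠ 0 := fun h => hs (by simp [h])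
      simp only [Complex.ofReal_one]
      rw [Complex.Gamma_add_one s h0]
      have : Complex.exp (-(s * w)) = Complex.exp w * Complex.exp (-((s + 1) * w)) := by
        rw [← Complex.exp_add]; congr 1; ring
      rw [this]; ring) one_pos one_pos
  have h2 := loop_comp_add (R := 1) (h₁ := 1) (h₂ := 1)
    (k := fun s => Complex.Gamma s * Complex.exp (-(s * w))) 1
  rw [h1, loop_const_mul, h2, loop_indep hk (by norm_num) one_pos one_pos one_pos one_pos one_pos]

/-- The Cahen-Mellin integral. The differential equation gives L = c exp(-e^w). To find c, let w
tend to -∞: moving the loop to Re s = -1/2 picks up the residue 1 of Γ at 0 and leaves a term that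
vanishes in the limit. -/
lemma loop_Gamma (w : ℂ) : (loop 1 1 1 fun s => Complex.Gamma s * Complex.exp (-(s * w))) =
    2 * Real.pi * Complex.I * Complex.exp (-Complex.exp w) := by
  set L : ℂ → ℂ := fun w => loop 1 1 1 fun s => Complex.Gamma s * Complex.exp (-(s * w)) with hL
  have hconst : ∀ z, L z * Complex.exp (Complex.exp z) = L 0 * Complex.exp (Complex.exp 0) := by
    intro z
    have hd : ∀ z, HasDerivAt (fun z => L z * Complex.exp (Complex.exp z)) 0 z := fun z =>
      ((loop_Gamma_hasDerivAt z).mul (Complex.hasDerivAt_exp z).cexp).congr_deriv (by ring)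
    exact is_const_of_deriv_eq_zero (fun z => (hd z).differentiableAt) (fun z => (hd z).deriv) z 0
  set c := L 0 * Complex.exp (Complex.exp 0) with hc
  have hLz : ∀ z, L z = c * Complex.exp (-Complex.exp z) := fun z => by
    rw [← hconst z, mul_assoc, ← Complex.exp_add]; simp
  have hv : Continuous fun y : ℝ => Complex.Gamma ((-1 / 2 : ℝ) + y * Complex.I) := by
    refine continuous_iff_continuousAt.2 fun y => ?_
    have : ContinuousAt Complex.Gamma ((-1 / 2 : ℝ) + y * Complex.I) := by
      refine (Complex.differentiableAt_Gamma _ fun m hm => ?_).continuousAt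
      have h1 := congrArg Complex.re hm
      simp at h1
      have h2 : ((1 : ℕ) : ℝ) = ((2 * m : ℕ) : ℝ) := by push_cast; linarith
      have h3 := Nat.cast_injective h2
      omega
    exact ContinuousAt.comp (f := fun y : ℝ => ((-1 / 2 : ℝ) : ℂ) + y * Complex.I) this
      (by fun_prop)
  obtain ⟨C, hC0, hC⟩ := norm_loop_le isHankel_Gamma one_pos hv
  have hres : ∀ z, L z - 2 * Real.pi * Complex.I =
      loop (-1 / 2) 1 1 fun s => Complex.Gamma s * Complex.exp (-(s * z)) := fun z => by
    have h1 := loop_sub_loop (R := -1 / 2) (R' := 1) (isHankel_Gamma.mul_exp z) one_pos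
    have h2 := rectIntegral_div_sub (a := -1 / 2) (b := 1) (c := -1) (d := 1) (s₀ := 0)
      (F := fun s => Complex.Gamma (s + 1) * Complex.exp (-(s * z))) (by norm_num) (by norm_num)
      (by norm_num) (by norm_num) (fun s h1 _ _ _ => by
        have : DifferentiableAt ℂ Complex.Gamma (s + 1) :=
          differentiableAt_Gamma_of_pos (Or.inl (by simp; linarith))
        have h3 : DifferentiableAt ℂ (fun s => Complex.Gamma (s + 1)) s :=
          this.comp s (by fun_prop)
        exact h3.mul (by fun_prop))
    have h3 : rectIntegral (-1 / 2) 1 (-1) 1 (fun s => Complex.Gamma s * Complex.exp (-(s * z))) =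
        2 * Real.pi * Complex.I := by
      rw [rectIntegral_congr (g := fun s => Complex.Gamma (s + 1) * Complex.exp (-(s * z)) *
        (s - (0 : ℝ))⁻¹) (fun s hs => ?_) (by norm_num) (by norm_num), h2]
      · simp
      · have hs0 : s ≠ 0 := by
          rintro rfl
          have := hs.2
          norm_num at this
        simp only [Complex.ofReal_zero, sub_zero]
        rw [Complex.Gamma_add_one s hs0]
        field_simp
    rw [h3] at h1
    linear_combination h1
  have hlim1 : Tendsto (fun x : ℝ => L x - 2 * Real.pi * Complex.I) atBot (𝓝 0) := by
    have h1 : Tendsto (fun x : ℝ => C * Real.exp (x / 2)) atBot (𝓝 0) := by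
      have : Tendsto (fun x : ℝ => x / 2) atBot atBot := tendsto_id.atBot_div_const (by norm_num)
      simpa using (Real.tendsto_exp_atBot.comp this).const_mul C
    refine squeeze_zero_norm' ?_ h1
    filter_upwards [eventually_le_atBot 0] with x hx
    rw [hres]
    refine (hC x (by simpa using hx)).trans_eq ?_
    simp
    left; ring
  have hlim2 : Tendsto (fun x : ℝ => L x - 2 * Real.pi * Complex.I) atBot
      (𝓝 (c - 2 * Real.pi * Complex.I)) := by
    simp only [hLz]
    have h1 : Tendsto (fun x : ℝ => Complex.exp (x : ℂ)) atBot (𝓝 0) := by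
      have := (Complex.continuous_ofReal.tendsto 0).comp Real.tendsto_exp_atBot
      refine this.congr fun x => ?_
      simp
    have h2 := ((h1.neg).cexp).const_mul c
    simp only [neg_zero, Complex.exp_zero, mul_one] at h2
    exact h2.sub_const _
  have := sub_eq_zero.1 (tendsto_nhds_unique hlim2 hlim1)
  rw [← this]
  exact hLz w

end CauchyChain
end

noncomputable section
namespace CauchyChain

/-! ### Comparison of a product of gamma functions with a single gamma function -/

/-- The distance (up to a constant) from the negative axis. -/
def cutDist (u : ℂ) : ℝ := max u.re |u.im|

lemma farFromCut_cutDist (u : ℂ) : FarFromCut (cutDist u) u := by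
  unfold FarFromCut cutDist
  rcases le_total u.re |u.im| with h | h
  · right; simp [h]
  · left; simp [h]

/-- Points tend to infinity away from the negative axis. -/
def awayFromCut : Filter ℂ := comap cutDist atTop

lemma tendsto_cutDist : Tendsto cutDist awayFromCut atTop := tendsto_comap

lemma eventually_awayFromCut {P : ℂ → Prop} :
    (∀ᶠ u in awayFromCut, P u) ↔ ∃ r : ℝ, ∀ u, r ≤ cutDist u → P u := by
  rw [awayFromCut, eventually_comap]
  constructor
  · intro h
    obtain ⟨r, hr⟩ := eventually_atTop.1 h
    exact ⟨r, fun u hu => hr _ hu u rfl⟩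
  · rintro ⟨r, hr⟩
    exact eventually_atTop.2 ⟨r, fun d hd u hu => hr u (by rw [hu]; exact hd)⟩

lemma eventually_le_cutDist (r : ℝ) : ∀ᶠ u in awayFromCut, r ≤ cutDist u :=
  eventually_awayFromCut.2 ⟨r, fun _ h => h⟩

lemma stirling_eventually (b : ℝ) : ∃ δ : ℂ → ℂ,
    δ =O[awayFromCut] (fun u => (cutDist u)⁻¹ ^ 2) ∧
    ∀ᶠ u in awayFromCut, Complex.Gamma (u + b) = (Real.sqrt (2 * Real.pi) : ℝ) *
      Complex.exp (stirlingExp b u - stirlingCoeff b / u + δ u) := by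
  obtain ⟨C, r, hC, hr, h⟩ := stirling b
  choose! δ hδ using fun (u : ℂ) (hu : r ≤ cutDist u) => h _ hu u (farFromCut_cutDist u)
  refine ⟨δ, IsBigO.of_bound C ?_, ?_⟩
  · filter_upwards [eventually_le_cutDist r] with u hu
    refine (hδ u hu).1.trans_eq ?_
    have : 0 < cutDist u := by linarith
    rw [Real.norm_of_nonneg (by positivity)]
    field_simp
  · filter_upwards [eventually_le_cutDist r] with u hu using (hδ u hu).2

lemma prod_stirling (b : ℕ → ℝ) (n : ℕ) : ∃ (K : ℝ) (δ : ℂ → ℂ),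
    δ =O[awayFromCut] (fun u => (cutDist u)⁻¹ ^ 2) ∧
    ∀ᶠ u in awayFromCut, ∏ l ∈ Finset.range n, Complex.Gamma (u + b l) =
      (Real.sqrt (2 * Real.pi) ^ n : ℝ) * Complex.exp (n * (u * Complex.log u - u) +
        ((∑ l ∈ Finset.range n, b l - n / 2 : ℝ) : ℂ) * Complex.log u - K / u + δ u) := by
  induction n with
  | zero => exact ⟨0, 0, isBigO_zero _ _, Eventually.of_forall fun u => by simp⟩
  | succ n ih =>
    obtain ⟨K, δ, h1, h2⟩ := ih
    obtain ⟨δ', h1', h2'⟩ := stirling_eventually (b n)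
    refine ⟨K + stirlingCoeff (b n), fun u => δ u + δ' u, h1.add h1', ?_⟩
    filter_upwards [h2, h2'] with u hu hu'
    rw [Finset.prod_range_succ, hu, hu', mul_mul_mul_comm, ← Complex.exp_add,
      ← Complex.ofReal_mul, ← pow_succ, Finset.sum_range_succ, stirlingExp]
    congr 2
    push_cast
    ring

lemma inv_isBigO : (fun u : ℂ => u⁻¹) =O[awayFromCut] fun u => (cutDist u)⁻¹ := by
  refine IsBigO.of_bound 1 ?_
  filter_upwards [eventually_le_cutDist 1] with u hu
  have h1 := (farFromCut_cutDist u).le_norm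
  rw [norm_inv, one_mul, norm_inv, Real.norm_of_nonneg (by linarith)]
  gcongr

lemma inv_add_isBigO {a c : ℝ} (ha : 1 ≤ a) :
    (fun u : ℂ => ((a : ℂ) * u + c)⁻¹) =O[awayFromCut] fun u => (cutDist u)⁻¹ := by
  refine IsBigO.of_bound 2 ?_
  filter_upwards [eventually_le_cutDist (1 + 2 * |c|)] with u hu
  have h1 := (farFromCut_cutDist u).le_norm
  have hc := abs_nonneg c
  have h2 : cutDist u / 2 ≤ ‖(a : ℂ) * u + c‖ := by
    have h3 := norm_sub_norm_le ((a : ℂ) * u) (-c)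
    rw [sub_neg_eq_add, norm_neg, norm_mul, Complex.norm_real, Complex.norm_real,
      Real.norm_of_nonneg (by linarith), Real.norm_eq_abs] at h3
    nlinarith
  have h4 : 0 < cutDist u / 2 := by linarith
  rw [norm_inv, norm_inv, Real.norm_of_nonneg (by linarith : 0 ≤ cutDist u), ← div_eq_mul_inv,
    ← inv_div]
  exact inv_anti₀ h4 h2

lemma tendsto_inv_cutDist : Tendsto (fun u => (cutDist u)⁻¹) awayFromCut (𝓝 0) :=
  tendsto_inv_atTop_zero.comp tendsto_cutDist

lemma inv_isBigO_inv_sq_trans {f : ℂ → ℂ} (h : f =O[awayFromCut] fun u => (cutDist u)⁻¹ ^ 2) :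
    f =O[awayFromCut] fun u => (cutDist u)⁻¹ := by
  refine h.trans ((IsBigO.of_bound 1 ?_))
  filter_upwards [eventually_le_cutDist 1] with u hu
  have : 0 < cutDist u := by linarith
  rw [one_mul, norm_pow, Real.norm_of_nonneg (by positivity)]
  have h1 : (cutDist u)⁻¹ ≤ 1 := inv_le_one_of_one_le₀ hu
  have h2 : 0 ≤ (cutDist u)⁻¹ := by positivity
  nlinarith

lemma exp_expansion {K : ℂ} {δ : ℂ → ℂ} (hδ : δ =O[awayFromCut] fun u => (cutDist u)⁻¹ ^ 2) :
    (fun u => Complex.exp (-(K * u⁻¹) + δ u) - (1 - K * u⁻¹)) =O[awayFromCut]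
      fun u => (cutDist u)⁻¹ ^ 2 := by
  have hx : (fun u => -(K * u⁻¹) + δ u) =O[awayFromCut] fun u => (cutDist u)⁻¹ :=
    ((inv_isBigO.const_mul_left K).neg_left).add (inv_isBigO_inv_sq_trans hδ)
  have h1 := (Complex.exp_sub_sum_range_isBigO_pow 2).comp_tendsto
    (hx.trans_tendsto tendsto_inv_cutDist)
  have h2 := (h1.trans (hx.pow 2)).add hδ
  refine h2.congr_left fun u => ?_
  simp [Finset.sum_range_succ]
  ring

/-- The exponent of the model kernel in Stirling's formula. -/
def modelExp (N : ℕ) (β : ℝ) (u : ℂ) : ℂ :=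
  N * (u * Complex.log u - u) + (β - 1 / 2) * Complex.log u

/-- The model kernel, a single gamma function. -/
def modelKernel (N : ℕ) (γ : ℝ) (u : ℂ) : ℂ :=
  Complex.exp (-(u * (N * Real.log N))) * Complex.Gamma (N * u + γ)

lemma cutDist_mul {a : ℝ} (ha : 0 ≤ a) (u : ℂ) : cutDist (a * u) = a * cutDist u := by
  simp [cutDist, abs_mul, abs_of_nonneg ha, mul_max_of_nonneg _ _ ha]

lemma tendsto_mul_awayFromCut {a : ℝ} (ha : 0 < a) :
    Tendsto (fun u : ℂ => (a : ℂ) * u) awayFromCut awayFromCut := by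
  rw [awayFromCut, tendsto_comap_iff]
  have : cutDist ∘ (fun u : ℂ => (a : ℂ) * u) = fun u => a * cutDist u := by
    ext u; exact cutDist_mul ha.le u
  rw [this]
  exact tendsto_cutDist.const_mul_atTop ha

/-- Since log(Nu) = log N + log u, the factor N^{-Nu} in the model removes the contribution of log N
that depends on u; what remains has the same main exponent as a product of N gamma functions. -/
lemma modelKernel_stirling {N : ℕ} (hN : 1 ≤ N) (β : ℝ) : ∃ δ : ℂ → ℂ,
    δ =O[awayFromCut] (fun u => (cutDist u)⁻¹ ^ 2) ∧
    ∀ᶠ u in awayFromCut, modelKernel N β u =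
      (Real.sqrt (2 * Real.pi) * Real.exp ((β - 1 / 2) * Real.log N) : ℝ) *
        Complex.exp (modelExp N β u) *
        Complex.exp (-(((stirlingCoeff β / N : ℝ) : ℂ) * u⁻¹) + δ u) := by
  obtain ⟨δ, h1, h2⟩ := stirling_eventually β
  have hN0 : (0 : ℝ) < N := by exact_mod_cast hN
  have ht := tendsto_mul_awayFromCut hN0
  refine ⟨fun u => δ ((N : ℝ) * u), ?_, ?_⟩
  · refine (h1.comp_tendsto ht).trans (IsBigO.of_bound 1 ?_)
    filter_upwards [eventually_le_cutDist 1] with u hu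
    have hd : 0 < cutDist u := by linarith
    simp only [Function.comp, cutDist_mul hN0.le]
    rw [Real.norm_of_nonneg (by positivity), Real.norm_of_nonneg (by positivity), one_mul]
    gcongr
    have : (1 : ℝ) ≤ N := by exact_mod_cast hN
    nlinarith
  · filter_upwards [ht.eventually h2, eventually_le_cutDist 1] with u hu hu1
    have hu0 : u ≠ 0 := norm_pos_iff.1 (by linarith [(farFromCut_cutDist u).le_norm])
    have hlog := Complex.log_ofReal_mul hN0 hu0
    have hNC : (N : ℂ) ≠ 0 := by exact_mod_cast hN0.ne'
    simp only [Complex.ofReal_natCast] at hu hlog ⊢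
    rw [modelKernel, hu, Complex.ofReal_mul, Complex.ofReal_exp, mul_left_comm, ← Complex.exp_add,
      mul_assoc, mul_assoc, ← Complex.exp_add, ← Complex.exp_add, stirlingExp, modelExp, hlog]
    generalize Real.log N = x
    congr 2
    push_cast
    field_simp
    ring

/-- By the functional equation of Γ, lowering β by one is a relative correction of order 1/u, so the
second model can adjust the first order coefficient. -/
lemma model_combination (N : ℕ) (β c : ℝ) {u : ℂ} (hu : (N : ℂ) * u + (β - 1) ≠ 0) :
    modelKernel N β u + c * modelKernel N (β - 1) u =
      modelKernel N β u * (1 + c * ((N : ℂ) * u + (β - 1))⁻¹) := by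
  have h1 := Complex.Gamma_add_one _ hu
  have h2 : (N : ℂ) * u + (β - 1) + 1 = N * u + β := by ring
  rw [h2] at h1
  unfold modelKernel
  push_cast
  rw [h1]
  generalize (N : ℂ) * u + (β - 1) = x at hu
  field_simp

/-- The product of the gamma functions `Γ(u + b l)` agrees to second order with a combination of two
single gamma functions. -/
theorem prod_Gamma_compare {N : ℕ} (hN : 1 ≤ N) (b : ℕ → ℝ) (β : ℝ)
    (hβ : β = ∑ l ∈ Finset.range N, b l - (N - 1) / 2) : ∃ c C r : ℝ, 0 ≤ C ∧
    ∀ u : ℂ, r ≤ cutDist u →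
      ‖(∏ l ∈ Finset.range N, Complex.Gamma (u + b l)) -
        (Real.sqrt (2 * Real.pi) ^ (N - 1 : ℕ) * Real.exp ((1 / 2 - β) * Real.log N) : ℝ) *
          (modelKernel N β u + c * modelKernel N (β - 1) u)‖ ≤
        C * (cutDist u)⁻¹ ^ 2 * ‖Complex.exp (modelExp N β u)‖ := by
  obtain ⟨K, δ, h1, h2⟩ := prod_stirling b N
  obtain ⟨δ', h1', h2'⟩ := modelKernel_stirling hN β
  have hN1 : (1 : ℝ) ≤ N := by exact_mod_cast hN
  have hN0 : (N : ℂ) ≠ 0 := by exact_mod_cast (by linarith : (N : ℝ) ≠ 0)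
  set κ : ℝ := stirlingCoeff β with hκ
  -- The product has the relative first order term -K/u, the model -κ/(Nu), and the correction
  -- c/(Nu); this c makes them match. The second order is needed because the later contour estimate
  -- takes absolute values and loses half an order.
  set c : ℝ := κ - N * K with hc
  have e1 := exp_expansion (K := (K : ℂ)) h1
  have e2 := exp_expansion (K := ((κ / N : ℝ) : ℂ)) h1'
  have y1 : (fun u : ℂ => (c : ℂ) * ((N : ℂ) * u + (β - 1))⁻¹) =O[awayFromCut]
      fun u => (cutDist u)⁻¹ := by
    have := (inv_add_isBigO (a := N) (c := β - 1) hN1).const_mul_left (c : ℂ)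
    simpa using this
  have hne : ∀ᶠ u in awayFromCut, (N : ℂ) * u + (β - 1) ≠ 0 := by
    filter_upwards [eventually_le_cutDist (1 + |β - 1|)] with u hu h0
    have h3 := (farFromCut_cutDist u).le_norm
    have h4 : (N : ℂ) * u = -((β - 1 : ℝ) : ℂ) := by push_cast; linear_combination h0
    have h5 := congrArg norm h4
    rw [norm_mul, norm_neg, Complex.norm_real, Real.norm_eq_abs, Complex.norm_natCast] at h5
    nlinarith [abs_nonneg (β - 1)]
  have hne0 : ∀ᶠ u in awayFromCut, u ≠ 0 := by
    filter_upwards [eventually_le_cutDist 1] with u hu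
    exact norm_pos_iff.1 (by linarith [(farFromCut_cutDist u).le_norm])
  have y2 : (fun u : ℂ => (c : ℂ) * ((N : ℂ) * u + (β - 1))⁻¹ - c / N * u⁻¹) =O[awayFromCut]
      fun u => (cutDist u)⁻¹ ^ 2 := by
    have h3 := ((y1.mul inv_isBigO).const_mul_left ((1 - β : ℂ) / N))
    refine (h3.congr' ?_ (Eventually.of_forall fun u => (sq _).symm))
    filter_upwards [hne, hne0] with u hu hu0
    field_simp
    ring
  have y3 : (fun u : ℂ => ((κ / N : ℝ) : ℂ) * u⁻¹ * (c * ((N : ℂ) * u + (β - 1))⁻¹)) =O[awayFromCut]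
      fun u => (cutDist u)⁻¹ ^ 2 :=
    ((inv_isBigO.const_mul_left _).mul y1).congr_right fun u => (sq _).symm
  have y4 : (fun u : ℂ => (Complex.exp (-(((κ / N : ℝ) : ℂ) * u⁻¹) + δ' u) -
      (1 - ((κ / N : ℝ) : ℂ) * u⁻¹)) * (1 + c * ((N : ℂ) * u + (β - 1))⁻¹)) =O[awayFromCut]
      fun u => (cutDist u)⁻¹ ^ 2 := by
    have h3 : (fun u : ℂ => (1 : ℂ) + c * ((N : ℂ) * u + (β - 1))⁻¹) =O[awayFromCut]
        fun _ => (1 : ℝ) :=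
      (isBigO_const_const _ one_ne_zero _).add (y1.trans (tendsto_inv_cutDist.isBigO_one ℝ))
    simpa using e2.mul h3
  have hdiff : (fun u : ℂ => Complex.exp (-(K * u⁻¹) + δ u) -
      Complex.exp (-(((κ / N : ℝ) : ℂ) * u⁻¹) + δ' u) *
        (1 + c * ((N : ℂ) * u + (β - 1))⁻¹)) =O[awayFromCut] fun u => (cutDist u)⁻¹ ^ 2 := by
    refine (((e1.sub y4).add y3).sub y2).congr_left fun u => ?_
    have : (c : ℂ) / N = (κ / N : ℝ) - K := by
      rw [hc]; push_cast; field_simp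
    rw [this]
    ring
  obtain ⟨C, hC0, hC⟩ := hdiff.exists_nonneg
  have key := hC.bound
  have hall := (key.and h2).and (h2'.and (hne.and (eventually_le_cutDist 1)))
  obtain ⟨r, hr⟩ := eventually_awayFromCut.1 hall
  refine ⟨c, Real.sqrt (2 * Real.pi) ^ N * C, r, by positivity, fun u hu => ?_⟩
  obtain ⟨⟨k1, k2⟩, k3, k4, k5⟩ := hr u hu
  rw [k2, model_combination N β c k4, k3]
  have hexp : (N : ℂ) * (u * Complex.log u - u) +
      ((∑ l ∈ Finset.range N, b l - N / 2 : ℝ) : ℂ) * Complex.log u - K / u + δ u =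
      modelExp N β u + (-(K * u⁻¹) + δ u) := by
    rw [modelExp, hβ]; push_cast; field_simp; ring
  have hconst : ((Real.sqrt (2 * Real.pi) ^ (N - 1 : ℕ) *
      Real.exp ((1 / 2 - β) * Real.log N) : ℝ) : ℂ) *
      ((Real.sqrt (2 * Real.pi) * Real.exp ((β - 1 / 2) * Real.log N) : ℝ) : ℂ) =
      (Real.sqrt (2 * Real.pi) ^ N : ℝ) := by
    rw [← Complex.ofReal_mul]
    congr 1
    have h6 : Real.exp ((1 / 2 - β) * Real.log N) * Real.exp ((β - 1 / 2) * Real.log N) = 1 := by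
      rw [← Real.exp_add]; ring_nf; simp
    have h7 : Real.sqrt (2 * Real.pi) ^ N =
        Real.sqrt (2 * Real.pi) ^ (N - 1) * Real.sqrt (2 * Real.pi) := by
      rw [← pow_succ, Nat.sub_add_cancel hN]
    rw [h7]
    linear_combination Real.sqrt (2 * Real.pi) ^ (N - 1) * Real.sqrt (2 * Real.pi) * h6
  rw [hexp, Complex.exp_add]
  set A := Complex.exp (-(K * u⁻¹) + δ u)
  set B := Complex.exp (-(((κ / N : ℝ) : ℂ) * u⁻¹) + δ' u)
  set Y := (N : ℂ) * u + (β - 1)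
  set E := Complex.exp (modelExp N β u)
  have hfin : ∀ P Q S : ℂ, Q * S = P → P * (E * A) - Q * (S * E * B * (1 + c * Y⁻¹)) =
      P * E * (A - B * (1 + c * Y⁻¹)) := by
    rintro P Q S rfl; ring
  rw [hfin _ _ _ hconst, norm_mul, norm_mul, Complex.norm_real, Real.norm_of_nonneg (by positivity)]
  rw [norm_pow, norm_inv, Real.norm_of_nonneg (by linarith : 0 ≤ cutDist u)] at k1
  calc _ ≤ Real.sqrt (2 * Real.pi) ^ N * ‖E‖ * (C * (cutDist u)⁻¹ ^ 2) := by gcongr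
    _ = _ := by ring

end CauchyChain
end

noncomputable section
namespace CauchyChain

/-! ### Exact loop integrals of the model kernel -/

lemma IsHankel.comp_mul {R₀ : ℝ} {k : ℂ → ℂ} (hk : IsHankel R₀ k) {a : ℝ} (ha : 0 < a) :
    IsHankel (R₀ / a) fun s => k (a * s) := by
  refine ⟨fun s hs => ?_, fun η H R M hη => ?_⟩
  · have h1 : DifferentiableAt ℂ k ((a : ℂ) * s) := by
      refine hk.diff _ ?_
      rcases hs with hs | hs
      · left; rw [Complex.re_ofReal_mul]; rwa [div_lt_iff₀' ha] at hs
      · right; rw [Complex.im_ofReal_mul]; exact mul_ne_zero ha.ne' hs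
    exact DifferentiableAt.comp (f := fun s : ℂ => (a : ℂ) * s) s h1 (by fun_prop)
  · obtain ⟨C, hC, h⟩ := hk.decay (a * η) (a * H) (a * R) (M / a) (by positivity)
    refine ⟨C, hC, fun s h1 h2 h3 => ?_⟩
    have := h (a * s)
    rw [Complex.re_ofReal_mul, Complex.im_ofReal_mul, abs_mul, abs_of_pos ha] at this
    have e : M / a * (a * s.re) = M * s.re := by field_simp
    rw [e] at this
    exact this (by gcongr) (by gcongr) (by gcongr)

lemma modelKernel_eq (N : ℕ) (γ : ℝ) : modelKernel N γ =
    fun u => Complex.Gamma (((N : ℝ) : ℂ) * u + γ) *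
      Complex.exp (-(u * ((N * Real.log N : ℝ) : ℂ))) := by
  ext u
  unfold modelKernel
  push_cast
  ring

lemma isHankel_modelKernel {N : ℕ} (hN : 1 ≤ N) (γ : ℝ) :
    IsHankel (|γ| / N) (modelKernel N γ) := by
  rw [modelKernel_eq]
  refine IsHankel.mul_exp ?_ _
  exact (isHankel_Gamma_add (neg_le_abs γ)).comp_mul (by exact_mod_cast hN)

/-- The substitution s = Nu + γ turns this into the Cahen-Mellin integral at W = w/N + log N. -/
lemma loop_modelKernel {N : ℕ} (hN : 1 ≤ N) (γ : ℝ) {R h₁ h₂ : ℝ} (hR : |γ| / N < R)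
    (h1 : 0 < h₁) (h2 : 0 < h₂) (w : ℂ) :
    loop R h₁ h₂ (fun u => modelKernel N γ u * Complex.exp (-(u * w))) =
      2 * Real.pi * Complex.I * ((N : ℂ)⁻¹ * Complex.exp (γ * (w / N + Real.log N)) *
        Complex.exp (-(N * Complex.exp (w / N)))) := by
  have hN0 : (0 : ℝ) < N := by exact_mod_cast hN
  have hNC : (N : ℂ) ≠ 0 := by exact_mod_cast hN0.ne'
  set W : ℂ := w / N + Real.log N with hW
  have e1 : (fun u => modelKernel N γ u * Complex.exp (-(u * w))) =
      fun u : ℂ => (fun s : ℂ => Complex.Gamma (s + γ) * Complex.exp (-(s * W))) ((N : ℝ) * u) := by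
    ext u
    simp only [modelKernel_eq, mul_assoc, ← Complex.exp_add]
    congr 2
    rw [hW]
    push_cast
    field_simp
    ring
  have e2 : (fun s : ℂ => Complex.Gamma (s + γ) * Complex.exp (-(s * W))) =
      fun s : ℂ => (fun s => Complex.exp (γ * W) *
        (Complex.Gamma s * Complex.exp (-(s * W)))) (s + γ) := by
    ext s
    simp only
    rw [mul_left_comm, ← Complex.exp_add]
    congr 2
    ring
  have hNR : 0 < N * R + γ := by
    rw [div_lt_iff₀' hN0] at hR
    linarith [neg_le_abs γ]
  have key := loop_scale (k := fun s : ℂ => Complex.Gamma (s + γ) * Complex.exp (-(s * W)))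
    (R := R) (h₁ := h₁) (h₂ := h₂) hN0
  rw [← e1] at key
  rw [e2, loop_comp_add (k := fun s => Complex.exp (γ * W) *
      (Complex.Gamma s * Complex.exp (-(s * W)))), loop_const_mul,
    loop_indep (isHankel_Gamma.mul_exp W) hNR one_pos (by positivity) (by positivity) one_pos
      one_pos, loop_Gamma] at key
  have e3 : Complex.exp W = N * Complex.exp (w / N) := by
    rw [hW, Complex.exp_add, ← Complex.ofReal_exp, Real.exp_log hN0]
    push_cast
    ring
  rw [e3] at key
  have := congrArg (fun z => (N : ℂ)⁻¹ * z) key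
  simp only [Complex.ofReal_natCast] at this
  rw [inv_mul_cancel_left₀ hNC] at this
  rw [← this]
  ring

/-! ### The loop integral of a remainder on a scaled loop -/

/-- The points of the loop with parameters `R, h₁, h₂`. -/
def OnLoop (R h₁ h₂ : ℝ) (v : ℂ) : Prop :=
  (v.re = R ∧ -h₁ ≤ v.im ∧ v.im ≤ h₂) ∨ (v.re ≤ R ∧ (v.im = -h₁ ∨ v.im = h₂))

/-- The real part of the phase function, whose saddle point is `exp (i φ)`. -/
def phase (φ : ℝ) (v : ℂ) : ℝ := (v * Complex.log v - v - Complex.I * φ * v).re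

lemma norm_loop_le_of_bounds {R h₁ h₂ A B : ℝ} (h : -h₁ ≤ h₂) {f : ℂ → ℂ}
    (hA : ∀ v : ℂ, v.re ≤ R → (v.im = -h₁ ∨ v.im = h₂) → ‖f v‖ ≤ A * Real.exp v.re)
    (hB : ∀ v : ℂ, v.re = R → -h₁ ≤ v.im → v.im ≤ h₂ → ‖f v‖ ≤ B) :
    ‖loop R h₁ h₂ f‖ ≤ 2 * (A * Real.exp R) + B * (h₂ + h₁) := by
  have hint : ∀ y : ℝ, (y = -h₁ ∨ y = h₂) →
      ‖∫ x in Set.Iic R, f (x + y * Complex.I)‖ ≤ A * Real.exp R := fun y hy => by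
    have : ∫ x in Set.Iic R, A * Real.exp x = A * Real.exp R := by
      rw [integral_const_mul, integral_exp_Iic]
    rw [← this]
    refine norm_integral_le_of_norm_le ((integrableOn_exp_Iic R).const_mul A) ?_
    refine (ae_restrict_mem measurableSet_Iic).mono fun x hx => ?_
    simpa using hA (x + y * Complex.I) (by simpa using hx) (by simpa using hy)
  have hvert : ‖∫ y in (-h₁)..h₂, f (R + y * Complex.I)‖ ≤ B * (h₂ + h₁) := by
    have := intervalIntegral.norm_integral_le_of_norm_le_const (a := -h₁) (b := h₂) (C := B)
      (f := fun y : ℝ => f (R + y * Complex.I)) fun y hy => by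
        rw [Set.uIoc_of_le h] at hy
        exact hB _ (by simp) (by simpa using hy.1.le) (by simpa using hy.2)
    rwa [abs_of_nonneg (by linarith), sub_neg_eq_add] at this
  have e : (fun x : ℝ => f (x - h₁ * Complex.I)) =
      fun x : ℝ => f (x + (-h₁ : ℝ) * Complex.I) := by ext x; push_cast; ring_nf
  unfold loop
  rw [e]
  refine (norm_sub_le _ _).trans ?_
  have h3 := norm_add_le (∫ x in Set.Iic R, f (x + (-h₁ : ℝ) * Complex.I))
    ((∫ y in (-h₁)..h₂, f (R + y * Complex.I)) * Complex.I)
  rw [norm_mul, Complex.norm_I, mul_one] at h3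
  linarith [hint (-h₁) (Or.inl rfl), hint h₂ (Or.inr rfl)]

lemma continuousOn_modelExp (N : ℕ) (β : ℝ) :
    ContinuousOn (modelExp N β) Complex.slitPlane := by
  unfold modelExp
  have : ContinuousOn Complex.log Complex.slitPlane := fun z hz =>
    (Complex.differentiableAt_log hz).continuousAt.continuousWithinAt
  fun_prop

lemma exists_bound_exp_modelExp (β η H R : ℝ) (hη : 0 < η) : ∃ C : ℝ, 0 ≤ C ∧
    ∀ v : ℂ, η ≤ |v.im| → |v.im| ≤ H → v.re ≤ R →
      ‖Complex.exp (modelExp 1 β v)‖ ≤ C * Real.exp v.re := by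
  set K : ℝ := |β - 1 / 2| with hK
  have hK0 : 0 ≤ K := abs_nonneg _
  -- To the left of -X one has log |v| ≥ 4 and -Re v ≥ 2K, which suffices for Re v · log |v| to
  -- dominate the term with β - 1/2 and to leave the decay e^{Re v}.
  set X : ℝ := 2 * K + Real.exp 4 with hX
  have hcomp := (isCompact_strip (-X) R η H).exists_bound_of_continuousOn
    (f := fun v => Complex.exp (modelExp 1 β v) * Complex.exp (-v)) (by
      refine ContinuousOn.mul (Complex.continuous_exp.comp_continuousOn
        ((continuousOn_modelExp 1 β).mono ?_)) (by fun_prop)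
      rintro s ⟨-, h1, -⟩
      right
      intro h0
      rw [h0] at h1
      simp at h1
      linarith)
  obtain ⟨C, hC⟩ := hcomp
  refine ⟨max C (Real.exp (Real.pi * H)), le_max_of_le_right (Real.exp_pos _).le,
    fun v h1 h2 h3 => ?_⟩
  rcases le_total (-X) v.re with hv | hv
  · have := hC v ⟨⟨hv, h3⟩, h1, h2⟩
    rw [norm_mul, Complex.norm_exp (-v), Complex.neg_re, Real.exp_neg, ← div_eq_mul_inv,
      div_le_iff₀ (Real.exp_pos _)] at this
    exact this.trans (by gcongr; exact le_max_left _ _)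
  · refine le_trans ?_ (mul_le_mul_of_nonneg_right (le_max_right _ _) (Real.exp_pos _).le)
    rw [Complex.norm_exp, ← Real.exp_add, Real.exp_le_exp]
    have e4 := Real.exp_pos 4
    have hn : Real.exp 4 ≤ ‖v‖ := by
      have := Complex.abs_re_le_norm v
      rw [abs_of_nonpos (by linarith)] at this
      linarith
    have hlog : 4 ≤ Real.log ‖v‖ := by
      rwa [Real.le_log_iff_exp_le (by linarith)]
    have harg : -(v.im * v.arg) ≤ Real.pi * H := by
      have := Complex.abs_arg_le_pi v
      calc -(v.im * v.arg) ≤ |v.im| * |v.arg| := by rw [← abs_mul]; exact neg_le_abs _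
        _ ≤ H * Real.pi := by gcongr; exact (abs_nonneg _).trans h2
        _ = _ := mul_comm _ _
    have hre : (modelExp 1 β v).re = v.re * Real.log ‖v‖ - v.im * v.arg - v.re +
        (β - 1 / 2) * Real.log ‖v‖ := by
      have : ((β : ℂ) - 1 / 2) = ((β - 1 / 2 : ℝ) : ℂ) := by push_cast; ring
      rw [modelExp, this, Complex.add_re, Complex.re_ofReal_mul, Complex.log_re]
      simp [Complex.log_re, Complex.log_im]
    rw [hre]
    have hb : β - 1 / 2 ≤ K := le_abs_self _
    nlinarith [mul_le_mul_of_nonneg_right hb (by linarith : 0 ≤ Real.log ‖v‖),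
      mul_nonneg (by linarith : 0 ≤ -v.re - 2 * K) (by linarith : 0 ≤ Real.log ‖v‖ - 4),
      mul_nonneg hK0 (by linarith : 0 ≤ Real.log ‖v‖ - 4)]

lemma exists_bound_exp_modelExp_vertical (β : ℝ) {R : ℝ} (hR : 0 < R) (h₁ h₂ : ℝ) : ∃ C : ℝ,
    0 ≤ C ∧ ∀ v : ℂ, v.re = R → -h₁ ≤ v.im → v.im ≤ h₂ → ‖Complex.exp (modelExp 1 β v)‖ ≤ C := by
  have hcomp := ((isCompact_Icc (a := -h₁) (b := h₂)).image
    (f := fun y : ℝ => (R : ℂ) + y * Complex.I) (by fun_prop)).exists_bound_of_continuousOn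
    (f := fun v => Complex.exp (modelExp 1 β v)) (by
      refine Complex.continuous_exp.comp_continuousOn ((continuousOn_modelExp 1 β).mono ?_)
      rintro _ ⟨y, -, rfl⟩
      left
      simpa using hR)
  obtain ⟨C, hC⟩ := hcomp
  refine ⟨max C 0, le_max_right _ _, fun v h1 h2 h3 => (hC v ⟨v.im, ⟨h2, h3⟩, ?_⟩).trans
    (le_max_left _ _)⟩
  rw [← h1]
  exact Complex.re_add_im v

/-- With u = e^τ v the terms in τ u cancel between u log u and u w / N. What is left is the large
parameter N e^τ times a phase that does not depend on τ. -/
lemma norm_exp_scaled {N : ℕ} (β τ φ : ℝ) {v : ℂ} (hv : v ≠ 0) :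
    ‖Complex.exp (modelExp N β (Real.exp τ * v)) *
        Complex.exp (-(Real.exp τ * v * (N * (τ + φ * Complex.I))))‖ =
      Real.exp ((β - 1 / 2) * τ) * Real.exp (N * Real.exp τ * phase φ v) *
        ‖Complex.exp ((β - 1 / 2) * Complex.log v)‖ := by
  rw [modelExp, Complex.log_ofReal_mul (Real.exp_pos τ) hv, Real.log_exp, ← Complex.exp_add,
    Complex.norm_exp, Complex.norm_exp, ← Real.exp_add, ← Real.exp_add, phase]
  congr 1
  have e : (β - 1 / 2) * τ = (((β : ℂ) - 1 / 2) * τ).re := by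
    have : ((β : ℂ) - 1 / 2) * τ = (((β - 1 / 2) * τ : ℝ) : ℂ) := by push_cast; ring
    rw [this, Complex.ofReal_re]
  have e2 : N * Real.exp τ * (v * Complex.log v - v - Complex.I * φ * v).re =
      ((N : ℂ) * Real.exp τ * (v * Complex.log v - v - Complex.I * φ * v)).re := by
    have : ((N : ℂ) * Real.exp τ) = ((N * Real.exp τ : ℝ) : ℂ) := by push_cast; ring
    rw [this, Complex.re_ofReal_mul]
  rw [e, e2, ← Complex.add_re, ← Complex.add_re]
  congr 1
  ring

/-- The bound for the loop integral of a remainder which is smaller by two orders than the model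
kernel, on a scaled loop. -/
lemma norm_scaled_loop_le {N : ℕ} (hN : 1 ≤ N) {β C r R h₁ h₂ : ℝ} {Ξ : ℂ → ℂ} (hC : 0 ≤ C)
    (hΞ : ∀ u : ℂ, r ≤ cutDist u →
      ‖Ξ u‖ ≤ C * (cutDist u)⁻¹ ^ 2 * ‖Complex.exp (modelExp N β u)‖)
    (hR : 0 < R) (h1 : 0 < h₁) (h2 : 0 < h₂) (Y M₀ : ℝ) : ∃ C' τ₀ : ℝ, 0 ≤ C' ∧ 0 ≤ τ₀ ∧
      ∀ τ φ M : ℝ, τ₀ ≤ τ → |φ| ≤ Y → |M| ≤ M₀ → (∀ v, OnLoop R h₁ h₂ v → phase φ v ≤ M) →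
        ‖loop (Real.exp τ * R) (Real.exp τ * h₁) (Real.exp τ * h₂)
          (fun u => Ξ u * Complex.exp (-(u * (N * (τ + φ * Complex.I)))))‖ ≤
          C' * Real.exp ((β - 3 / 2) * τ) * Real.exp (N * Real.exp τ * M) := by
  set d : ℝ := min R (min h₁ h₂) with hd
  have hd0 : 0 < d := lt_min hR (lt_min h1 h2)
  set H : ℝ := max h₁ h₂ with hH
  obtain ⟨A, hA0, hA⟩ := exists_bound_exp_modelExp β (min h₁ h₂) H R (lt_min h1 h2)
  obtain ⟨B, hB0, hB⟩ := exists_bound_exp_modelExp_vertical β hR h₁ h₂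
  have hloop : ∀ v, OnLoop R h₁ h₂ v → d ≤ cutDist v ∧ |v.im| ≤ H := by
    rintro v (⟨e1, e2, e3⟩ | ⟨e1, e2⟩)
    · refine ⟨(min_le_left _ _).trans (e1 ▸ le_max_left _ _), abs_le.2 ⟨?_, ?_⟩⟩
      · exact (neg_le_neg (le_max_left _ _)).trans e2
      · exact e3.trans (le_max_right _ _)
    · have hm : min h₁ h₂ ≤ |v.im| ∧ |v.im| ≤ H := by
        rcases e2 with e2 | e2 <;> rw [e2]
        · rw [abs_neg, abs_of_pos h1]; exact ⟨min_le_left _ _, le_max_left _ _⟩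
        · rw [abs_of_pos h2]; exact ⟨min_le_right _ _, le_max_right _ _⟩
      exact ⟨(min_le_right _ _).trans (hm.1.trans (le_max_right _ _)), hm.2⟩
  set P : ℝ := C * d⁻¹ ^ 2 * Real.exp (Y * H + M₀) with hP
  have hP0 : 0 ≤ P := by positivity
  refine ⟨P * (2 * (A * Real.exp R) + B * (h₂ + h₁)), max 0 (Real.log (max 1 (r / d))),
    by positivity, le_max_left _ _, fun τ φ M hτ hφ hM hph => ?_⟩
  have hτ0 : 0 ≤ τ := (le_max_left _ _).trans hτ
  have hτr : r ≤ Real.exp τ * d := by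
    have := (le_max_right _ _).trans hτ
    rw [Real.log_le_iff_le_exp (by positivity)] at this
    rw [← div_le_iff₀ hd0]
    exact (le_max_right _ _).trans this
  have he := Real.exp_pos τ
  have he1 : 1 ≤ Real.exp τ := Real.one_le_exp hτ0
  have hN1 : (1 : ℝ) ≤ N := by exact_mod_cast hN
  have hNe : 1 ≤ N * Real.exp τ := by nlinarith
  -- The exponent of e^τ is β - 1/2 from the model minus 2 from the remainder; the scaling of the
  -- loop adds 1 at the end.
  set Q : ℝ := P * Real.exp ((β - 5 / 2) * τ) * Real.exp (N * Real.exp τ * M) with hQ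
  have hpt : ∀ v, OnLoop R h₁ h₂ v → ‖Ξ (Real.exp τ * v) *
      Complex.exp (-(Real.exp τ * v * (N * (τ + φ * Complex.I))))‖ ≤
        Q * ‖Complex.exp (modelExp 1 β v)‖ := fun v hv => by
    obtain ⟨hcd, him⟩ := hloop v hv
    have hv0 : v ≠ 0 := norm_pos_iff.1
      ((hd0.trans_le hcd).trans_le (farFromCut_cutDist v).le_norm)
    have hcu : cutDist (Real.exp τ * v) = Real.exp τ * cutDist v := cutDist_mul he.le v
    have hb := hΞ (Real.exp τ * v) (by rw [hcu]; exact hτr.trans (by gcongr))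
    rw [norm_mul]
    refine (mul_le_mul_of_nonneg_right hb (norm_nonneg _)).trans ?_
    rw [mul_assoc, ← norm_mul, norm_exp_scaled β τ φ hv0, hcu]
    have hinv : (Real.exp τ * cutDist v)⁻¹ ^ 2 ≤ d⁻¹ ^ 2 * Real.exp (-2 * τ) := by
      have : Real.exp (-2 * τ) = (Real.exp τ)⁻¹ ^ 2 := by
        rw [← Real.exp_neg, ← Real.exp_nat_mul]; congr 1; push_cast; ring
      rw [this, mul_inv, mul_pow, mul_comm]
      have : (cutDist v)⁻¹ ≤ d⁻¹ := inv_anti₀ hd0 hcd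
      have : 0 ≤ (cutDist v)⁻¹ := inv_nonneg.2 (hd0.le.trans hcd)
      gcongr
    have hE : ‖Complex.exp (modelExp 1 β v)‖ = Real.exp (phase φ v) * Real.exp (-(φ * v.im)) *
        ‖Complex.exp ((β - 1 / 2) * Complex.log v)‖ := by
      rw [modelExp, Complex.norm_exp, Complex.norm_exp, ← Real.exp_add, ← Real.exp_add, phase]
      congr 1
      simp
    -- As N e^τ ≥ 1 and phase - M ≤ 0, one has N e^τ (phase - M) ≤ phase - M. The single copy of the
    -- phase kept on the right provides integrability along the horizontal edges.
    have hexp : Real.exp (N * Real.exp τ * phase φ v) ≤ Real.exp (N * Real.exp τ * M) *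
        (Real.exp (Y * H + M₀) * (Real.exp (phase φ v) * Real.exp (-(φ * v.im)))) := by
      simp only [← Real.exp_add]
      rw [Real.exp_le_exp]
      have h3 := hph v hv
      have h4 : φ * v.im ≤ Y * H := (le_abs_self _).trans (by
        rw [abs_mul]; exact mul_le_mul hφ him (abs_nonneg _) ((abs_nonneg _).trans hφ))
      have h5 := (abs_le.1 hM).1
      nlinarith [mul_nonneg (sub_nonneg.2 hNe) (sub_nonneg.2 h3)]
    rw [hE, hQ, hP]
    calc _ ≤ C * (d⁻¹ ^ 2 * Real.exp (-2 * τ)) * (Real.exp ((β - 1 / 2) * τ) *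
          (Real.exp (N * Real.exp τ * M) * (Real.exp (Y * H + M₀) * (Real.exp (phase φ v) *
            Real.exp (-(φ * v.im))))) * ‖Complex.exp ((β - 1 / 2) * Complex.log v)‖) := by
          gcongr
      _ = _ := by
          have : Real.exp ((β - 5 / 2) * τ) = Real.exp (-2 * τ) * Real.exp ((β - 1 / 2) * τ) := by
            rw [← Real.exp_add]; congr 1; ring
          rw [this]; ring
  have hQ0 : 0 ≤ Q := by positivity
  have hbound := norm_loop_le_of_bounds (R := R) (h₁ := h₁) (h₂ := h₂) (A := Q * A) (B := Q * B)
    (by linarith) (f := fun v => Ξ (Real.exp τ * v) *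
      Complex.exp (-(Real.exp τ * v * (N * (τ + φ * Complex.I)))))
    (fun v e1 e2 => by
      refine (hpt v (Or.inr ⟨e1, e2⟩)).trans ?_
      rw [mul_assoc Q]
      refine mul_le_mul_of_nonneg_left (hA v ?_ (hloop v (Or.inr ⟨e1, e2⟩)).2 e1) hQ0
      rcases e2 with e2 | e2 <;> rw [e2]
      · rw [abs_neg, abs_of_pos h1]; exact min_le_left _ _
      · rw [abs_of_pos h2]; exact min_le_right _ _)
    (fun v e1 e2 e3 => (hpt v (Or.inl ⟨e1, e2, e3⟩)).trans
      (mul_le_mul_of_nonneg_left (hB v e1 e2 e3) hQ0))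
  rw [loop_scale he, norm_mul, Complex.norm_real, Real.norm_of_nonneg he.le]
  refine (mul_le_mul_of_nonneg_left hbound he.le).trans_eq ?_
  have : Real.exp ((β - 3 / 2) * τ) = Real.exp τ * Real.exp ((β - 5 / 2) * τ) := by
    rw [← Real.exp_add]; congr 1; ring
  rw [this, hQ]
  ring

end CauchyChain
end

noncomputable section
namespace CauchyChain

/-! ### Bounds of the phase on loops through the saddle point -/

lemma hasDerivAt_phase_aux (φ : ℝ) {v : ℂ} (hv : v ∈ Complex.slitPlane) :
    HasDerivAt (fun v : ℂ => v * Complex.log v - v - Complex.I * φ * v)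
      (Complex.log v - Complex.I * φ) v := by
  have h := (((hasDerivAt_id v).mul (Complex.hasDerivAt_log hv)).sub (hasDerivAt_id v)).sub
    ((hasDerivAt_id v).const_mul (Complex.I * φ))
  refine (h.congr_deriv ?_)
  have : v ≠ 0 := Complex.slitPlane_ne_zero hv
  simp only [id]
  field_simp
  ring

lemma hasDerivAt_phase_re (φ : ℝ) {x y : ℝ} (hv : (x + y * Complex.I : ℂ) ∈ Complex.slitPlane) :
    HasDerivAt (fun x : ℝ => phase φ (x + y * Complex.I)) (Real.log ‖(x + y * Complex.I : ℂ)‖) x := by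
  have h1 : HasDerivAt (fun z : ℂ => z + y * Complex.I) 1 (x : ℂ) :=
    (hasDerivAt_id _).add_const _
  have h2 := HasDerivAt.comp (x : ℂ) (hasDerivAt_phase_aux φ hv) h1
  have h3 := h2.real_of_complex
  refine h3.congr_deriv ?_
  simp [Complex.log_re]

lemma hasDerivAt_phase_im (φ : ℝ) {x y : ℝ} (hv : (x + y * Complex.I : ℂ) ∈ Complex.slitPlane) :
    HasDerivAt (fun y : ℝ => phase φ (x + y * Complex.I)) (φ - (x + y * Complex.I : ℂ).arg) y := by
  have h1 : HasDerivAt (fun z : ℂ => x + z * Complex.I) Complex.I (y : ℂ) := by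
    simpa using ((hasDerivAt_id (y : ℂ)).mul_const Complex.I).const_add (x : ℂ)
  have h2 := HasDerivAt.comp (y : ℂ) (hasDerivAt_phase_aux φ hv) h1
  have h3 := h2.real_of_complex
  refine h3.congr_deriv ?_
  simp [Complex.log_im]

/-- The horizontal derivative of the phase is log |v|, so the unit circle separates growth from
decrease; vertically the derivative is φ - arg v. The loops below are chosen by these two signs
alone. -/
lemma phase_mono_horizontal (φ : ℝ) {x x' y : ℝ} (hy : y ≠ 0) (hx : x ≤ x')
    (h : ∀ t, x < t → t < x' → 1 ≤ t ^ 2 + y ^ 2) :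
    phase φ (x + y * Complex.I) ≤ phase φ (x' + y * Complex.I) := by
  have hm : ∀ t : ℝ, (t + y * Complex.I : ℂ) ∈ Complex.slitPlane := fun t => Or.inr (by simpa using hy)
  refine monotoneOn_of_deriv_nonneg (convex_Icc x x')
    (f := fun x : ℝ => phase φ (x + y * Complex.I))
    (fun t _ => (hasDerivAt_phase_re φ (hm t)).continuousAt.continuousWithinAt)
    (fun t _ => (hasDerivAt_phase_re φ (hm t)).differentiableAt.differentiableWithinAt)
    (fun t ht => ?_) (Set.left_mem_Icc.2 hx) (Set.right_mem_Icc.2 hx) hx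
  rw [interior_Icc] at ht
  rw [(hasDerivAt_phase_re φ (hm t)).deriv]
  refine Real.log_nonneg ?_
  rw [Complex.norm_add_mul_I]
  exact Real.one_le_sqrt.2 (h t ht.1 ht.2)

lemma phase_anti_horizontal (φ : ℝ) {x x' y : ℝ} (hy : y ≠ 0) (hx : x ≤ x')
    (h : ∀ t, x < t → t < x' → t ^ 2 + y ^ 2 ≤ 1) :
    phase φ (x' + y * Complex.I) ≤ phase φ (x + y * Complex.I) := by
  have hm : ∀ t : ℝ, (t + y * Complex.I : ℂ) ∈ Complex.slitPlane := fun t => Or.inr (by simpa using hy)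
  refine antitoneOn_of_deriv_nonpos (convex_Icc x x')
    (f := fun x : ℝ => phase φ (x + y * Complex.I))
    (fun t _ => (hasDerivAt_phase_re φ (hm t)).continuousAt.continuousWithinAt)
    (fun t _ => (hasDerivAt_phase_re φ (hm t)).differentiableAt.differentiableWithinAt)
    (fun t ht => ?_) (Set.left_mem_Icc.2 hx) (Set.right_mem_Icc.2 hx) hx
  rw [interior_Icc] at ht
  rw [(hasDerivAt_phase_re φ (hm t)).deriv]
  refine Real.log_nonpos (norm_nonneg _) ?_
  rw [Complex.norm_add_mul_I]
  exact Real.sqrt_le_one.2 (h t ht.1 ht.2)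

lemma phase_mono_vertical {φ x y y' : ℝ} (hx : 0 < x) (hy : y ≤ y')
    (h : ∀ t, y < t → t < y' → (x + t * Complex.I : ℂ).arg ≤ φ) :
    phase φ (x + y * Complex.I) ≤ phase φ (x + y' * Complex.I) := by
  have hm : ∀ t : ℝ, (x + t * Complex.I : ℂ) ∈ Complex.slitPlane := fun t => Or.inl (by simpa using hx)
  refine monotoneOn_of_deriv_nonneg (convex_Icc y y')
    (f := fun y : ℝ => phase φ (x + y * Complex.I))
    (fun t _ => (hasDerivAt_phase_im φ (hm t)).continuousAt.continuousWithinAt)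
    (fun t _ => (hasDerivAt_phase_im φ (hm t)).differentiableAt.differentiableWithinAt)
    (fun t ht => ?_) (Set.left_mem_Icc.2 hy) (Set.right_mem_Icc.2 hy) hy
  rw [interior_Icc] at ht
  rw [(hasDerivAt_phase_im φ (hm t)).deriv]
  linarith [h t ht.1 ht.2]

lemma phase_anti_vertical {φ x y y' : ℝ} (hx : 0 < x) (hy : y ≤ y')
    (h : ∀ t, y < t → t < y' → φ ≤ (x + t * Complex.I : ℂ).arg) :
    phase φ (x + y' * Complex.I) ≤ phase φ (x + y * Complex.I) := by
  have hm : ∀ t : ℝ, (x + t * Complex.I : ℂ) ∈ Complex.slitPlane := fun t => Or.inl (by simpa using hx)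
  refine antitoneOn_of_deriv_nonpos (convex_Icc y y')
    (f := fun y : ℝ => phase φ (x + y * Complex.I))
    (fun t _ => (hasDerivAt_phase_im φ (hm t)).continuousAt.continuousWithinAt)
    (fun t _ => (hasDerivAt_phase_im φ (hm t)).differentiableAt.differentiableWithinAt)
    (fun t ht => ?_) (Set.left_mem_Icc.2 hy) (Set.right_mem_Icc.2 hy) hy
  rw [interior_Icc] at ht
  rw [(hasDerivAt_phase_im φ (hm t)).deriv]
  linarith [h t ht.1 ht.2]

/-- For φ = 0 the saddle point is v = 1. On Re v = 1 the phase falls away from the real axis because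
its vertical derivative is -arg v; the edges Im v = ±1 avoid the open unit disc, so there it falls
to the left. -/
lemma phase_zero_le {v : ℂ} (hv : OnLoop 1 1 1 v) : phase 0 v ≤ -1 := by
  have h1 : phase 0 1 = -1 := by simp [phase]
  have hvert : ∀ y : ℝ, phase 0 ((1 : ℝ) + y * Complex.I) ≤ -1 := fun y => by
    rw [← h1]
    rcases le_total y 0 with hy | hy
    · have := phase_mono_vertical (φ := 0) (x := 1) one_pos hy fun t _ ht => by
        exact (Complex.arg_neg_iff.2 (by simpa using ht)).le
      simpa using this
    · have := phase_anti_vertical (φ := 0) (x := 1) one_pos hy fun t ht _ =>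
        Complex.arg_nonneg_iff.2 (by simpa using ht.le)
      simpa using this
  rw [← Complex.re_add_im v]
  rcases hv with ⟨e1, -, -⟩ | ⟨e1, e2⟩
  · rw [e1]; exact hvert _
  · have hne : v.im ≠ 0 := by rcases e2 with e2 | e2 <;> rw [e2] <;> norm_num
    refine (phase_mono_horizontal 0 hne e1 fun t _ _ => ?_).trans (hvert _)
    have : v.im ^ 2 = 1 := by rcases e2 with e2 | e2 <;> rw [e2] <;> norm_num
    nlinarith [sq_nonneg t]

/-- Not sharp, but valid for every φ with one loop: this supplies the a priori growth bound in
strips which the Phragmén-Lindelöf argument requires. -/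
lemma phase_le_of_abs (φ : ℝ) {v : ℂ} (hv : OnLoop 1 1 1 v) : phase φ v ≤ -1 + |φ| := by
  have h1 := phase_zero_le hv
  have h2 : phase φ v = phase 0 v + φ * v.im := by simp [phase]
  have h3 : |v.im| ≤ 1 := by
    rcases hv with ⟨-, e1, e2⟩ | ⟨-, e2⟩
    · exact abs_le.2 ⟨e1, e2⟩
    · rcases e2 with e2 | e2 <;> rw [e2] <;> simp
  have h4 : φ * v.im ≤ |φ| * 1 := (le_abs_self _).trans (by rw [abs_mul]; gcongr)
  linarith

/-- The upper edge runs through the saddle point e^{iφ}. Along it the phase rises up to Re v = cos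
φ, then falls inside the unit disc, and the edge ends at -cos φ, where it leaves the disc. On the
vertical side arg v < π/2 < φ, so the phase rises towards the upper corner; on the lower edge it
falls to the left. -/
lemma phase_le_saddle {φ : ℝ} (h1 : Real.pi / 2 < φ) (h2 : φ < Real.pi) {v : ℂ}
    (hv : OnLoop (-Real.cos φ) 1 (Real.sin φ) v) : phase φ v ≤ -Real.cos φ := by
  have hs : 0 < Real.sin φ := Real.sin_pos_of_pos_of_lt_pi (by linarith [Real.pi_pos]) h2
  have hc : Real.cos φ < 0 := Real.cos_neg_of_pi_div_two_lt_of_lt h1 (by linarith)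
  have hcs := Real.sin_sq_add_cos_sq φ
  have hsad : phase φ (Real.cos φ + Real.sin φ * Complex.I) = -Real.cos φ := by
    have e : (Real.cos φ + Real.sin φ * Complex.I : ℂ) = Complex.exp (φ * Complex.I) := by
      rw [Complex.exp_mul_I]; push_cast; ring
    have e' : (Complex.exp (φ * Complex.I)).re = Real.cos φ := Complex.exp_ofReal_mul_I_re φ
    rw [e, phase, Complex.log_exp (by simp; linarith [Real.pi_pos]) (by simp; linarith), ← e']
    have : Complex.exp (φ * Complex.I) * (φ * Complex.I) - Complex.exp (φ * Complex.I) -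
      Complex.I * φ * Complex.exp (φ * Complex.I) = -Complex.exp (φ * Complex.I) := by ring
    rw [this, Complex.neg_re]
  have htop : ∀ x : ℝ, x ≤ -Real.cos φ → phase φ (x + Real.sin φ * Complex.I) ≤ -Real.cos φ :=
    fun x hx => by
      rw [← hsad]
      rcases le_total x (Real.cos φ) with hxc | hxc
      · exact phase_mono_horizontal φ hs.ne' hxc fun t _ ht => by nlinarith
      · exact phase_anti_horizontal φ hs.ne' hxc fun t ht1 ht2 => by nlinarith
  have hvert : ∀ y : ℝ, y ≤ Real.sin φ →
      phase φ ((-Real.cos φ : ℝ) + y * Complex.I) ≤ -Real.cos φ := fun y hy => by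
    refine (phase_mono_vertical (by linarith) hy fun t _ _ => ?_).trans (htop _ le_rfl)
    have : |((-Real.cos φ : ℝ) + t * Complex.I : ℂ).arg| < Real.pi / 2 :=
      Complex.abs_arg_lt_pi_div_two_iff.2 (Or.inl (by
        rw [Complex.add_re, Complex.ofReal_re]; simp only [Complex.re_ofReal_mul, Complex.I_re]
        linarith))
    linarith [(abs_lt.1 this).2]
  rw [← Complex.re_add_im v]
  rcases hv with ⟨e1, -, e2⟩ | ⟨e1, e2⟩
  · rw [e1]; exact hvert _ e2
  · rcases e2 with e2 | e2
    · rw [e2]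
      refine (phase_mono_horizontal φ (by norm_num) e1 fun t _ _ => ?_).trans
        (hvert (-1) (by linarith))
      nlinarith [sq_nonneg t]
    · rw [e2]; exact htop _ e1

/-! ### Asymptotics on horizontal lines and a growth bound -/

/-- The leading term of `meijer N b 0 N` at infinity. -/
def leading (N : ℕ) (β : ℝ) (w : ℂ) : ℂ :=
  Complex.exp (β * (w / N)) * Complex.exp (-(N * Complex.exp (w / N)))

/-- The exponent `β` of the leading term. -/
def leadingExponent (N : ℕ) (b : ℕ → ℝ) : ℝ := ∑ l ∈ Finset.range N, b l - (N - 1) / 2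

/-- The constant of the leading term. -/
def leadingConst (N : ℕ) : ℝ := Real.sqrt (2 * Real.pi) ^ (N - 1) * Real.exp (-(Real.log N / 2))

lemma norm_leading {N : ℕ} (hN : 1 ≤ N) (β τ φ : ℝ) :
    ‖leading N β (N * (τ + φ * Complex.I))‖ =
      Real.exp (β * τ) * Real.exp (-(N * Real.exp τ * Real.cos φ)) := by
  have hNC : (N : ℂ) ≠ 0 := by exact_mod_cast (by omega : N ≠ 0)
  have e : (N : ℂ) * Complex.exp (τ + φ * Complex.I) =
      ((N * Real.exp τ : ℝ) : ℂ) * Complex.exp (φ * Complex.I) := by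
    rw [Complex.exp_add]; push_cast; ring
  rw [leading, mul_div_cancel_left₀ _ hNC, norm_mul, Complex.norm_exp, Complex.norm_exp, e]
  congr 2
  · simp
  · rw [Complex.neg_re, Complex.re_ofReal_mul, Complex.exp_ofReal_mul_I_re]

/-- The two model kernels are integrated exactly and give the leading term with its first
correction; only the difference kernel is estimated on the scaled loop. The loop shape and the bound
M of the phase stay free, to serve both the sharp lines and the crude growth bound. -/
lemma meijer_sub_model {N : ℕ} (hN : 1 ≤ N) (b : ℕ → ℝ) : ∃ c : ℝ, ∀ R h₁ h₂ Y M₀ : ℝ,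
    0 < R → 0 < h₁ → 0 < h₂ → ∃ C τ₀ : ℝ, 0 ≤ C ∧ 0 ≤ τ₀ ∧ ∀ τ φ M : ℝ, τ₀ ≤ τ → |φ| ≤ Y →
      |M| ≤ M₀ → (∀ v, OnLoop R h₁ h₂ v → phase φ v ≤ M) →
      ‖meijer N b 0 N (N * (τ + φ * Complex.I)) -
        leadingConst N * (1 + c * Complex.exp (-(τ + φ * Complex.I))) *
          leading N (leadingExponent N b) (N * (τ + φ * Complex.I))‖ ≤
        C * Real.exp ((leadingExponent N b - 3 / 2) * τ) * Real.exp (N * Real.exp τ * M) := by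
  obtain ⟨c, C, r, hC, hΞ⟩ := prod_Gamma_compare hN b (leadingExponent N b) rfl
  set β := leadingExponent N b with hβ
  have hN0 : (0 : ℝ) < N := by exact_mod_cast hN
  have hNC : (N : ℂ) ≠ 0 := by exact_mod_cast hN0.ne'
  set F : ℝ := Real.sqrt (2 * Real.pi) ^ (N - 1 : ℕ) * Real.exp ((1 / 2 - β) * Real.log N) with hF
  set Ξ : ℂ → ℂ := fun u => (∏ l ∈ Finset.range N, Complex.Gamma (u + b l)) -
    F * (modelKernel N β u + c * modelKernel N (β - 1) u) with hΞdef
  -- Lowering β by one multiplies the exact integral by e^{-w/N}/N, whence the division by N.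
  refine ⟨c / N, fun R h₁ h₂ Y M₀ hR h1 h2 => ?_⟩
  obtain ⟨C', τ₀, hC', hτ₀, hb⟩ := norm_scaled_loop_le hN hC hΞ hR h1 h2 Y M₀
  set R₀ : ℝ := radius N b + |β| / N + |β - 1| / N with hR₀
  have hr1 : radius N b ≤ R₀ := by
    have : 0 ≤ |β| / N + |β - 1| / N := by positivity
    linarith
  have hr2 : |β| / N ≤ R₀ := by
    have : 0 ≤ |β - 1| / N := by positivity
    linarith [radius_nonneg N b]
  have hr3 : |β - 1| / N ≤ R₀ := by
    have : 0 ≤ |β| / N := by positivity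
    linarith [radius_nonneg N b]
  have hR₀0 : 0 ≤ R₀ := (radius_nonneg N b).trans hr1
  -- The second threshold makes the scaled loop large enough to pass to the right of all poles of
  -- the product and of both models.
  refine ⟨(2 * Real.pi)⁻¹ * C', max τ₀ (Real.log ((R₀ + 1) / R)), by positivity,
    le_max_of_le_left hτ₀, fun τ φ M hτ hφ hM hph => ?_⟩
  have key := hb τ φ M ((le_max_left _ _).trans hτ) hφ hM hph
  have hτR : R₀ < Real.exp τ * R := by
    have := (le_max_right _ _).trans hτ
    rw [Real.log_le_iff_le_exp (by positivity), div_le_iff₀ hR] at this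
    linarith
  have he := Real.exp_pos τ
  set w : ℂ := N * (τ + φ * Complex.I) with hw
  have hwN : w / N = τ + φ * Complex.I := by rw [hw, mul_div_cancel_left₀ _ hNC]
  have h1' : 0 < Real.exp τ * h₁ := by positivity
  have h2' : 0 < Real.exp τ * h₂ := by positivity
  have k1 := (isHankel_modelKernel hN β).mono hr2
  have k2 := (isHankel_modelKernel hN (β - 1)).mono hr3
  have k0 : IsHankel R₀ fun u => ∏ l ∈ Finset.range N, Complex.Gamma (u + b l) :=
    (isHankel_prod_Gamma hN fun l hl => neg_le_radius b hl).mono hr1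
  have kΞ : IsHankel R₀ Ξ := k0.sub ((k1.add (k2.const_mul c)).const_mul F)
  have hm := meijer_eq_loop (b := b) (i := 0) hN le_rfl (fun l hl => neg_le_radius b hl)
    (hr1.trans_lt hτR) h1' h2' w
  have hsplit : (fun u => hankelKernel N b N u * (-u) ^ 0 * Complex.exp (-(u * w))) =
      fun u => Ξ u * Complex.exp (-(u * w)) +
        (F * (modelKernel N β u * Complex.exp (-(u * w))) +
        F * c * (modelKernel N (β - 1) u * Complex.exp (-(u * w)))) := by
    ext u
    simp [hΞdef, hankelKernel]
    ring
  rw [hsplit, loop_add (kΞ.mul_exp w) (((k1.mul_exp w).const_mul F).add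
    ((k2.mul_exp w).const_mul (F * c))) hτR h1' h2', loop_add ((k1.mul_exp w).const_mul F)
    ((k2.mul_exp w).const_mul (F * c)) hτR h1' h2', loop_const_mul, loop_const_mul,
    loop_modelKernel hN β (hr2.trans_lt hτR) h1' h2',
    loop_modelKernel hN (β - 1) (hr3.trans_lt hτR) h1' h2'] at hm
  have hlogN : Complex.exp (Real.log N) = N := by
    rw [← Complex.ofReal_exp, Real.exp_log hN0]; simp
  have hconst : (F : ℂ) * ((N : ℂ)⁻¹ * Complex.exp (β * Real.log N)) = leadingConst N := by
    have : (N : ℂ)⁻¹ = Complex.exp (-(Real.log N)) := by rw [Complex.exp_neg, hlogN]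
    rw [this, ← Complex.exp_add, hF, leadingConst]
    push_cast
    rw [mul_assoc, ← Complex.exp_add]
    congr 2
    ring
  have hE1 : Complex.exp (β * (w / N + Real.log N)) =
      Complex.exp (β * (w / N)) * Complex.exp (β * Real.log N) := by
    rw [← Complex.exp_add, mul_add]
  have hE2 : Complex.exp ((β - 1 : ℝ) * (w / N + Real.log N)) =
      Complex.exp (β * (w / N)) * Complex.exp (β * Real.log N) *
        Complex.exp (-(w / N)) * (N : ℂ)⁻¹ := by
    rw [← hlogN, ← Complex.exp_neg, ← Complex.exp_add, ← Complex.exp_add, ← Complex.exp_add, hlogN]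
    congr 1
    push_cast
    ring
  have hpi : (2 * Real.pi * Complex.I : ℂ) ≠ 0 := by
    simp [Real.pi_ne_zero, Complex.I_ne_zero]
  have hdiff : meijer N b 0 N w - leadingConst N *
      (1 + (c / N : ℝ) * Complex.exp (-(τ + φ * Complex.I))) * leading N β w =
      (2 * Real.pi * Complex.I)⁻¹ * loop (Real.exp τ * R) (Real.exp τ * h₁) (Real.exp τ * h₂)
        (fun u => Ξ u * Complex.exp (-(u * w))) := by
    rw [hm, hE1, hE2, ← hconst, leading, ← hwN]
    generalize loop _ _ _ _ = S
    push_cast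
    field_simp
    ring
  rw [hdiff, norm_mul]
  have hn : ‖(2 * Real.pi * Complex.I : ℂ)⁻¹‖ = (2 * Real.pi)⁻¹ := by
    rw [norm_inv, norm_mul, norm_mul, Complex.norm_I, Complex.norm_real,
      Real.norm_of_nonneg Real.pi_pos.le]
    simp
  rw [hn, mul_assoc, mul_assoc, ← mul_assoc C']
  gcongr

/-- The asymptotics on the horizontal lines `Im w = N φ` for which a good loop is known. -/
lemma meijer_asymp_line {N : ℕ} (hN : 1 ≤ N) (b : ℕ → ℝ) {φ : ℝ}
    (hφ : φ = 0 ∨ (Real.pi / 2 < φ ∧ φ < Real.pi)) : ∃ C τ₀ : ℝ, 0 ≤ C ∧ 0 ≤ τ₀ ∧ ∀ τ : ℝ, τ₀ ≤ τ →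
      ‖meijer N b 0 N (N * (τ + φ * Complex.I)) -
        leadingConst N * leading N (leadingExponent N b) (N * (τ + φ * Complex.I))‖ ≤
        C * Real.exp (-τ) * ‖leading N (leadingExponent N b) (N * (τ + φ * Complex.I))‖ := by
  obtain ⟨c, hc⟩ := meijer_sub_model hN b
  set β := leadingExponent N b
  obtain ⟨R, h₁, h₂, hR, h1, h2, hph⟩ : ∃ R h₁ h₂ : ℝ, 0 < R ∧ 0 < h₁ ∧ 0 < h₂ ∧
      ∀ v, OnLoop R h₁ h₂ v → phase φ v ≤ -Real.cos φ := by
    rcases hφ with rfl | ⟨hφ1, hφ2⟩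
    · exact ⟨1, 1, 1, one_pos, one_pos, one_pos, fun v hv => by simpa using phase_zero_le hv⟩
    · refine ⟨-Real.cos φ, 1, Real.sin φ, ?_, one_pos, ?_, fun v hv => phase_le_saddle hφ1 hφ2 hv⟩
      · linarith [Real.cos_neg_of_pi_div_two_lt_of_lt hφ1 (by linarith)]
      · exact Real.sin_pos_of_pos_of_lt_pi (by linarith [Real.pi_pos]) hφ2
  obtain ⟨C, τ₀, hC, hτ₀, hb⟩ := hc R h₁ h₂ |φ| |Real.cos φ| hR h1 h2
  refine ⟨C + |leadingConst N * c|, τ₀, by positivity, hτ₀, fun τ hτ => ?_⟩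
  have hτ0 : 0 ≤ τ := hτ₀.trans hτ
  have key := hb τ φ (-Real.cos φ) hτ le_rfl (by rw [abs_neg]) hph
  set w : ℂ := N * (τ + φ * Complex.I) with hw
  have hsplit : meijer N b 0 N w - leadingConst N * leading N β w =
      (meijer N b 0 N w - leadingConst N * (1 + c * Complex.exp (-(τ + φ * Complex.I))) *
        leading N β w) + ((leadingConst N * c : ℝ) : ℂ) * Complex.exp (-(τ + φ * Complex.I)) *
        leading N β w := by push_cast; ring
  have hn : ‖((leadingConst N * c : ℝ) : ℂ) * Complex.exp (-(τ + φ * Complex.I)) *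
        leading N β w‖ = |leadingConst N * c| * Real.exp (-τ) * ‖leading N β w‖ := by
    rw [norm_mul, norm_mul, Complex.norm_real, Complex.norm_exp]
    simp
  rw [hsplit]
  refine (norm_add_le _ _).trans ?_
  rw [hn, add_mul, add_mul]
  gcongr
  refine key.trans ?_
  rw [hw, norm_leading hN, mul_assoc, mul_assoc C, ← Real.exp_add, ← Real.exp_add, ← Real.exp_add]
  refine mul_le_mul_of_nonneg_left (Real.exp_le_exp.2 ?_) hC
  nlinarith

lemma norm_leading_le {N : ℕ} (hN : 1 ≤ N) (β : ℝ) {τ : ℝ} (hτ : 0 ≤ τ) (φ : ℝ) :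
    ‖leading N β (N * (τ + φ * Complex.I))‖ ≤ Real.exp ((|β| + N) * Real.exp τ) := by
  rw [norm_leading hN, ← Real.exp_add, Real.exp_le_exp, add_mul]
  have h1 : τ ≤ Real.exp τ := by linarith [Real.add_one_le_exp τ]
  have h2 : β * τ ≤ |β| * Real.exp τ :=
    mul_le_mul (le_abs_self β) h1 hτ (abs_nonneg β)
  have h3 : -Real.cos φ ≤ 1 := by linarith [Real.neg_one_le_cos φ]
  have h4 : (0 : ℝ) ≤ N * Real.exp τ := by positivity
  nlinarith

lemma meijer_differentiable {N : ℕ} {b : ℕ → ℝ} {j : ℕ} (hj : 1 ≤ j) (hjN : j ≤ N) (i : ℕ) :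
    Differentiable ℂ (meijer N b i j) := fun w => (hasDerivAt_meijer hj hjN i w).differentiableAt

/-- The growth of `meijer N b 0 N` in horizontal strips. -/
lemma meijer_growth {N : ℕ} (hN : 1 ≤ N) (b : ℕ → ℝ) (Y : ℝ) : ∃ A B : ℝ, 0 ≤ A ∧ 0 ≤ B ∧
    ∀ w : ℂ, 0 ≤ w.re → |w.im| ≤ Y → ‖meijer N b 0 N w‖ ≤ A * Real.exp (B * Real.exp (w.re / N)) := by
  obtain ⟨c, hc⟩ := meijer_sub_model hN b
  have hN0 : (0 : ℝ) < N := by exact_mod_cast hN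
  have hNC : (N : ℂ) ≠ 0 := by exact_mod_cast hN0.ne'
  set β := leadingExponent N b
  set Y' : ℝ := |Y| / N with hY'
  obtain ⟨C, τ₀, hC, hτ₀, hb⟩ := hc 1 1 1 Y' (1 + Y') one_pos one_pos one_pos
  have hY0 : 0 ≤ Y' := by positivity
  set K : Set ℂ := Set.Icc 0 (N * τ₀) ×ℂ Set.Icc (-Y) Y with hK
  have hKc : IsCompact K := isCompact_Icc.reProdIm isCompact_Icc
  obtain ⟨A₀, hA₀⟩ := hKc.exists_bound_of_continuousOn
    (meijer_differentiable (b := b) hN le_rfl 0).continuous.continuousOn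
  set B : ℝ := (|β| + N) + (|β| + N * (1 + Y')) with hB
  refine ⟨|A₀| + C + |leadingConst N| * (1 + |c|), B, by positivity, by positivity,
    fun w hw0 hwY => ?_⟩
  have hone : 1 ≤ Real.exp (B * Real.exp (w.re / N)) := Real.one_le_exp (by positivity)
  rcases le_total w.re (N * τ₀) with hw | hw
  · have h1 := hA₀ w ⟨⟨hw0, hw⟩, abs_le.1 hwY⟩
    calc ‖meijer N b 0 N w‖ ≤ |A₀| * 1 := by rw [mul_one]; exact h1.trans (le_abs_self _)
      _ ≤ (|A₀| + C + |leadingConst N| * (1 + |c|)) * Real.exp (B * Real.exp (w.re / N)) := by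
        gcongr
        rw [add_assoc]
        exact le_add_of_nonneg_right (by positivity)
  · set τ : ℝ := w.re / N with hτ
    set φ : ℝ := w.im / N with hφ
    have hwe : w = N * (τ + φ * Complex.I) := by
      rw [hτ, hφ]
      push_cast
      field_simp
      exact (Complex.re_add_im w).symm
    have hττ : τ₀ ≤ τ := by rwa [hτ, le_div_iff₀' hN0]
    have hτ0 : 0 ≤ τ := hτ₀.trans hττ
    have hφY : |φ| ≤ Y' := by
      rw [hφ, hY', abs_div, abs_of_pos hN0]
      exact div_le_div_of_nonneg_right (hwY.trans (le_abs_self Y)) hN0.le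
    have key := hb τ φ (-1 + |φ|) hττ hφY (abs_le.2 ⟨by linarith [abs_nonneg φ], by linarith⟩)
      (fun v hv => phase_le_of_abs φ hv)
    rw [← hwe] at key
    have hlead : ‖leading N β w‖ ≤ Real.exp ((|β| + N) * Real.exp τ) := by
      rw [hwe]; exact norm_leading_le hN β hτ0 φ
    have hfac : ‖(leadingConst N : ℂ) * (1 + c * Complex.exp (-(τ + φ * Complex.I)))‖ ≤
        |leadingConst N| * (1 + |c|) := by
      rw [norm_mul, Complex.norm_real, Real.norm_eq_abs]
      gcongr
      refine (norm_add_le _ _).trans ?_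
      rw [norm_one, norm_mul, Complex.norm_real, Complex.norm_exp, Real.norm_eq_abs]
      have : Real.exp (-(τ + φ * Complex.I : ℂ)).re ≤ 1 := by
        rw [Real.exp_le_one_iff]; simpa using hτ0
      nlinarith [abs_nonneg c]
    have h3 := norm_le_norm_add_norm_sub' (meijer N b 0 N w)
      ((leadingConst N : ℂ) * (1 + c * Complex.exp (-(τ + φ * Complex.I))) * leading N β w)
    have h1 : τ ≤ Real.exp τ := by linarith [Real.add_one_le_exp τ]
    have hE1 : Real.exp ((β - 3 / 2) * τ) * Real.exp (N * Real.exp τ * (-1 + |φ|)) ≤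
        Real.exp (B * Real.exp τ) := by
      rw [← Real.exp_add, Real.exp_le_exp]
      have h2 : β * τ ≤ |β| * Real.exp τ :=
        mul_le_mul (le_abs_self β) h1 hτ0 (abs_nonneg β)
      have h4 : (0 : ℝ) ≤ N * Real.exp τ := by positivity
      have h5 : N * Real.exp τ * (-1 + |φ|) ≤ N * Real.exp τ * (1 + Y') := by gcongr; linarith
      have h6 : 0 ≤ (|β| + N) * Real.exp τ := by positivity
      nlinarith
    have hE2 : Real.exp ((|β| + N) * Real.exp τ) ≤ Real.exp (B * Real.exp τ) := by
      gcongr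
      rw [hB]
      exact le_add_of_nonneg_right (by positivity)
    calc ‖meijer N b 0 N w‖ ≤ _ := h3
      _ ≤ |leadingConst N| * (1 + |c|) * Real.exp (B * Real.exp τ) +
          C * Real.exp (B * Real.exp τ) := by
        refine add_le_add ?_ ?_
        · rw [norm_mul]
          exact mul_le_mul hfac (hlead.trans hE2) (norm_nonneg _) (by positivity)
        · refine key.trans ?_
          rw [mul_assoc]
          gcongr
      _ ≤ _ := by
        have := mul_nonneg (abs_nonneg A₀) (zero_le_one.trans hone)
        linarith

/-- The growth of `meijer N b 0 N` to the left. -/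
lemma meijer_growth_left {N : ℕ} (hN : 1 ≤ N) (b : ℕ → ℝ) (Y : ℝ) : ∃ A M : ℝ, 0 ≤ A ∧ 0 ≤ M ∧
    ∀ w : ℂ, w.re ≤ 0 → |w.im| ≤ Y → ‖meijer N b 0 N w‖ ≤ A * Real.exp (-(M * w.re)) := by
  have hk := isHankel_kernel_mul_pow (N := N) (b := b) hN (fun l hl => neg_le_radius b hl) 0
  obtain ⟨C, hC, h⟩ := norm_loop_le hk one_pos (hk.continuous_vertical (lt_add_one (radius N b)))
  refine ⟨‖(2 * Real.pi * Complex.I : ℂ)⁻¹‖ * C * Real.exp |Y|, radius N b + 1, by positivity,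
    by linarith [radius_nonneg N b], fun w hw hY => ?_⟩
  rw [meijer, norm_mul]
  calc _ ≤ ‖(2 * Real.pi * Complex.I : ℂ)⁻¹‖ * (C * Real.exp (1 * |w.im|) *
        Real.exp (-(radius N b + 1) * w.re)) := by gcongr; exact h w hw
    _ ≤ ‖(2 * Real.pi * Complex.I : ℂ)⁻¹‖ * (C * Real.exp |Y| *
        Real.exp (-(radius N b + 1) * w.re)) := by
      gcongr
      rw [one_mul]
      exact hY.trans (le_abs_self Y)
    _ = _ := by rw [neg_mul]; ring

end CauchyChain
end

noncomputable section
namespace CauchyChain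

/-! ### A Phragmen-Lindelof principle for half strips -/

/-- An entire function of moderate growth in a strip which is bounded on the right halves of the two
boundary lines is bounded in the right half of the strip. -/
lemma bounded_of_half_strip {g : ℂ → ℂ} (hg : Differentiable ℂ g) {a b c A B M K : ℝ} (hab : a < b)
    (hc : c < Real.pi / (b - a)) (hA : 0 ≤ A)
    (hright : ∀ w : ℂ, 0 ≤ w.re → a ≤ w.im → w.im ≤ b →
      ‖g w‖ ≤ A * Real.exp (B * Real.exp (c * w.re)))
    (hleft : ∀ w : ℂ, w.re ≤ 0 → a ≤ w.im → w.im ≤ b → ‖g w‖ ≤ A * Real.exp (-(M * w.re)))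
    (hbd : ∀ w : ℂ, 0 ≤ w.re → w.im = a ∨ w.im = b → ‖g w‖ ≤ K) :
    ∃ K' : ℝ, ∀ w : ℂ, 0 ≤ w.re → a ≤ w.im → w.im ≤ b → ‖g w‖ ≤ K' := by
  set κ : ℝ := Real.pi / (b - a) with hκ
  have hba : 0 < b - a := by linarith
  have hκ0 : 0 < κ := div_pos Real.pi_pos hba
  obtain ⟨n, hn⟩ := exists_nat_ge (M / κ)
  rw [div_le_iff₀ hκ0] at hn
  -- In the strip Re E ≥ 0, so q = E/(1 + E) has no pole, is bounded by 1 and by |E| = e^{κ Re w},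
  -- and is at least 1/2 in modulus for Re w ≥ 0. The power q^n with nκ ≥ M cancels the growth to
  -- the left, and the principle for the full strip applies to g q^n.
  set E : ℂ → ℂ := fun w => Complex.exp (κ * (w - ((a + b) / 2 : ℝ) * Complex.I)) with hE
  have hEn : ∀ w, ‖E w‖ = Real.exp (κ * w.re) := fun w => by
    simp only [hE]
    rw [Complex.norm_exp, Complex.re_ofReal_mul]
    simp
  have hEre : ∀ w : ℂ, a ≤ w.im → w.im ≤ b → 0 ≤ (E w).re := fun w h1 h2 => by
    have him : (κ * (w - ((a + b) / 2 : ℝ) * Complex.I) : ℂ).im = κ * (w.im - (a + b) / 2) := by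
      rw [Complex.im_ofReal_mul, Complex.sub_im, Complex.im_ofReal_mul, Complex.I_im, mul_one]
    simp only [hE]
    rw [Complex.exp_re, him]
    refine mul_nonneg (Real.exp_pos _).le (Real.cos_nonneg_of_mem_Icc ?_)
    have e : κ * (b - a) = Real.pi := div_mul_cancel₀ _ hba.ne'
    constructor <;> nlinarith
  have h1E : ∀ w : ℂ, a ≤ w.im → w.im ≤ b → 1 ≤ ‖1 + E w‖ ∧ ‖E w‖ ≤ ‖1 + E w‖ := fun w h1 h2 => by
    have h := hEre w h1 h2
    constructor
    · refine le_trans ?_ (Complex.re_le_norm _)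
      simpa using h
    · rw [← sq_le_sq₀ (norm_nonneg _) (norm_nonneg _), Complex.sq_norm, Complex.sq_norm,
        Complex.normSq_apply, Complex.normSq_apply]
      simp only [Complex.add_re, Complex.one_re, Complex.add_im, Complex.one_im]
      nlinarith
  set q : ℂ → ℂ := fun w => E w / (1 + E w) with hq
  have hq1 : ∀ w : ℂ, a ≤ w.im → w.im ≤ b → ‖q w‖ ≤ 1 ∧ ‖q w‖ ≤ ‖E w‖ := fun w h1 h2 => by
    obtain ⟨h3, h4⟩ := h1E w h1 h2
    simp only [hq, norm_div]
    exact ⟨div_le_one_of_le₀ h4 (norm_nonneg _), div_le_self (norm_nonneg _) h3⟩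
  have hq2 : ∀ w : ℂ, 0 ≤ w.re → a ≤ w.im → w.im ≤ b → 1 / 2 ≤ ‖q w‖ := fun w h0 h1 h2 => by
    obtain ⟨h3, h4⟩ := h1E w h1 h2
    simp only [hq, norm_div]
    rw [le_div_iff₀ (by linarith)]
    have h5 := norm_add_le 1 (E w)
    have h6 : 1 ≤ ‖E w‖ := by rw [hEn]; exact Real.one_le_exp (by positivity)
    rw [norm_one] at h5
    linarith
  set F : ℂ → ℂ := fun w => g w * q w ^ n with hF
  have hFg : ∀ w : ℂ, a ≤ w.im → w.im ≤ b → ‖F w‖ ≤ ‖g w‖ := fun w h1 h2 => by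
    simp only [hF, norm_mul, norm_pow]
    exact mul_le_of_le_one_right (norm_nonneg _)
      (pow_le_one₀ (norm_nonneg _) (hq1 w h1 h2).1)
  have hFleft : ∀ w : ℂ, w.re ≤ 0 → a ≤ w.im → w.im ≤ b → ‖F w‖ ≤ A := fun w h0 h1 h2 => by
    simp only [hF, norm_mul, norm_pow]
    calc ‖g w‖ * ‖q w‖ ^ n ≤ A * Real.exp (-(M * w.re)) * Real.exp (κ * w.re) ^ n := by
          gcongr
          · exact hleft w h0 h1 h2
          · rw [← hEn]; exact (hq1 w h1 h2).2
      _ = A * Real.exp ((n * κ - M) * w.re) := by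
          rw [← Real.exp_nat_mul, mul_assoc, ← Real.exp_add]; ring_nf
      _ ≤ A * 1 := by
          gcongr
          rw [Real.exp_le_one_iff]
          nlinarith
      _ = A := mul_one A
  have hcl : closure (Complex.im ⁻¹' Set.Ioo a b) ⊆ Complex.im ⁻¹' Set.Icc a b :=
    closure_minimal (fun w hw => ⟨hw.1.le, hw.2.le⟩) (isClosed_Icc.preimage Complex.continuous_im)
  have hmain : ∀ w : ℂ, a ≤ w.im → w.im ≤ b → ‖F w‖ ≤ max A K := fun w h1 h2 => by
    refine PhragmenLindelof.horizontal_strip (a := a) (b := b) ?_ ⟨c, hc, |B|, ?_⟩ ?_ ?_ h1 h2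
    · refine DifferentiableOn.diffContOnCl fun w hw => ?_
      have hw' := hcl hw
      have hne : 1 + E w ≠ 0 := norm_pos_iff.1 (by linarith [(h1E w hw'.1 hw'.2).1])
      have hEd : DifferentiableAt ℂ E w := by simp only [hE]; fun_prop
      exact ((hg w).mul ((hEd.div (hEd.const_add 1) hne).pow n)).differentiableWithinAt
    · refine IsBigO.of_bound A ?_
      refine eventually_inf_principal.2 (Eventually.of_forall fun w hw => ?_)
      rw [Real.norm_of_nonneg (Real.exp_pos _).le]
      rcases le_total 0 w.re with h0 | h0
      · refine (hFg w hw.1.le hw.2.le).trans ((hright w h0 hw.1.le hw.2.le).trans ?_)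
        rw [abs_of_nonneg h0]
        gcongr
        exact le_abs_self B
      · refine (hFleft w h0 hw.1.le hw.2.le).trans (le_mul_of_one_le_right hA ?_)
        exact Real.one_le_exp (by positivity)
    · intro w hw
      rcases le_total 0 w.re with h0 | h0
      · exact (hFg w hw.ge (hw.le.trans hab.le)).trans
          ((hbd w h0 (Or.inl hw)).trans (le_max_right _ _))
      · exact (hFleft w h0 hw.ge (hw.le.trans hab.le)).trans (le_max_left _ _)
    · intro w hw
      rcases le_total 0 w.re with h0 | h0
      · exact (hFg w (hab.le.trans hw.ge) hw.le).trans
          ((hbd w h0 (Or.inr hw)).trans (le_max_right _ _))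
      · exact (hFleft w h0 (hab.le.trans hw.ge) hw.le).trans (le_max_left _ _)
  refine ⟨2 ^ n * max A K, fun w h0 h1 h2 => ?_⟩
  have h3 := hmain w h1 h2
  have h4 : (1 / 2 : ℝ) ^ n ≤ ‖q w‖ ^ n := by gcongr; exact hq2 w h0 h1 h2
  simp only [hF, norm_mul, norm_pow] at h3
  calc ‖g w‖ = 2 ^ n * (‖g w‖ * (1 / 2) ^ n) := by
        rw [mul_left_comm, ← mul_pow]; norm_num
    _ ≤ 2 ^ n * (‖g w‖ * ‖q w‖ ^ n) := by gcongr
    _ ≤ _ := by gcongr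

/-! ### The asymptotics in horizontal strips -/

lemma leading_ne_zero (N : ℕ) (β : ℝ) (w : ℂ) : leading N β w ≠ 0 :=
  mul_ne_zero (Complex.exp_ne_zero _) (Complex.exp_ne_zero _)

lemma leading_differentiable (N : ℕ) (β : ℝ) : Differentiable ℂ (leading N β) := by
  unfold leading; fun_prop

lemma norm_leading' {N : ℕ} (hN : 1 ≤ N) (β : ℝ) (w : ℂ) : ‖leading N β w‖ =
    Real.exp (β * (w.re / N)) * Real.exp (-(N * Real.exp (w.re / N) * Real.cos (w.im / N))) := by
  have hNC : (N : ℂ) ≠ 0 := by exact_mod_cast (by omega : N ≠ 0)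
  rw [← norm_leading hN]
  congr 2
  push_cast
  field_simp
  exact (Complex.re_add_im w).symm

/-- The asymptotic relation `meijer N b 0 N w = leadingConst N * leading w * (1 + O(exp (-w / N)))`
in the right half of a set of horizontal lines. -/
def LeadingAsymp (N : ℕ) (b : ℕ → ℝ) (S : Set ℝ) : Prop :=
  ∃ K : ℝ, ∀ w : ℂ, 0 ≤ w.re → w.im ∈ S →
    ‖meijer N b 0 N w - leadingConst N * leading N (leadingExponent N b) w‖ ≤
      K * Real.exp (-(w.re / N)) * ‖leading N (leadingExponent N b) w‖

/-- The rescaled deviation of `meijer N b 0 N` from its leading term. -/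
def deviation (N : ℕ) (b : ℕ → ℝ) (w : ℂ) : ℂ :=
  (meijer N b 0 N w - leadingConst N * leading N (leadingExponent N b) w) *
    (leading N (leadingExponent N b) w)⁻¹ * Complex.exp (w / N)

variable {N : ℕ} {b : ℕ → ℝ}

lemma deviation_differentiable (hN : 1 ≤ N) : Differentiable ℂ (deviation N b) := by
  unfold deviation
  have h1 := meijer_differentiable (b := b) hN le_rfl 0
  have h2 := leading_differentiable N (leadingExponent N b)
  exact ((h1.sub (h2.const_mul _)).mul (h2.inv fun w => leading_ne_zero _ _ w)).mul (by fun_prop)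

lemma norm_deviation_le_iff (K : ℝ) (w : ℂ) : ‖deviation N b w‖ ≤ K ↔
    ‖meijer N b 0 N w - leadingConst N * leading N (leadingExponent N b) w‖ ≤
      K * Real.exp (-(w.re / N)) * ‖leading N (leadingExponent N b) w‖ := by
  have h0 : 0 < ‖leading N (leadingExponent N b) w‖ := norm_pos_iff.2 (leading_ne_zero _ _ _)
  have h1 : ‖Complex.exp (w / N)‖ = Real.exp (w.re / N) := by
    rw [Complex.norm_exp, Complex.div_natCast_re]
  rw [deviation, norm_mul, norm_mul, norm_inv, h1, Real.exp_neg, ← div_eq_mul_inv,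
    ← le_div_iff₀ (Real.exp_pos _), div_le_iff₀ h0, div_eq_mul_inv K]

lemma leadingAsymp_iff {S : Set ℝ} : LeadingAsymp N b S ↔
    ∃ K : ℝ, ∀ w : ℂ, 0 ≤ w.re → w.im ∈ S → ‖deviation N b w‖ ≤ K := by
  simp only [norm_deviation_le_iff]
  rfl

lemma LeadingAsymp.union {S T : Set ℝ} (hS : LeadingAsymp N b S) (hT : LeadingAsymp N b T) :
    LeadingAsymp N b (S ∪ T) := by
  rw [leadingAsymp_iff] at *
  obtain ⟨K, hK⟩ := hS
  obtain ⟨K', hK'⟩ := hT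
  exact ⟨max K K', fun w h0 h1 => h1.elim (fun h => (hK w h0 h).trans (le_max_left _ _))
    fun h => (hK' w h0 h).trans (le_max_right _ _)⟩

lemma LeadingAsymp.mono {S T : Set ℝ} (hS : LeadingAsymp N b S) (h : T ⊆ S) :
    LeadingAsymp N b T := by
  obtain ⟨K, hK⟩ := hS
  exact ⟨K, fun w h0 h1 => hK w h0 (h h1)⟩

/-- The deviation is continuous, so the compact piece 0 ≤ Re w ≤ x₀ of the line costs only a
constant. -/
lemma LeadingAsymp.of_large (hN : 1 ≤ N) {y x₀ K : ℝ}
    (h : ∀ x : ℝ, x₀ ≤ x → ‖deviation N b (x + y * Complex.I)‖ ≤ K) : LeadingAsymp N b {y} := by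
  have hc : Continuous fun x : ℝ => deviation N b (x + y * Complex.I) :=
    (deviation_differentiable hN).continuous.comp (by fun_prop)
  obtain ⟨K', hK'⟩ := (isCompact_Icc (a := (0 : ℝ)) (b := x₀)).exists_bound_of_continuousOn
    hc.continuousOn
  rw [leadingAsymp_iff]
  refine ⟨max K K', fun w h0 h1 => ?_⟩
  rw [← Complex.re_add_im w, Set.mem_singleton_iff.1 h1]
  rcases le_total x₀ w.re with hx | hx
  · exact (h _ hx).trans (le_max_left _ _)
  · exact (hK' _ ⟨h0, hx⟩).trans (le_max_right _ _)

lemma LeadingAsymp.conj {S : Set ℝ} (hS : LeadingAsymp N b S) :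
    LeadingAsymp N b (Neg.neg ⁻¹' S) := by
  obtain ⟨K, hK⟩ := hS
  refine ⟨K, fun w h0 h1 => ?_⟩
  have hl : leading N (leadingExponent N b) (starRingEnd ℂ w) =
      starRingEnd ℂ (leading N (leadingExponent N b) w) := by
    unfold leading
    rw [map_mul, ← Complex.exp_conj, ← Complex.exp_conj]
    simp [← Complex.exp_conj]
  have := hK (starRingEnd ℂ w) (by simpa using h0) (by simpa using h1)
  rw [meijer_conj, hl, Complex.conj_re, Complex.norm_conj] at this
  rw [← Complex.norm_conj]
  simpa using this

/-- The asymptotics on two horizontal lines extend to the strip between them. -/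
lemma LeadingAsymp.strip (hN : 1 ≤ N) {y y' : ℝ} (hy : y < y') (hy' : y' - y < N * Real.pi)
    (h : LeadingAsymp N b {y, y'}) : LeadingAsymp N b (Set.Icc y y') := by
  have hN0 : (0 : ℝ) < N := by exact_mod_cast hN
  rw [leadingAsymp_iff] at *
  obtain ⟨K, hK⟩ := h
  set Y : ℝ := max |y| |y'| with hY
  set β := leadingExponent N b with hβ
  obtain ⟨A, B, hA, hB, hg⟩ := meijer_growth hN b Y
  obtain ⟨A', M, hA', hM, hg'⟩ := meijer_growth_left hN b Y
  have him : ∀ w : ℂ, y ≤ w.im → w.im ≤ y' → |w.im| ≤ Y := fun w h1 h2 =>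
    abs_le_max_abs_abs h1 h2
  have hsplit : ∀ w, ‖deviation N b w‖ ≤ (‖meijer N b 0 N w‖ * ‖(leading N β w)⁻¹‖ +
      |leadingConst N|) * Real.exp (w.re / N) := fun w => by
    have h1 : ‖Complex.exp (w / N)‖ = Real.exp (w.re / N) := by
      rw [Complex.norm_exp, Complex.div_natCast_re]
    rw [deviation, norm_mul, h1, sub_mul, mul_assoc,
      mul_inv_cancel₀ (leading_ne_zero _ _ _), mul_one]
    gcongr
    refine (norm_sub_le _ _).trans ?_
    rw [norm_mul, Complex.norm_real, Real.norm_eq_abs]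
  have hinv : ∀ w, ‖(leading N β w)⁻¹‖ ≤
      Real.exp (-(β * (w.re / N))) * Real.exp (N * Real.exp (w.re / N)) := fun w => by
    rw [norm_inv, norm_leading' hN, mul_inv, ← Real.exp_neg, ← Real.exp_neg, neg_neg]
    refine mul_le_mul_of_nonneg_left (Real.exp_le_exp.2 ?_) (Real.exp_pos _).le
    have h1 : (0 : ℝ) ≤ N * Real.exp (w.re / N) := by positivity
    exact mul_le_of_le_one_right h1 (Real.cos_le_one _)
  -- The growth is of the type exp(B e^{Re w/N}), and the rate 1/N is admissible precisely when y' -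
  -- y < Nπ.
  suffices hgr : (∀ w : ℂ, 0 ≤ w.re → y ≤ w.im → w.im ≤ y' → ‖deviation N b w‖ ≤
      (A + |leadingConst N| + A' * Real.exp N) *
        Real.exp ((B + |β| + N + 1) * Real.exp (1 / N * w.re))) ∧
      ∀ w : ℂ, w.re ≤ 0 → y ≤ w.im → w.im ≤ y' → ‖deviation N b w‖ ≤
        (A + |leadingConst N| + A' * Real.exp N) * Real.exp (-((M + |β| / N) * w.re)) by
    obtain ⟨K', hK'⟩ := bounded_of_half_strip (deviation_differentiable hN) hy
      (by rw [div_lt_div_iff₀ hN0 (by linarith)]; linarith) (by positivity) hgr.1 hgr.2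
      (fun w h0 h1 => hK w h0 h1)
    exact ⟨K', fun w h0 h1 => hK' w h0 h1.1 h1.2⟩
  constructor
  · intro w h0 h1 h2
    have hx : 0 ≤ w.re / N := div_nonneg h0 hN0.le
    rw [one_div_mul_eq_div]
    set x := w.re / N
    have hex : x ≤ Real.exp x := by linarith [Real.add_one_le_exp x]
    have e1 : ‖meijer N b 0 N w‖ * ‖(leading N β w)⁻¹‖ ≤
        A * Real.exp ((B + |β| + N) * Real.exp x) := by
      calc _ ≤ A * Real.exp (B * Real.exp x) * (Real.exp (-(β * x)) *
            Real.exp (N * Real.exp x)) := by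
              gcongr
              · exact hg w h0 (him w h1 h2)
              · exact hinv w
        _ = A * Real.exp (B * Real.exp x + -(β * x) + N * Real.exp x) := by
              rw [Real.exp_add, Real.exp_add]; ring
        _ ≤ _ := by
              gcongr
              have : -(β * x) ≤ |β| * Real.exp x := by
                rw [← neg_mul]
                exact mul_le_mul (neg_le_abs β) hex hx (abs_nonneg β)
              linarith
    have e2 : 1 ≤ Real.exp ((B + |β| + N) * Real.exp x) := Real.one_le_exp (by positivity)
    calc _ ≤ _ := hsplit w
      _ ≤ (A * Real.exp ((B + |β| + N) * Real.exp x) +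
          |leadingConst N| * Real.exp ((B + |β| + N) * Real.exp x)) * Real.exp (Real.exp x) := by
            gcongr
            exact le_mul_of_one_le_right (abs_nonneg _) e2
      _ = (A + |leadingConst N|) * Real.exp ((B + |β| + N + 1) * Real.exp x) := by
            rw [← add_mul, mul_assoc, ← Real.exp_add]; ring_nf
      _ ≤ _ := by
            refine mul_le_mul_of_nonneg_right ?_ (Real.exp_pos _).le
            exact le_add_of_nonneg_right (by positivity)
  · intro w h0 h1 h2
    have hx : w.re / N ≤ 0 := div_nonpos_of_nonpos_of_nonneg h0 hN0.le
    set x := w.re / N with hxdef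
    have hwx : w.re = N * x := by rw [hxdef]; field_simp
    have hx1 : Real.exp x ≤ 1 := Real.exp_le_one_iff.2 hx
    have hE : -((M + |β| / N) * w.re) = -(M * w.re) + |β| * (-x) := by
      rw [hwx]; field_simp; ring
    have hE0 : 0 ≤ -(M * w.re) := by nlinarith
    have e1 : ‖meijer N b 0 N w‖ * ‖(leading N β w)⁻¹‖ ≤
        A' * Real.exp N * Real.exp (-((M + |β| / N) * w.re)) := by
      calc _ ≤ A' * Real.exp (-(M * w.re)) * (Real.exp (-(β * x)) * Real.exp (N * Real.exp x)) := by
              gcongr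
              · exact hg' w h0 (him w h1 h2)
              · exact hinv w
        _ ≤ A' * Real.exp (-(M * w.re)) * (Real.exp (|β| * (-x)) * Real.exp N) := by
              gcongr
              · have := mul_le_mul_of_nonneg_right (le_abs_self β) (neg_nonneg.2 hx)
                linarith
              · exact mul_le_of_le_one_right hN0.le hx1
        _ = _ := by rw [hE, Real.exp_add]; ring
    have e2 : 1 ≤ Real.exp (-((M + |β| / N) * w.re)) := by
      refine Real.one_le_exp ?_
      rw [hE]
      have := mul_nonneg (abs_nonneg β) (neg_nonneg.2 hx)
      linarith
    calc _ ≤ _ := hsplit w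
      _ ≤ (A' * Real.exp N * Real.exp (-((M + |β| / N) * w.re)) +
          |leadingConst N| * Real.exp (-((M + |β| / N) * w.re))) * 1 := by
            gcongr
            exact le_mul_of_one_le_right (abs_nonneg _) e2
      _ ≤ _ := by
        rw [mul_one, ← add_mul]
        refine mul_le_mul_of_nonneg_right ?_ (Real.exp_pos _).le
        linarith

/-- The asymptotics in the strip that is reached by saddle points. -/
lemma leadingAsymp_inner (hN : 2 ≤ N) :
    LeadingAsymp N b (Set.Icc (-(N * Real.pi - Real.pi / 2)) (N * Real.pi - Real.pi / 2)) := by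
  have hN1 : 1 ≤ N := by omega
  have hN0 : (0 : ℝ) < N := by exact_mod_cast hN1
  have hN2 : (2 : ℝ) ≤ N := by exact_mod_cast hN
  have hpi := Real.pi_pos
  have hline : ∀ φ : ℝ, (φ = 0 ∨ (Real.pi / 2 < φ ∧ φ < Real.pi)) → LeadingAsymp N b {N * φ} := by
    intro φ hφ
    obtain ⟨C, τ₀, -, -, h⟩ := meijer_asymp_line hN1 b hφ
    refine LeadingAsymp.of_large hN1 (x₀ := N * τ₀) (K := C) fun x hx => ?_
    rw [norm_deviation_le_iff]
    have e : (x + (N * φ : ℝ) * Complex.I : ℂ) = N * ((x / N : ℝ) + φ * Complex.I) := by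
      have hNC : (N : ℂ) ≠ 0 := by exact_mod_cast hN0.ne'
      push_cast
      field_simp
    have hre : (x + (N * φ : ℝ) * Complex.I : ℂ).re / N = x / N := by simp
    rw [hre, e]
    exact h (x / N) (by rwa [le_div_iff₀' hN0])
  -- For N ≥ 2 this angle lies between π/2 and π, where a saddle point loop is known; Nφ₁ = Nπ - π/2
  -- is still at distance less than Nπ from the line φ = 0.
  set φ₁ : ℝ := Real.pi - Real.pi / (2 * N) with hφ₁
  have hφN : N * φ₁ = N * Real.pi - Real.pi / 2 := by rw [hφ₁]; field_simp
  have hsmall : Real.pi / (2 * N) ≤ Real.pi / 4 := by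
    gcongr; linarith
  have hup : LeadingAsymp N b (Set.Icc 0 (N * Real.pi - Real.pi / 2)) := by
    refine LeadingAsymp.strip hN1 (by nlinarith) (by linarith) ?_
    have h0 := hline 0 (Or.inl rfl)
    have h1 := hline φ₁ (Or.inr ⟨by linarith, by rw [hφ₁]; linarith [div_pos hpi (by linarith : (0:ℝ) < 2 * N)]⟩)
    rw [mul_zero] at h0
    rw [hφN] at h1
    exact h0.union h1
  refine (hup.union hup.conj).mono fun y hy => ?_
  rcases le_total 0 y with h | h
  · exact Or.inl ⟨h, hy.2⟩
  · right
    simp only [Set.mem_preimage, Set.mem_Icc]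
    exact ⟨by linarith, by linarith [hy.1]⟩

end CauchyChain
end

/-! ### Translates of a single Meijer function, and the asymptotics in a wider strip -/

noncomputable section
namespace CauchyChain

variable {N : ℕ} {b : ℕ → ℝ}

/-- All the functions `meijer N b i j` are combinations of shifts of the one with `j = N`. -/
lemma meijer_shift_expansion (N : ℕ) (b : ℕ → ℝ) {m : ℕ} (hm : m ≤ N) : ∃ c : ℕ → ℂ,
    (∀ i w, meijer N b i (N - m) w = ∑ k ∈ Finset.range (m + 1),
      c k * meijer N b i N (w + ((m : ℂ) - 2 * k) * (Real.pi * Complex.I))) ∧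
    c 0 = ∏ l ∈ Finset.Ico (N - m) N,
      (-Complex.exp (-(Complex.I * Real.pi * b l)) / (2 * Real.pi * Complex.I)) ∧
    c m = ∏ l ∈ Finset.Ico (N - m) N,
      (Complex.exp (Complex.I * Real.pi * b l) / (2 * Real.pi * Complex.I)) := by
  suffices h : ∃ c : ℕ → ℂ, (∀ k, m < k → c k = 0) ∧
    (∀ i w, meijer N b i (N - m) w = ∑ k ∈ Finset.range (m + 1),
      c k * meijer N b i N (w + ((m : ℂ) - 2 * k) * (Real.pi * Complex.I))) ∧
    c 0 = ∏ l ∈ Finset.Ico (N - m) N,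
      (-Complex.exp (-(Complex.I * Real.pi * b l)) / (2 * Real.pi * Complex.I)) ∧
    c m = ∏ l ∈ Finset.Ico (N - m) N,
      (Complex.exp (Complex.I * Real.pi * b l) / (2 * Real.pi * Complex.I)) by
    obtain ⟨c, -, h⟩ := h
    exact ⟨c, h⟩
  induction m with
  | zero =>
    refine ⟨fun k => if k = 0 then 1 else 0, fun k hk => by simp [hk.ne'], fun i w => ?_, ?_, ?_⟩
    · simp
    · simp
    · simp
  | succ m ih =>
    obtain ⟨c, h0, h1, h2, h3⟩ := ih (by omega)
    have hj : N - (m + 1) < N := by omega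
    have hj1 : N - (m + 1) + 1 = N - m := by omega
    set e₁ : ℂ := Complex.exp (Complex.I * Real.pi * b (N - (m + 1))) /
      (2 * Real.pi * Complex.I) with he₁
    set e₂ : ℂ := -Complex.exp (-(Complex.I * Real.pi * b (N - (m + 1)))) /
      (2 * Real.pi * Complex.I) with he₂
    -- A recursion of Pascal type: the translation by +πi keeps the index k, the one by -πi raises
    -- it. The extreme coefficients are therefore pure products.
    refine ⟨fun k => e₂ * c k + match k with | 0 => 0 | k + 1 => e₁ * c k, ?_, ?_, ?_, ?_⟩
    · intro k hk
      obtain ⟨k, rfl⟩ : ∃ k', k = k' + 1 := ⟨k - 1, by omega⟩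
      simp [h0 (k + 1) (by omega), h0 k (by omega)]
    · intro i w
      have hs := meijer_step (b := b) hj i w
      rw [hj1] at hs
      have e : meijer N b i (N - (m + 1)) w = e₂ * meijer N b i (N - m) (w + Real.pi * Complex.I) +
          e₁ * meijer N b i (N - m) (w - Real.pi * Complex.I) := by
        rw [hs, he₁, he₂]; ring
      rw [e, h1, h1]
      simp only [add_mul, Finset.sum_add_distrib]
      congr 1
      · rw [Finset.sum_range_succ _ (m + 1), h0 (m + 1) (by omega), Finset.mul_sum]
        simp only [mul_zero, zero_mul, add_zero]
        refine Finset.sum_congr rfl fun k _ => ?_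
        rw [mul_assoc]
        congr 3
        push_cast
        ring
      · rw [Finset.sum_range_succ' _ (m + 1), Finset.mul_sum]
        simp only [zero_mul, add_zero]
        refine Finset.sum_congr rfl fun k _ => ?_
        rw [mul_assoc]
        congr 3
        push_cast
        ring
    · rw [Finset.prod_eq_prod_Ico_succ_bot hj, hj1, ← h2, ← he₂]
      exact add_zero _
    · rw [Finset.prod_eq_prod_Ico_succ_bot hj, hj1, ← h3, ← he₁]
      change e₂ * c (m + 1) + e₁ * c m = _
      rw [h0 (m + 1) (by omega), mul_zero, zero_add]

/-- The difference of the cosines is 2 sin(x - γ/2) sin(γ/2), and x - γ/2 lies in [γ/2, π - γ/2],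
where the sine is at least sin(γ/2). -/
lemma cos_sub_le {x γ : ℝ} (hγ : 0 ≤ γ) (hx : γ ≤ x) (hxπ : x ≤ Real.pi) :
    Real.cos x + 2 * Real.sin (γ / 2) ^ 2 ≤ Real.cos (x - γ) := by
  have h1 : Real.cos (x - γ) - Real.cos x = 2 * Real.sin (x - γ / 2) * Real.sin (γ / 2) := by
    rw [Real.cos_sub_cos]
    have e1 : (x - γ + x) / 2 = x - γ / 2 := by ring
    have e2 : (x - γ - x) / 2 = -(γ / 2) := by ring
    rw [e1, e2, Real.sin_neg]
    ring
  have h2 : 0 ≤ Real.sin (γ / 2) := Real.sin_nonneg_of_nonneg_of_le_pi (by linarith) (by linarith)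
  have h3 : Real.sin (γ / 2) ≤ Real.sin (x - γ / 2) := by
    rcases le_total (x - γ / 2) (Real.pi / 2) with h | h
    · exact Real.sin_le_sin_of_le_of_le_pi_div_two (by linarith [Real.pi_pos]) h (by linarith)
    · rw [← Real.sin_pi_sub (x - γ / 2)]
      exact Real.sin_le_sin_of_le_of_le_pi_div_two (by linarith [Real.pi_pos]) (by linarith)
        (by linarith)
  nlinarith

/-- The leading term on a line is negligible compared with that on a line farther away from the real
axis. -/
lemma norm_leading_gap (hN : 1 ≤ N) (β : ℝ) {g : ℝ} (hg : 0 < g) : ∃ K : ℝ, 0 ≤ K ∧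
    ∀ w w' : ℂ, w'.re = w.re → |w'.im| + g ≤ |w.im| → |w.im| ≤ N * Real.pi →
      ‖leading N β w'‖ ≤ K * Real.exp (-(w.re / N)) * ‖leading N β w‖ := by
  have hN0 : (0 : ℝ) < N := by exact_mod_cast hN
  set δ : ℝ := 2 * Real.sin (g / N / 2) ^ 2 with hδ
  by_cases hgN : g ≤ N * Real.pi
  swap
  · exact ⟨0, le_rfl, fun w w' _ h1 h2 => absurd (by linarith [abs_nonneg w'.im]) hgN⟩
  have hδ0 : 0 < δ := by
    have h1 : 0 < g / N / 2 := by positivity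
    have h2 : g / N ≤ Real.pi := by rwa [div_le_iff₀' hN0]
    have : 0 < Real.sin (g / N / 2) := Real.sin_pos_of_pos_of_lt_pi h1 (by linarith [Real.pi_pos])
    positivity
  refine ⟨(N * δ)⁻¹, by positivity, fun w w' hre h1 h2 => ?_⟩
  have hcos : Real.cos (w.im / N) + δ ≤ Real.cos (w'.im / N) := by
    rw [← Real.cos_abs (w'.im / N), ← Real.cos_abs (w.im / N), abs_div, abs_div, abs_of_pos hN0]
    have h3 : |w'.im| / N ≤ |w.im| / N - g / N := by
      rw [← sub_div]; gcongr; linarith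
    have h4 : |w.im| / N ≤ Real.pi := by rwa [div_le_iff₀' hN0]
    have h5 : g / N ≤ |w.im| / N :=
      div_le_div_of_nonneg_right (by linarith [abs_nonneg w'.im]) hN0.le
    have h0 : 0 ≤ |w'.im| / N := by positivity
    refine (cos_sub_le (by positivity) h5 h4).trans ?_
    exact Real.cos_le_cos_of_nonneg_of_le_pi h0 (by linarith [div_pos hg hN0]) h3
  rw [norm_leading' hN, norm_leading' hN, hre]
  set x := w.re / N
  set y : ℝ := N * δ * Real.exp x with hy
  have hy0 : 0 < y := by positivity
  -- The gap in the cosine gives the doubly exponential gain e^{-y} with y = Nδe^x. Only e^{-y} ≤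
  -- 1/y is used, in order to match the form of the other errors.
  have h6 : Real.exp (-y) ≤ (N * δ)⁻¹ * Real.exp (-x) := by
    rw [Real.exp_neg, Real.exp_neg, ← mul_inv]
    exact inv_anti₀ hy0 (by linarith [Real.add_one_le_exp y])
  calc Real.exp (β * x) * Real.exp (-(N * Real.exp x * Real.cos (w'.im / N))) ≤
        Real.exp (β * x) * (Real.exp (-y) * Real.exp (-(N * Real.exp x * Real.cos (w.im / N)))) := by
        rw [← Real.exp_add (-y)]
        refine mul_le_mul_of_nonneg_left (Real.exp_le_exp.2 ?_) (Real.exp_pos _).le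
        have : (0 : ℝ) ≤ N * Real.exp x := by positivity
        rw [hy]
        nlinarith
    _ ≤ Real.exp (β * x) * ((N * δ)⁻¹ * Real.exp (-x) *
          Real.exp (-(N * Real.exp x * Real.cos (w.im / N)))) := by gcongr
    _ = _ := by ring

/-- Translating by +Nπi or by -Nπi changes the sign of e^{w/N} in the same way, so the two leading
terms differ by a constant. The exponent β = Σ b_l - (N - 1)/2 is such that this constant balances
the extreme coefficients of the relation with j = 0. -/
lemma leading_shift (hN : 1 ≤ N) (b : ℕ → ℝ) (v : ℂ) :
    (∏ l ∈ Finset.range N, (-Complex.exp (-(Complex.I * Real.pi * b l)) /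
      (2 * Real.pi * Complex.I))) *
      leading N (leadingExponent N b) (v + N * (Real.pi * Complex.I)) =
    -((∏ l ∈ Finset.range N, (Complex.exp (Complex.I * Real.pi * b l) /
      (2 * Real.pi * Complex.I))) *
      leading N (leadingExponent N b) (v - N * (Real.pi * Complex.I))) := by
  have hNC : (N : ℂ) ≠ 0 := by exact_mod_cast (by omega : N ≠ 0)
  have e1 : (v + N * (Real.pi * Complex.I)) / N = v / N + Real.pi * Complex.I := by field_simp
  have e2 : (v - N * (Real.pi * Complex.I)) / N = v / N - Real.pi * Complex.I := by field_simp
  unfold leading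
  rw [e1, e2, Complex.exp_sub, Complex.exp_add, Complex.exp_pi_mul_I]
  simp only [neg_div, Finset.prod_neg, Finset.prod_div_distrib, ← Complex.exp_sum, Finset.card_range,
    mul_neg, mul_one, div_neg, div_one, neg_neg]
  have hsum : ∑ l ∈ Finset.range N, -(Complex.I * Real.pi * b l) =
      -(∑ l ∈ Finset.range N, Complex.I * Real.pi * b l) := Finset.sum_neg_distrib _
  have hβ : ((leadingExponent N b : ℝ) : ℂ) * (Real.pi * Complex.I) =
      ∑ l ∈ Finset.range N, Complex.I * Real.pi * b l - ((N - 1 : ℕ) : ℂ) * (Real.pi * Complex.I) / 2 := by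
    rw [leadingExponent, ← Finset.mul_sum, Nat.cast_sub hN]
    push_cast
    ring
  have hexp : Complex.exp (((N - 1 : ℕ) : ℂ) * (Real.pi * Complex.I)) = (-1) ^ (N - 1) := by
    rw [Complex.exp_nat_mul, Complex.exp_pi_mul_I]
  set S := ∑ l ∈ Finset.range N, Complex.I * Real.pi * b l with hS
  have key : Complex.exp (-S) * Complex.exp (leadingExponent N b * (v / N + Real.pi * Complex.I)) *
      (-1) ^ (N - 1) =
      Complex.exp S * Complex.exp (leadingExponent N b * (v / N - Real.pi * Complex.I)) := by
    rw [← hexp, ← Complex.exp_add, ← Complex.exp_add, ← Complex.exp_add]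
    congr 1
    linear_combination 2 * hβ
  have hpow : (-1 : ℂ) ^ N = -(-1) ^ (N - 1) := by
    conv_lhs => rw [← Nat.sub_add_cancel hN, pow_succ]
    ring
  rw [hsum, hpow]
  generalize Complex.exp (N * Complex.exp (v / N)) = X
  generalize (∏ l ∈ Finset.range N, (2 * Real.pi * Complex.I : ℂ)) = Q
  linear_combination (-(X / Q)) * key

/-- For j = 0 the expansion into translates is a linear relation between the values at v + (N -
2k)πi, 0 ≤ k ≤ N, with Im v = π/2. The point k = 0 is the one in question, k = N lies on the edge of
the strip already treated, and the others are closer to the real axis and negligible. By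
`leading_shift` the point k = 0 inherits the asymptotics of k = N. -/
lemma leadingAsymp_boundary (hN : 2 ≤ N) : LeadingAsymp N b {N * Real.pi + Real.pi / 2} := by
  have hN1 : 1 ≤ N := by omega
  have hN2 : (2 : ℝ) ≤ N := by exact_mod_cast hN
  have hpi := Real.pi_pos
  have hNpi : 2 * Real.pi ≤ N * Real.pi := by nlinarith
  obtain ⟨c, h1, h2, h3⟩ := meijer_shift_expansion N b le_rfl
  rw [Nat.sub_self, Nat.Ico_zero_eq_range] at h2 h3
  simp only [Nat.sub_self, meijer_zero hN1] at h1
  obtain ⟨K, hK⟩ := leadingAsymp_inner (b := b) hN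
  set β := leadingExponent N b with hβ
  obtain ⟨G, hG0, hG⟩ := norm_leading_gap hN1 β hpi
  have hc0 : c 0 ≠ 0 := by
    rw [h2, Finset.prod_ne_zero_iff]
    intro l _
    exact div_ne_zero (neg_ne_zero.2 (Complex.exp_ne_zero _)) (by
      simp [Real.pi_ne_zero, Complex.I_ne_zero])
  set T : ℝ := ‖c N‖ * |K| + ∑ k ∈ Finset.range (N - 1),
    ‖c (k + 1)‖ * ((|K| + |leadingConst N|) * G) with hT
  refine LeadingAsymp.of_large hN1 (x₀ := 0) (K := T / ‖c 0‖) fun x hx => ?_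
  rw [norm_deviation_le_iff]
  set v : ℂ := x + (Real.pi / 2 : ℝ) * Complex.I with hv
  have hvre : v.re = x := by simp [hv]
  have hvim : v.im = Real.pi / 2 := by simp [hv]
  have hw : (x + (N * Real.pi + Real.pi / 2 : ℝ) * Complex.I : ℂ) =
      v + N * (Real.pi * Complex.I) := by rw [hv]; push_cast; ring
  rw [hw]
  set w₀ : ℂ := v - N * (Real.pi * Complex.I) with hw₀
  have hre0 : w₀.re = x := by simp [hw₀, hvre]
  have him0 : w₀.im = Real.pi / 2 - N * Real.pi := by simp [hw₀, hvim]
  have hre1 : (v + N * (Real.pi * Complex.I)).re = x := by simp [hvre]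
  have him1 : (v + N * (Real.pi * Complex.I)).im = Real.pi / 2 + N * Real.pi := by simp [hvim]
  have hnorm : ‖leading N β (v + N * (Real.pi * Complex.I))‖ = ‖leading N β w₀‖ := by
    rw [norm_leading' hN1, norm_leading' hN1, hre0, hre1, him0, him1]
    have : (Real.pi / 2 + N * Real.pi) / N = (Real.pi / 2 - N * Real.pi) / N + 2 * Real.pi := by
      field_simp; ring
    rw [this, Real.cos_add_two_pi]
  rw [hre1, hnorm]
  have hsum := h1 0 v
  rw [Finset.sum_range_succ'] at hsum
  obtain ⟨n, rfl⟩ : ∃ n, N = n + 1 := ⟨N - 1, by omega⟩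
  rw [Finset.sum_range_succ] at hsum
  have ea : v + (((n + 1 : ℕ) : ℂ) - 2 * ((0 : ℕ) : ℂ)) * (Real.pi * Complex.I) =
      v + ((n + 1 : ℕ) : ℂ) * (Real.pi * Complex.I) := by push_cast; ring
  have eb : v + (((n + 1 : ℕ) : ℂ) - 2 * ((n + 1 : ℕ) : ℂ)) * (Real.pi * Complex.I) = w₀ := by
    rw [hw₀]; ring
  rw [ea, eb] at hsum
  have hshift := leading_shift hN1 b v
  rw [← h2, ← h3, ← hβ] at hshift
  set Λ := leadingConst (n + 1)
  have hid : c 0 * (meijer (n + 1) b 0 (n + 1) (v + ((n + 1 : ℕ) : ℂ) * (Real.pi * Complex.I)) -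
      Λ * leading (n + 1) β (v + ((n + 1 : ℕ) : ℂ) * (Real.pi * Complex.I))) =
      -(c (n + 1) * (meijer (n + 1) b 0 (n + 1) w₀ - Λ * leading (n + 1) β w₀)) -
      ∑ k ∈ Finset.range n, c (k + 1) * meijer (n + 1) b 0 (n + 1)
        (v + (((n + 1 : ℕ) : ℂ) - 2 * ((k + 1 : ℕ) : ℂ)) * (Real.pi * Complex.I)) := by
    linear_combination -hsum - Λ * hshift
  have hb0 := hK w₀ (by rw [hre0]; exact hx) (by
    rw [him0]; constructor <;> linarith)
  rw [hre0] at hb0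
  set P : ℝ := Real.exp (-(x / (n + 1 : ℕ))) * ‖leading (n + 1) β w₀‖ with hP
  have hP0 : 0 ≤ P := by positivity
  have hterm : ∀ k ∈ Finset.range n, ‖c (k + 1) * meijer (n + 1) b 0 (n + 1)
      (v + (((n + 1 : ℕ) : ℂ) - 2 * ((k + 1 : ℕ) : ℂ)) * (Real.pi * Complex.I))‖ ≤
      ‖c (k + 1)‖ * ((|K| + |Λ|) * G) * P := by
    intro k hk
    rw [Finset.mem_range] at hk
    have hk' : (k : ℝ) + 1 ≤ n := by exact_mod_cast hk
    have hk0 : (0 : ℝ) ≤ k := Nat.cast_nonneg k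
    set u : ℂ := v + (((n + 1 : ℕ) : ℂ) - 2 * ((k + 1 : ℕ) : ℂ)) * (Real.pi * Complex.I) with hu
    have e : u = v + ((((n + 1 : ℕ) : ℝ) - 2 * ((k + 1 : ℕ) : ℝ)) * Real.pi : ℝ) * Complex.I := by
      rw [hu]; push_cast; ring
    have hure : u.re = x := by rw [e]; simp [hvre]
    have huim : u.im = Real.pi / 2 + (n - 1 - 2 * k) * Real.pi := by
      rw [e, Complex.add_im, Complex.im_ofReal_mul, Complex.I_im, hvim]; push_cast; ring
    have hkpi := mul_le_mul_of_nonneg_right hk' hpi.le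
    have hkpi0 := mul_nonneg hk0 hpi.le
    have habs : |u.im| + Real.pi ≤ |w₀.im| := by
      have h0 : |w₀.im| = (n + 1 : ℕ) * Real.pi - Real.pi / 2 := by
        rw [him0, abs_of_nonpos (by linarith)]; ring
      rw [h0, ← le_sub_iff_add_le, huim, abs_le]
      push_cast
      constructor <;> linarith
    have hgap := hG w₀ u (by rw [hure, hre0]) habs (by
      rw [him0, abs_of_nonpos (by linarith)]; linarith)
    rw [hre0, mul_assoc, ← hP] at hgap
    have hw0 : |w₀.im| = (n + 1 : ℕ) * Real.pi - Real.pi / 2 := by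
      rw [him0, abs_of_nonpos (by linarith)]; ring
    rw [hw0] at habs
    have hb := hK u (by rw [hure]; exact hx) (abs_le.1 (by linarith))
    have hone : Real.exp (-(u.re / (n + 1 : ℕ))) ≤ 1 := by
      rw [Real.exp_le_one_iff, hure]
      have : 0 ≤ x / (n + 1 : ℕ) := by positivity
      linarith
    have hL : ‖meijer (n + 1) b 0 (n + 1) u‖ ≤ (|K| + |Λ|) * ‖leading (n + 1) β u‖ := by
      have h4 := norm_le_norm_add_norm_sub' (meijer (n + 1) b 0 (n + 1) u)
        (Λ * leading (n + 1) β u)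
      rw [norm_mul, Complex.norm_real, Real.norm_eq_abs] at h4
      have h5 : K * Real.exp (-(u.re / (n + 1 : ℕ))) ≤ |K| * 1 := by
        gcongr
        exact le_abs_self K
      have h6 := mul_le_mul_of_nonneg_right h5 (norm_nonneg (leading (n + 1) β u))
      linarith
    rw [norm_mul, mul_assoc]
    gcongr
    refine hL.trans ?_
    rw [mul_assoc]
    gcongr
  have hn0 : 0 < ‖c 0‖ := norm_pos_iff.2 hc0
  have hmain : ‖c 0‖ * ‖meijer (n + 1) b 0 (n + 1) (v + ((n + 1 : ℕ) : ℂ) * (Real.pi * Complex.I)) -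
      Λ * leading (n + 1) β (v + ((n + 1 : ℕ) : ℂ) * (Real.pi * Complex.I))‖ ≤ T * P := by
    rw [← norm_mul, hid, hT, add_mul, Finset.sum_mul]
    refine (norm_sub_le _ _).trans (add_le_add ?_ ((norm_sum_le _ _).trans
      (Finset.sum_le_sum hterm)))
    rw [norm_neg, norm_mul, mul_assoc]
    gcongr
    refine hb0.trans ?_
    rw [mul_assoc]
    gcongr
    exact le_abs_self K
  rw [← le_div_iff₀' hn0] at hmain
  refine hmain.trans_eq ?_
  rw [hP]
  ring

/-- The new line and the edge of the inner strip are only π apart, which is less than Nπ;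
Phragmén-Lindelöf fills the gap, and conjugation treats the lower side. -/
lemma leadingAsymp_outer (hN : 2 ≤ N) :
    LeadingAsymp N b (Set.Icc (-(N * Real.pi + Real.pi / 2)) (N * Real.pi + Real.pi / 2)) := by
  have hN1 : 1 ≤ N := by omega
  have hN2 : (2 : ℝ) ≤ N := by exact_mod_cast hN
  have hpi := Real.pi_pos
  have hin := leadingAsymp_inner (b := b) hN
  have hup : LeadingAsymp N b (Set.Icc (N * Real.pi - Real.pi / 2) (N * Real.pi + Real.pi / 2)) := by
    refine LeadingAsymp.strip hN1 (by linarith) (by nlinarith) ?_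
    refine LeadingAsymp.union (S := {_}) (hin.mono ?_) (leadingAsymp_boundary hN)
    rintro y rfl
    exact ⟨by nlinarith, le_rfl⟩
  refine ((hin.union hup).union hup.conj).mono fun y hy => ?_
  by_cases h1 : y ≤ N * Real.pi - Real.pi / 2
  · by_cases h2 : -(N * Real.pi - Real.pi / 2) ≤ y
    · exact Or.inl (Or.inl ⟨h2, h1⟩)
    · right
      simp only [Set.mem_preimage, Set.mem_Icc]
      exact ⟨by linarith, by linarith [hy.1]⟩
  · exact Or.inl (Or.inr ⟨by linarith, hy.2⟩)

end CauchyChain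
end

/-! ### Asymptotics of derivatives, and of all Meijer functions in half planes -/

noncomputable section
namespace CauchyChain

variable {N : ℕ} {b : ℕ → ℝ}

/-- The quotient of `meijer N b i N` and its leading term. -/
def leadingQuotient (N : ℕ) (b : ℕ → ℝ) (i : ℕ) (w : ℂ) : ℂ :=
  meijer N b i N w * (leading N (leadingExponent N b) w)⁻¹ * (-Complex.exp (-(w / N))) ^ i

lemma hasDerivAt_leading (N : ℕ) (β : ℝ) (w : ℂ) :
    HasDerivAt (leading N β) ((β / N - N * (Complex.exp (w / N) / N)) * leading N β w) w := by
  have h0 : HasDerivAt (fun w : ℂ => w / N) (1 / N) w := (hasDerivAt_id w).div_const _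
  have h1 := (h0.const_mul (β : ℂ)).cexp
  have h2 : HasDerivAt (fun w : ℂ => Complex.exp (-(N * Complex.exp (w / N))))
      (Complex.exp (-(N * Complex.exp (w / N))) * -(N * (Complex.exp (w / N) * (1 / N)))) w :=
    ((h0.cexp.const_mul (N : ℂ)).neg).cexp
  refine (h1.mul h2).congr_deriv ?_
  unfold leading
  ring

/-- The normalization is made for this identity: solved for the next quotient it reads q_{i+1} = q_i
- e^{-w/N}(q_i' + (β + i)/N · q_i), so a bound of q_i' suffices to pass from i to i + 1. -/
lemma hasDerivAt_leadingQuotient (hN : 1 ≤ N) (i : ℕ) (w : ℂ) :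
    HasDerivAt (leadingQuotient N b i) (Complex.exp (w / N) *
      (leadingQuotient N b i w - leadingQuotient N b (i + 1) w) -
        ((leadingExponent N b + i : ℝ) / N) * leadingQuotient N b i w) w := by
  have hNC : (N : ℂ) ≠ 0 := by exact_mod_cast (by omega : N ≠ 0)
  set β := leadingExponent N b with hβ
  have hl := leading_ne_zero N β w
  have h0 : HasDerivAt (fun w : ℂ => w / N) (1 / N) w := (hasDerivAt_id w).div_const _
  have h1 := hasDerivAt_meijer (b := b) hN le_rfl i w
  have h2 : HasDerivAt (fun z => (leading N β z)⁻¹) _ w := (hasDerivAt_leading N β w).inv hl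
  have h3 : HasDerivAt (fun z : ℂ => (-Complex.exp (-(z / N))) ^ i)
      (i * (-Complex.exp (-(w / N))) ^ (i - 1) * -(Complex.exp (-(w / N)) * -(1 / N))) w :=
    (h0.neg.cexp.neg).pow i
  have h12 : HasDerivAt (fun z => meijer N b i N z * (leading N β z)⁻¹) _ w := h1.mul h2
  have h123 : HasDerivAt (leadingQuotient N b i) _ w := h12.mul h3
  refine h123.congr_deriv ?_
  unfold leadingQuotient
  rw [← hβ]
  have hE : Complex.exp (-(w / N)) = (Complex.exp (w / N))⁻¹ := Complex.exp_neg _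
  have hE0 := Complex.exp_ne_zero (w / N)
  simp only [hE]
  rcases i with _ | i
  · simp only [pow_zero, Nat.cast_zero]
    push_cast
    field_simp
    ring
  · simp only [Nat.add_sub_cancel, pow_succ]
    push_cast
    field_simp
    ring

/-- Induction on the order of the derivative: Cauchy's estimate on small discs bounds q_i', and its
prefactor e^{-w/N} makes it part of the error. Each step uses up at most one unit of Re w and part
of the margin below Nπ + π/2. -/
lemma norm_leadingQuotient_sub_le (i : ℕ) {Y : ℝ} (hN : 2 ≤ N)
    (hY : Y < N * Real.pi + Real.pi / 2) : ∃ K : ℝ, ∀ w : ℂ, (i : ℝ) ≤ w.re → |w.im| ≤ Y →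
      ‖leadingQuotient N b i w - leadingConst N‖ ≤ K * Real.exp (-(w.re / N)) := by
  have hN1 : 1 ≤ N := by omega
  have hN0 : (0 : ℝ) < N := by exact_mod_cast hN1
  induction i generalizing Y with
  | zero =>
    obtain ⟨K, hK⟩ := leadingAsymp_outer (b := b) hN
    refine ⟨K, fun w h0 h1 => ?_⟩
    have h := hK w (by simpa using h0) ⟨by linarith [(abs_le.1 h1).1], by linarith [(abs_le.1 h1).2]⟩
    have hl := leading_ne_zero N (leadingExponent N b) w
    rw [← div_le_iff₀ (norm_pos_iff.2 hl), ← norm_div, sub_div, mul_div_cancel_right₀ _ hl] at h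
    simpa [leadingQuotient, div_eq_mul_inv] using h
  | succ i ih =>
    -- Half of the remaining margin is kept for the induction hypothesis; the discs of radius r fit
    -- into the other half.
    set Y' : ℝ := (Y + (N * Real.pi + Real.pi / 2)) / 2 with hY'
    set r : ℝ := min 1 (Y' - Y) with hr
    have hr0 : 0 < r := lt_min one_pos (by rw [hY']; linarith)
    obtain ⟨K, hK⟩ := ih (Y := Y') (by rw [hY']; linarith)
    set Q : ℝ := |leadingConst N| + |K| with hQ
    have hQ0 : 0 ≤ Q := by positivity
    have hbound : ∀ w : ℂ, (i : ℝ) ≤ w.re → |w.im| ≤ Y' → ‖leadingQuotient N b i w‖ ≤ Q :=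
      fun w h0 h1 => by
        have h := hK w h0 h1
        have h2 := norm_le_norm_add_norm_sub' (leadingQuotient N b i w) (leadingConst N)
        rw [Complex.norm_real, Real.norm_eq_abs] at h2
        have h3 : K * Real.exp (-(w.re / N)) ≤ |K| * 1 := by
          have : Real.exp (-(w.re / N)) ≤ 1 := by
            rw [Real.exp_le_one_iff]
            have : 0 ≤ w.re / N := div_nonneg ((Nat.cast_nonneg i).trans h0) hN0.le
            linarith
          gcongr
          exact le_abs_self K
        linarith
    refine ⟨|K| + Q / r + |(leadingExponent N b + i) / N| * Q, fun w h0 h1 => ?_⟩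
    push_cast at h0
    have hYY : Y ≤ Y' := by linarith [hr0.le.trans (min_le_right 1 (Y' - Y))]
    have hd := Complex.norm_deriv_le_of_forall_mem_sphere_norm_le hr0 (C := Q)
      (f := leadingQuotient N b i) (c := w)
      (Differentiable.diffContOnCl fun z =>
        (hasDerivAt_leadingQuotient (b := b) hN1 i z).differentiableAt)
      (fun z hz => by
        have hz' : ‖z - w‖ = r := by simpa [dist_eq_norm] using hz
        have h2 := Complex.abs_re_le_norm (z - w)
        have h3 := Complex.abs_im_le_norm (z - w)
        rw [Complex.sub_re] at h2
        rw [Complex.sub_im] at h3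
        refine hbound z ?_ ?_
        · linarith [(abs_le.1 h2).1, min_le_left 1 (Y' - Y)]
        · have := abs_sub_abs_le_abs_sub z.im w.im
          linarith [min_le_right 1 (Y' - Y)])
    have hder := (hasDerivAt_leadingQuotient (b := b) hN1 i w).deriv
    have hid : leadingQuotient N b (i + 1) w - leadingConst N =
        (leadingQuotient N b i w - leadingConst N) - Complex.exp (-(w / N)) *
          (deriv (leadingQuotient N b i) w +
            ((leadingExponent N b + i : ℝ) / N) * leadingQuotient N b i w) := by
      rw [hder, Complex.exp_neg]
      field_simp
      ring
    have hw := hK w (by linarith) (h1.trans hYY)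
    have hQw := hbound w (by linarith) (h1.trans hYY)
    have hE : ‖Complex.exp (-(w / N))‖ = Real.exp (-(w.re / N)) := by
      rw [Complex.norm_exp, Complex.neg_re, Complex.div_natCast_re]
    have hcoef : ‖(((leadingExponent N b + i : ℝ) : ℂ) / N)‖ = |(leadingExponent N b + i) / N| := by
      rw [← Real.norm_eq_abs, ← Complex.norm_real]
      push_cast
      rfl
    rw [hid]
    refine (norm_sub_le _ _).trans ?_
    rw [norm_mul, hE, add_assoc, add_mul]
    refine add_le_add (hw.trans (by gcongr; exact le_abs_self K)) ?_
    rw [mul_comm]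
    gcongr
    refine (norm_add_le _ _).trans (add_le_add hd ?_)
    rw [norm_mul, hcoef]
    gcongr

lemma leadingQuotient_mul (i : ℕ) (w : ℂ) : leadingQuotient N b i w *
    ((-Complex.exp (w / N)) ^ i * leading N (leadingExponent N b) w) = meijer N b i N w := by
  have hl := leading_ne_zero N (leadingExponent N b) w
  have h1 : (-Complex.exp (-(w / N))) * (-Complex.exp (w / N)) = 1 := by
    rw [neg_mul_neg, ← Complex.exp_add, neg_add_cancel, Complex.exp_zero]
  have h2 : (-Complex.exp (-(w / N))) ^ i * (-Complex.exp (w / N)) ^ i = 1 := by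
    rw [← mul_pow, h1, one_pow]
  rw [leadingQuotient]
  calc _ = meijer N b i N w * ((leading N (leadingExponent N b) w)⁻¹ *
        leading N (leadingExponent N b) w) *
        ((-Complex.exp (-(w / N))) ^ i * (-Complex.exp (w / N)) ^ i) := by ring
    _ = _ := by rw [inv_mul_cancel₀ hl, h2, mul_one, mul_one]

/-- The coefficient of the dominant term of `meijer N b i (N - m)` in the upper half plane. -/
def dominantCoeff (N : ℕ) (b : ℕ → ℝ) (m : ℕ) : ℂ :=
  ∏ l ∈ Finset.Ico (N - m) N,
    (-Complex.exp (-(Complex.I * Real.pi * b l)) / (2 * Real.pi * Complex.I))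

/-- The size of the leading term of `meijer N b i N`. -/
def leadingSize (N : ℕ) (b : ℕ → ℝ) (i : ℕ) (w : ℂ) : ℂ :=
  (-Complex.exp (w / N)) ^ i * leading N (leadingExponent N b) w

lemma norm_leadingSize (i : ℕ) (w : ℂ) : ‖leadingSize N b i w‖ =
    Real.exp (w.re / N) ^ i * ‖leading N (leadingExponent N b) w‖ := by
  rw [leadingSize, norm_mul, norm_pow, norm_neg, Complex.norm_exp, Complex.div_natCast_re]

/-- The asymptotics in the upper half plane. -/
theorem meijer_asymp_upper (hN : 2 ≤ N) (b : ℕ → ℝ) (i : ℕ) {m : ℕ} (hm : m ≤ N) {g : ℝ}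
    (hg : 0 < g) (hg2 : g ≤ 2 * Real.pi) : ∃ K : ℝ, 0 ≤ K ∧ ∀ w : ℂ, (i : ℝ) ≤ w.re →
      (m = 0 ∨ g ≤ 2 * w.im) → |w.im + m * Real.pi| ≤ N * Real.pi →
      ‖meijer N b i (N - m) w - dominantCoeff N b m * leadingConst N *
        leadingSize N b i (w + m * (Real.pi * Complex.I))‖ ≤
        K * Real.exp (-(w.re / N)) * ‖leadingSize N b i (w + m * (Real.pi * Complex.I))‖ := by
  have hN1 : 1 ≤ N := by omega
  have hN0 : (0 : ℝ) < N := by exact_mod_cast hN1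
  have hpi := Real.pi_pos
  obtain ⟨c, h1, h2, -⟩ := meijer_shift_expansion N b hm
  obtain ⟨K, hK⟩ := norm_leadingQuotient_sub_le (b := b) i hN (Y := N * Real.pi) (by linarith)
  set β := leadingExponent N b with hβ
  set Λ := leadingConst N
  -- The translates have the imaginary parts Im w + (m - 2k)π. The one with k = 0 is farthest from
  -- the real axis: its lead over k = m is 2 Im w and over k = 1 at least 2π or again 2 Im w. For m
  -- = 0 there is no competitor.
  obtain ⟨G, hG0, hG⟩ := norm_leading_gap hN1 β hg
  refine ⟨‖c 0‖ * |K| + ∑ k ∈ Finset.range m, ‖c (k + 1)‖ * ((|Λ| + |K|) * G), by positivity,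
    fun w hre hcase him => ?_⟩
  have hκ : dominantCoeff N b m = c 0 := h2.symm
  set w₀ : ℂ := w + m * (Real.pi * Complex.I) with hw₀
  have hre0 : w₀.re = w.re := by simp [hw₀]
  have him0 : w₀.im = w.im + m * Real.pi := by simp [hw₀]
  have hbd : ∀ u : ℂ, u.re = w.re → |u.im| ≤ N * Real.pi →
      ‖meijer N b i N u - Λ * leadingSize N b i u‖ ≤
        |K| * Real.exp (-(w.re / N)) * ‖leadingSize N b i u‖ := fun u hu1 hu2 => by
    have h := hK u (by rw [hu1]; exact hre) hu2
    rw [← leadingQuotient_mul i u]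
    change ‖leadingQuotient N b i u * leadingSize N b i u - _‖ ≤ _
    rw [← sub_mul, norm_mul, ← hu1]
    gcongr
    exact h.trans (by gcongr; exact le_abs_self K)
  have hone : Real.exp (-(w.re / N)) ≤ 1 := by
    rw [Real.exp_le_one_iff]
    have : 0 ≤ w.re / N := div_nonneg ((Nat.cast_nonneg i).trans hre) hN0.le
    linarith
  have hbd2 : ∀ u : ℂ, u.re = w.re → |u.im| ≤ N * Real.pi →
      ‖meijer N b i N u‖ ≤ (|Λ| + |K|) * ‖leadingSize N b i u‖ := fun u hu1 hu2 => by
    have h := hbd u hu1 hu2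
    have h3 := norm_le_norm_add_norm_sub' (meijer N b i N u) (Λ * leadingSize N b i u)
    rw [norm_mul, Complex.norm_real, Real.norm_eq_abs] at h3
    have h4 : |K| * Real.exp (-(w.re / N)) ≤ |K| * 1 := by gcongr
    have h5 := mul_le_mul_of_nonneg_right h4 (norm_nonneg (leadingSize N b i u))
    linarith
  rw [h1, Finset.sum_range_succ', hκ]
  have e0 : w + ((m : ℂ) - 2 * ((0 : ℕ) : ℂ)) * (Real.pi * Complex.I) = w₀ := by
    rw [hw₀]; push_cast; ring
  rw [e0]
  have hsplit : ∀ S : ℂ, S + c 0 * meijer N b i N w₀ - c 0 * Λ * leadingSize N b i w₀ =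
      c 0 * (meijer N b i N w₀ - Λ * leadingSize N b i w₀) + S := fun S => by ring
  rw [hsplit, add_mul, add_mul, Finset.sum_mul, Finset.sum_mul]
  refine (norm_add_le _ _).trans (add_le_add ?_ ((norm_sum_le _ _).trans
    (Finset.sum_le_sum fun k hk => ?_)))
  · rw [norm_mul, mul_assoc, mul_assoc, ← mul_assoc |K|]
    gcongr
    exact hbd w₀ hre0 (by rw [him0]; exact him)
  · rw [Finset.mem_range] at hk
    have hk' : (k : ℝ) + 1 ≤ m := by exact_mod_cast hk
    have hk0 : (0 : ℝ) ≤ k := Nat.cast_nonneg k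
    have hkpi := mul_le_mul_of_nonneg_right hk' hpi.le
    have hkpi0 := mul_nonneg hk0 hpi.le
    have hgw : g ≤ 2 * w.im := hcase.resolve_left (by omega)
    set u : ℂ := w + ((m : ℂ) - 2 * ((k + 1 : ℕ) : ℂ)) * (Real.pi * Complex.I) with hu
    have e : u = w + (((m : ℝ) - 2 * ((k + 1 : ℕ) : ℝ)) * Real.pi : ℝ) * Complex.I := by
      rw [hu]; push_cast; ring
    have hure : u.re = w.re := by rw [e]; simp
    have huim : u.im = w.im + (m - 2 * (k + 1)) * Real.pi := by
      rw [e, Complex.add_im, Complex.im_ofReal_mul, Complex.I_im]; push_cast; ring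
    have habs0 : |w₀.im| = w.im + m * Real.pi := by
      rw [him0]; exact abs_of_nonneg (by nlinarith)
    have habs : |u.im| + g ≤ |w₀.im| := by
      rw [habs0, ← le_sub_iff_add_le, huim, abs_le]
      constructor <;> linarith
    have hgap := hG w₀ u (by rw [hure, hre0]) habs (by rw [him0]; exact him)
    rw [hre0] at hgap
    have hle : |u.im| ≤ N * Real.pi := by
      rw [him0] at habs; linarith
    rw [norm_mul, mul_assoc, mul_assoc]
    gcongr
    refine (hbd2 u hure hle).trans ?_
    rw [mul_assoc]
    gcongr
    rw [norm_leadingSize, norm_leadingSize, hure, hre0, ← hβ]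
    calc Real.exp (w.re / N) ^ i * ‖leading N β u‖ ≤ Real.exp (w.re / N) ^ i *
          (G * Real.exp (-(w.re / N)) * ‖leading N β w₀‖) := by gcongr
      _ = _ := by ring

lemma leadingSize_conj (i : ℕ) (w : ℂ) :
    leadingSize N b i (starRingEnd ℂ w) = starRingEnd ℂ (leadingSize N b i w) := by
  unfold leadingSize leading
  simp [← Complex.exp_conj]

/-- The asymptotics in the lower half plane. -/
theorem meijer_asymp_lower (hN : 2 ≤ N) (b : ℕ → ℝ) (i : ℕ) {m : ℕ} (hm : m ≤ N) {g : ℝ}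
    (hg : 0 < g) (hg2 : g ≤ 2 * Real.pi) : ∃ K : ℝ, 0 ≤ K ∧ ∀ w : ℂ, (i : ℝ) ≤ w.re →
      (m = 0 ∨ 2 * w.im ≤ -g) → |w.im - m * Real.pi| ≤ N * Real.pi →
      ‖meijer N b i (N - m) w - starRingEnd ℂ (dominantCoeff N b m) * leadingConst N *
        leadingSize N b i (w - m * (Real.pi * Complex.I))‖ ≤
        K * Real.exp (-(w.re / N)) * ‖leadingSize N b i (w - m * (Real.pi * Complex.I))‖ := by
  obtain ⟨K, hK0, hK⟩ := meijer_asymp_upper hN b i hm hg hg2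
  refine ⟨K, hK0, fun w h0 h1 h2 => ?_⟩
  have h := hK (starRingEnd ℂ w) (by simpa using h0)
    (h1.imp id fun h => by rw [Complex.conj_im]; linarith)
    (by rw [Complex.conj_im, ← abs_neg]; convert h2 using 2; ring)
  have e : starRingEnd ℂ w + m * (Real.pi * Complex.I) =
      starRingEnd ℂ (w - m * (Real.pi * Complex.I)) := by simp
  rw [e, leadingSize_conj, meijer_conj, Complex.conj_re, Complex.norm_conj] at h
  rw [← Complex.norm_conj]
  simpa using h

end CauchyChain
end

noncomputable section
namespace CauchyChain

/-! ### The functions `gFun` and the entries of the matrix `bareMatrixPM` -/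

/-- The shifts `-a_{1,l}` of the gamma functions. -/
def shiftParam (a : ℕ → ℝ) (l : ℕ) : ℝ := -partialSum a 1 l

lemma shiftParam_zero (a : ℕ → ℝ) : shiftParam a 0 = 0 := by simp [shiftParam, partialSum]

lemma shiftParam_succ (a : ℕ → ℝ) (l : ℕ) : shiftParam a (l + 1) = shiftParam a l - a (l + 1) := by
  unfold shiftParam partialSum
  rw [Finset.sum_Icc_succ_top (by omega)]
  ring

/-- Every a_{k+1,l} is a difference of shifts. This lets all columns share one parameter sequence.
-/
lemma partialSum_eq (a : ℕ → ℝ) {k l : ℕ} (h : k ≤ l) :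
    partialSum a (k + 1) l = shiftParam a k - shiftParam a l := by
  induction l, h using Nat.le_induction with
  | base => simp [partialSum]
  | succ l hl ih =>
    rw [shiftParam_succ, partialSum, Finset.sum_Icc_succ_top (by omega), ← partialSum, ih]
    ring

/-- The `(i, k)` entry (zero-based) of `bareMatrixPM` as a function of `w = log ζ`. -/
def entry (p : ℕ) (a : ℕ → ℝ) (ε : ℝ) (i k : ℕ) (w : ℂ) : ℂ :=
  normConst p (k + 1) *
    Complex.exp (-(shiftParam a k * (w - ε * (k % 2 : ℕ) * (Real.pi * Complex.I)))) *
    meijer (p + 1) (shiftParam a) i (k + 1) (w - ε * (k % 2 : ℕ) * (Real.pi * Complex.I))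

variable {p : ℕ} {a : ℕ → ℝ}

/-- The translation u = s + a_{1,k} makes the gamma factors of every column depend on the same b_l.
The factor e^{±πisσ} merges with ζ^{-s} into a translation of log ζ by ∓πi, present only for odd
zero-based k. -/
lemma kernel_eq (p : ℕ) (a : ℕ → ℝ) (k : ℕ) (ε : ℝ) {ζ : ℂ} (hζ : ζ ≠ 0) :
    kernel p a (k + 1) ε ζ = fun s : ℂ =>
      (fun u => Complex.exp (-(shiftParam a k *
        (Complex.log ζ - ε * (k % 2 : ℕ) * (Real.pi * Complex.I)))) *
      (hankelKernel (p + 1) (shiftParam a) (k + 1) u * Complex.exp (-(u *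
        (Complex.log ζ - ε * (k % 2 : ℕ) * (Real.pi * Complex.I)))))) (s + (-shiftParam a k : ℝ)) := by
  ext s
  set W : ℂ := Complex.log ζ - ε * (k % 2 : ℕ) * (Real.pi * Complex.I) with hW
  have e1 : ∏ l ∈ Finset.Icc 1 (k + 1), Complex.Gamma (s + partialSum a l (k + 1 - 1)) =
      ∏ l ∈ Finset.range (k + 1), Complex.Gamma (s + (-shiftParam a k : ℝ) + shiftParam a l) := by
    refine Finset.prod_nbij' (fun l => l - 1) (fun l => l + 1) ?_ ?_ ?_ ?_ fun l hl => ?_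
    any_goals simp only [Finset.mem_Icc, Finset.mem_range]; omega
    rw [Finset.mem_Icc] at hl
    obtain ⟨l, rfl⟩ : ∃ l', l = l' + 1 := ⟨l - 1, by omega⟩
    rw [Nat.add_sub_cancel, Nat.add_sub_cancel, partialSum_eq a (by omega)]
    congr 1
    push_cast
    ring
  have e2 : ∏ l ∈ Finset.Icc (k + 1) p, Complex.Gamma (1 + partialSum a (k + 1) l - s) =
      ∏ l ∈ Finset.Ico (k + 1) (p + 1),
        Complex.Gamma (1 - shiftParam a l - (s + (-shiftParam a k : ℝ))) := by
    refine Finset.prod_congr (by ext x; simp) fun l hl => ?_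
    rw [Finset.mem_Ico] at hl
    rw [partialSum_eq a (by omega)]
    congr 1
    push_cast
    ring
  have e3 : (k + 1 + 1) % 2 = k % 2 := by omega
  have hexp : Complex.exp (ε * Complex.I * Real.pi * s * ((k % 2 : ℕ) : ℂ)) *
      Complex.exp (Complex.log ζ * -s) =
      Complex.exp (-(shiftParam a k * W)) *
        Complex.exp (-((s + (-shiftParam a k : ℝ)) * W)) := by
    rw [← Complex.exp_add, ← Complex.exp_add]
    congr 1
    rw [hW]
    push_cast
    ring
  simp only [kernel, hankelKernel]
  rw [e1, e2, e3, Complex.cpow_def_of_ne_zero hζ, mul_assoc, hexp, Finset.prod_inv_distrib]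
  ring

lemma exists_radius {R : ℝ} (hR : 0 < R)
    (hL : ∀ k l : ℕ, 1 ≤ k → k ≤ l → l ≤ p → -partialSum a k l < R) {k : ℕ} (hk : k ≤ p) :
    ∃ R₀ : ℝ, R₀ < R + (-shiftParam a k) ∧ ∀ l < k + 1, -shiftParam a l ≤ R₀ := by
  have hne : (Finset.range (k + 1)).Nonempty := ⟨0, by simp⟩
  refine ⟨(Finset.range (k + 1)).sup' hne (fun l => -shiftParam a l), ?_, fun l hl =>
    Finset.le_sup' (fun l => -shiftParam a l) (Finset.mem_range.2 hl)⟩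
  rw [Finset.sup'_lt_iff]
  intro l hl
  rw [Finset.mem_range] at hl
  rcases (Nat.lt_succ_iff.1 hl).eq_or_lt with rfl | h
  · linarith
  · have := hL (l + 1) k (by omega) h hk
    rw [partialSum_eq a h.le] at this
    linarith

lemma kernel_isHankel {R : ℝ} (hR : 0 < R)
    (hL : ∀ k l : ℕ, 1 ≤ k → k ≤ l → l ≤ p → -partialSum a k l < R) {k : ℕ} (hk : k ≤ p) (ε : ℝ)
    {ζ : ℂ} (hζ : ζ ≠ 0) : ∃ R₀ < R, IsHankel R₀ (kernel p a (k + 1) ε ζ) := by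
  obtain ⟨R₀, h1, h2⟩ := exists_radius hR hL hk
  refine ⟨R₀ - (-shiftParam a k), by linarith, ?_⟩
  rw [kernel_eq p a k ε hζ]
  exact (((isHankel_hankelKernel (by omega) h2).mul_exp _).const_mul _).comp_add _

lemma gFun_eq {R h : ℝ} (hR : 0 < R) (hh : 0 < h)
    (hL : ∀ k l : ℕ, 1 ≤ k → k ≤ l → l ≤ p → -partialSum a k l < R) {k : ℕ} (hk : k ≤ p) (ε : ℝ)
    {ζ : ℂ} (hζ : ζ ≠ 0) : gFun p a R h (k + 1) ε ζ = entry p a ε 0 k (Complex.log ζ) := by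
  obtain ⟨R₀, h1, h2⟩ := exists_radius hR hL hk
  have hm := meijer_eq_loop (N := p + 1) (b := shiftParam a) (i := 0) (j := k + 1) (by omega)
    (by omega) h2 h1 hh hh (Complex.log ζ - ε * (k % 2 : ℕ) * (Real.pi * Complex.I))
  rw [gFun, loopIntegral_eq_loop, kernel_eq p a k ε hζ, loop_comp_add (k := fun u =>
    Complex.exp (-(shiftParam a k *
        (Complex.log ζ - ε * (k % 2 : ℕ) * (Real.pi * Complex.I)))) *
      (hankelKernel (p + 1) (shiftParam a) (k + 1) u * Complex.exp (-(u *
        (Complex.log ζ - ε * (k % 2 : ℕ) * (Real.pi * Complex.I)))))), loop_const_mul, entry, hm]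
  simp only [pow_zero, mul_one]
  ring

lemma hasDerivAt_entry {k : ℕ} (hk : k ≤ p) (ε : ℝ) (i : ℕ) (w : ℂ) :
    HasDerivAt (entry p a ε i k)
      (entry p a ε (i + 1) k w - shiftParam a k * entry p a ε i k w) w := by
  set s : ℂ := ε * (k % 2 : ℕ) * (Real.pi * Complex.I) with hs
  have h0 : HasDerivAt (fun w : ℂ => w - s) 1 w := (hasDerivAt_id w).sub_const s
  have h1 : HasDerivAt (fun w : ℂ => meijer (p + 1) (shiftParam a) i (k + 1) (w - s))
      (meijer (p + 1) (shiftParam a) (i + 1) (k + 1) (w - s)) w := by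
    have := HasDerivAt.comp (h := fun w : ℂ => w - s) w
      (hasDerivAt_meijer (N := p + 1) (b := shiftParam a) (j := k + 1) (by omega) (by omega) i
        (w - s)) h0
    rwa [mul_one] at this
  have h2 : HasDerivAt (fun w : ℂ => Complex.exp (-(shiftParam a k * (w - s))))
      (Complex.exp (-(shiftParam a k * (w - s))) * -(shiftParam a k * 1)) w :=
    ((h0.const_mul (shiftParam a k : ℂ)).neg).cexp
  have h3 : HasDerivAt (entry p a ε i k) _ w := (h2.const_mul (normConst p (k + 1))).mul h1
  refine h3.congr_deriv ?_
  rw [entry, entry, ← hs]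
  ring

lemma entry_differentiable {k : ℕ} (hk : k ≤ p) (ε : ℝ) (i : ℕ) :
    Differentiable ℂ (entry p a ε i k) := fun w => (hasDerivAt_entry hk ε i w).differentiableAt

/-- In the variable w = log ζ the operator Δ_ζ is d/dw, and subtracting a_{1,k} cancels the
derivative of the prefactor exp(-b_k w). Iteration therefore leaves pure derivatives of the Meijer
function. -/
lemma bareMatrixPM_apply {R h : ℝ} (hR : 0 < R) (hh : 0 < h)
    (hL : ∀ k l : ℕ, 1 ≤ k → k ≤ l → l ≤ p → -partialSum a k l < R) (ε : ℝ)
    {ζ : ℂ} (hζ : ζ ∈ Complex.slitPlane) (i k : Fin (p + 1)) :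
    bareMatrixPM p a R h ε ζ i k = entry p a ε i k (Complex.log ζ) := by
  have hk : (k : ℕ) ≤ p := by omega
  rw [bareMatrixPM, Matrix.of_apply]
  generalize (i : ℕ) = n
  induction n generalizing ζ with
  | zero => exact gFun_eq hR hh hL hk ε (Complex.slitPlane_ne_zero hζ)
  | succ n ih =>
    have hζ0 := Complex.slitPlane_ne_zero hζ
    rw [Function.iterate_succ_apply', eulerOp, ih hζ]
    have hd : HasDerivAt (fun z => entry p a ε n k (Complex.log z)) _ ζ :=
      HasDerivAt.comp ζ (hasDerivAt_entry hk ε n (Complex.log ζ)) (Complex.hasDerivAt_log hζ)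
    have heq : (eulerOp (partialSum a 1 k))^[n] (gFun p a R h (k + 1) ε) =ᶠ[𝓝 ζ]
        fun z => entry p a ε n k (Complex.log z) := by
      filter_upwards [Complex.isOpen_slitPlane.mem_nhds hζ] with z hz using ih hz
    rw [heq.deriv_eq, hd.deriv]
    have : ((partialSum a 1 k : ℝ) : ℂ) = -shiftParam a k := by simp [shiftParam]
    rw [this]
    field_simp
    ring

/-! ### Relations between the entries -/

lemma normConst_succ {k : ℕ} (hk : k < p) :
    normConst p (k + 1) = 2 * Real.pi * Complex.I * normConst p (k + 2) := by
  have : p + 1 - (k + 1) = p + 1 - (k + 2) + 1 := by omega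
  rw [normConst, normConst, this, pow_succ]
  ring

lemma ofReal_shiftParam_succ (a : ℕ → ℝ) (k : ℕ) :
    (shiftParam a (k + 1) : ℂ) = shiftParam a k - a (k + 1) := by
  rw [shiftParam_succ]; push_cast; rfl

/-- The three term relation at w: the two translates by ∓πi are the branches ε = ±1 of the next
column, and the ratio of the constants c_j absorbs 2πi. This is the jump on the positive axis. -/
lemma entry_even {k : ℕ} (hk : k < p) (h2 : k % 2 = 0) (ε : ℝ) (i : ℕ) (w : ℂ) :
    entry p a ε i k w = Complex.exp (-(a (k + 1) * w)) *
      (entry p a 1 i (k + 1) w - entry p a (-1) i (k + 1) w) := by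
  have h2' : (k + 1) % 2 = 1 := by omega
  have hs := meijer_step (N := p + 1) (b := shiftParam a) (j := k + 1) (by omega) i w
  have hpi : (2 * Real.pi * Complex.I : ℂ) ≠ 0 := by
    simp [Real.pi_ne_zero, Complex.I_ne_zero]
  simp only [entry, h2, h2', normConst_succ hk]
  simp only [Nat.cast_zero, mul_zero, zero_mul, sub_zero, Nat.cast_one, mul_one, Complex.ofReal_one,
    one_mul, Complex.ofReal_neg, neg_mul, sub_neg_eq_add]
  rw [hs]
  have e1 : Complex.exp (-(shiftParam a (k + 1) * (w - Real.pi * Complex.I))) =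
      Complex.exp (a (k + 1) * w) * Complex.exp (-(shiftParam a k * w)) *
        Complex.exp (Complex.I * Real.pi * shiftParam a (k + 1)) := by
    rw [← Complex.exp_add, ← Complex.exp_add, ofReal_shiftParam_succ]
    congr 1; ring
  have e2 : Complex.exp (-(shiftParam a (k + 1) * (w + Real.pi * Complex.I))) =
      Complex.exp (a (k + 1) * w) * Complex.exp (-(shiftParam a k * w)) *
        Complex.exp (-(Complex.I * Real.pi * shiftParam a (k + 1))) := by
    rw [← Complex.exp_add, ← Complex.exp_add, ofReal_shiftParam_succ]
    congr 1; ring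
  have e3 := Complex.exp_ne_zero (a (k + 1) * w)
  rw [e1, e2, Complex.exp_neg (a (k + 1) * w)]
  field_simp

lemma entry_odd_top {k : ℕ} (h2 : k % 2 = 1) (i : ℕ) (w : ℂ) :
    entry p a 1 i k (w + Real.pi * Complex.I) = entry p a (-1) i k (w - Real.pi * Complex.I) := by
  simp only [entry, h2]
  simp

/-- The same relation for columns that carry their own translation: it compares the two sides arg ζ
= ±π of the negative axis. -/
lemma entry_odd {k : ℕ} (hk : k < p) (h2 : k % 2 = 1) (ε : ℝ) (i : ℕ) (w : ℂ) :
    entry p a 1 i k (w + Real.pi * Complex.I) = Complex.exp (-(a (k + 1) * w)) *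
      (entry p a ε i (k + 1) (w - Real.pi * Complex.I) -
        entry p a ε i (k + 1) (w + Real.pi * Complex.I)) := by
  have h2' : (k + 1) % 2 = 0 := by omega
  have hs := meijer_step (N := p + 1) (b := shiftParam a) (j := k + 1) (by omega) i w
  have hpi : (2 * Real.pi * Complex.I : ℂ) ≠ 0 := by
    simp [Real.pi_ne_zero, Complex.I_ne_zero]
  simp only [entry, h2, h2', normConst_succ hk]
  simp only [Nat.cast_zero, mul_zero, zero_mul, sub_zero, Nat.cast_one, mul_one, Complex.ofReal_one,
    one_mul, add_sub_cancel_right]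
  rw [hs]
  have e1 : Complex.exp (-(shiftParam a (k + 1) * (w - Real.pi * Complex.I))) =
      Complex.exp (a (k + 1) * w) * Complex.exp (-(shiftParam a k * w)) *
        Complex.exp (Complex.I * Real.pi * shiftParam a (k + 1)) := by
    rw [← Complex.exp_add, ← Complex.exp_add, ofReal_shiftParam_succ]
    congr 1; ring
  have e2 : Complex.exp (-(shiftParam a (k + 1) * (w + Real.pi * Complex.I))) =
      Complex.exp (a (k + 1) * w) * Complex.exp (-(shiftParam a k * w)) *
        Complex.exp (-(Complex.I * Real.pi * shiftParam a (k + 1))) := by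
    rw [← Complex.exp_add, ← Complex.exp_add, ofReal_shiftParam_succ]
    congr 1; ring
  have e3 := Complex.exp_ne_zero (a (k + 1) * w)
  rw [e1, e2, Complex.exp_neg (a (k + 1) * w)]
  field_simp

/-- The Meijer functions are real for real w; the sign comes from the powers of i in the normalizing
constant. -/
lemma entry_conj {k : ℕ} (hk : k ≤ p) (ε : ℝ) (i : ℕ) (w : ℂ) :
    entry p a (-ε) i k (starRingEnd ℂ w) =
      (-1) ^ (p - k) * starRingEnd ℂ (entry p a ε i k w) := by
  have hn : starRingEnd ℂ (normConst p (k + 1)) = (-1) ^ (p - k) * normConst p (k + 1) := by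
    have : p + 1 - (k + 1) = p - k := by omega
    rw [normConst, this, map_mul, map_pow, Complex.conj_ofReal]
    simp only [map_mul, Complex.conj_ofReal, Complex.conj_I, map_ofNat]
    rw [mul_neg, neg_pow]
    ring
  have hs : (starRingEnd ℂ w - ((-ε : ℝ) : ℂ) * (k % 2 : ℕ) * (Real.pi * Complex.I)) =
      starRingEnd ℂ (w - ε * (k % 2 : ℕ) * (Real.pi * Complex.I)) := by
    simp
  have hsq : ((-1 : ℂ) ^ (p - k)) * (-1) ^ (p - k) = 1 := by
    rw [← mul_pow]; simp
  rw [entry, hs, meijer_conj, entry, map_mul, map_mul, hn, ← Complex.exp_conj]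
  have e : starRingEnd ℂ (-(shiftParam a k * (w - ε * (k % 2 : ℕ) * (Real.pi * Complex.I)))) =
      -(shiftParam a k * starRingEnd ℂ (w - ε * (k % 2 : ℕ) * (Real.pi * Complex.I))) := by
    rw [map_neg, map_mul, Complex.conj_ofReal]
  rw [e]
  linear_combination (-(normConst p (k + 1) * Complex.exp (-(shiftParam a k *
    starRingEnd ℂ (w - ε * (k % 2 : ℕ) * (Real.pi * Complex.I)))) *
    starRingEnd ℂ (meijer (p + 1) (shiftParam a) i (k + 1)
      (w - ε * (k % 2 : ℕ) * (Real.pi * Complex.I))))) * hsq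

end CauchyChain
end

noncomputable section
namespace CauchyChain

/-! ### Products with block diagonal matrices -/

/-- The `k`-th entry of the product of the row `g` with `blockSum p s B`. -/
def blockCol (p s : ℕ) (B : ℕ → Matrix (Fin 2) (Fin 2) ℂ) (g : ℕ → ℂ) (k : ℕ) : ℂ :=
  if IsBlockStart p s (k + 1) then g k * B (k + 1) 0 0 + g (k + 1) * B (k + 1) 1 0
  else if IsBlockStart p s k then g (k - 1) * B k 0 1 + g k * B k 1 1
  else g k

lemma mul_blockSum_apply (p s : ℕ) (B : ℕ → Matrix (Fin 2) (Fin 2) ℂ) (f : ℕ → ℕ → ℂ)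
    (i k : Fin (p + 1)) :
    ((Matrix.of fun i k : Fin (p + 1) => f i k) * blockSum p s B) i k =
      blockCol p s B (f i) k := by
  obtain ⟨k, hk⟩ := k
  rw [Matrix.mul_apply]
  simp only [Matrix.of_apply, blockSum]
  rw [Fin.sum_univ_eq_sum_range (fun j => f i j *
    (if IsBlockStart p s (j + 1) ∧ k + 1 = j + 1 then B (j + 1) 0 0
    else if IsBlockStart p s (j + 1) ∧ k + 1 = j + 1 + 1 then B (j + 1) 0 1
    else if IsBlockStart p s (k + 1) ∧ j + 1 = k + 1 + 1 then B (k + 1) 1 0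
    else if IsBlockStart p s (j + 1 - 1) ∧ k + 1 = j + 1 then B (j + 1 - 1) 1 1
    else if k + 1 = j + 1 then 1 else 0)) (p + 1)]
  unfold blockCol
  by_cases h1 : IsBlockStart p s (k + 1)
  · have h1' := h1
    unfold IsBlockStart at h1'
    have hk0 : ¬ IsBlockStart p s k := by unfold IsBlockStart; omega
    have hk2 : ¬ IsBlockStart p s (k + 1 + 1) := by unfold IsBlockStart; omega
    rw [if_pos h1, Finset.sum_eq_add k (k + 1) (by omega) ?_ ?_ ?_]
    · simp [h1, hk2]
    · intro j hj hne
      rw [if_neg (by omega), if_neg, if_neg (by omega), if_neg (by omega), if_neg (by omega),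
        mul_zero]
      rintro ⟨h3, h4⟩
      unfold IsBlockStart at h3
      omega
    · intro h; exact absurd (Finset.mem_range.2 (by omega)) h
    · intro h; exact absurd (Finset.mem_range.2 (by omega)) h
  · rw [if_neg h1]
    by_cases h2 : IsBlockStart p s k
    · have h2' := h2
      unfold IsBlockStart at h2'
      obtain ⟨k, rfl⟩ : ∃ k', k = k' + 1 := ⟨k - 1, by omega⟩
      rw [if_pos h2, Finset.sum_eq_add k (k + 1) (by omega) ?_ ?_ ?_]
      · simp [h1, h2]
      · intro j hj hne
        rw [if_neg (by omega), if_neg (by omega), if_neg (fun h => h1 h.1), if_neg (by omega),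
          if_neg (by omega), mul_zero]
      · intro h; exact absurd (Finset.mem_range.2 (by omega)) h
      · intro h; exact absurd (Finset.mem_range.2 (by omega)) h
    · rw [if_neg h2, Finset.sum_eq_single k ?_ ?_]
      · simp [h1, h2]
      · intro j hj hne
        rw [if_neg (by omega), if_neg, if_neg (fun h => h1 h.1), if_neg (by omega),
          if_neg (by omega), mul_zero]
        rintro ⟨h3, h4⟩
        obtain rfl : k = j + 1 := by omega
        exact h2 h3
      · intro h; exact absurd (Finset.mem_range.2 (by omega)) h

/-! ### The matrix function in the six sectors -/

/-- The entry of `bareMatrixPM` times a lower triangular block diagonal matrix, as a function of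
`w = log ζ`. -/
def sectorEntry (p : ℕ) (a : ℕ → ℝ) (ε : ℝ) (s : ℕ) (c : ℕ → ℂ) (i k : ℕ) (w : ℂ) : ℂ :=
  entry p a ε i k w + if IsBlockStart p s (k + 1) then
    c (k + 1) * Complex.exp (-(a (k + 1) * w)) * entry p a ε i (k + 1) w else 0

variable {p : ℕ} {a : ℕ → ℝ}

/-- The matrix with the entries `sectorEntry`. -/
def sectorMatrix (p : ℕ) (a : ℕ → ℝ) (ε : ℝ) (s : ℕ) (c : ℕ → ℂ) (w : ℂ) :
    Matrix (Fin (p + 1)) (Fin (p + 1)) ℂ :=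
  Matrix.of fun i k => sectorEntry p a ε s c i k w

lemma sectorEntry_differentiable {k : ℕ} (hk : k ≤ p) (ε : ℝ) (s : ℕ) (c : ℕ → ℂ) (i : ℕ) :
    Differentiable ℂ (sectorEntry p a ε s c i k) := by
  unfold sectorEntry
  have h1 := entry_differentiable (a := a) hk ε i
  by_cases h : IsBlockStart p s (k + 1)
  · have h2 := entry_differentiable (a := a) h.2.2 ε i
    simp only [if_pos h]
    fun_prop
  · simp only [if_neg h, add_zero]
    exact h1

lemma sectorMatrix_continuous (ε : ℝ) (s : ℕ) (c : ℕ → ℂ) :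
    Continuous (sectorMatrix p a ε s c) :=
  continuous_matrix fun _ k => (sectorEntry_differentiable (by omega) ε s c _).continuous

lemma blockCol_lower (s : ℕ) (d : ℕ → ℂ) (g : ℕ → ℂ) (k : ℕ) :
    blockCol p s (fun m => !![1, 0; d m, 1]) g k =
      g k + if IsBlockStart p s (k + 1) then d (k + 1) * g (k + 1) else 0 := by
  unfold blockCol
  split_ifs <;> simp [mul_comm]

lemma cpow_eq_exp {ζ : ℂ} (hζ : ζ ≠ 0) (x : ℂ) : ζ ^ (-x) = Complex.exp (-(x * Complex.log ζ)) := by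
  rw [Complex.cpow_def_of_ne_zero hζ]; ring_nf

lemma bareMatrixPM_mul_lower {R h : ℝ} (hR : 0 < R) (hh : 0 < h)
    (hL : ∀ k l : ℕ, 1 ≤ k → k ≤ l → l ≤ p → -partialSum a k l < R) (ε : ℝ) (s : ℕ) (c : ℕ → ℂ)
    {ζ : ℂ} (hζ : ζ ∈ Complex.slitPlane) :
    bareMatrixPM p a R h ε ζ * blockSum p s (fun m => !![1, 0; c m * ζ ^ (-(a m : ℂ)), 1]) =
      sectorMatrix p a ε s c (Complex.log ζ) := by
  have e : bareMatrixPM p a R h ε ζ =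
      Matrix.of fun i k : Fin (p + 1) => (fun i k => entry p a ε i k (Complex.log ζ)) i k := by
    ext i k; exact bareMatrixPM_apply hR hh hL ε hζ i k
  rw [e]
  ext i k
  refine (mul_blockSum_apply p s _ (fun i k => entry p a ε i k (Complex.log ζ)) i k).trans ?_
  rw [blockCol_lower, cpow_eq_exp (Complex.slitPlane_ne_zero hζ)]
  rfl

lemma bareMatrixPM_eq {R h : ℝ} (hR : 0 < R) (hh : 0 < h)
    (hL : ∀ k l : ℕ, 1 ≤ k → k ≤ l → l ≤ p → -partialSum a k l < R) (ε : ℝ) (s : ℕ)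
    {ζ : ℂ} (hζ : ζ ∈ Complex.slitPlane) :
    bareMatrixPM p a R h ε ζ = sectorMatrix p a ε s (fun _ => 0) (Complex.log ζ) := by
  ext i k
  rw [bareMatrixPM_apply hR hh hL ε hζ i k]
  simp [sectorMatrix, sectorEntry]

lemma mem_slitPlane_of_arg {ζ : ℂ} (h0 : ζ.arg ≠ 0) (h : ζ.arg ≠ Real.pi) :
    ζ ∈ Complex.slitPlane :=
  Complex.mem_slitPlane_iff_arg.2 ⟨h, fun h' => h0 (by simp [h'])⟩

lemma im_pos_of_arg {ζ : ℂ} (h0 : 0 < ζ.arg) (h : ζ.arg < Real.pi) : 0 < ζ.im := by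
  rw [← Complex.norm_mul_sin_arg]
  have : ζ ≠ 0 := fun h' => by simp [h'] at h0
  exact mul_pos (norm_pos_iff.2 this) (Real.sin_pos_of_pos_of_lt_pi h0 h)

lemma bareParametrix_sector_right_up {R h : ℝ} (hR : 0 < R) (hh : 0 < h)
    (hL : ∀ k l : ℕ, 1 ≤ k → k ≤ l → l ≤ p → -partialSum a k l < R) {ζ : ℂ}
    (h0 : 0 < ζ.arg) (h1 : ζ.arg < Real.pi / 4) :
    bareParametrix p a R h ζ = sectorMatrix p a 1 1 (fun _ => -1) (Complex.log ζ) := by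
  have hpi := Real.pi_pos
  have hs := mem_slitPlane_of_arg (ζ := ζ) (by linarith) (by linarith)
  rw [bareParametrix, bareMatrix, if_pos (im_pos_of_arg h0 (by linarith)), sectorFactor,
    if_neg (fun h => by linarith [h.1]), if_pos ⟨h0, h1⟩, ← bareMatrixPM_mul_lower hR hh hL 1 1 _ hs]
  simp

lemma bareParametrix_sector_top {R h : ℝ} (hR : 0 < R) (hh : 0 < h)
    (hL : ∀ k l : ℕ, 1 ≤ k → k ≤ l → l ≤ p → -partialSum a k l < R) {ζ : ℂ}
    (h0 : Real.pi / 4 < ζ.arg) (h1 : ζ.arg < 3 * Real.pi / 4) (s : ℕ) :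
    bareParametrix p a R h ζ = sectorMatrix p a 1 s (fun _ => 0) (Complex.log ζ) := by
  have hpi := Real.pi_pos
  have hs := mem_slitPlane_of_arg (ζ := ζ) (by linarith) (by linarith)
  rw [bareParametrix, bareMatrix, if_pos (im_pos_of_arg (by linarith) (by linarith)), sectorFactor,
    if_neg (fun h => by linarith [h.1]), if_neg (fun h => by linarith [h.2]),
    if_neg (fun h => by linarith [h.2]), if_neg (fun h => by linarith [h.2]), mul_one,
    bareMatrixPM_eq hR hh hL 1 s hs]

lemma bareParametrix_sector_left_up {R h : ℝ} (hR : 0 < R) (hh : 0 < h)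
    (hL : ∀ k l : ℕ, 1 ≤ k → k ≤ l → l ≤ p → -partialSum a k l < R) {ζ : ℂ}
    (h0 : 3 * Real.pi / 4 < ζ.arg) (h1 : ζ.arg < Real.pi) :
    bareParametrix p a R h ζ = sectorMatrix p a 1 2
      (fun m => Complex.exp (Complex.I * Real.pi * a m)) (Complex.log ζ) := by
  have hpi := Real.pi_pos
  have hs := mem_slitPlane_of_arg (ζ := ζ) (by linarith) (by linarith)
  rw [bareParametrix, bareMatrix, if_pos (im_pos_of_arg (by linarith) (by linarith)), sectorFactor,
    if_pos ⟨h0, h1⟩, ← bareMatrixPM_mul_lower hR hh hL 1 2 _ hs]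
  simp only [mul_comm]

lemma bareParametrix_sector_right_down {R h : ℝ} (hR : 0 < R) (hh : 0 < h)
    (hL : ∀ k l : ℕ, 1 ≤ k → k ≤ l → l ≤ p → -partialSum a k l < R) {ζ : ℂ}
    (h0 : ζ.arg < 0) (h1 : -(Real.pi / 4) < ζ.arg) :
    bareParametrix p a R h ζ = sectorMatrix p a (-1) 1 (fun _ => 1) (Complex.log ζ) := by
  have hpi := Real.pi_pos
  have hs := mem_slitPlane_of_arg (ζ := ζ) (by linarith) (by linarith)
  rw [bareParametrix, bareMatrix, if_neg (not_lt.2 (Complex.arg_neg_iff.1 h0).le), sectorFactor,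
    if_neg (fun h => by linarith [h.1]), if_neg (fun h => by linarith [h.1]),
    if_neg (fun h => by linarith [h.2]), if_pos ⟨h1, h0⟩,
    ← bareMatrixPM_mul_lower hR hh hL (-1) 1 _ hs]
  simp

lemma bareParametrix_sector_bottom {R h : ℝ} (hR : 0 < R) (hh : 0 < h)
    (hL : ∀ k l : ℕ, 1 ≤ k → k ≤ l → l ≤ p → -partialSum a k l < R) {ζ : ℂ}
    (h0 : ζ.arg < -(Real.pi / 4)) (h1 : -(3 * Real.pi / 4) < ζ.arg)
    (s : ℕ) :
    bareParametrix p a R h ζ = sectorMatrix p a (-1) s (fun _ => 0) (Complex.log ζ) := by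
  have hpi := Real.pi_pos
  have hs := mem_slitPlane_of_arg (ζ := ζ) (by linarith) (by linarith)
  rw [bareParametrix, bareMatrix, if_neg (not_lt.2 (Complex.arg_neg_iff.1 (by linarith)).le),
    sectorFactor,
    if_neg (fun h => by linarith [h.1]), if_neg (fun h => by linarith [h.1]),
    if_neg (fun h => by linarith [h.2]), if_neg (fun h => by linarith [h.1]), mul_one,
    bareMatrixPM_eq hR hh hL (-1) s hs]

lemma bareParametrix_sector_left_down {R h : ℝ} (hR : 0 < R) (hh : 0 < h)
    (hL : ∀ k l : ℕ, 1 ≤ k → k ≤ l → l ≤ p → -partialSum a k l < R) {ζ : ℂ}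
    (h0 : ζ.arg < -(3 * Real.pi / 4)) (h1 : -Real.pi < ζ.arg) :
    bareParametrix p a R h ζ = sectorMatrix p a (-1) 2
      (fun m => -Complex.exp (-(Complex.I * Real.pi * a m))) (Complex.log ζ) := by
  have hpi := Real.pi_pos
  have hs := mem_slitPlane_of_arg (ζ := ζ) (by linarith) (by linarith)
  rw [bareParametrix, bareMatrix, if_neg (not_lt.2 (Complex.arg_neg_iff.1 (by linarith)).le),
    sectorFactor,
    if_neg (fun h => by linarith [h.1]), if_neg (fun h => by linarith [h.1]),
    if_pos ⟨h1, h0⟩, ← bareMatrixPM_mul_lower hR hh hL (-1) 2 _ hs]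
  congr! 5
  ring_nf


/-! ### Analyticity -/

lemma eq_mul_rayDir {ζ : ℂ} (l : Fin 6) (h : ζ.arg = rayAngle l) : ζ = ‖ζ‖ * rayDir l := by
  rw [rayDir, ← h, Complex.norm_mul_exp_arg_mul_I]

lemma arg_ne_of_notMem {ζ : ℂ} (hζ : ζ ∉ jumpContour) (l : Fin 6) : ζ.arg ≠ rayAngle l :=
  fun h => hζ ⟨l, ‖ζ‖, norm_nonneg _, eq_mul_rayDir l h⟩

/-- Off the rays, the argument lies in one of the six open sectors. -/
lemma sector_cases {ζ : ℂ} (hζ : ζ ∉ jumpContour) :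
    (0 < ζ.arg ∧ ζ.arg < Real.pi / 4) ∨ (Real.pi / 4 < ζ.arg ∧ ζ.arg < 3 * Real.pi / 4) ∨
    (3 * Real.pi / 4 < ζ.arg ∧ ζ.arg < Real.pi) ∨ (-(Real.pi / 4) < ζ.arg ∧ ζ.arg < 0) ∨
    (-(3 * Real.pi / 4) < ζ.arg ∧ ζ.arg < -(Real.pi / 4)) ∨
    (-Real.pi < ζ.arg ∧ ζ.arg < -(3 * Real.pi / 4)) := by
  have h0 : ζ.arg ≠ 0 := arg_ne_of_notMem hζ 0
  have h1 : ζ.arg ≠ Real.pi / 4 := arg_ne_of_notMem hζ 1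
  have h2 : ζ.arg ≠ -(Real.pi / 4) := arg_ne_of_notMem hζ 2
  have h3 : ζ.arg ≠ 3 * Real.pi / 4 := arg_ne_of_notMem hζ 3
  have h4 : ζ.arg ≠ -(3 * Real.pi / 4) := arg_ne_of_notMem hζ 4
  have h5 : ζ.arg ≠ Real.pi := arg_ne_of_notMem hζ 5
  have h6 := Complex.neg_pi_lt_arg ζ
  have h7 := (Complex.arg_le_pi ζ).lt_of_ne h5
  rcases lt_or_gt_of_ne h0 with h0 | h0 <;> rcases lt_or_gt_of_ne h1 with h1 | h1 <;>
    rcases lt_or_gt_of_ne h2 with h2 | h2 <;> rcases lt_or_gt_of_ne h3 with h3 | h3 <;>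
    rcases lt_or_gt_of_ne h4 with h4 | h4 <;> tauto

lemma differentiableAt_of_sector {G : ℂ → Matrix (Fin (p + 1)) (Fin (p + 1)) ℂ} {α β ε : ℝ} {s : ℕ}
    {c : ℕ → ℂ} (hG : ∀ z : ℂ, α < z.arg → z.arg < β → G z = sectorMatrix p a ε s c (Complex.log z))
    {ζ : ℂ} (hζ : ζ ∈ Complex.slitPlane) (h1 : α < ζ.arg) (h2 : ζ.arg < β) (i k : Fin (p + 1)) :
    DifferentiableAt ℂ (fun z => G z i k) ζ := by
  have hc := Complex.continuousAt_arg hζ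
  have heq : (fun z => G z i k) =ᶠ[𝓝 ζ] fun z => sectorEntry p a ε s c i k (Complex.log z) := by
    filter_upwards [hc.eventually (lt_mem_nhds h1), hc.eventually (gt_mem_nhds h2)] with z h3 h4
    rw [hG z h3 h4]
    rfl
  refine DifferentiableAt.congr_of_eventuallyEq ?_ heq
  exact DifferentiableAt.comp ζ (sectorEntry_differentiable (by omega) ε s c i _)
    (Complex.differentiableAt_log hζ)

lemma bareParametrix_differentiableOn {R h : ℝ} (hR : 0 < R) (hh : 0 < h)
    (hL : ∀ k l : ℕ, 1 ≤ k → k ≤ l → l ≤ p → -partialSum a k l < R) (i k : Fin (p + 1)) :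
    DifferentiableOn ℂ (fun ζ => bareParametrix p a R h ζ i k) jumpContourᶜ := by
  intro ζ hζ
  refine DifferentiableAt.differentiableWithinAt ?_
  have hs := mem_slitPlane_of_arg (arg_ne_of_notMem hζ 0) (arg_ne_of_notMem hζ 5)
  rcases sector_cases hζ with ⟨h1, h2⟩ | ⟨h1, h2⟩ | ⟨h1, h2⟩ | ⟨h1, h2⟩ | ⟨h1, h2⟩ | ⟨h1, h2⟩
  · exact differentiableAt_of_sector (fun z h3 h4 => bareParametrix_sector_right_up hR hh hL h3 h4)
      hs h1 h2 i k
  · exact differentiableAt_of_sector (fun z h3 h4 => bareParametrix_sector_top hR hh hL h3 h4 1)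
      hs h1 h2 i k
  · exact differentiableAt_of_sector (fun z h3 h4 => bareParametrix_sector_left_up hR hh hL h3 h4)
      hs h1 h2 i k
  · exact differentiableAt_of_sector (fun z h3 h4 => bareParametrix_sector_right_down hR hh hL h4 h3)
      hs h1 h2 i k
  · exact differentiableAt_of_sector (fun z h3 h4 => bareParametrix_sector_bottom hR hh hL h4 h3 1)
      hs h1 h2 i k
  · exact differentiableAt_of_sector (fun z h3 h4 => bareParametrix_sector_left_down hR hh hL h4 h3)
      hs h1 h2 i k

/-! ### Jumps -/

/-- Lower triangular factors on the same index pairs form an additive group. All four jumps on the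
oblique rays are instances of this. -/
lemma sectorMatrix_mul_lower (ε : ℝ) (s : ℕ) (_hs : s = 1 ∨ s = 2) (c d : ℕ → ℂ) (w : ℂ) :
    sectorMatrix p a ε s c w * blockSum p s
      (fun m => !![1, 0; d m * Complex.exp (-(a m * w)), 1]) =
      sectorMatrix p a ε s (fun m => c m + d m) w := by
  ext i k
  rw [sectorMatrix, mul_blockSum_apply p s _ (fun i k => sectorEntry p a ε s c i k w),
    blockCol_lower, sectorMatrix, Matrix.of_apply, sectorEntry, sectorEntry]
  by_cases h1 : IsBlockStart p s ((k : ℕ) + 1)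
  · have h2 : ¬ IsBlockStart p s ((k : ℕ) + 1 + 1) := by
      unfold IsBlockStart at h1 ⊢; omega
    simp only [if_pos h1, sectorEntry, if_neg h2]
    ring
  · simp only [if_neg h1, add_zero, sectorEntry]

/-- Rotation by the angle `-θ` makes the two sides of a ray visible in the argument. -/
lemma im_mul_conj (z : ℂ) (θ : ℝ) : (z * starRingEnd ℂ (Complex.exp (θ * Complex.I))).im =
    ‖z‖ * Real.sin (z.arg - θ) := by
  rw [← Complex.exp_conj]
  conv_lhs => rw [← Complex.norm_mul_exp_arg_mul_I z]
  rw [mul_assoc, ← Complex.exp_add, Complex.im_ofReal_mul]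
  have : (z.arg * Complex.I + starRingEnd ℂ (θ * Complex.I) : ℂ) =
      ((z.arg - θ : ℝ) : ℂ) * Complex.I := by
    simp; ring
  rw [this, Complex.exp_ofReal_mul_I_im]

/-- For |θ| < π the logarithm is continuous across the ray, so a jump is an identity between
continuous functions of w at w = log t + iθ. -/
lemma hasJump_of_sectors {G : ℂ → Matrix (Fin (p + 1)) (Fin (p + 1)) ℂ} {θ η : ℝ} (hη : 0 < η)
    (hθ : |θ| < Real.pi) {Mp Mm : ℂ → Matrix (Fin (p + 1)) (Fin (p + 1)) ℂ}
    (hMp : Continuous Mp) (hMm : Continuous Mm)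
    (hp : ∀ z : ℂ, θ < z.arg → z.arg < θ + η → G z = Mp (Complex.log z))
    (hm : ∀ z : ℂ, z.arg < θ → θ - η < z.arg → G z = Mm (Complex.log z))
    {J : ℂ → Matrix (Fin (p + 1)) (Fin (p + 1)) ℂ}
    (hJ : ∀ t : ℝ, 0 < t → Mp (Real.log t + θ * Complex.I) = Mm (Real.log t + θ * Complex.I) *
      J (t * Complex.exp (θ * Complex.I))) : HasJump G (Complex.exp (θ * Complex.I)) J := by
  intro t ht
  obtain ⟨hθ1, hθ2⟩ := abs_lt.1 hθ
  set z₀ : ℂ := t * Complex.exp (θ * Complex.I) with hz₀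
  have hlog : Complex.log z₀ = Real.log t + θ * Complex.I := by
    rw [hz₀, Complex.log_ofReal_mul ht (Complex.exp_ne_zero _), Complex.log_exp (by simpa using hθ1)
      (by simpa using hθ2.le)]
  have harg : z₀.arg = θ := by rw [← Complex.log_im, hlog]; simp
  have hs : z₀ ∈ Complex.slitPlane := Complex.mem_slitPlane_iff_arg.2
    ⟨by rw [harg]; exact hθ2.ne, mul_ne_zero (by exact_mod_cast ht.ne') (Complex.exp_ne_zero _)⟩
  have hnear : ∀ᶠ z in 𝓝 z₀, |z.arg - θ| < min η Real.pi := by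
    have hc : ContinuousAt (fun z : ℂ => |z.arg - θ|) z₀ :=
      ((Complex.continuousAt_arg hs).sub continuousAt_const).abs
    refine hc.eventually (gt_mem_nhds ?_)
    simp [harg, hη, Real.pi_pos]
  have hlim : ∀ {M : ℂ → Matrix (Fin (p + 1)) (Fin (p + 1)) ℂ}, Continuous M → ∀ S : Set ℂ,
      Tendsto (fun z => M (Complex.log z)) (𝓝[S] z₀) (𝓝 (M (Complex.log z₀))) := fun hM S =>
    (hM.tendsto _).comp ((continuousAt_clog hs).tendsto.mono_left nhdsWithin_le_nhds)
  refine ⟨Mp (Complex.log z₀), Mm (Complex.log z₀), (hlim hMp _).congr' ?_, (hlim hMm _).congr' ?_,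
    by rw [hlog]; exact hJ t ht⟩
  · filter_upwards [self_mem_nhdsWithin, nhdsWithin_le_nhds hnear] with z hz1 hz2
    change 0 < _ at hz1
    rw [im_mul_conj] at hz1
    obtain ⟨h3, h4⟩ := abs_lt.1 hz2
    have hsin : 0 < Real.sin (z.arg - θ) := pos_of_mul_pos_right hz1 (norm_nonneg _)
    have hpos : 0 < z.arg - θ := by
      by_contra hcon
      have := Real.sin_nonpos_of_nonpos_of_neg_pi_le (not_lt.1 hcon)
        (by linarith [min_le_right η Real.pi])
      linarith
    exact (hp z (by linarith) (by linarith [min_le_left η Real.pi])).symm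
  · filter_upwards [self_mem_nhdsWithin, nhdsWithin_le_nhds hnear] with z hz1 hz2
    change _ < (0 : ℝ) at hz1
    rw [im_mul_conj] at hz1
    obtain ⟨h3, h4⟩ := abs_lt.1 hz2
    have hneg : z.arg - θ < 0 := by
      by_contra hcon
      have := Real.sin_nonneg_of_nonneg_of_le_pi (not_lt.1 hcon)
        (by linarith [min_le_right η Real.pi])
      linarith [mul_nonneg (norm_nonneg z) this]
    exact (hm z (by linarith) (by linarith [min_le_left η Real.pi])).symm

lemma entry_even_indep {k : ℕ} (h2 : k % 2 = 0) (ε ε' : ℝ) (i : ℕ) (w : ℂ) :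
    entry p a ε i k w = entry p a ε' i k w := by
  simp only [entry, h2]
  simp

/-- Within a block both columns are rearrangements of `entry_even`: the even column corrected from
above is -e^{-aw} times the lower branch of the next one, and the even column corrected from below
is e^{-aw} times its upper branch. -/
lemma sectorMatrix_jump_right (w : ℂ) : sectorMatrix p a 1 1 (fun _ => -1) w =
    sectorMatrix p a (-1) 1 (fun _ => 1) w * blockSum p 1
      (fun m => !![0, Complex.exp (a m * w); -Complex.exp (-(a m * w)), 0]) := by
  ext i k
  refine Eq.trans ?_ (mul_blockSum_apply p 1 _
    (fun i k => sectorEntry p a (-1) 1 (fun _ => 1) i k w) i k).symm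
  obtain ⟨k, hk⟩ := k
  change sectorEntry p a 1 1 (fun _ => -1) i k w = _
  unfold blockCol
  by_cases h1 : IsBlockStart p 1 (k + 1)
  · have h2 : ¬ IsBlockStart p 1 (k + 1 + 1) := by unfold IsBlockStart at h1 ⊢; omega
    have h3 := h1
    unfold IsBlockStart at h3
    have he := entry_even (p := p) (a := a) (by omega : k < p) (by omega) 1 i w
    simp only [sectorEntry, if_pos h1, if_neg h2, he]
    simp
    ring
  · by_cases h2 : IsBlockStart p 1 k
    · have h3 := h2
      unfold IsBlockStart at h3
      obtain ⟨k, rfl⟩ : ∃ k', k = k' + 1 := ⟨k - 1, by omega⟩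
      have he := entry_even (p := p) (a := a) (by omega : k < p) (by omega) (-1) i w
      simp only [sectorEntry, if_pos h2, if_neg h1, Nat.add_sub_cancel, he, Complex.exp_neg]
      have := Complex.exp_ne_zero (a (k + 1) * w)
      simp
      field_simp
      ring
    · simp only [sectorEntry, if_neg h1, if_neg h2]
      rw [entry_even_indep (by unfold IsBlockStart at h1 h2; omega)]

/-- The three term relation for j = 0, where the left side vanishes and b_0 = 0: the first column is
2πi-periodic in w, so it has no jump on the negative axis. -/
lemma entry_zero_left (i : ℕ) (ε ε' : ℝ) (w : ℂ) :
    entry p a ε i 0 (w - Real.pi * Complex.I) = entry p a ε' i 0 (w + Real.pi * Complex.I) := by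
  have hs := meijer_step (N := p + 1) (b := shiftParam a) (j := 0) (by omega) i w
  rw [meijer_zero (by omega), shiftParam_zero] at hs
  have hpi : (2 * Real.pi * Complex.I : ℂ) ≠ 0 := by
    simp [Real.pi_ne_zero, Complex.I_ne_zero]
  rw [eq_comm, div_eq_zero_iff, or_iff_left hpi] at hs
  simp only [Complex.ofReal_zero, mul_zero, neg_zero, Complex.exp_zero, one_mul, zero_add] at hs
  simp only [entry, shiftParam_zero]
  simp only [Complex.ofReal_zero, zero_mul, neg_zero, Complex.exp_zero, mul_one, Nat.zero_mod,
    Nat.cast_zero, mul_zero, sub_zero, zero_add]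
  rw [sub_eq_zero.1 hs]

/-- The blocks now begin at odd zero-based columns and follow from `entry_odd`. Outside the blocks
are the first column, which is single-valued, and possibly a last odd column, whose own translation
compensates the change of log ζ. -/
lemma sectorMatrix_jump_left (w : ℂ) :
    sectorMatrix p a (-1) 2 (fun m => -Complex.exp (-(Complex.I * Real.pi * a m)))
      (w - Real.pi * Complex.I) =
    sectorMatrix p a 1 2 (fun m => Complex.exp (Complex.I * Real.pi * a m))
      (w + Real.pi * Complex.I) * blockSum p 2
      (fun m => !![0, Complex.exp (a m * w); -Complex.exp (-(a m * w)), 0]) := by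
  ext i k
  refine Eq.trans ?_ (mul_blockSum_apply p 2 _ (fun i k => sectorEntry p a 1 2
    (fun m => Complex.exp (Complex.I * Real.pi * a m)) i k (w + Real.pi * Complex.I)) i k).symm
  obtain ⟨k, hk⟩ := k
  change sectorEntry p a (-1) 2 (fun m => -Complex.exp (-(Complex.I * Real.pi * a m))) i k
    (w - Real.pi * Complex.I) = _
  have e1 : ∀ m, Complex.exp (-(Complex.I * Real.pi * a m)) *
      Complex.exp (-(a m * (w - Real.pi * Complex.I))) = Complex.exp (-(a m * w)) := fun m => by
    rw [← Complex.exp_add]; ring_nf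
  have e2 : ∀ m, Complex.exp (Complex.I * Real.pi * a m) *
      Complex.exp (-(a m * (w + Real.pi * Complex.I))) = Complex.exp (-(a m * w)) := fun m => by
    rw [← Complex.exp_add]; ring_nf
  unfold blockCol
  by_cases h1 : IsBlockStart p 2 (k + 1)
  · have h2 : ¬ IsBlockStart p 2 (k + 1 + 1) := by unfold IsBlockStart at h1 ⊢; omega
    have h3 := h1
    unfold IsBlockStart at h3
    have he := entry_odd (p := p) (a := a) (by omega : k < p) (by omega) 1 i w
    have he' := entry_odd_top (p := p) (a := a) (by omega : k % 2 = 1) i w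
    simp only [sectorEntry, if_pos h1, if_neg h2]
    rw [neg_mul, e1, ← he', he, entry_even_indep (by omega : (k + 1) % 2 = 0) (-1) 1]
    simp
    ring
  · by_cases h2 : IsBlockStart p 2 k
    · have h3 := h2
      unfold IsBlockStart at h3
      obtain ⟨k, rfl⟩ : ∃ k', k = k' + 1 := ⟨k - 1, by omega⟩
      have he := entry_odd (p := p) (a := a) (by omega : k < p) (by omega) 1 i w
      simp only [sectorEntry, if_pos h2, if_neg h1, Nat.add_sub_cancel, e2, he]
      rw [entry_even_indep (by omega : (k + 1) % 2 = 0) (-1) 1, Complex.exp_neg]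
      have := Complex.exp_ne_zero (a (k + 1) * w)
      simp
      field_simp
      ring
    · simp only [sectorEntry, if_neg h1, if_neg h2, add_zero]
      rcases Nat.eq_zero_or_pos k with rfl | hk0
      · exact entry_zero_left i _ _ w
      · exact (entry_odd_top (by unfold IsBlockStart at h1 h2; omega) i w).symm

lemma log_ray {t : ℝ} (ht : 0 < t) {θ : ℝ} (h1 : -Real.pi < θ) (h2 : θ ≤ Real.pi) :
    Complex.log (t * Complex.exp (θ * Complex.I)) = Real.log t + θ * Complex.I := by
  rw [Complex.log_ofReal_mul ht (Complex.exp_ne_zero _), Complex.log_exp (by simpa using h1)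
      (by simpa using h2)]

lemma cpow_ray {t : ℝ} (ht : 0 < t) {θ : ℝ} (h1 : -Real.pi < θ) (h2 : θ ≤ Real.pi) (x : ℂ) :
    (t * Complex.exp (θ * Complex.I)) ^ x = Complex.exp (x * (Real.log t + θ * Complex.I)) := by
  rw [Complex.cpow_def_of_ne_zero (mul_ne_zero (by exact_mod_cast ht.ne') (Complex.exp_ne_zero _)),
    log_ray ht h1 h2, mul_comm]

lemma arg_near_negative {t : ℝ} (ht : 0 < t) :
    ∀ᶠ z : ℂ in 𝓝 (-(t : ℂ)), 3 * Real.pi / 4 < |z.arg| := by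
  have hpi := Real.pi_pos
  have hc : Tendsto (fun z : ℂ => (-z).arg) (𝓝 (-(t : ℂ))) (𝓝 0) := by
    have h1 : Tendsto (fun z : ℂ => -z) (𝓝 (-(t : ℂ))) (𝓝 (t : ℂ)) := by
      simpa using (continuous_neg (G := ℂ)).tendsto (-(t : ℂ))
    have h2 := Complex.continuousAt_arg (x := (t : ℂ)) (Complex.ofReal_mem_slitPlane.2 ht)
    have h3 := h2.tendsto.comp h1
    rwa [Complex.arg_ofReal_of_nonneg ht.le] at h3
  have h1 := hc.eventually (Ioo_mem_nhds (a := -(Real.pi / 4)) (b := Real.pi / 4)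
    (by linarith) (by linarith))
  have h2 : ∀ᶠ z : ℂ in 𝓝 (-(t : ℂ)), z.re < 0 :=
    Complex.continuous_re.continuousAt.eventually (gt_mem_nhds (by simpa using ht))
  filter_upwards [h1, h2] with z h3 h4
  rcases le_or_gt 0 z.im with him | him
  · have h5 : (-z).arg = z.arg - Real.pi := by
      rcases him.eq_or_lt with him | him
      · rw [Complex.arg_neg_eq_arg_sub_pi_iff]
        exact Or.inr ⟨him.symm, h4⟩
      · exact Complex.arg_neg_eq_arg_sub_pi_of_im_pos him
    rw [h5] at h3
    exact lt_of_lt_of_le (by linarith [h3.1]) (le_abs_self _)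
  · rw [Complex.arg_neg_eq_arg_add_pi_of_im_neg him] at h3
    exact lt_of_lt_of_le (by linarith [h3.2]) (neg_le_abs _)

lemma bareParametrix_tendsto_left_down {R h : ℝ} (hR : 0 < R) (hh : 0 < h)
    (hL : ∀ k l : ℕ, 1 ≤ k → k ≤ l → l ≤ p → -partialSum a k l < R) {t : ℝ} (ht : 0 < t) :
    Tendsto (bareParametrix p a R h) (𝓝[{z | z.im < 0}] (-(t : ℂ)))
      (𝓝 (sectorMatrix p a (-1) 2 (fun m => -Complex.exp (-(Complex.I * Real.pi * a m)))
        (Real.log t - Real.pi * Complex.I))) := by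
  have hlog := Complex.tendsto_log_nhdsWithin_im_neg_of_re_neg_of_im_zero (z := -(t : ℂ))
    (by simpa using ht) (by simp)
  rw [norm_neg, Complex.norm_of_nonneg ht.le] at hlog
  have hcont := (sectorMatrix_continuous (p := p) (a := a) (-1) 2
    (fun m => -Complex.exp (-(Complex.I * Real.pi * a m)))).tendsto
      (Real.log t - Real.pi * Complex.I)
  refine (hcont.comp hlog).congr' ?_
  filter_upwards [self_mem_nhdsWithin, nhdsWithin_le_nhds (arg_near_negative ht)] with z h1 h2
  have h3 := Complex.arg_neg_iff.2 h1
  rw [abs_of_neg h3] at h2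
  exact (bareParametrix_sector_left_down hR hh hL (by linarith) (Complex.neg_pi_lt_arg z)).symm

lemma bareParametrix_tendsto_left_up {R h : ℝ} (hR : 0 < R) (hh : 0 < h)
    (hL : ∀ k l : ℕ, 1 ≤ k → k ≤ l → l ≤ p → -partialSum a k l < R) {t : ℝ} (ht : 0 < t) :
    Tendsto (bareParametrix p a R h) (𝓝[{z | 0 < z.im}] (-(t : ℂ)))
      (𝓝 (sectorMatrix p a 1 2 (fun m => Complex.exp (Complex.I * Real.pi * a m))
        (Real.log t + Real.pi * Complex.I))) := by
  have hlog := Complex.tendsto_log_nhdsWithin_im_nonneg_of_re_neg_of_im_zero (z := -(t : ℂ))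
    (by simpa using ht) (by simp)
  rw [norm_neg, Complex.norm_of_nonneg ht.le] at hlog
  have hlog' := hlog.mono_left
    (nhdsWithin_mono (-(t : ℂ)) fun (z : ℂ) (hz : 0 < z.im) => (le_of_lt hz : 0 ≤ z.im))
  have hcont := (sectorMatrix_continuous (p := p) (a := a) 1 2
    (fun m => Complex.exp (Complex.I * Real.pi * a m))).tendsto
      (Real.log t + Real.pi * Complex.I)
  refine (hcont.comp hlog').congr' ?_
  filter_upwards [self_mem_nhdsWithin, nhdsWithin_le_nhds (arg_near_negative ht)] with z h1 h2
  have h3 : 0 ≤ z.arg := Complex.arg_nonneg_iff.2 (le_of_lt h1)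
  rw [abs_of_nonneg h3] at h2
  have h4 : z.arg ≠ Real.pi := fun h => by
    rw [Complex.arg_eq_pi_iff] at h
    have h5 : 0 < z.im := h1
    linarith [h.2]
  exact (bareParametrix_sector_left_up hR hh hL h2 ((Complex.arg_le_pi z).lt_of_ne h4)).symm

lemma jumpMatrix_zero (ζ : ℂ) : jumpMatrix p a 0 ζ =
    blockSum p 1 fun m => !![0, ζ ^ (a m : ℂ); -ζ ^ (-(a m : ℂ)), 0] := by
  rfl

lemma jumpMatrix_one (ζ : ℂ) : jumpMatrix p a 1 ζ =
    blockSum p 1 fun m => !![1, 0; ζ ^ (-(a m : ℂ)), 1] := by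
  rfl

lemma jumpMatrix_two (ζ : ℂ) : jumpMatrix p a 2 ζ =
    blockSum p 1 fun m => !![1, 0; ζ ^ (-(a m : ℂ)), 1] := by
  rfl

lemma jumpMatrix_three (ζ : ℂ) : jumpMatrix p a 3 ζ =
    blockSum p 2 fun m =>
      !![1, 0; ζ ^ (-(a m : ℂ)) * Complex.exp (Complex.I * Real.pi * a m), 1] := by
  rfl

lemma jumpMatrix_four (ζ : ℂ) : jumpMatrix p a 4 ζ =
    blockSum p 2 fun m =>
      !![1, 0; ζ ^ (-(a m : ℂ)) * Complex.exp (-(Complex.I * Real.pi * a m)), 1] := by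
  rfl

lemma jumpMatrix_five (ζ : ℂ) : jumpMatrix p a 5 ζ =
    blockSum p 2 fun m => !![0, (-ζ) ^ (a m : ℂ); -(-ζ) ^ (-(a m : ℂ)), 0] := by
  rfl

lemma hasJump_five {R h : ℝ} (hR : 0 < R) (hh : 0 < h)
    (hL : ∀ k l : ℕ, 1 ≤ k → k ≤ l → l ≤ p → -partialSum a k l < R) :
    HasJump (bareParametrix p a R h) (rayDir 5) (jumpMatrix p a 5) := by
  have hdir : rayDir 5 = -1 := Complex.exp_pi_mul_I
  intro t ht
  -- The ray points to -∞, so its left side is the lower half plane.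
  have hset1 : {z : ℂ | 0 < (z * (starRingEnd ℂ) (-1)).im} = {z : ℂ | z.im < 0} := by
    ext z; simp
  have hset2 : {z : ℂ | (z * (starRingEnd ℂ) (-1)).im < 0} = {z : ℂ | 0 < z.im} := by
    ext z; simp
  rw [hdir, hset1, hset2, mul_neg_one]
  refine ⟨_, _, bareParametrix_tendsto_left_down hR hh hL ht,
    bareParametrix_tendsto_left_up hR hh hL ht, ?_⟩
  rw [sectorMatrix_jump_left, jumpMatrix_five, neg_neg]
  have ht0 : (t : ℂ) ≠ 0 := by exact_mod_cast ht.ne'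
  congr 2
  ext1 m
  rw [Complex.cpow_def_of_ne_zero ht0, Complex.cpow_def_of_ne_zero ht0, ← Complex.ofReal_log ht.le,
    mul_neg, mul_comm]

lemma hasJump_zero {R h : ℝ} (hR : 0 < R) (hh : 0 < h)
    (hL : ∀ k l : ℕ, 1 ≤ k → k ≤ l → l ≤ p → -partialSum a k l < R) :
    HasJump (bareParametrix p a R h) (rayDir 0) (jumpMatrix p a 0) := by
  have hpi := Real.pi_pos
  change HasJump _ (Complex.exp ((0 : ℝ) * Complex.I)) _
  refine hasJump_of_sectors (θ := 0) (η := Real.pi / 4) (by linarith) (by simpa using hpi)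
    (sectorMatrix_continuous 1 1 fun _ => -1) (sectorMatrix_continuous (-1) 1 fun _ => 1)
    (fun z h1 h2 => bareParametrix_sector_right_up hR hh hL h1 (by linarith))
    (fun z h1 h2 => bareParametrix_sector_right_down hR hh hL h1 (by linarith))
    fun t ht => ?_
  rw [sectorMatrix_jump_right]
  congr 1
  rw [jumpMatrix_zero]
  simp only [cpow_ray ht (by linarith : -Real.pi < 0) hpi.le, neg_mul]

lemma hasJump_one {R h : ℝ} (hR : 0 < R) (hh : 0 < h)
    (hL : ∀ k l : ℕ, 1 ≤ k → k ≤ l → l ≤ p → -partialSum a k l < R) :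
    HasJump (bareParametrix p a R h) (rayDir 1) (jumpMatrix p a 1) := by
  have hpi := Real.pi_pos
  change HasJump _ (Complex.exp ((Real.pi / 4 : ℝ) * Complex.I)) _
  refine hasJump_of_sectors (θ := Real.pi / 4) (η := Real.pi / 4) (by linarith)
    (by rw [abs_of_pos] <;> linarith)
    (sectorMatrix_continuous 1 1 fun _ => 0) (sectorMatrix_continuous 1 1 fun _ => -1)
    (fun z h1 h2 => bareParametrix_sector_top hR hh hL h1 (by linarith) 1)
    (fun z h1 h2 => bareParametrix_sector_right_up hR hh hL (by linarith) h1)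
    fun t ht => ?_
  rw [jumpMatrix_one]
  simp only [cpow_ray ht (by linarith : -Real.pi < Real.pi / 4) (by linarith), neg_mul]
  have := sectorMatrix_mul_lower (p := p) (a := a) 1 1 (Or.inl rfl) (fun _ => -1) (fun _ => 1)
    (Real.log t + (Real.pi / 4 : ℝ) * Complex.I)
  simp only [one_mul, neg_add_cancel] at this
  exact this.symm

lemma hasJump_two {R h : ℝ} (hR : 0 < R) (hh : 0 < h)
    (hL : ∀ k l : ℕ, 1 ≤ k → k ≤ l → l ≤ p → -partialSum a k l < R) :
    HasJump (bareParametrix p a R h) (rayDir 2) (jumpMatrix p a 2) := by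
  have hpi := Real.pi_pos
  change HasJump _ (Complex.exp ((-(Real.pi / 4) : ℝ) * Complex.I)) _
  refine hasJump_of_sectors (θ := -(Real.pi / 4)) (η := Real.pi / 4) (by linarith)
    (by rw [abs_neg, abs_of_pos] <;> linarith)
    (sectorMatrix_continuous (-1) 1 fun _ => 1) (sectorMatrix_continuous (-1) 1 fun _ => 0)
    (fun z h1 h2 => bareParametrix_sector_right_down hR hh hL (by linarith) h1)
    (fun z h1 h2 => bareParametrix_sector_bottom hR hh hL h1 (by linarith) 1)
    fun t ht => ?_
  rw [jumpMatrix_two]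
  simp only [cpow_ray ht (by linarith : -Real.pi < -(Real.pi / 4)) (by linarith), neg_mul]
  have := sectorMatrix_mul_lower (p := p) (a := a) (-1) 1 (Or.inl rfl) (fun _ => 0) (fun _ => 1)
    (Real.log t + (-(Real.pi / 4) : ℝ) * Complex.I)
  simp only [one_mul, zero_add] at this
  exact this.symm

lemma hasJump_three {R h : ℝ} (hR : 0 < R) (hh : 0 < h)
    (hL : ∀ k l : ℕ, 1 ≤ k → k ≤ l → l ≤ p → -partialSum a k l < R) :
    HasJump (bareParametrix p a R h) (rayDir 3) (jumpMatrix p a 3) := by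
  have hpi := Real.pi_pos
  change HasJump _ (Complex.exp ((3 * Real.pi / 4 : ℝ) * Complex.I)) _
  refine hasJump_of_sectors (θ := 3 * Real.pi / 4) (η := Real.pi / 4) (by linarith)
    (by rw [abs_of_pos] <;> linarith)
    (sectorMatrix_continuous 1 2 fun m => Complex.exp (Complex.I * Real.pi * a m))
    (sectorMatrix_continuous 1 2 fun _ => 0)
    (fun z h1 h2 => bareParametrix_sector_left_up hR hh hL h1 (by linarith))
    (fun z h1 h2 => bareParametrix_sector_top hR hh hL (by linarith) h1 2)
    fun t ht => ?_
  rw [jumpMatrix_three]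
  simp only [cpow_ray ht (by linarith : -Real.pi < 3 * Real.pi / 4) (by linarith), neg_mul]
  have := sectorMatrix_mul_lower (p := p) (a := a) 1 2 (Or.inr rfl) (fun _ => 0)
    (fun m => Complex.exp (Complex.I * Real.pi * a m))
    (Real.log t + (3 * Real.pi / 4 : ℝ) * Complex.I)
  simp only [zero_add] at this
  rw [← this]
  simp only [mul_comm]

lemma hasJump_four {R h : ℝ} (hR : 0 < R) (hh : 0 < h)
    (hL : ∀ k l : ℕ, 1 ≤ k → k ≤ l → l ≤ p → -partialSum a k l < R) :
    HasJump (bareParametrix p a R h) (rayDir 4) (jumpMatrix p a 4) := by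
  have hpi := Real.pi_pos
  change HasJump _ (Complex.exp ((-(3 * Real.pi / 4) : ℝ) * Complex.I)) _
  refine hasJump_of_sectors (θ := -(3 * Real.pi / 4)) (η := Real.pi / 4) (by linarith)
    (by rw [abs_neg, abs_of_pos] <;> linarith)
    (sectorMatrix_continuous (-1) 2 fun _ => 0)
    (sectorMatrix_continuous (-1) 2 fun m => -Complex.exp (-(Complex.I * Real.pi * a m)))
    (fun z h1 h2 => bareParametrix_sector_bottom hR hh hL (by linarith) h1 2)
    (fun z h1 h2 => bareParametrix_sector_left_down hR hh hL h1 (by linarith))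
    fun t ht => ?_
  rw [jumpMatrix_four]
  simp only [cpow_ray ht (by linarith : -Real.pi < -(3 * Real.pi / 4)) (by linarith), neg_mul]
  have := sectorMatrix_mul_lower (p := p) (a := a) (-1) 2 (Or.inr rfl)
    (fun m => -Complex.exp (-(Complex.I * Real.pi * a m)))
    (fun m => Complex.exp (-(Complex.I * Real.pi * a m)))
    (Real.log t + (-(3 * Real.pi / 4) : ℝ) * Complex.I)
  simp only [neg_add_cancel] at this
  rw [← this]
  simp only [mul_comm]

/-- The jump relations. -/
theorem bareParametrix_hasJump {R h : ℝ} (hR : 0 < R) (hh : 0 < h)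
    (hL : ∀ k l : ℕ, 1 ≤ k → k ≤ l → l ≤ p → -partialSum a k l < R) :
    ∀ l : Fin 6, HasJump (bareParametrix p a R h) (rayDir l) (jumpMatrix p a l)
  | 0 => hasJump_zero hR hh hL
  | 1 => hasJump_one hR hh hL
  | 2 => hasJump_two hR hh hL
  | 3 => hasJump_three hR hh hL
  | 4 => hasJump_four hR hh hL
  | 5 => hasJump_five hR hh hL

end CauchyChain
end

noncomputable section
namespace CauchyChain

variable {p : ℕ} {a : ℕ → ℝ}

/-! ### The coefficients of the expansion at infinity -/

/-- In the upper half plane the column `k` is governed by the leading term at `w + n π i`, where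
`n = dominantIndex p k`. -/
def dominantIndex (p k : ℕ) : ℤ := if k % 2 = 0 then (p : ℤ) - k else (k : ℤ) - 1 - p

/-- The normalization of the column `k`. -/
def columnPhase (p : ℕ) (b : ℕ → ℝ) (k : ℕ) : ℂ :=
  if k % 2 = 0 then (-1) ^ (p - k) *
    Complex.exp (-(Complex.I * Real.pi * (∑ l ∈ Finset.Ico (k + 1) (p + 1), b l : ℝ)))
  else Complex.exp (Complex.I * Real.pi * (∑ l ∈ Finset.Ico k (p + 1), b l : ℝ))

/-- The diagonal entries of `Ω_+`. -/
def dominantPoint (p k : ℕ) : ℂ :=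
  Complex.exp (Complex.I * Real.pi * dominantIndex p k / (p + 1))

/-- The entries of `U^+`. -/
def upperCoeff (p : ℕ) (b : ℕ → ℝ) (i k : ℕ) : ℂ :=
  columnPhase p b k * (-dominantPoint p k) ^ i *
    Complex.exp (leadingExponent (p + 1) b * (Complex.I * Real.pi * dominantIndex p k / (p + 1)))

lemma omega_cpow (p : ℕ) (x : ℂ) :
    omega p ^ x = Complex.exp (x * (Complex.I * (Real.pi / 2) * (p / (p + 1)))) := by
  have hp : (0 : ℝ) < p + 1 := by positivity
  have e : Complex.I * (Real.pi / 2) * (p / (p + 1)) =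
      ((Real.pi / 2 * (p / (p + 1)) : ℝ) : ℂ) * Complex.I := by push_cast; ring
  have h1 : (p : ℝ) / (p + 1) ≤ 1 := by rw [div_le_one hp]; linarith
  have h2 : 0 ≤ (p : ℝ) / (p + 1) := by positivity
  have hpi := Real.pi_pos
  rw [omega, Complex.cpow_def_of_ne_zero (Complex.exp_ne_zero _), Complex.log_exp, mul_comm]
  · rw [e]; simp only [Complex.im_ofReal_mul, Complex.I_im]; nlinarith
  · rw [e]; simp only [Complex.im_ofReal_mul, Complex.I_im]; nlinarith

/-- Telescoping gives A_{k+1} = A_1 - (p + 1) b_k, and the vanishing sum of the A_j identifies A_1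
with Σ b_l. -/
lemma exponent_eq {A : ℕ → ℝ} (hA : ∀ j : ℕ, 1 ≤ j → j ≤ p → A (j + 1) - A j = (p + 1) * a j)
    (hA0 : ∑ j ∈ Finset.Icc 1 (p + 1), A j = 0) {k : ℕ} (hk : k ≤ p) :
    A (k + 1) = ∑ l ∈ Finset.range (p + 1), shiftParam a l - (p + 1) * shiftParam a k := by
  have h1 : ∀ k ≤ p, A (k + 1) = A 1 - (p + 1) * shiftParam a k := by
    intro k
    induction k with
    | zero => intro _; rw [shiftParam_zero]; ring
    | succ k ih =>
      intro hk
      have h2 := hA (k + 1) (by omega) hk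
      rw [shiftParam_succ]
      linarith [ih (by omega)]
  have h3 : ∑ j ∈ Finset.Icc 1 (p + 1), A j = ∑ l ∈ Finset.range (p + 1), A (l + 1) := by
    rw [Finset.range_eq_Ico, Finset.sum_Ico_add' A 0 (p + 1) 1]; rfl
  rw [h3, Finset.sum_congr rfl fun l hl => h1 l (by rw [Finset.mem_range] at hl; omega),
    Finset.sum_sub_distrib, ← Finset.mul_sum, Finset.sum_const, Finset.card_range, nsmul_eq_mul,
    Nat.cast_add, Nat.cast_one, ← mul_sub] at hA0
  have h4 : ((p : ℝ) + 1) ≠ 0 := by positivity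
  have h5 := (mul_eq_zero.1 hA0).resolve_left h4
  rw [h1 k hk]
  linarith

lemma sum_exponent {A b : ℕ → ℝ} {B : ℝ} (hA : ∀ k ≤ p, A (k + 1) = B - (p + 1) * b k) {j : ℕ}
    (hj : j ≤ p + 1) : ∑ m ∈ Finset.Icc (j + 1) (p + 1), A m =
      (p + 1 - j) * B - (p + 1) * ∑ l ∈ Finset.Ico j (p + 1), b l := by
  have h3 : ∑ m ∈ Finset.Icc (j + 1) (p + 1), A m = ∑ l ∈ Finset.Ico j (p + 1), A (l + 1) := by
    rw [Finset.sum_Ico_add' A j (p + 1) 1]; rfl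
  rw [h3, Finset.sum_congr rfl fun l hl => hA l (by rw [Finset.mem_Ico] at hl; omega),
    Finset.sum_sub_distrib, ← Finset.mul_sum, Finset.sum_const, Nat.card_Ico, nsmul_eq_mul,
    Nat.cast_sub hj]
  push_cast
  ring

lemma leadingExponent_succ (b : ℕ → ℝ) :
    leadingExponent (p + 1) b = ∑ l ∈ Finset.range (p + 1), b l - p / 2 := by
  rw [leadingExponent]; push_cast; ring

lemma matrixUplus_apply (hp : p ≠ 0) {A b : ℕ → ℝ}
    (hA : ∀ k ≤ p, A (k + 1) = ∑ l ∈ Finset.range (p + 1), b l - (p + 1) * b k)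
    (i k : Fin (p + 1)) : matrixUplus p A i k = upperCoeff p b i k := by
  obtain ⟨i, hi⟩ := i
  obtain ⟨k, hk⟩ := k
  have hp0 : (p : ℂ) ≠ 0 := by exact_mod_cast hp
  have hp1 : (p : ℂ) + 1 ≠ 0 := by exact_mod_cast p.succ_ne_zero
  simp only [matrixUplus, Matrix.of_apply, omega_cpow, upperCoeff, columnPhase, dominantPoint,
    dominantIndex, leadingExponent_succ]
  set B : ℝ := ∑ l ∈ Finset.range (p + 1), b l with hB
  rw [neg_pow (Complex.exp _) i, ← Complex.exp_nat_mul]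
  rcases Nat.even_or_odd' k with ⟨c, rfl | rfl⟩
  · have hc : 2 * c / 2 = c := by omega
    have hc2 : 2 * c % 2 = 0 := by omega
    have h1 : (-1 : ℂ) ^ (2 * c) = 1 := (even_two_mul c).neg_one_pow
    have h2 : (-1 : ℂ) ^ (2 * c + 1) = -1 := by rw [pow_succ, h1]; ring
    have hs : (if p % 2 = 1 then (-1 : ℂ) ^ (2 * c + i + 1) else (-1) ^ i) =
        (-1) ^ (p - 2 * c) * (-1) ^ i := by
      split_ifs with h
      · rw [(by rw [Nat.odd_iff]; omega : Odd (p - 2 * c)).neg_one_pow, pow_succ, pow_add, h1]; ring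
      · rw [(by rw [Nat.even_iff]; omega : Even (p - 2 * c)).neg_one_pow, one_mul]
    simp only [hc, hc2, if_true, h1, h2, hs]
    -- The zero-based columns 2c and 2c + 1 share the tail sum of A_m from m = 2c + 2, which becomes
    -- the sum of b_l from l = 2c + 1.
    rw [sum_exponent (j := 2 * c + 1) hA (by omega)]
    set T : ℝ := ∑ l ∈ Finset.Ico (2 * c + 1) (p + 1), b l
    rw [mul_assoc, mul_assoc, ← Complex.exp_add, ← Complex.exp_add]
    have e : ∀ s t x y z : ℂ, s * Complex.exp x * (t * Complex.exp y) * Complex.exp z =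
        s * t * Complex.exp (x + y + z) := fun s t x y z => by
      rw [Complex.exp_add, Complex.exp_add]; ring
    rw [e]
    congr 2
    push_cast
    field_simp
    ring
  · have hc : (2 * c + 1) / 2 = c := by omega
    have hc2 : ¬ (2 * c + 1) % 2 = 0 := by omega
    have h1 : (-1 : ℂ) ^ (2 * c) = 1 := (even_two_mul c).neg_one_pow
    have h2 : (-1 : ℂ) ^ (2 * c + 1) = -1 := by rw [pow_succ, h1]; ring
    have h3 : (-1 : ℂ) ^ (2 * c + 1 + 1) = 1 := by rw [pow_succ, h2]; ring
    have hs : (if p % 2 = 1 then (-1 : ℂ) ^ (2 * c + 1 + i + 1) else (-1) ^ i) = (-1) ^ i := by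
      split_ifs with h
      · rw [pow_succ, pow_add, h2]; ring
      · rfl
    simp only [hc, hc2, if_false, h2, h3, hs]
    rw [sum_exponent (j := 2 * c + 1) hA (by omega)]
    set T : ℝ := ∑ l ∈ Finset.Ico (2 * c + 1) (p + 1), b l
    rw [mul_assoc, mul_assoc, ← Complex.exp_add, ← Complex.exp_add]
    have e : ∀ t x y z : ℂ, Complex.exp x * (t * Complex.exp y) * Complex.exp z =
        t * Complex.exp (x + y + z) := fun t x y z => by
      rw [Complex.exp_add, Complex.exp_add]; ring
    rw [e]
    congr 2
    push_cast
    field_simp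
    ring

lemma omegaDiag_apply (hp : p ≠ 0) (k : Fin (p + 1)) : omegaDiag p 1 k = dominantPoint p k := by
  obtain ⟨k, hk⟩ := k
  have hp0 : (p : ℂ) ≠ 0 := by exact_mod_cast hp
  have hp1 : (p : ℂ) + 1 ≠ 0 := by exact_mod_cast p.succ_ne_zero
  simp only [omegaDiag, omega_cpow, dominantPoint, dominantIndex]
  rcases Nat.even_or_odd' k with ⟨c, rfl | rfl⟩
  · have hc : 2 * c / 2 = c := by omega
    have hc2 : 2 * c % 2 = 0 := by omega
    have h1 : (-1 : ℂ) ^ (2 * c) = 1 := (even_two_mul c).neg_one_pow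
    simp only [hc, hc2, if_true, h1]
    congr 1
    push_cast
    field_simp
  · have hc : (2 * c + 1) / 2 = c := by omega
    have hc2 : ¬ (2 * c + 1) % 2 = 0 := by omega
    have h1 : (-1 : ℂ) ^ (2 * c) = 1 := (even_two_mul c).neg_one_pow
    have h2 : (-1 : ℂ) ^ (2 * c + 1) = -1 := by rw [pow_succ, h1]; ring
    simp only [hc, hc2, if_false, h2]
    congr 1
    push_cast
    field_simp
    ring

lemma omegaDiag_neg (p : ℕ) (k : Fin (p + 1)) :
    omegaDiag p (-1) k = starRingEnd ℂ (omegaDiag p 1 k) := by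
  simp only [omegaDiag, omega_cpow, ← Complex.exp_conj]
  have h2 : starRingEnd ℂ 2 = 2 := map_ofNat _ 2
  congr 1
  simp [h2]

lemma conj_dominantPoint (p k : ℕ) : starRingEnd ℂ (dominantPoint p k) =
    Complex.exp (Complex.I * Real.pi * (-dominantIndex p k : ℤ) / (p + 1)) := by
  simp only [dominantPoint, ← Complex.exp_conj]
  congr 1
  simp

lemma dominantIndex_succ {k : ℕ} (h : k % 2 = 0) :
    dominantIndex p (k + 1) = -dominantIndex p k := by
  rw [dominantIndex, dominantIndex, if_neg (by omega), if_pos h]; push_cast; ring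

lemma conj_columnPhase {k : ℕ} (h : k % 2 = 0) :
    columnPhase p a (k + 1) = (-1) ^ (p - k) * starRingEnd ℂ (columnPhase p a k) := by
  rw [columnPhase, columnPhase, if_neg (by omega), if_pos h, map_mul, map_pow, ← Complex.exp_conj,
    ← mul_assoc]
  have : (-1 : ℂ) ^ (p - k) * (starRingEnd ℂ) (-1) ^ (p - k) = 1 := by
    rw [map_neg, map_one, ← mul_pow]; simp
  rw [this, one_mul]
  congr 1
  simp

/-- Paired columns have opposite dominant indices, so they are conjugate up to sign. Conjugating U^+
therefore amounts to swapping columns within pairs, which is the definition of U^-. -/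
lemma conj_upperCoeff {k : ℕ} (h : k % 2 = 0) (i : ℕ) :
    upperCoeff p a i (k + 1) = (-1) ^ (p - k) * starRingEnd ℂ (upperCoeff p a i k) := by
  rw [upperCoeff, upperCoeff, map_mul, map_mul, map_pow, map_neg, conj_dominantPoint,
    conj_columnPhase h, dominantPoint, dominantIndex_succ h, ← Complex.exp_conj, ← mul_assoc,
    ← mul_assoc]
  congr 2
  simp

/-- `U^-` is obtained from `U^+` by conjugation and change of signs. -/
lemma matrixU_neg (hp : p ≠ 0) {A b : ℕ → ℝ}
    (hA : ∀ k ≤ p, A (k + 1) = ∑ l ∈ Finset.range (p + 1), b l - (p + 1) * b k)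
    (i k : Fin (p + 1)) :
    matrixU p A (-1) i k = (-1) ^ (p - k : ℕ) * starRingEnd ℂ (upperCoeff p b i k) := by
  have e : matrixUplus p A = Matrix.of fun i k : Fin (p + 1) => (upperCoeff p b) i k := by
    ext i k; exact matrixUplus_apply hp hA i k
  rw [matrixU, if_neg (by norm_num), e, mul_blockSum_apply p 1 _ (upperCoeff p b)]
  obtain ⟨k, hk⟩ := k
  change blockCol p 1 _ (upperCoeff p b i) k = (-1) ^ (p - k) * starRingEnd ℂ (upperCoeff p b i k)
  unfold blockCol
  have hsq : ∀ n : ℕ, (-1 : ℂ) ^ n * (-1) ^ n = 1 := fun n => by rw [← mul_pow]; simp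
  by_cases h1 : IsBlockStart p 1 (k + 1)
  · rw [if_pos h1]
    unfold IsBlockStart at h1
    rw [conj_upperCoeff (by omega)]
    simp
  · rw [if_neg h1]
    by_cases h2 : IsBlockStart p 1 k
    · rw [if_pos h2]
      unfold IsBlockStart at h2
      obtain ⟨k, rfl⟩ : ∃ k', k = k' + 1 := ⟨k - 1, by omega⟩
      have h3 : p - k = p - (k + 1) + 1 := by omega
      rw [conj_upperCoeff (by omega), map_mul, map_pow, map_neg, map_one, Complex.conj_conj,
        ← mul_assoc, h3, pow_succ (-1 : ℂ) (p - (k + 1)), ← mul_assoc, hsq]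
      simp
    · rw [if_neg h2]
      unfold IsBlockStart at h1 h2
      -- The unpaired last column, present for even p, has dominant index 0 and real entries.
      obtain rfl : k = p := by omega
      have h3 : k % 2 = 0 := by omega
      simp [upperCoeff, columnPhase, dominantPoint, dominantIndex, h3]

lemma exp_index_injective {n n' : ℤ} (h : |n - n'| < 2 * (p + 1))
    (he : Complex.exp (Complex.I * Real.pi * n / (p + 1)) =
      Complex.exp (Complex.I * Real.pi * n' / (p + 1))) : n = n' := by
  have hp1 : (p : ℂ) + 1 ≠ 0 := by exact_mod_cast p.succ_ne_zero
  have hpi : (Real.pi : ℂ) ≠ 0 := by exact_mod_cast Real.pi_ne_zero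
  obtain ⟨z, hz⟩ := Complex.exp_eq_exp_iff_exists_int.1 he
  have h1 : ((n : ℤ) : ℂ) = ((n' + 2 * (p + 1) * z : ℤ) : ℂ) := by
    have hI := Complex.I_ne_zero
    field_simp at hz
    push_cast
    have h2 : (n : ℂ) - (n' + 2 * (p + 1) * z) = 0 := by linear_combination hz
    linear_combination h2
  have h2 : n = n' + 2 * (p + 1) * z := by exact_mod_cast h1
  rw [abs_lt] at h
  have h3 : z = 0 := by
    have h4 : (0 : ℤ) < 2 * (p + 1) := by positivity
    have h5 : (2 * ((p : ℤ) + 1)) * z < 2 * (p + 1) * 1 := by linarith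
    have h6 : (2 * ((p : ℤ) + 1)) * (-1) < 2 * (p + 1) * z := by linarith
    have := lt_of_mul_lt_mul_left h5 h4.le
    have := lt_of_mul_lt_mul_left h6 h4.le
    omega
  rw [h2, h3]; ring

/-- The dominant indices run through p, p - 2, …, -p in the order p, -p, p - 2, …; they differ by
less than the period 2(p + 1). -/
lemma dominantPoint_injective :
    Function.Injective fun k : Fin (p + 1) => dominantPoint p k := by
  intro k k' h
  have h1 := exp_index_injective (p := p) (n := dominantIndex p k) (n' := dominantIndex p k') ?_ h
  · unfold dominantIndex at h1
    ext
    split_ifs at h1 <;> omega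
  · unfold dominantIndex
    rw [abs_lt]
    split_ifs <;> omega

lemma isUnit_det_of_power_columns {n : ℕ} {v c : Fin n → ℂ} (hv : Function.Injective v)
    (hc : ∀ k, c k ≠ 0) {U : Matrix (Fin n) (Fin n) ℂ} (hU : ∀ i k, U i k = c k * v k ^ (i : ℕ)) :
    IsUnit U.det := by
  have : U = (Matrix.vandermonde v).transpose * Matrix.diagonal c := by
    ext i k
    rw [Matrix.mul_diagonal, Matrix.transpose_apply, Matrix.vandermonde_apply, hU, mul_comm]
  rw [this, Matrix.det_mul, Matrix.det_transpose, Matrix.det_diagonal, isUnit_iff_ne_zero]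
  exact mul_ne_zero (Matrix.det_vandermonde_ne_zero_iff.2 hv) (Finset.prod_ne_zero_iff.2 fun k _ => hc k)

lemma columnPhase_ne_zero (b : ℕ → ℝ) (k : ℕ) : columnPhase p b k ≠ 0 := by
  unfold columnPhase
  split_ifs
  · exact mul_ne_zero (pow_ne_zero _ (by norm_num)) (Complex.exp_ne_zero _)
  · exact Complex.exp_ne_zero _

lemma matrixU_isUnit_det (hp : p ≠ 0) {A b : ℕ → ℝ}
    (hA : ∀ k ≤ p, A (k + 1) = ∑ l ∈ Finset.range (p + 1), b l - (p + 1) * b k) {ε : ℝ}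
    (hε : ε = 1 ∨ ε = -1) : IsUnit (matrixU p A ε).det := by
  have hinj := dominantPoint_injective (p := p)
  rcases hε with rfl | rfl
  · refine isUnit_det_of_power_columns (v := fun k => -dominantPoint p k)
      (c := fun k => columnPhase p b k * Complex.exp (leadingExponent (p + 1) b *
        (Complex.I * Real.pi * dominantIndex p k / (p + 1)))) (neg_injective.comp hinj)
      (fun k => mul_ne_zero (columnPhase_ne_zero b k) (Complex.exp_ne_zero _)) fun i k => ?_
    rw [matrixU, if_pos one_pos, matrixUplus_apply hp hA, upperCoeff]
    ring
  · refine isUnit_det_of_power_columns (v := fun k => starRingEnd ℂ (-dominantPoint p k))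
      (c := fun k => (-1) ^ (p - k : ℕ) * starRingEnd ℂ (columnPhase p b k *
        Complex.exp (leadingExponent (p + 1) b *
        (Complex.I * Real.pi * dominantIndex p k / (p + 1)))))
      ((starRingEnd ℂ).injective.comp (neg_injective.comp hinj))
      (fun k => mul_ne_zero (pow_ne_zero _ (by norm_num)) ((map_ne_zero _).2
        (mul_ne_zero (columnPhase_ne_zero b k) (Complex.exp_ne_zero _)))) fun i k => ?_
    rw [matrixU_neg hp hA, upperCoeff, ← map_pow]
    simp only [map_mul]
    ring

end CauchyChain
end

noncomputable section
namespace CauchyChain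

variable {p : ℕ} {a : ℕ → ℝ}

/-! ### The entries at infinity -/

lemma sqrt_mul_leadingConst (p : ℕ) :
    Real.sqrt ((p + 1) / (2 * Real.pi) ^ p) * leadingConst (p + 1) = 1 := by
  have hp : (0 : ℝ) < p + 1 := by positivity
  have hpi : (0 : ℝ) < 2 * Real.pi := by positivity
  have h1 : Real.sqrt (2 * Real.pi) ^ p = Real.sqrt ((2 * Real.pi) ^ p) := by
    rw [← Real.sqrt_sq (pow_nonneg (Real.sqrt_nonneg (2 * Real.pi)) p), ← pow_mul, mul_comm p 2,
      pow_mul, Real.sq_sqrt hpi.le]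
  have h2 : Real.exp (-(Real.log (p + 1) / 2)) = (Real.sqrt (p + 1))⁻¹ := by
    rw [Real.exp_neg, Real.exp_half, Real.exp_log hp]
  have h3 : Real.sqrt (p + 1) ≠ 0 := (Real.sqrt_pos.2 hp).ne'
  have h4 : Real.sqrt ((2 * Real.pi) ^ p) ≠ 0 := (Real.sqrt_pos.2 (by positivity)).ne'
  rw [leadingConst, Nat.add_sub_cancel, Nat.cast_add, Nat.cast_one, h1, h2,
    Real.sqrt_div' _ (by positivity)]
  field_simp

/-- This is what the constants c_j are made for: the powers of 2πi and the constant of Stirling's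
formula cancel, and a unimodular factor remains. -/
lemma normConst_mul_dominantCoeff (b : ℕ → ℝ) {k : ℕ} (hk : k ≤ p) :
    normConst p (k + 1) * (dominantCoeff (p + 1) b (p - k) * leadingConst (p + 1)) = (-1) ^ (p - k) *
      Complex.exp (-(Complex.I * Real.pi * (∑ l ∈ Finset.Ico (k + 1) (p + 1), b l : ℝ))) := by
  have h0 : (2 * Real.pi * Complex.I : ℂ) ≠ 0 := by simp [Real.pi_ne_zero, Complex.I_ne_zero]
  have h1 : p + 1 - (p - k) = k + 1 := by omega
  have h2 : p + 1 - (k + 1) = p - k := by omega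
  have h3 : ((Real.sqrt ((p + 1) / (2 * Real.pi) ^ p) : ℝ) : ℂ) * (leadingConst (p + 1) : ℝ) = 1 := by
    exact_mod_cast sqrt_mul_leadingConst p
  have h4 : ∏ l ∈ Finset.Ico (k + 1) (p + 1), -Complex.exp (-(Complex.I * Real.pi * b l)) =
      (-1) ^ (p - k) *
        Complex.exp (-(Complex.I * Real.pi * (∑ l ∈ Finset.Ico (k + 1) (p + 1), b l : ℝ))) := by
    rw [Finset.prod_neg, ← Complex.exp_sum, Nat.card_Ico, h2]
    congr 2
    push_cast
    rw [Finset.mul_sum, Finset.sum_neg_distrib]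
  rw [dominantCoeff, h1, Finset.prod_div_distrib, h4, Finset.prod_const, Nat.card_Ico, normConst, h2]
  have h5 := pow_ne_zero (p - k) h0
  rw [mul_comm ((2 * Real.pi * Complex.I : ℂ) ^ (p - k))]
  field_simp
  linear_combination h3

lemma conj_normConst {k : ℕ} (hk : k ≤ p) :
    starRingEnd ℂ (normConst p (k + 1)) = (-1) ^ (p - k) * normConst p (k + 1) := by
  have : p + 1 - (k + 1) = p - k := by omega
  rw [normConst, this, map_mul, map_pow, Complex.conj_ofReal]
  simp only [map_mul, Complex.conj_ofReal, Complex.conj_I, map_ofNat]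
  rw [mul_neg, neg_pow]
  ring

lemma normConst_mul_conj_dominantCoeff (b : ℕ → ℝ) {k : ℕ} (hk : k ≤ p) :
    normConst p (k + 1) * (starRingEnd ℂ (dominantCoeff (p + 1) b (p - k)) * leadingConst (p + 1)) =
      Complex.exp (Complex.I * Real.pi * (∑ l ∈ Finset.Ico (k + 1) (p + 1), b l : ℝ)) := by
  have h1 := congrArg (starRingEnd ℂ) (normConst_mul_dominantCoeff b hk)
  rw [map_mul, conj_normConst hk, map_mul, Complex.conj_ofReal, map_mul, map_pow, map_neg, map_one,
    mul_assoc] at h1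
  have h2 := mul_left_cancel₀ (pow_ne_zero (p - k) (by norm_num : (-1 : ℂ) ≠ 0)) h1
  rw [h2, ← Complex.exp_conj]
  congr 1
  simp

/-- The distance π/4 from the real axis gives the gap π/2 between competing translates; for k = p
there is only one translate. The free factor q carries the exponential prefactors of the entries. -/
lemma meijer_upper (hp : p ≠ 0) (b : ℕ → ℝ) (i : ℕ) {k : ℕ} (hk : k ≤ p) :
    ∃ K : ℝ, 0 ≤ K ∧ ∀ q w : ℂ, (i : ℝ) ≤ w.re → (k = p ∨ Real.pi / 4 ≤ w.im) →
      |w.im + (p - k : ℕ) * Real.pi| ≤ (p + 1) * Real.pi →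
      ‖q * (normConst p (k + 1) * meijer (p + 1) b i (k + 1) w) - q * ((-1) ^ (p - k) *
        Complex.exp (-(Complex.I * Real.pi * (∑ l ∈ Finset.Ico (k + 1) (p + 1), b l : ℝ))) *
        leadingSize (p + 1) b i (w + (p - k : ℕ) * (Real.pi * Complex.I)))‖ ≤
        K * Real.exp (-(w.re / (p + 1))) *
          ‖q * leadingSize (p + 1) b i (w + (p - k : ℕ) * (Real.pi * Complex.I))‖ := by
  have hpi := Real.pi_pos
  obtain ⟨K, hK0, hK⟩ := meijer_asymp_upper (N := p + 1) (by omega) b i (m := p - k) (by omega)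
    (g := Real.pi / 2) (by linarith) (by linarith)
  have h1 : p + 1 - (p - k) = k + 1 := by omega
  rw [h1] at hK
  refine ⟨‖normConst p (k + 1)‖ * K, by positivity, fun q w h2 h3 h4 => ?_⟩
  have h := hK w h2 (h3.imp (fun h => by omega) fun h => by linarith) (by push_cast; exact h4)
  rw [← normConst_mul_dominantCoeff b hk, mul_assoc (normConst p (k + 1)), ← mul_sub, ← mul_sub,
    norm_mul, norm_mul, norm_mul q]
  push_cast at h
  refine (mul_le_mul_of_nonneg_left (mul_le_mul_of_nonneg_left h (norm_nonneg _))
    (norm_nonneg q)).trans_eq ?_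
  ring

lemma meijer_lower (hp : p ≠ 0) (b : ℕ → ℝ) (i : ℕ) {k : ℕ} (hk : k ≤ p) :
    ∃ K : ℝ, 0 ≤ K ∧ ∀ q w : ℂ, (i : ℝ) ≤ w.re → (k = p ∨ w.im ≤ -(Real.pi / 4)) →
      |w.im - (p - k : ℕ) * Real.pi| ≤ (p + 1) * Real.pi →
      ‖q * (normConst p (k + 1) * meijer (p + 1) b i (k + 1) w) - q * (
        Complex.exp (Complex.I * Real.pi * (∑ l ∈ Finset.Ico (k + 1) (p + 1), b l : ℝ)) *
        leadingSize (p + 1) b i (w - (p - k : ℕ) * (Real.pi * Complex.I)))‖ ≤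
        K * Real.exp (-(w.re / (p + 1))) *
          ‖q * leadingSize (p + 1) b i (w - (p - k : ℕ) * (Real.pi * Complex.I))‖ := by
  have hpi := Real.pi_pos
  obtain ⟨K, hK0, hK⟩ := meijer_asymp_lower (N := p + 1) (by omega) b i (m := p - k) (by omega)
    (g := Real.pi / 2) (by linarith) (by linarith)
  have h1 : p + 1 - (p - k) = k + 1 := by omega
  rw [h1] at hK
  refine ⟨‖normConst p (k + 1)‖ * K, by positivity, fun q w h2 h3 h4 => ?_⟩
  have h := hK w h2 (h3.imp (fun h => by omega) fun h => by linarith) (by push_cast; exact h4)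
  rw [← normConst_mul_conj_dominantCoeff b hk, mul_assoc (normConst p (k + 1)), ← mul_sub, ← mul_sub,
    norm_mul, norm_mul, norm_mul q]
  push_cast at h
  refine (mul_le_mul_of_nonneg_left (mul_le_mul_of_nonneg_left h (norm_nonneg _))
    (norm_nonneg q)).trans_eq ?_
  ring

/-- The leading term of the entry `(i, k)` in the upper half plane. -/
def leadTerm (p : ℕ) (b : ℕ → ℝ) (i k : ℕ) (w : ℂ) : ℂ :=
  columnPhase p b k * Complex.exp (-(b k * w)) *
    leadingSize (p + 1) b i (w + dominantIndex p k * (Real.pi * Complex.I))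

lemma dominantIndex_even {k : ℕ} (hk : k ≤ p) (h : k % 2 = 0) :
    (dominantIndex p k : ℂ) = (p - k : ℕ) := by
  rw [dominantIndex, if_pos h, Nat.cast_sub hk]; push_cast; ring

lemma dominantIndex_odd {k : ℕ} (hk : k ≤ p) (h : k % 2 = 1) :
    (dominantIndex p k : ℂ) = -((p - k : ℕ) + 1) := by
  rw [dominantIndex, if_neg (by omega), Nat.cast_sub hk]; push_cast; ring

lemma norm_exp_I_pi (x : ℝ) : ‖Complex.exp (Complex.I * Real.pi * x)‖ = 1 := by
  rw [Complex.norm_exp]; simp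

/-- Conclude from the asymptotics of a multiple of a function `meijer`. -/
lemma leadTerm_bound {b : ℕ → ℝ} {i k : ℕ} {w X Y T S κ q : ℂ} {K e : ℝ}
    (h : ‖q * Y - q * (κ * S)‖ ≤ K * e * ‖q * S‖) (hX : X = q * Y)
    (hT : leadTerm p b i k w = q * (κ * S)) (hκ : ‖κ‖ = 1) (hTT : T = leadTerm p b i k w) :
    ‖X - T‖ ≤ K * e * ‖T‖ := by
  have : ‖T‖ = ‖q * S‖ := by rw [hTT, hT, norm_mul, norm_mul, norm_mul, hκ, one_mul]
  rw [this, hTT, hT, hX]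
  exact h

lemma entry_of_even {k : ℕ} (h : k % 2 = 0) (ε : ℝ) (i : ℕ) (w : ℂ) :
    entry p a ε i k w = Complex.exp (-(shiftParam a k * w)) *
      (normConst p (k + 1) * meijer (p + 1) (shiftParam a) i (k + 1) w) := by
  simp only [entry, h, Nat.cast_zero, mul_zero, zero_mul, sub_zero]
  ring

lemma entry_of_odd {k : ℕ} (h : k % 2 = 1) (ε : ℝ) (i : ℕ) (w : ℂ) :
    entry p a ε i k w = Complex.exp (-(shiftParam a k * (w - ε * (Real.pi * Complex.I)))) *
      (normConst p (k + 1) * meijer (p + 1) (shiftParam a) i (k + 1)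
        (w - ε * (Real.pi * Complex.I))) := by
  simp only [entry, h, Nat.cast_one, mul_one]
  ring

lemma norm_sign_mul_exp (n : ℕ) (x : ℝ) :
    ‖(-1) ^ n * Complex.exp (-(Complex.I * Real.pi * x))‖ = 1 := by
  rw [norm_mul, norm_pow, norm_neg, norm_one, one_pow, one_mul, Complex.norm_exp]; simp

/-- The dominant translate is w + (p - k)πi. For k = 0 and Im w = π it reaches the line Im = Nπ, so
the asymptotics are needed up to the full height. -/
lemma entry_asymp_even (hp : p ≠ 0) (i : ℕ) {k : ℕ} (hk : k ≤ p) (h2 : k % 2 = 0) :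
    ∃ K : ℝ, 0 ≤ K ∧ ∀ w : ℂ, (i : ℝ) ≤ w.re → (k = p ∨ Real.pi / 4 ≤ w.im) → 0 ≤ w.im →
      w.im ≤ Real.pi → ‖entry p a 1 i k w - leadTerm p (shiftParam a) i k w‖ ≤
        K * Real.exp (-(w.re / (p + 1))) * ‖leadTerm p (shiftParam a) i k w‖ := by
  have hpi := Real.pi_pos
  obtain ⟨K, hK0, hK⟩ := meijer_upper hp (shiftParam a) i hk
  refine ⟨K, hK0, fun w h3 h4 h5 h6 => ?_⟩
  have h7 : |w.im + (p - k : ℕ) * Real.pi| ≤ (p + 1) * Real.pi := by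
    have h8 : ((p - k : ℕ) : ℝ) ≤ p := by exact_mod_cast Nat.sub_le p k
    rw [abs_of_nonneg (by positivity)]
    nlinarith
  refine leadTerm_bound (hK (Complex.exp (-(shiftParam a k * w))) w h3 h4 h7) (entry_of_even h2 1 i w)
    ?_ (norm_sign_mul_exp _ _) rfl
  rw [leadTerm, dominantIndex_even hk h2, columnPhase, if_pos h2]
  ring

lemma sum_Ico_shift {f : ℕ → ℝ} {k : ℕ} (hk : k < p) : ∑ l ∈ Finset.Ico (k + 1) (p + 1), f l =
    f (k + 1) + ∑ l ∈ Finset.Ico (k + 1 + 1) (p + 1), f l :=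
  Finset.sum_eq_sum_Ico_succ_bot (by omega) f

/-- Near the positive axis the extreme translates of an even column are of comparable size. By
`entry_even` the triangular correction leaves -e^{-aw} times the next column at w + πi, where one
translate dominates down to Im w = 0. -/
lemma entry_asymp_even_right (hp : p ≠ 0) (i : ℕ) {k : ℕ} (hk : k < p) (h2 : k % 2 = 0) :
    ∃ K : ℝ, 0 ≤ K ∧ ∀ w : ℂ, (i : ℝ) ≤ w.re → 0 ≤ w.im → w.im ≤ Real.pi →
      ‖entry p a 1 i k w - Complex.exp (-(a (k + 1) * w)) * entry p a 1 i (k + 1) w -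
        leadTerm p (shiftParam a) i k w‖ ≤
        K * Real.exp (-(w.re / (p + 1))) * ‖leadTerm p (shiftParam a) i k w‖ := by
  have hpi := Real.pi_pos
  obtain ⟨K, hK0, hK⟩ := meijer_upper hp (shiftParam a) i (k := k + 1) hk
  refine ⟨K, hK0, fun w h3 h5 h6 => ?_⟩
  set w' : ℂ := w + Real.pi * Complex.I with hw'
  have hre : w'.re = w.re := by simp [hw']
  have him : w'.im = w.im + Real.pi := by simp [hw']
  have hcast : ((p - k : ℕ) : ℝ) = (p - (k + 1) : ℕ) + 1 := by
    have : p - k = p - (k + 1) + 1 := by omega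
    rw [this]; push_cast; ring
  have hcastC : ((p - k : ℕ) : ℂ) = (p - (k + 1) : ℕ) + 1 := by exact_mod_cast hcast
  have h7 : |w'.im + (p - (k + 1) : ℕ) * Real.pi| ≤ (p + 1) * Real.pi := by
    have h8 : ((p - k : ℕ) : ℝ) ≤ p := by exact_mod_cast Nat.sub_le p k
    rw [him, abs_of_nonneg (by positivity)]
    nlinarith
  have h := hK (-(Complex.exp (-(a (k + 1) * w)) * Complex.exp (-(shiftParam a (k + 1) * w')))) w'
    (by rw [hre]; exact h3) (Or.inr (by rw [him]; linarith)) h7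
  rw [hre] at h
  refine leadTerm_bound h ?_ ?_ (norm_sign_mul_exp _ _) rfl
  · rw [entry_even hk h2, entry_of_odd (by omega : (k + 1) % 2 = 1) (-1)]
    have : w - ((-1 : ℝ) : ℂ) * (Real.pi * Complex.I) = w' := by rw [hw']; push_cast; ring
    rw [this]
    ring
  · rw [leadTerm, dominantIndex_even hk.le h2, columnPhase, if_pos h2, sum_Ico_shift hk]
    have e1 : w' + (p - (k + 1) : ℕ) * (Real.pi * Complex.I) =
        w + (p - k : ℕ) * (Real.pi * Complex.I) := by rw [hw', hcastC]; ring
    have e2 : (-1 : ℂ) ^ (p - k) = -(-1) ^ (p - (k + 1)) := by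
      have : p - k = p - (k + 1) + 1 := by omega
      rw [this, pow_succ]; ring
    set T : ℝ := ∑ l ∈ Finset.Ico (k + 1 + 1) (p + 1), shiftParam a l
    rw [e1, e2]
    have e3 : Complex.exp (-(Complex.I * Real.pi * (shiftParam a (k + 1) + T : ℝ))) *
        Complex.exp (-(shiftParam a k * w)) = Complex.exp (-(a (k + 1) * w)) *
        Complex.exp (-(shiftParam a (k + 1) * w')) * Complex.exp (-(Complex.I * Real.pi * T)) := by
      rw [← Complex.exp_add, ← Complex.exp_add, ← Complex.exp_add, hw', Complex.ofReal_add,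
        ofReal_shiftParam_succ]
      congr 1
      ring
    linear_combination (-(-1) ^ (p - (k + 1)) *
      leadingSize (p + 1) (shiftParam a) i (w + (p - k : ℕ) * (Real.pi * Complex.I))) * e3

/-- Odd columns are evaluated at w - πi, so they follow the asymptotics of the lower half plane, and
the critical direction is the negative axis. -/
lemma entry_asymp_odd (hp : p ≠ 0) (i : ℕ) {k : ℕ} (hk : k ≤ p) (h2 : k % 2 = 1) :
    ∃ K : ℝ, 0 ≤ K ∧ ∀ w : ℂ, (i : ℝ) ≤ w.re → (k = p ∨ w.im ≤ 3 * Real.pi / 4) → 0 ≤ w.im →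
      w.im ≤ Real.pi → ‖entry p a 1 i k w - leadTerm p (shiftParam a) i k w‖ ≤
        K * Real.exp (-(w.re / (p + 1))) * ‖leadTerm p (shiftParam a) i k w‖ := by
  have hpi := Real.pi_pos
  obtain ⟨K, hK0, hK⟩ := meijer_lower hp (shiftParam a) i hk
  refine ⟨K, hK0, fun w h3 h4 h5 h6 => ?_⟩
  set w' : ℂ := w - Real.pi * Complex.I with hw'
  have hre : w'.re = w.re := by simp [hw']
  have him : w'.im = w.im - Real.pi := by simp [hw']
  have h7 : |w'.im - (p - k : ℕ) * Real.pi| ≤ (p + 1) * Real.pi := by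
    have h8 : ((p - k : ℕ) : ℝ) ≤ p := by exact_mod_cast Nat.sub_le p k
    have h9 : (0 : ℝ) ≤ (p - k : ℕ) := by positivity
    rw [him, abs_le]
    constructor <;> nlinarith
  have h := hK (Complex.exp (-(shiftParam a k * w'))) w' (by rw [hre]; exact h3)
    (h4.imp id fun h => by rw [him]; linarith) h7
  rw [hre] at h
  refine leadTerm_bound h ?_ ?_ (norm_exp_I_pi _) rfl
  · rw [entry_of_odd h2, Complex.ofReal_one, one_mul]
  · rw [leadTerm, dominantIndex_odd hk h2, columnPhase, if_neg (by omega),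
      Finset.sum_eq_sum_Ico_succ_bot (by omega : k < p + 1)]
    have e1 : w' - (p - k : ℕ) * (Real.pi * Complex.I) =
        w + -((p - k : ℕ) + 1) * (Real.pi * Complex.I) := by rw [hw']; ring
    set T : ℝ := ∑ l ∈ Finset.Ico (k + 1) (p + 1), shiftParam a l
    have e3 : Complex.exp (Complex.I * Real.pi * (shiftParam a k + T : ℝ)) *
        Complex.exp (-(shiftParam a k * w)) = Complex.exp (-(shiftParam a k * w')) *
        Complex.exp (Complex.I * Real.pi * T) := by
      rw [← Complex.exp_add, ← Complex.exp_add, hw', Complex.ofReal_add]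
      congr 1
      ring
    rw [e1, e3, mul_assoc]

/-- Near the negative axis `entry_odd`, taken at w - πi, turns the corrected column into a multiple
of the next one at w - 2πi, whose imaginary part is at most -π. -/
lemma entry_asymp_odd_left (hp : p ≠ 0) (i : ℕ) {k : ℕ} (hk : k < p) (h2 : k % 2 = 1) :
    ∃ K : ℝ, 0 ≤ K ∧ ∀ w : ℂ, (i : ℝ) ≤ w.re → 0 ≤ w.im → w.im ≤ Real.pi →
      ‖entry p a 1 i k w + Complex.exp (Complex.I * Real.pi * a (k + 1)) *
        Complex.exp (-(a (k + 1) * w)) * entry p a 1 i (k + 1) w -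
        leadTerm p (shiftParam a) i k w‖ ≤
        K * Real.exp (-(w.re / (p + 1))) * ‖leadTerm p (shiftParam a) i k w‖ := by
  have hpi := Real.pi_pos
  obtain ⟨K, hK0, hK⟩ := meijer_lower hp (shiftParam a) i (k := k + 1) hk
  refine ⟨K, hK0, fun w h3 h5 h6 => ?_⟩
  set w' : ℂ := w - 2 * (Real.pi * Complex.I) with hw'
  have hre : w'.re = w.re := by simp [hw']
  have him : w'.im = w.im - 2 * Real.pi := by simp [hw']
  have hcast : ((p - k : ℕ) : ℝ) = (p - (k + 1) : ℕ) + 1 := by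
    have : p - k = p - (k + 1) + 1 := by omega
    rw [this]; push_cast; ring
  have hcastC : ((p - k : ℕ) : ℂ) = (p - (k + 1) : ℕ) + 1 := by exact_mod_cast hcast
  have h7 : |w'.im - (p - (k + 1) : ℕ) * Real.pi| ≤ (p + 1) * Real.pi := by
    have h8 : ((p - k : ℕ) : ℝ) ≤ p := by exact_mod_cast Nat.sub_le p k
    have h9 : (0 : ℝ) ≤ (p - (k + 1) : ℕ) := by positivity
    rw [him, abs_le]
    constructor <;> nlinarith
  have h := hK (Complex.exp (Complex.I * Real.pi * a (k + 1)) * Complex.exp (-(a (k + 1) * w)) *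
    Complex.exp (-(shiftParam a (k + 1) * w'))) w'
    (by rw [hre]; exact h3) (Or.inr (by rw [him]; linarith)) h7
  rw [hre] at h
  refine leadTerm_bound h ?_ ?_ (norm_exp_I_pi _) rfl
  · have h8 := entry_odd (a := a) hk h2 1 i (w - Real.pi * Complex.I)
    have e1 : w - Real.pi * Complex.I - Real.pi * Complex.I = w' := by rw [hw']; ring
    have e2 : Complex.exp (-(a (k + 1) * (w - Real.pi * Complex.I))) =
        Complex.exp (Complex.I * Real.pi * a (k + 1)) * Complex.exp (-(a (k + 1) * w)) := by
      rw [← Complex.exp_add]; congr 1; ring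
    rw [sub_add_cancel, e1, e2, entry_of_even (by omega : (k + 1) % 2 = 0) 1 i w'] at h8
    rw [h8]
    ring
  · rw [leadTerm, dominantIndex_odd hk.le h2, columnPhase, if_neg (by omega),
      Finset.sum_eq_sum_Ico_succ_bot (by omega : k < p + 1), sum_Ico_shift hk]
    have e1 : w' - (p - (k + 1) : ℕ) * (Real.pi * Complex.I) =
        w + -((p - k : ℕ) + 1) * (Real.pi * Complex.I) := by rw [hw', hcastC]; ring
    set T : ℝ := ∑ l ∈ Finset.Ico (k + 1 + 1) (p + 1), shiftParam a l
    have e3 : Complex.exp (Complex.I * Real.pi * (shiftParam a k + (shiftParam a (k + 1) + T) : ℝ)) *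
        Complex.exp (-(shiftParam a k * w)) = Complex.exp (Complex.I * Real.pi * a (k + 1)) *
        Complex.exp (-(a (k + 1) * w)) * Complex.exp (-(shiftParam a (k + 1) * w')) *
        Complex.exp (Complex.I * Real.pi * T) := by
      rw [← Complex.exp_add, ← Complex.exp_add, ← Complex.exp_add, ← Complex.exp_add, hw',
        Complex.ofReal_add, Complex.ofReal_add, ofReal_shiftParam_succ]
      congr 1
      ring
    rw [e1, e3, mul_assoc]

end CauchyChain
end

noncomputable section
namespace CauchyChain

variable {p : ℕ} {a : ℕ → ℝ}

/-! ### The matrix function at infinity -/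

/-- `θ` is the argument of a point of one of the open sectors of the upper half plane. -/
def UpperSector (θ : ℝ) : Prop :=
  (0 < θ ∧ θ < Real.pi / 4) ∨ (Real.pi / 4 < θ ∧ θ < 3 * Real.pi / 4) ∨
    (3 * Real.pi / 4 < θ ∧ θ < Real.pi)

lemma UpperSector.pos {θ : ℝ} (h : UpperSector θ) : 0 < θ := by
  have := Real.pi_pos
  rcases h with h | h | h <;> linarith [h.1]

lemma UpperSector.lt_pi {θ : ℝ} (h : UpperSector θ) : θ < Real.pi := by
  have := Real.pi_pos
  rcases h with h | h | h <;> linarith [h.2]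

lemma upperSector_of_im_pos {ζ : ℂ} (hζ : ζ ∉ jumpContour) (h : 0 < ζ.im) :
    UpperSector ζ.arg := by
  have h0 : 0 ≤ ζ.arg := Complex.arg_nonneg_iff.2 h.le
  have hpi := Real.pi_pos
  rcases sector_cases hζ with h1 | h1 | h1 | h1 | h1 | h1
  · exact Or.inl h1
  · exact Or.inr (Or.inl h1)
  · exact Or.inr (Or.inr h1)
  · linarith [h1.2]
  · linarith [h1.2]
  · linarith [h1.2]

lemma upperSector_neg_of_im_neg {ζ : ℂ} (hζ : ζ ∉ jumpContour) (h : ζ.im < 0) :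
    UpperSector (-ζ.arg) := by
  have h0 : ζ.arg < 0 := Complex.arg_neg_iff.2 h
  have hpi := Real.pi_pos
  rcases sector_cases hζ with h1 | h1 | h1 | h1 | h1 | h1
  · linarith [h1.1]
  · linarith [h1.1]
  · linarith [h1.1]
  · exact Or.inl ⟨by linarith [h1.2], by linarith [h1.1]⟩
  · exact Or.inr (Or.inl ⟨by linarith [h1.2], by linarith [h1.1]⟩)
  · exact Or.inr (Or.inr ⟨by linarith [h1.2], by linarith [h1.1]⟩)

lemma sectorEntry_eq_entry {ε : ℝ} {s : ℕ} {c : ℕ → ℂ} {i k : ℕ} {w : ℂ}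
    (h : ¬ IsBlockStart p s (k + 1)) : sectorEntry p a ε s c i k w = entry p a ε i k w := by
  rw [sectorEntry, if_neg h, add_zero]

lemma sectorEntry_zero {ε : ℝ} {s : ℕ} {i k : ℕ} {w : ℂ} :
    sectorEntry p a ε s (fun _ => 0) i k w = entry p a ε i k w := by
  simp [sectorEntry]

/-- Even columns are modified only in the right sector and odd ones only in the left sector, exactly
where their bare asymptotics fail. The last column is a single translate and needs no correction. -/
theorem bareParametrix_upper (hp : p ≠ 0) {R h : ℝ} (hR : 0 < R) (hh : 0 < h)
    (hL : ∀ k l : ℕ, 1 ≤ k → k ≤ l → l ≤ p → -partialSum a k l < R) (i k : Fin (p + 1)) :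
    ∃ K : ℝ, ∀ ζ : ℂ, UpperSector ζ.arg → (i : ℝ) ≤ (Complex.log ζ).re →
      ‖bareParametrix p a R h ζ i k - leadTerm p (shiftParam a) i k (Complex.log ζ)‖ ≤
        K * Real.exp (-((Complex.log ζ).re / (p + 1))) *
          ‖leadTerm p (shiftParam a) i k (Complex.log ζ)‖ := by
  have hpi := Real.pi_pos
  have hmono : ∀ {K K' e t x : ℝ}, 0 ≤ e → 0 ≤ t → K ≤ K' → x ≤ K * e * t → x ≤ K' * e * t :=
    fun he ht hK hx => hx.trans (by gcongr)
  obtain ⟨k, hk⟩ := k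
  obtain ⟨i, hi⟩ := i
  dsimp only
  have htop : ∀ ζ : ℂ, Real.pi / 4 < ζ.arg → ζ.arg < 3 * Real.pi / 4 →
      bareParametrix p a R h ζ ⟨i, hi⟩ ⟨k, hk⟩ = entry p a 1 i k (Complex.log ζ) := fun ζ h1 h2 => by
    rw [bareParametrix_sector_top hR hh hL h1 h2 1]
    exact sectorEntry_zero
  have hright : ∀ ζ : ℂ, 0 < ζ.arg → ζ.arg < Real.pi / 4 →
      bareParametrix p a R h ζ ⟨i, hi⟩ ⟨k, hk⟩ =
        sectorEntry p a 1 1 (fun _ => -1) i k (Complex.log ζ) := fun ζ h1 h2 => by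
    rw [bareParametrix_sector_right_up hR hh hL h1 h2]
    rfl
  have hleft : ∀ ζ : ℂ, 3 * Real.pi / 4 < ζ.arg → ζ.arg < Real.pi →
      bareParametrix p a R h ζ ⟨i, hi⟩ ⟨k, hk⟩ =
        sectorEntry p a 1 2 (fun m => Complex.exp (Complex.I * Real.pi * a m)) i k
          (Complex.log ζ) := fun ζ h1 h2 => by
    rw [bareParametrix_sector_left_up hR hh hL h1 h2]
    rfl
  rcases Nat.mod_two_eq_zero_or_one k with h2 | h2
  · obtain ⟨K, hK0, hK⟩ := entry_asymp_even (a := a) hp i (by omega : k ≤ p) h2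
    have hnot : ¬ IsBlockStart p 2 (k + 1) := by unfold IsBlockStart; omega
    rcases eq_or_ne k p with hkp | hkp
    · have hnot' : ¬ IsBlockStart p 1 (k + 1) := by unfold IsBlockStart; omega
      refine ⟨K, fun ζ hζ hre => ?_⟩
      have him := Complex.log_im ζ
      have hb := hK _ hre (Or.inl hkp) (by rw [him]; exact hζ.pos.le) (by rw [him]; exact hζ.lt_pi.le)
      rcases hζ with h1 | h1 | h1
      · rwa [hright ζ h1.1 h1.2, sectorEntry_eq_entry hnot']
      · rwa [htop ζ h1.1 h1.2]
      · rwa [hleft ζ h1.1 h1.2, sectorEntry_eq_entry hnot]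
    · have hlt : k < p := by omega
      obtain ⟨K', hK0', hK'⟩ := entry_asymp_even_right (a := a) hp i hlt h2
      refine ⟨K + K', fun ζ hζ hre => ?_⟩
      have him := Complex.log_im ζ
      have hge := hζ.pos.le
      have hle := hζ.lt_pi.le
      rw [← him] at hge hle
      rcases hζ with h1 | h1 | h1
      · have hyes : IsBlockStart p 1 (k + 1) := by unfold IsBlockStart; omega
        refine hmono (Real.exp_pos _).le (norm_nonneg _) (by linarith : K' ≤ K + K') ?_
        have hb := hK' _ hre hge hle
        rw [hright ζ h1.1 h1.2, sectorEntry, if_pos hyes, neg_one_mul, neg_mul, ← sub_eq_add_neg]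
        exact hb
      · refine hmono (Real.exp_pos _).le (norm_nonneg _) (by linarith : K ≤ K + K') ?_
        rw [htop ζ h1.1 h1.2]
        exact hK _ hre (Or.inr (by rw [him]; exact h1.1.le)) hge hle
      · refine hmono (Real.exp_pos _).le (norm_nonneg _) (by linarith : K ≤ K + K') ?_
        rw [hleft ζ h1.1 h1.2, sectorEntry_eq_entry hnot]
        exact hK _ hre (Or.inr (by rw [him]; linarith [h1.1])) hge hle
  · obtain ⟨K, hK0, hK⟩ := entry_asymp_odd (a := a) hp i (by omega : k ≤ p) h2
    have hnot : ¬ IsBlockStart p 1 (k + 1) := by unfold IsBlockStart; omega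
    rcases eq_or_ne k p with hkp | hkp
    · have hnot' : ¬ IsBlockStart p 2 (k + 1) := by unfold IsBlockStart; omega
      refine ⟨K, fun ζ hζ hre => ?_⟩
      have him := Complex.log_im ζ
      have hb := hK _ hre (Or.inl hkp) (by rw [him]; exact hζ.pos.le) (by rw [him]; exact hζ.lt_pi.le)
      rcases hζ with h1 | h1 | h1
      · rwa [hright ζ h1.1 h1.2, sectorEntry_eq_entry hnot]
      · rwa [htop ζ h1.1 h1.2]
      · rwa [hleft ζ h1.1 h1.2, sectorEntry_eq_entry hnot']
    · have hlt : k < p := by omega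
      obtain ⟨K', hK0', hK'⟩ := entry_asymp_odd_left (a := a) hp i hlt h2
      refine ⟨K + K', fun ζ hζ hre => ?_⟩
      have him := Complex.log_im ζ
      have hge := hζ.pos.le
      have hle := hζ.lt_pi.le
      rw [← him] at hge hle
      rcases hζ with h1 | h1 | h1
      · refine hmono (Real.exp_pos _).le (norm_nonneg _) (by linarith : K ≤ K + K') ?_
        rw [hright ζ h1.1 h1.2, sectorEntry_eq_entry hnot]
        exact hK _ hre (Or.inr (by rw [him]; linarith [h1.2])) hge hle
      · refine hmono (Real.exp_pos _).le (norm_nonneg _) (by linarith : K ≤ K + K') ?_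
        rw [htop ζ h1.1 h1.2]
        exact hK _ hre (Or.inr (by rw [him]; exact h1.2.le)) hge hle
      · have hyes : IsBlockStart p 2 (k + 1) := by unfold IsBlockStart; omega
        refine hmono (Real.exp_pos _).le (norm_nonneg _) (by linarith : K' ≤ K + K') ?_
        rw [hleft ζ h1.1 h1.2, sectorEntry, if_pos hyes]
        exact hK' _ hre hge hle

/-! ### Conjugation -/

lemma sectorEntry_conj {s : ℕ} {c c' : ℕ → ℂ} {i k : ℕ} (hk : k ≤ p)
    (hc : c' (k + 1) = -starRingEnd ℂ (c (k + 1))) (w : ℂ) :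
    sectorEntry p a (-1) s c' i k (starRingEnd ℂ w) =
      (-1) ^ (p - k) * starRingEnd ℂ (sectorEntry p a 1 s c i k w) := by
  unfold sectorEntry
  rw [entry_conj hk]
  by_cases h : IsBlockStart p s (k + 1)
  · have h1 : p - k = p - (k + 1) + 1 := by have := h.2.2; omega
    rw [if_pos h, if_pos h, entry_conj h.2.2, hc, h1, pow_succ, map_add, map_mul, map_mul,
      ← Complex.exp_conj]
    simp
    ring
  · rw [if_neg h, if_neg h, add_zero, add_zero]

/-- The sign (-1)^{p-k} alternates between neighbouring columns, and the sector coefficients below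
and above the axis are negative conjugates of each other, so the symmetry survives the triangular
factors. It reduces the lower half plane to the upper one. -/
lemma bareParametrix_conj {R h : ℝ} (hR : 0 < R) (hh : 0 < h)
    (hL : ∀ k l : ℕ, 1 ≤ k → k ≤ l → l ≤ p → -partialSum a k l < R) {ζ : ℂ}
    (hζ : UpperSector ζ.arg) (i k : Fin (p + 1)) :
    bareParametrix p a R h (starRingEnd ℂ ζ) i k =
      (-1) ^ (p - k : ℕ) * starRingEnd ℂ (bareParametrix p a R h ζ i k) := by
  have harg : (starRingEnd ℂ ζ).arg = -ζ.arg := by rw [Complex.arg_conj, if_neg hζ.lt_pi.ne]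
  have hlog : Complex.log (starRingEnd ℂ ζ) = starRingEnd ℂ (Complex.log ζ) :=
    Complex.log_conj ζ hζ.lt_pi.ne
  have hk : (k : ℕ) ≤ p := by omega
  rcases hζ with h1 | h1 | h1
  · rw [bareParametrix_sector_right_up hR hh hL h1.1 h1.2,
      bareParametrix_sector_right_down hR hh hL (by linarith [h1.1]) (by linarith [h1.2]), hlog]
    change sectorEntry p a (-1) 1 (fun _ => 1) i k _ = (-1) ^ (p - k : ℕ) *
      starRingEnd ℂ (sectorEntry p a 1 1 (fun _ => -1) i k _)
    refine sectorEntry_conj hk ?_ _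
    simp
  · rw [bareParametrix_sector_top hR hh hL h1.1 h1.2 1,
      bareParametrix_sector_bottom hR hh hL (by linarith [h1.1]) (by linarith [h1.2]) 1, hlog]
    change sectorEntry p a (-1) 1 (fun _ => 0) i k _ = (-1) ^ (p - k : ℕ) *
      starRingEnd ℂ (sectorEntry p a 1 1 (fun _ => 0) i k _)
    refine sectorEntry_conj hk ?_ _
    simp
  · rw [bareParametrix_sector_left_up hR hh hL h1.1 h1.2,
      bareParametrix_sector_left_down hR hh hL (by linarith [h1.1]) (by linarith [h1.2]), hlog]
    change sectorEntry p a (-1) 2 (fun m => -Complex.exp (-(Complex.I * Real.pi * a m))) i k _ =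
      (-1) ^ (p - k : ℕ) * starRingEnd ℂ
        (sectorEntry p a 1 2 (fun m => Complex.exp (Complex.I * Real.pi * a m)) i k _)
    refine sectorEntry_conj hk ?_ _
    simp [← Complex.exp_conj]

/-! ### The expansion at infinity -/

/-- The product of the scalar factors of the entry `(i, k)` of the expansion at infinity. -/
def infScale (p : ℕ) (A : ℕ → ℝ) (ε : ℝ) (i k : Fin (p + 1)) (w : ℂ) : ℂ :=
  Complex.exp (w * (-((p : ℂ) - 2 * (i : ℕ)) / (2 * (p + 1)))) *
    Complex.exp (w * ((A (k + 1) : ℂ) / (p + 1))) *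
    Complex.exp (-(p + 1) * Complex.exp (w * (1 / ((p : ℂ) + 1))) * omegaDiag p ε k)

lemma infScale_ne_zero (p : ℕ) (A : ℕ → ℝ) (ε : ℝ) (i k : Fin (p + 1)) (w : ℂ) :
    infScale p A ε i k w ≠ 0 :=
  mul_ne_zero (mul_ne_zero (Complex.exp_ne_zero _) (Complex.exp_ne_zero _)) (Complex.exp_ne_zero _)

lemma infScale_conj (p : ℕ) (A : ℕ → ℝ) (i k : Fin (p + 1)) (w : ℂ) :
    infScale p A (-1) i k (starRingEnd ℂ w) = starRingEnd ℂ (infScale p A 1 i k w) := by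
  have h2 : starRingEnd ℂ 2 = 2 := map_ofNat _ 2
  simp only [infScale, omegaDiag_neg, map_mul, ← Complex.exp_conj]
  simp [h2]

/-- The exponents of ζ match because -b_k + (i + β)/(p + 1) = (2i - p)/(2(p + 1)) + A_{k+1}/(p + 1),
with β = Σ b_l - p/2 and A_{k+1} = Σ b_l - (p + 1) b_k. -/
lemma leadTerm_eq (hp : p ≠ 0) {A b : ℕ → ℝ}
    (hA : ∀ k ≤ p, A (k + 1) = ∑ l ∈ Finset.range (p + 1), b l - (p + 1) * b k)
    (i k : Fin (p + 1)) (w : ℂ) :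
    leadTerm p b i k w = upperCoeff p b i k * infScale p A 1 i k w := by
  have hp1 : (p : ℂ) + 1 ≠ 0 := by exact_mod_cast p.succ_ne_zero
  have hβ := leadingExponent_succ (p := p) b
  have hAk := hA k (by omega)
  rw [infScale, omegaDiag_apply hp, leadTerm, upperCoeff, leadingSize, leading]
  set β := leadingExponent (p + 1) b
  have e1 : (w + dominantIndex p k * (Real.pi * Complex.I)) / ((p + 1 : ℕ) : ℂ) =
      w * (1 / (p + 1)) + Complex.I * Real.pi * dominantIndex p k / (p + 1) := by
    push_cast; ring
  rw [e1, Complex.exp_add (w * (1 / (p + 1))), ← dominantPoint, mul_add (β : ℂ), Complex.exp_add,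
    neg_mul_eq_mul_neg (Complex.exp (w * (1 / (p + 1)))), mul_pow, ← Complex.exp_nat_mul]
  have e2 : Complex.exp (-(b k * w)) * Complex.exp ((i : ℕ) * (w * (1 / (p + 1)))) *
      Complex.exp (β * (w * (1 / (p + 1)))) =
      Complex.exp (w * (-((p : ℂ) - 2 * (i : ℕ)) / (2 * (p + 1)))) *
        Complex.exp (w * ((A (k + 1) : ℂ) / (p + 1))) := by
    rw [← Complex.exp_add, ← Complex.exp_add, ← Complex.exp_add, hAk, hβ]
    congr 1
    push_cast
    field_simp
    ring
  have e3 : Complex.exp (-(((p + 1 : ℕ) : ℂ) * (Complex.exp (w * (1 / (p + 1))) * dominantPoint p k))) =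
      Complex.exp (-(p + 1) * Complex.exp (w * (1 / (p + 1))) * dominantPoint p k) := by
    congr 1; push_cast; ring
  rw [e3]
  linear_combination (columnPhase p b k * (-dominantPoint p k) ^ (i : ℕ) *
    Complex.exp (β * (Complex.I * Real.pi * dominantIndex p k / (p + 1))) *
    Complex.exp (-(p + 1) * Complex.exp (w * (1 / (p + 1))) * dominantPoint p k)) * e2

/-- The scale of an entry is a row factor times a column factor, so dividing entrywise removes both
diagonal matrices and leaves M = U + O(·). Since U is invertible, E = U⁻¹(M - U) moves the error to
the right of U. -/
lemma hasAsymptotics_of_bound {A : ℕ → ℝ} {ε : ℝ} (hU : IsUnit (matrixU p A ε).det)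
    {G : ℂ → Matrix (Fin (p + 1)) (Fin (p + 1)) ℂ}
    (hb : ∀ i k, ∃ K : ℝ, ∀ᶠ ζ in atInfinity ε,
      ‖G ζ i k - matrixU p A ε i k * infScale p A ε i k (Complex.log ζ)‖ ≤
        K * ‖ζ‖ ^ (-(1 / ((p : ℝ) + 1))) * ‖infScale p A ε i k (Complex.log ζ)‖) :
    HasAsymptotics p A G ε := by
  set U := matrixU p A ε
  let M : ℂ → Matrix (Fin (p + 1)) (Fin (p + 1)) ℂ := fun ζ =>
    Matrix.of fun i k => G ζ i k * (infScale p A ε i k (Complex.log ζ))⁻¹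
  have hM : ∀ i k, (fun ζ => M ζ i k - U i k) =O[atInfinity ε]
      fun ζ => ‖ζ‖ ^ (-(1 / ((p : ℝ) + 1))) := by
    intro i k
    obtain ⟨K, hK⟩ := hb i k
    refine IsBigO.of_bound K ?_
    filter_upwards [hK] with ζ hζ
    have h0 := infScale_ne_zero p A ε i k (Complex.log ζ)
    have e : M ζ i k - U i k = (G ζ i k - U i k * infScale p A ε i k (Complex.log ζ)) *
        (infScale p A ε i k (Complex.log ζ))⁻¹ := by
      rw [sub_mul, mul_inv_cancel_right₀ h0]; rfl
    rw [e, norm_mul, norm_inv, ← div_eq_mul_inv, div_le_iff₀ (norm_pos_iff.2 h0), Real.norm_eq_abs,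
      abs_of_nonneg (Real.rpow_nonneg (norm_nonneg _) _)]
    exact hζ
  refine ⟨fun ζ => U⁻¹ * (M ζ - U), fun i k => ?_, ?_⟩
  · simp only [Matrix.mul_apply, Matrix.sub_apply]
    exact IsBigO.fun_sum fun j _ => (hM j k).const_mul_left _
  · have h0 : ∀ᶠ ζ : ℂ in atInfinity ε, 1 ≤ ‖ζ‖ :=
      (eventually_cobounded_le_norm (1 : ℝ)).filter_mono inf_le_left
    filter_upwards [h0] with ζ hζ
    have hζ0 : ζ ≠ 0 := fun h => by rw [h, norm_zero] at hζ; linarith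
    have e : U * (1 + U⁻¹ * (M ζ - U)) = M ζ := by
      rw [mul_add, mul_one, Matrix.mul_nonsing_inv_cancel_left _ _ hU, add_sub_cancel]
    rw [mul_assoc (Matrix.diagonal _) U, e]
    ext i k
    rw [Matrix.mul_diagonal, Matrix.mul_diagonal, Matrix.diagonal_mul]
    have h1 := infScale_ne_zero p A ε i k (Complex.log ζ)
    have h2 : ζ ^ (-((p : ℂ) - 2 * (i : ℕ)) / (2 * (p + 1))) * ζ ^ ((A (k + 1) : ℂ) / (p + 1)) *
        Complex.exp (-(p + 1) * ζ ^ (1 / ((p : ℂ) + 1)) * omegaDiag p ε k) =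
        infScale p A ε i k (Complex.log ζ) := by
      rw [infScale, Complex.cpow_def_of_ne_zero hζ0, Complex.cpow_def_of_ne_zero hζ0,
        Complex.cpow_def_of_ne_zero hζ0]
    change _ = _ * (G ζ i k * (infScale p A ε i k (Complex.log ζ))⁻¹) * _ * _
    set X := infScale p A ε i k (Complex.log ζ)
    linear_combination (-G ζ i k * X⁻¹) * h2 - G ζ i k * inv_mul_cancel₀ h1

lemma norm_rpow_eq (p : ℕ) {ζ : ℂ} (hζ : ζ ≠ 0) :
    Real.exp (-((Complex.log ζ).re / (p + 1))) = ‖ζ‖ ^ (-(1 / ((p : ℝ) + 1))) := by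
  rw [Real.rpow_def_of_pos (norm_pos_iff.2 hζ), Complex.log_re]
  congr 1
  ring

theorem hasAsymptotics_plus (hp : p ≠ 0) {R h : ℝ} (hR : 0 < R) (hh : 0 < h)
    (hL : ∀ k l : ℕ, 1 ≤ k → k ≤ l → l ≤ p → -partialSum a k l < R) {A : ℕ → ℝ}
    (hA : ∀ k ≤ p, A (k + 1) =
      ∑ l ∈ Finset.range (p + 1), shiftParam a l - (p + 1) * shiftParam a k) :
    HasAsymptotics p A (bareParametrix p a R h) 1 := by
  refine hasAsymptotics_of_bound (matrixU_isUnit_det hp hA (Or.inl rfl)) fun i k => ?_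
  obtain ⟨K, hK⟩ := bareParametrix_upper hp hR hh hL i k
  refine ⟨K * ‖upperCoeff p (shiftParam a) i k‖, ?_⟩
  have h0 : ∀ᶠ ζ : ℂ in atInfinity 1, Real.exp i ≤ ‖ζ‖ :=
    (eventually_cobounded_le_norm (Real.exp i)).filter_mono inf_le_left
  have h1 : ∀ᶠ ζ : ℂ in atInfinity 1, ζ ∈ {ζ : ℂ | 0 < (1 : ℝ) * ζ.im} \ jumpContour :=
    (eventually_principal.2 fun _ h => h).filter_mono inf_le_right
  filter_upwards [h0, h1] with ζ h2 h3
  have hζ0 : ζ ≠ 0 := fun h => by rw [h, norm_zero] at h2; linarith [Real.exp_pos (i : ℝ)]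
  have h4 : 0 < (1 : ℝ) * ζ.im := h3.1
  rw [one_mul] at h4
  have h5 := hK ζ (upperSector_of_im_pos h3.2 h4)
    (by rw [Complex.log_re, Real.le_log_iff_exp_le (norm_pos_iff.2 hζ0)]; exact h2)
  rw [leadTerm_eq hp hA, norm_rpow_eq p hζ0, norm_mul] at h5
  rw [matrixU, if_pos one_pos, matrixUplus_apply hp hA]
  exact h5.trans_eq (by ring)

theorem hasAsymptotics_minus (hp : p ≠ 0) {R h : ℝ} (hR : 0 < R) (hh : 0 < h)
    (hL : ∀ k l : ℕ, 1 ≤ k → k ≤ l → l ≤ p → -partialSum a k l < R) {A : ℕ → ℝ}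
    (hA : ∀ k ≤ p, A (k + 1) =
      ∑ l ∈ Finset.range (p + 1), shiftParam a l - (p + 1) * shiftParam a k) :
    HasAsymptotics p A (bareParametrix p a R h) (-1) := by
  refine hasAsymptotics_of_bound (matrixU_isUnit_det hp hA (Or.inr rfl)) fun i k => ?_
  obtain ⟨K, hK⟩ := bareParametrix_upper hp hR hh hL i k
  refine ⟨K * ‖upperCoeff p (shiftParam a) i k‖, ?_⟩
  have h0 : ∀ᶠ ζ : ℂ in atInfinity (-1), Real.exp i ≤ ‖ζ‖ :=
    (eventually_cobounded_le_norm (Real.exp i)).filter_mono inf_le_left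
  have h1 : ∀ᶠ ζ : ℂ in atInfinity (-1), ζ ∈ {ζ : ℂ | 0 < (-1 : ℝ) * ζ.im} \ jumpContour :=
    (eventually_principal.2 fun _ h => h).filter_mono inf_le_right
  filter_upwards [h0, h1] with ζ h2 h3
  have hζ0 : ζ ≠ 0 := fun h => by rw [h, norm_zero] at h2; linarith [Real.exp_pos (i : ℝ)]
  have h4 : 0 < (-1 : ℝ) * ζ.im := h3.1
  have h4' : ζ.im < 0 := by linarith
  obtain ⟨η, hη⟩ : ∃ η, η = starRingEnd ℂ ζ := ⟨_, rfl⟩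
  have hζη : ζ = starRingEnd ℂ η := by rw [hη, Complex.conj_conj]
  have hη0 : η ≠ 0 := fun h => hζ0 (by rw [hζη, h, map_zero])
  have harg : η.arg = -ζ.arg := by
    rw [hη, Complex.arg_conj, if_neg]
    exact fun h => by linarith [Complex.arg_neg_iff.2 h4', Real.pi_pos]
  have hsec : UpperSector η.arg := by rw [harg]; exact upperSector_neg_of_im_neg h3.2 h4'
  have hnorm : ‖ζ‖ = ‖η‖ := by rw [hη, Complex.norm_conj]
  rw [hnorm] at h2 ⊢
  have h5 := hK η hsec
    (by rw [Complex.log_re, Real.le_log_iff_exp_le (norm_pos_iff.2 hη0)]; exact h2)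
  rw [leadTerm_eq hp hA, norm_rpow_eq p hη0, norm_mul] at h5
  rw [hζη, matrixU_neg hp hA, bareParametrix_conj hR hh hL hsec, Complex.log_conj η hsec.lt_pi.ne,
    infScale_conj, mul_assoc, ← map_mul, ← mul_sub, ← map_sub, norm_mul, norm_pow, norm_neg, norm_one,
    one_pow, one_mul, Complex.norm_conj, Complex.norm_conj]
  exact h5.trans_eq (by ring)

end CauchyChain
end

noncomputable section
namespace CauchyChain

/-! ### Stieltjes transforms of powers with logarithms -/

/-- The function `x ^ c * (1 - log x) ^ n`. -/
def logRate (c : ℝ) (n : ℕ) (x : ℝ) : ℝ := x ^ c * (1 - Real.log x) ^ n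

lemma one_le_one_sub_log {x : ℝ} (hx : 0 < x) (h1 : x ≤ 1) : 1 ≤ 1 - Real.log x := by
  linarith [Real.log_nonpos hx.le h1]

lemma logRate_pos {c : ℝ} {n : ℕ} {x : ℝ} (hx : 0 < x) (h1 : x ≤ 1) : 0 < logRate c n x :=
  mul_pos (Real.rpow_pos_of_pos hx c) (pow_pos (by linarith [one_le_one_sub_log hx h1]) n)

lemma measurable_logRate (c : ℝ) (n : ℕ) : Measurable (logRate c n) := by
  unfold logRate
  exact (measurable_id.pow_const c).mul ((measurable_const.sub Real.measurable_log).pow_const n)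

/-- Replaces logarithms at x by logarithms at y: there is no loss for x ≥ y, and for x < y the
excess log(y/x) is smaller than any power of y/x. -/
lemma one_sub_log_pow_le (n : ℕ) {δ : ℝ} (hδ : 0 < δ) : ∃ C : ℝ, 0 < C ∧ ∀ x y : ℝ, 0 < x → x ≤ 1 →
    0 < y → y ≤ 1 → (1 - Real.log x) ^ n ≤ C * (1 - Real.log y) ^ n * (1 + (y / x) ^ δ) := by
  -- The n-th power of t^η must stay below t^δ, also for n = 0.
  set η : ℝ := δ / (n + 1) with hη
  have hη0 : 0 < η := by positivity
  refine ⟨(1 + 1 / η) ^ n, by positivity, fun x y hx hx1 hy hy1 => ?_⟩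
  have hLx := one_le_one_sub_log hx hx1
  have hLy := one_le_one_sub_log hy hy1
  have hC : 1 ≤ (1 + 1 / η) ^ n := one_le_pow₀ (by linarith [one_div_pos.2 hη0])
  have hpow : 0 ≤ (y / x) ^ δ := Real.rpow_nonneg (by positivity) δ
  rcases le_total y x with hyx | hxy
  · have h1 : (1 - Real.log x) ^ n ≤ (1 - Real.log y) ^ n :=
      pow_le_pow_left₀ (by linarith) (by linarith [Real.log_le_log hy hyx]) n
    calc (1 - Real.log x) ^ n ≤ 1 * (1 - Real.log y) ^ n * 1 := by linarith
      _ ≤ _ := by gcongr; linarith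
  · set t := y / x with ht
    have ht1 : 1 ≤ t := (one_le_div hx).2 hxy
    have ht0 : 0 < t := by linarith
    have hlog : Real.log t = Real.log y - Real.log x := Real.log_div hy.ne' hx.ne'
    have hlt : 0 ≤ Real.log t := Real.log_nonneg ht1
    have h1 : 1 - Real.log x ≤ (1 - Real.log y) * ((1 + 1 / η) * t ^ η) := by
      have h2 : Real.log t ≤ t ^ η / η := Real.log_le_rpow_div ht0.le hη0
      have h3 : 1 ≤ t ^ η := Real.one_le_rpow ht1 hη0.le
      have h4 : 1 + Real.log t ≤ (1 + 1 / η) * t ^ η := by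
        rw [add_mul, one_mul, one_div_mul_eq_div]; linarith
      calc 1 - Real.log x = (1 - Real.log y) + Real.log t := by rw [hlog]; ring
        _ ≤ (1 - Real.log y) * (1 + Real.log t) := by nlinarith
        _ ≤ _ := mul_le_mul_of_nonneg_left h4 (by linarith)
    have h5 : (t ^ η) ^ n ≤ t ^ δ := by
      rw [← Real.rpow_natCast, ← Real.rpow_mul ht0.le]
      refine Real.rpow_le_rpow_of_exponent_le ht1 ?_
      rw [hη, div_mul_eq_mul_div, div_le_iff₀ (by positivity)]
      nlinarith
    calc (1 - Real.log x) ^ n ≤ ((1 - Real.log y) * ((1 + 1 / η) * t ^ η)) ^ n :=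
          pow_le_pow_left₀ (by linarith) h1 n
      _ = (1 + 1 / η) ^ n * (1 - Real.log y) ^ n * (t ^ η) ^ n := by
          rw [mul_pow, mul_pow]; ring
      _ ≤ _ := by
          have h6 : (t ^ η) ^ n ≤ 1 + t ^ δ := by linarith
          gcongr

/-- With the logarithm frozen at y, Stieltjes transforms of powers with logarithms reduce to those
of the two pure powers x^c and x^{c-δ}. -/
lemma logRate_le (c : ℝ) (n : ℕ) {δ : ℝ} (hδ : 0 < δ) : ∃ C : ℝ, 0 < C ∧ ∀ x y : ℝ, 0 < x → x ≤ 1 →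
    0 < y → y ≤ 1 →
      logRate c n x ≤ C * (1 - Real.log y) ^ n * (x ^ c + y ^ δ * x ^ (c - δ)) := by
  obtain ⟨C, hC, h⟩ := one_sub_log_pow_le n hδ
  refine ⟨C, hC, fun x y hx hx1 hy hy1 => ?_⟩
  have h1 := h x y hx hx1 hy hy1
  have h2 : x ^ c + y ^ δ * x ^ (c - δ) = x ^ c * (1 + (y / x) ^ δ) := by
    rw [Real.div_rpow hy.le hx.le, Real.rpow_sub hx]; ring
  rw [h2, logRate]
  calc x ^ c * (1 - Real.log x) ^ n ≤ x ^ c * (C * (1 - Real.log y) ^ n * (1 + (y / x) ^ δ)) :=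
        mul_le_mul_of_nonneg_left h1 (Real.rpow_nonneg hx.le c)
    _ = _ := by ring

lemma intervalIntegrable_of_le {f g : ℝ → ℝ} (hg : IntervalIntegrable g volume 0 1)
    (hf : AEStronglyMeasurable f (volume.restrict (Set.Ioc 0 1)))
    (h : ∀ x, 0 < x → x ≤ 1 → |f x| ≤ g x) : IntervalIntegrable f volume 0 1 := by
  rw [← Set.uIoc_of_le zero_le_one] at hf
  refine hg.mono_fun' hf ?_
  rw [Set.uIoc_of_le zero_le_one]
  exact (ae_restrict_mem measurableSet_Ioc).mono fun x hx => h x hx.1 hx.2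

lemma intervalIntegrable_logRate {c : ℝ} (hc : -1 < c) (n : ℕ) :
    IntervalIntegrable (logRate c n) volume 0 1 := by
  set δ : ℝ := (c + 1) / 2 with hδ
  obtain ⟨C, hC, h⟩ := logRate_le c n (δ := δ) (by linarith)
  have h1 := (intervalIntegral.intervalIntegrable_rpow' (a := 0) (b := 1) hc)
  have h2 := (intervalIntegral.intervalIntegrable_rpow' (a := 0) (b := 1)
    (by linarith : -1 < c - δ))
  refine intervalIntegrable_of_le ((h1.add h2).const_mul C)
    (measurable_logRate c n).aestronglyMeasurable fun x hx hx1 => ?_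
  rw [abs_of_pos (logRate_pos hx hx1)]
  have := h x 1 hx hx1 one_pos le_rfl
  simpa using this

lemma intervalIntegrable_div_add {f : ℝ → ℝ} (hf : IntervalIntegrable f volume 0 1) {y : ℝ}
    (hy : 0 < y) : IntervalIntegrable (fun x => f x / (x + y)) volume 0 1 := by
  refine intervalIntegrable_of_le (hf.norm.mul_const y⁻¹) ?_ fun x hx _ => ?_
  · exact (hf.1.aestronglyMeasurable).mul
      ((measurable_id.add_const y).inv).aestronglyMeasurable
  · rw [abs_div, abs_of_pos (by linarith : 0 < x + y), div_eq_mul_inv, Real.norm_eq_abs]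
    gcongr
    linarith

lemma integral_mono_unit {f g : ℝ → ℝ} (hf : IntervalIntegrable f volume 0 1)
    (hg : IntervalIntegrable g volume 0 1) (h : ∀ x, 0 < x → x ≤ 1 → f x ≤ g x) :
    ∫ x in (0 : ℝ)..1, f x ≤ ∫ x in (0 : ℝ)..1, g x :=
  intervalIntegral.integral_mono_on_of_le_Ioo zero_le_one hf hg fun x hx => h x hx.1 hx.2.le

/-- Upper bounds for the Stieltjes transform of a power. -/
lemma stieltjes_rpow_neg {c : ℝ} (hc : -1 < c) (hc0 : c < 0) : ∃ C : ℝ, 0 < C ∧ ∀ y : ℝ, 0 < y →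
    y ≤ 1 → ∫ x in (0 : ℝ)..1, x ^ c / (x + y) ≤ C * y ^ c := by
  refine ⟨1 / (c + 1) + 1 / (-c), by
    have : 0 < 1 / (c + 1) := one_div_pos.2 (by linarith)
    have : 0 < 1 / (-c) := one_div_pos.2 (by linarith)
    linarith, fun y hy hy1 => ?_⟩
  have hI := intervalIntegral.intervalIntegrable_rpow' (a := 0) (b := 1) hc
  have hint := intervalIntegrable_div_add hI hy
  have hmem : y ∈ Set.uIcc (0 : ℝ) 1 := by rw [Set.uIcc_of_le zero_le_one]; exact ⟨hy.le, hy1⟩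
  have h1 : IntervalIntegrable (fun x => x ^ c / (x + y)) volume 0 y :=
    hint.mono_set (Set.uIcc_subset_uIcc Set.left_mem_uIcc hmem)
  have h2 : IntervalIntegrable (fun x => x ^ c / (x + y)) volume y 1 :=
    hint.mono_set (Set.uIcc_subset_uIcc hmem Set.right_mem_uIcc)
  have hn0 : (0 : ℝ) ∉ Set.uIcc y 1 := by
    rw [Set.uIcc_of_le hy1]; exact fun h => by linarith [h.1]
  have h3 : ∫ x in (0 : ℝ)..y, x ^ c / (x + y) ≤ y ^ c / (c + 1) := by
    have h4 : ∫ x in (0 : ℝ)..y, x ^ c / (x + y) ≤ ∫ x in (0 : ℝ)..y, x ^ c * y⁻¹ := by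
      refine intervalIntegral.integral_mono_on_of_le_Ioo hy.le h1
        ((intervalIntegral.intervalIntegrable_rpow' hc).mul_const _) fun x hx => ?_
      have h0 : 0 < x := hx.1
      rw [div_eq_mul_inv]
      have := Real.rpow_nonneg h0.le c
      gcongr
      linarith
    refine h4.trans_eq ?_
    rw [intervalIntegral.integral_mul_const, integral_rpow (Or.inl hc),
      Real.zero_rpow (by linarith), Real.rpow_add hy, Real.rpow_one]
    field_simp
    ring
  have h5 : ∫ x in y..1, x ^ c / (x + y) ≤ y ^ c / (-c) := by
    have h4 : ∫ x in y..1, x ^ c / (x + y) ≤ ∫ x in y..1, x ^ (c - 1) := by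
      refine intervalIntegral.integral_mono_on_of_le_Ioo hy1 h2
        (intervalIntegral.intervalIntegrable_rpow (Or.inr hn0)) fun x hx => ?_
      have h0 : 0 < x := hy.trans hx.1
      rw [Real.rpow_sub h0, Real.rpow_one]
      have := Real.rpow_nonneg h0.le c
      gcongr
      linarith
    refine h4.trans ?_
    rw [integral_rpow (Or.inr ⟨by linarith, hn0⟩), Real.one_rpow, sub_add_cancel,
      ← neg_div_neg_eq (1 - y ^ c) c]
    have : 0 < -c := by linarith
    gcongr
    linarith
  rw [← intervalIntegral.integral_add_adjacent_intervals h1 h2]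
  calc _ ≤ y ^ c / (c + 1) + y ^ c / (-c) := add_le_add h3 h5
    _ = _ := by ring

lemma stieltjes_one {y : ℝ} (hy : 0 < y) (hy1 : y ≤ 1) :
    ∫ x in (0 : ℝ)..1, x ^ (0 : ℝ) / (x + y) ≤ 1 - Real.log y := by
  simp only [Real.rpow_zero, one_div]
  rw [intervalIntegral.integral_comp_add_right (fun x => x⁻¹) y, zero_add,
    integral_inv_of_pos hy (by linarith), Real.log_div (by linarith) hy.ne']
  have := Real.log_le_sub_one_of_pos (by linarith : 0 < 1 + y)
  linarith

lemma stieltjes_rpow_pos {c : ℝ} (hc : 0 < c) {y : ℝ} (hy : 0 < y) :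
    ∫ x in (0 : ℝ)..1, x ^ c / (x + y) ≤ 1 / c := by
  have hI := intervalIntegral.intervalIntegrable_rpow' (a := 0) (b := 1) (by linarith : -1 < c)
  have h1 := integral_mono_unit (intervalIntegrable_div_add hI hy)
    (intervalIntegral.intervalIntegrable_rpow' (by linarith : -1 < c - 1)) fun x hx _ => by
      rw [Real.rpow_sub hx, Real.rpow_one]
      have := Real.rpow_nonneg hx.le c
      gcongr
      linarith
  refine h1.trans_eq ?_
  rw [integral_rpow (Or.inl (by linarith)), Real.one_rpow, sub_add_cancel, Real.zero_rpow hc.ne',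
    sub_zero]

lemma stieltjes_logRate_le_add {c : ℝ} (n : ℕ) {δ : ℝ} (hδ : 0 < δ) (hc : -1 < c - δ) :
    ∃ C : ℝ, 0 < C ∧ ∀ y : ℝ, 0 < y → y ≤ 1 → ∫ x in (0 : ℝ)..1, logRate c n x / (x + y) ≤
      C * (1 - Real.log y) ^ n * ((∫ x in (0 : ℝ)..1, x ^ c / (x + y)) +
        y ^ δ * ∫ x in (0 : ℝ)..1, x ^ (c - δ) / (x + y)) := by
  obtain ⟨C, hC, h⟩ := logRate_le c n hδ
  refine ⟨C, hC, fun y hy hy1 => ?_⟩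
  have i1 := intervalIntegrable_div_add
    (intervalIntegral.intervalIntegrable_rpow' (a := 0) (b := 1) (by linarith : -1 < c)) hy
  have i2 := intervalIntegrable_div_add
    (intervalIntegral.intervalIntegrable_rpow' (a := 0) (b := 1) hc) hy
  have i3 := intervalIntegrable_div_add (intervalIntegrable_logRate (by linarith : -1 < c) n) hy
  rw [← intervalIntegral.integral_const_mul, ← intervalIntegral.integral_add i1 (i2.const_mul _),
    ← intervalIntegral.integral_const_mul]
  refine integral_mono_unit i3 ((i1.add (i2.const_mul _)).const_mul _) fun x hx hx1 => ?_
  have h1 := h x y hx hx1 hy hy1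
  calc logRate c n x / (x + y) ≤
        (C * (1 - Real.log y) ^ n * (x ^ c + y ^ δ * x ^ (c - δ))) / (x + y) := by gcongr
    _ = _ := by ring

lemma stieltjes_logRate_upper_neg {c : ℝ} (hc : -1 < c) (hc0 : c < 0) (n : ℕ) : ∃ C : ℝ, 0 < C ∧
    ∀ y : ℝ, 0 < y → y ≤ 1 → ∫ x in (0 : ℝ)..1, logRate c n x / (x + y) ≤ C * logRate c n y := by
  -- With this choice c - δ = (c - 1)/2 stays strictly between -1 and 0.
  set δ : ℝ := (c + 1) / 2 with hδ
  obtain ⟨C, hC, h⟩ := stieltjes_logRate_le_add n (c := c) (δ := δ) (by linarith) (by linarith)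
  obtain ⟨C1, hC1, h1⟩ := stieltjes_rpow_neg hc hc0
  obtain ⟨C2, hC2, h2⟩ := stieltjes_rpow_neg (c := c - δ) (by linarith) (by linarith)
  refine ⟨C * (C1 + C2), by positivity, fun y hy hy1 => (h y hy hy1).trans ?_⟩
  have hL := one_le_one_sub_log hy hy1
  have e : y ^ δ * y ^ (c - δ) = y ^ c := by rw [← Real.rpow_add hy]; congr 1; ring
  calc _ ≤ C * (1 - Real.log y) ^ n * (C1 * y ^ c + y ^ δ * (C2 * y ^ (c - δ))) := by
        have := Real.rpow_nonneg hy.le δ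
        have : 0 ≤ 1 - Real.log y := by linarith
        gcongr
        · exact h1 y hy hy1
        · exact h2 y hy hy1
    _ = C * (1 - Real.log y) ^ n * (C1 * y ^ c + C2 * (y ^ δ * y ^ (c - δ))) := by ring
    _ = _ := by rw [e, logRate]; ring

lemma stieltjes_logRate_upper_zero (n : ℕ) : ∃ C : ℝ, 0 < C ∧
    ∀ y : ℝ, 0 < y → y ≤ 1 →
      ∫ x in (0 : ℝ)..1, logRate 0 n x / (x + y) ≤ C * logRate 0 (n + 1) y := by
  obtain ⟨C, hC, h⟩ := stieltjes_logRate_le_add n (c := 0) (δ := 1 / 2) (by norm_num) (by norm_num)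
  obtain ⟨C2, hC2, h2⟩ := stieltjes_rpow_neg (c := 0 - 1 / 2) (by norm_num) (by norm_num)
  refine ⟨C * (1 + C2), by positivity, fun y hy hy1 => (h y hy hy1).trans ?_⟩
  have hL := one_le_one_sub_log hy hy1
  have e : y ^ (1 / 2 : ℝ) * y ^ (0 - 1 / 2 : ℝ) = 1 := by
    rw [← Real.rpow_add hy]; norm_num
  have hL0 : 0 ≤ 1 - Real.log y := by linarith
  calc _ ≤ C * (1 - Real.log y) ^ n * ((1 - Real.log y) +
        y ^ (1 / 2 : ℝ) * (C2 * y ^ (0 - 1 / 2 : ℝ))) := by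
        have := Real.rpow_nonneg hy.le (1 / 2)
        gcongr
        · exact stieltjes_one hy hy1
        · exact h2 y hy hy1
    _ = C * (1 - Real.log y) ^ n * ((1 - Real.log y) + C2 *
        (y ^ (1 / 2 : ℝ) * y ^ (0 - 1 / 2 : ℝ))) := by ring
    _ ≤ C * (1 - Real.log y) ^ n * ((1 - Real.log y) + C2 * (1 - Real.log y)) := by
        rw [e]; gcongr
    _ = _ := by rw [logRate, Real.rpow_zero, pow_succ]; ring

lemma stieltjes_logRate_upper_pos {c : ℝ} (hc : 0 < c) (n : ℕ) : ∃ C : ℝ, 0 < C ∧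
    ∀ y : ℝ, 0 < y → y ≤ 1 →
      ∫ x in (0 : ℝ)..1, logRate c n x / (x + y) ≤ C * logRate 0 0 y := by
  obtain ⟨C, hC, h⟩ := logRate_le c n (δ := c / 2) (by linarith)
  refine ⟨C * (1 / c + 1 / (c / 2)), by positivity, fun y hy hy1 => ?_⟩
  have i1 := intervalIntegrable_div_add
    (intervalIntegral.intervalIntegrable_rpow' (a := 0) (b := 1) (by linarith : -1 < c)) hy
  have i2 := intervalIntegrable_div_add
    (intervalIntegral.intervalIntegrable_rpow' (a := 0) (b := 1) (by linarith : -1 < c / 2)) hy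
  have i3 := intervalIntegrable_div_add (intervalIntegrable_logRate (by linarith : -1 < c) n) hy
  have h1 := integral_mono_unit i3 ((i1.add i2).const_mul C) fun x hx hx1 => by
    have h1 := h x 1 hx hx1 one_pos le_rfl
    have e : c - c / 2 = c / 2 := by ring
    simp only [Real.log_one, sub_zero, one_pow, mul_one, Real.one_rpow, one_mul, e] at h1
    calc logRate c n x / (x + y) ≤ (C * (x ^ c + x ^ (c / 2))) / (x + y) := by gcongr
      _ = C * (x ^ c / (x + y) + x ^ (c / 2) / (x + y)) := by ring
  rw [intervalIntegral.integral_const_mul, intervalIntegral.integral_add i1 i2] at h1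
  refine h1.trans ?_
  have h2 := stieltjes_rpow_pos hc hy
  have h3 := stieltjes_rpow_pos (by linarith : 0 < c / 2) hy
  rw [logRate, Real.rpow_zero, pow_zero, mul_one, mul_one]
  gcongr

lemma stieltjes_logRate_nonneg {c : ℝ} {n : ℕ} {x y : ℝ} (hx : 0 < x) (hx1 : x ≤ 1) (hy : 0 < y) :
    0 ≤ logRate c n x / (x + y) := div_nonneg (logRate_pos hx hx1).le (by linarith)

/-- For c ≤ 0 the density is decreasing on (0, y), hence at least its value at y, while x + y ≤ 2y.
-/
lemma stieltjes_logRate_lower_part {c : ℝ} (hc : -1 < c) (hc0 : c ≤ 0) (n : ℕ) {y : ℝ} (hy : 0 < y)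
    (hy1 : y ≤ 1) : logRate c n y / 2 ≤ ∫ x in (0 : ℝ)..y, logRate c n x / (x + y) := by
  have hmem : y ∈ Set.uIcc (0 : ℝ) 1 := by rw [Set.uIcc_of_le zero_le_one]; exact ⟨hy.le, hy1⟩
  have hint := (intervalIntegrable_div_add (intervalIntegrable_logRate hc n) hy).mono_set
    (Set.uIcc_subset_uIcc Set.left_mem_uIcc hmem)
  have h1 : ∫ _x in (0 : ℝ)..y, logRate c n y / (2 * y) ≤
      ∫ x in (0 : ℝ)..y, logRate c n x / (x + y) := by
    refine intervalIntegral.integral_mono_on_of_le_Ioo hy.le intervalIntegrable_const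
      hint fun x hx => ?_
    have hx0 : 0 < x := hx.1
    have hxy : x < y := hx.2
    have h2 : logRate c n y ≤ logRate c n x := by
      unfold logRate
      have h3 : y ^ c ≤ x ^ c := Real.rpow_le_rpow_of_nonpos hx0 hxy.le hc0
      have h4 := Real.log_le_log hx0 hxy.le
      have h5 := one_le_one_sub_log hy hy1
      have h6 := Real.rpow_nonneg hx0.le c
      have h7 : 0 ≤ 1 - Real.log y := by linarith
      gcongr
    have h3 := (logRate_pos (c := c) (n := n) hy hy1).le
    gcongr
    · linarith
    · linarith
  refine le_trans (le_of_eq ?_) h1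
  rw [intervalIntegral.integral_const, sub_zero, smul_eq_mul]
  field_simp

lemma stieltjes_logRate_lower_neg {c : ℝ} (hc : -1 < c) (hc0 : c < 0) (n : ℕ) {y : ℝ} (hy : 0 < y)
    (hy1 : y ≤ 1) : 1 / 2 * logRate c n y ≤ ∫ x in (0 : ℝ)..1, logRate c n x / (x + y) := by
  have hint := intervalIntegrable_div_add (intervalIntegrable_logRate hc n) hy
  have h1 := intervalIntegral.integral_mono_interval le_rfl hy.le hy1
    ((ae_restrict_mem measurableSet_Ioc).mono fun x (hx : x ∈ Set.Ioc (0 : ℝ) 1) =>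
      stieltjes_logRate_nonneg (c := c) (n := n) hx.1 hx.2 hy) hint
  have h2 := stieltjes_logRate_lower_part hc hc0.le n hy hy1
  linarith

/-- On (y, 1) the bound 1/(x + y) ≥ 1/(2x) admits an explicit primitive and gives (L^{n+1} - 1)/(2(n
+ 1)) with L = 1 - log y; the missing 1/(2(n + 1)) is covered by the part over (0, y). -/
lemma stieltjes_logRate_lower_zero (n : ℕ) {y : ℝ} (hy : 0 < y) (hy1 : y ≤ 1) :
    1 / (2 * (n + 1)) * logRate 0 (n + 1) y ≤ ∫ x in (0 : ℝ)..1, logRate 0 n x / (x + y) := by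
  have hint := intervalIntegrable_div_add (intervalIntegrable_logRate (c := 0) (by norm_num) n) hy
  have hmem : y ∈ Set.uIcc (0 : ℝ) 1 := by rw [Set.uIcc_of_le zero_le_one]; exact ⟨hy.le, hy1⟩
  have i1 := hint.mono_set (Set.uIcc_subset_uIcc Set.left_mem_uIcc hmem)
  have i2 := hint.mono_set (Set.uIcc_subset_uIcc hmem Set.right_mem_uIcc)
  have h1 := stieltjes_logRate_lower_part (c := 0) (by norm_num) le_rfl n hy hy1
  have hL := one_le_one_sub_log hy hy1
  have hderiv : ∀ x ∈ Set.uIcc y 1, HasDerivAt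
      (fun x => -((1 - Real.log x) ^ (n + 1) / (2 * (n + 1)))) ((1 - Real.log x) ^ n / (2 * x)) x := by
    intro x hx
    rw [Set.uIcc_of_le hy1] at hx
    have hx0 : x ≠ 0 := by linarith [hx.1]
    have h3 := ((((Real.hasDerivAt_log hx0).const_sub 1).pow (n + 1)).div_const
      (2 * ((n : ℝ) + 1))).neg
    refine h3.congr_deriv ?_
    have : (n : ℝ) + 1 ≠ 0 := by positivity
    push_cast
    field_simp
  have hcont : ContinuousOn (fun x => (1 - Real.log x) ^ n / (2 * x)) (Set.uIcc y 1) := by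
    rw [Set.uIcc_of_le hy1]
    have h0 : ∀ x ∈ Set.Icc y 1, x ≠ 0 := fun x hx => by linarith [hx.1]
    exact ((continuousOn_const.sub (Real.continuousOn_log.mono h0)).pow n).div
      (continuousOn_const.mul continuousOn_id) fun x hx => mul_ne_zero two_ne_zero (h0 x hx)
  have h2 : ∫ x in y..1, (1 - Real.log x) ^ n / (2 * x) ≤
      ∫ x in y..1, logRate 0 n x / (x + y) := by
    refine intervalIntegral.integral_mono_on hy1 hcont.intervalIntegrable i2 fun x hx => ?_
    have hx0 : 0 < x := by linarith [hx.1]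
    have h4 := one_le_one_sub_log hx0 hx.2
    have h5 : 0 ≤ 1 - Real.log x := by linarith
    rw [logRate, Real.rpow_zero, one_mul]
    gcongr
    linarith [hx.1]
  rw [intervalIntegral.integral_eq_sub_of_hasDerivAt hderiv hcont.intervalIntegrable] at h2
  rw [← intervalIntegral.integral_add_adjacent_intervals i1 i2]
  have h6 : (1 : ℝ) / (2 * (n + 1)) ≤ 1 / 2 := by
    rw [div_le_div_iff_of_pos_left one_pos (by positivity) (by positivity)]
    have : (0 : ℝ) ≤ n := by positivity
    linarith
  have h7 : 1 ≤ logRate 0 n y := by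
    rw [logRate, Real.rpow_zero, one_mul]; exact one_le_pow₀ hL
  have h8 : (1 : ℝ) / (2 * (n + 1)) * logRate 0 (n + 1) y =
      (1 - Real.log y) ^ (n + 1) / (2 * (n + 1)) := by
    rw [logRate, Real.rpow_zero]; ring
  rw [h8]
  simp only [Real.log_one, sub_zero, one_pow] at h2
  linarith

lemma stieltjes_logRate_lower_pos {c : ℝ} (hc : 0 < c) (n : ℕ) {y : ℝ} (hy : 0 < y) (hy1 : y ≤ 1) :
    1 / (2 * (c + 1)) * logRate 0 0 y ≤ ∫ x in (0 : ℝ)..1, logRate c n x / (x + y) := by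
  have hint := intervalIntegrable_div_add (intervalIntegrable_logRate (by linarith : -1 < c) n) hy
  have hI := (intervalIntegral.intervalIntegrable_rpow' (a := 0) (b := 1)
    (by linarith : -1 < c)).mul_const (1 / 2)
  have h1 := integral_mono_unit hI hint fun x hx hx1 => by
    have h1 : 1 ≤ (1 - Real.log x) ^ n := one_le_pow₀ (one_le_one_sub_log hx hx1)
    have h2 := Real.rpow_nonneg hx.le c
    rw [logRate, mul_one_div]
    have h3 : x ^ c ≤ x ^ c * (1 - Real.log x) ^ n := le_mul_of_one_le_right h2 h1
    gcongr
    linarith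
  refine le_trans (le_of_eq ?_) h1
  rw [intervalIntegral.integral_mul_const, integral_rpow (Or.inl (by linarith)), Real.one_rpow,
    Real.zero_rpow (by linarith), logRate, Real.rpow_zero]
  field_simp
  ring

end CauchyChain
end

noncomputable section
namespace CauchyChain

variable {p : ℕ} {a : ℕ → ℝ}

/-! ### The order of the iterated Cauchy transforms at the origin -/

/-- The exponent of the order of `stieltjes a l` at the origin. -/
def zeroExp (a : ℕ → ℝ) : ℕ → ℝ
  | 0 => 0
  | l + 1 => min (zeroExp a l + a (l + 1)) 0

/-- The power of the logarithm in the order of `stieltjes a l` at the origin. -/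
def zeroLog (a : ℕ → ℝ) : ℕ → ℕ
  | 0 => 0
  | l + 1 => if zeroExp a l + a (l + 1) < 0 then zeroLog a l
      else if zeroExp a l + a (l + 1) = 0 then zeroLog a l + 1 else 0

/-- With the next lemma this solves the recursion: the sum on the left is the minimum of the b_j
with j ≤ l, whose negative is the rightmost pole of the kernel of the corresponding column. -/
lemma zeroExp_add_le (l : ℕ) : ∀ j ≤ l, zeroExp a l + shiftParam a l ≤ shiftParam a j := by
  induction l with
  | zero => intro j hj; obtain rfl : j = 0 := by omega
            simp [zeroExp]
  | succ l ih =>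
    intro j hj
    rw [zeroExp, shiftParam_succ]
    rcases Nat.lt_or_eq_of_le hj with h | rfl
    · linarith [ih j (by omega), min_le_left (zeroExp a l + a (l + 1)) 0]
    · rw [shiftParam_succ]
      linarith [min_le_right (zeroExp a l + a (l + 1)) 0]

lemma exists_zeroExp_add_eq (l : ℕ) : ∃ j ≤ l, zeroExp a l + shiftParam a l = shiftParam a j := by
  induction l with
  | zero => exact ⟨0, le_rfl, by simp [zeroExp]⟩
  | succ l ih =>
    obtain ⟨j, hj, h⟩ := ih
    rcases min_choice (zeroExp a l + a (l + 1)) 0 with h1 | h1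
    · exact ⟨j, by omega, by rw [zeroExp, h1, shiftParam_succ, ← h]; ring⟩
    · exact ⟨l + 1, le_rfl, by rw [zeroExp, h1, zero_add]⟩

/-- The recursion for the logarithms counts how often the minimum is attained: a new strict minimum
resets the count, a tie raises it. So the order of the rightmost pole is `zeroLog a l + 1`. -/
lemma card_zeroLog (l : ℕ) : ((Finset.range (l + 1)).filter
    fun j => shiftParam a j = zeroExp a l + shiftParam a l).card = zeroLog a l + 1 := by
  induction l with
  | zero => simp [zeroExp, zeroLog, Finset.filter_singleton]
  | succ l ih =>
    rw [Finset.range_add_one, Finset.filter_insert, zeroExp, zeroLog]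
    have hmem : ∀ x : ℝ, l + 1 ∉ (Finset.range (l + 1)).filter fun j => shiftParam a j = x :=
      fun x => by simp
    rcases lt_trichotomy (zeroExp a l + a (l + 1)) 0 with h | h | h
    · rw [if_pos h, min_eq_left h.le, if_neg (by intro h'; linarith), ← ih]
      congr 2
      ext j
      rw [shiftParam_succ]
      constructor <;> intro h' <;> linarith
    · rw [if_neg h.not_lt, if_pos h, h, min_self, zero_add, if_pos rfl,
        Finset.card_insert_of_notMem (hmem _), ← ih]
      congr 3
      ext j
      rw [shiftParam_succ]
      constructor <;> intro h' <;> linarith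
    · rw [if_neg h.le.not_gt, if_neg h.ne', min_eq_right h.le, zero_add, if_pos rfl,
        Finset.card_insert_of_notMem (hmem _), Finset.filter_false_of_mem, Finset.card_empty]
      intro j hj h'
      have := zeroExp_add_le (a := a) l j (by rw [Finset.mem_range] at hj; omega)
      rw [shiftParam_succ] at h'
      linarith

lemma neg_one_lt_shiftParam_sub
    (ha : ∀ k l : ℕ, 1 ≤ k → k ≤ l → l ≤ p → -1 < partialSum a k l) {j l : ℕ} (hjl : j ≤ l)
    (hl : l ≤ p) : -1 < shiftParam a j - shiftParam a l := by
  rcases hjl.eq_or_lt with rfl | h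
  · simp
  · rw [← partialSum_eq a hjl]; exact ha (j + 1) l (by omega) (by omega) hl

lemma neg_one_lt_zeroExp_add (ha : ∀ k l : ℕ, 1 ≤ k → k ≤ l → l ≤ p → -1 < partialSum a k l)
    {l : ℕ} (hl : l < p) : -1 < zeroExp a l + a (l + 1) := by
  obtain ⟨j, hj, h⟩ := exists_zeroExp_add_eq (a := a) l
  have := neg_one_lt_shiftParam_sub ha (by omega : j ≤ l + 1) hl
  rw [shiftParam_succ] at this
  linarith

lemma stieltjes_logRate {c : ℝ} (hc : -1 < c) (n : ℕ) : ∃ c₁ c₂ : ℝ, 0 < c₁ ∧ 0 < c₂ ∧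
    ∀ y : ℝ, 0 < y → y ≤ 1 →
      c₁ * logRate (min c 0) (if c < 0 then n else if c = 0 then n + 1 else 0) y ≤
        ∫ x in (0 : ℝ)..1, logRate c n x / (x + y) ∧
      ∫ x in (0 : ℝ)..1, logRate c n x / (x + y) ≤
        c₂ * logRate (min c 0) (if c < 0 then n else if c = 0 then n + 1 else 0) y := by
  rcases lt_trichotomy c 0 with h | h | h
  · obtain ⟨C, hC, hu⟩ := stieltjes_logRate_upper_neg hc h n
    rw [if_pos h, min_eq_left h.le]
    exact ⟨1 / 2, C, by norm_num, hC, fun y hy hy1 =>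
      ⟨stieltjes_logRate_lower_neg hc h n hy hy1, hu y hy hy1⟩⟩
  · subst h
    obtain ⟨C, hC, hu⟩ := stieltjes_logRate_upper_zero n
    rw [if_neg (lt_irrefl _), if_pos rfl, min_self]
    exact ⟨1 / (2 * (n + 1)), C, by positivity, hC, fun y hy hy1 =>
      ⟨stieltjes_logRate_lower_zero n hy hy1, hu y hy hy1⟩⟩
  · obtain ⟨C, hC, hu⟩ := stieltjes_logRate_upper_pos h n
    rw [if_neg h.le.not_gt, if_neg h.ne', min_eq_right h.le]
    exact ⟨1 / (2 * (c + 1)), C, by positivity, hC, fun y hy hy1 =>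
      ⟨stieltjes_logRate_lower_pos h n hy hy1, hu y hy hy1⟩⟩

/-- `stieltjes a l` has the order given by `zeroExp` and `zeroLog`. -/
def StieltjesOrder (a : ℕ → ℝ) (l : ℕ) : Prop :=
  AntitoneOn (stieltjes a l) (Set.Ioi 0) ∧ ∃ c₁ c₂ : ℝ, 0 < c₁ ∧ 0 < c₂ ∧ ∀ y : ℝ, 0 < y → y ≤ 1 →
    c₁ * logRate (zeroExp a l) (zeroLog a l) y ≤ stieltjes a l y ∧
    stieltjes a l y ≤ c₂ * logRate (zeroExp a l) (zeroLog a l) y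

/-- The density of the Stieltjes transform. -/
lemma StieltjesOrder.density {l : ℕ} (h : StieltjesOrder a l) (hc : -1 < zeroExp a l + a (l + 1)) :
    IntervalIntegrable (fun x => x ^ a (l + 1) * stieltjes a l x) volume 0 1 ∧
    ∃ c₁ c₂ : ℝ, 0 < c₁ ∧ 0 < c₂ ∧ ∀ x : ℝ, 0 < x → x ≤ 1 →
      c₁ * logRate (zeroExp a l + a (l + 1)) (zeroLog a l) x ≤ x ^ a (l + 1) * stieltjes a l x ∧
      x ^ a (l + 1) * stieltjes a l x ≤
        c₂ * logRate (zeroExp a l + a (l + 1)) (zeroLog a l) x := by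
  obtain ⟨hanti, c₁, c₂, h1, h2, hb⟩ := h
  have hb' : ∀ x : ℝ, 0 < x → x ≤ 1 →
      c₁ * logRate (zeroExp a l + a (l + 1)) (zeroLog a l) x ≤ x ^ a (l + 1) * stieltjes a l x ∧
      x ^ a (l + 1) * stieltjes a l x ≤
        c₂ * logRate (zeroExp a l + a (l + 1)) (zeroLog a l) x := by
    intro x hx hx1
    have e : logRate (zeroExp a l + a (l + 1)) (zeroLog a l) x =
        x ^ a (l + 1) * logRate (zeroExp a l) (zeroLog a l) x := by
      rw [logRate, logRate, Real.rpow_add hx]; ring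
    have h3 := Real.rpow_nonneg hx.le (a (l + 1))
    obtain ⟨h4, h5⟩ := hb x hx hx1
    rw [e, mul_left_comm c₁, mul_left_comm c₂]
    exact ⟨mul_le_mul_of_nonneg_left h4 h3, mul_le_mul_of_nonneg_left h5 h3⟩
  refine ⟨?_, c₁, c₂, h1, h2, hb'⟩
  refine intervalIntegrable_of_le ((intervalIntegrable_logRate hc (zeroLog a l)).const_mul c₂) ?_
    fun x hx hx1 => ?_
  · refine ((measurable_id.pow_const (a (l + 1))).aestronglyMeasurable).mul ?_
    -- Monotonicity is carried through the induction in order to supply measurability here.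
    exact (aemeasurable_restrict_of_antitoneOn measurableSet_Ioc
      (hanti.mono fun x hx => hx.1)).aestronglyMeasurable
  · obtain ⟨h4, h5⟩ := hb' x hx hx1
    rw [abs_of_nonneg ((mul_pos h1 (logRate_pos hx hx1)).le.trans h4)]
    exact h5

theorem stieltjesOrder (ha : ∀ k l : ℕ, 1 ≤ k → k ≤ l → l ≤ p → -1 < partialSum a k l) :
    ∀ l ≤ p, StieltjesOrder a l := by
  intro l
  induction l with
  | zero =>
    intro _
    refine ⟨fun x _ y _ _ => le_rfl, 1, 1, one_pos, one_pos, fun y hy hy1 => ?_⟩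
    simp [stieltjes, zeroExp, zeroLog, logRate]
  | succ l ih =>
    intro hl
    have hc := neg_one_lt_zeroExp_add ha (by omega : l < p)
    obtain ⟨hint, c₁, c₂, h1, h2, hb⟩ := (ih (by omega)).density hc
    have hpos : ∀ x : ℝ, 0 < x → x ≤ 1 → 0 ≤ x ^ a (l + 1) * stieltjes a l x := fun x hx hx1 =>
      (mul_pos h1 (logRate_pos hx hx1)).le.trans (hb x hx hx1).1
    refine ⟨fun y hy y' hy' hyy => ?_, ?_⟩
    · refine integral_mono_unit (intervalIntegrable_div_add hint hy')
        (intervalIntegrable_div_add hint hy) fun x hx hx1 => ?_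
      have h3 := hpos x hx hx1
      have h4 : 0 < x + y := add_pos hx hy
      gcongr
    · obtain ⟨d₁, d₂, hd1, hd2, hd⟩ := stieltjes_logRate hc (zeroLog a l)
      refine ⟨c₁ * d₁, c₂ * d₂, by positivity, by positivity, fun y hy hy1 => ?_⟩
      obtain ⟨h3, h4⟩ := hd y hy hy1
      have hK := intervalIntegrable_div_add (intervalIntegrable_logRate hc (zeroLog a l)) hy
      have h5 := integral_mono_unit (hK.const_mul c₁) (intervalIntegrable_div_add hint hy)
        fun x hx hx1 => by
          rw [← mul_div_assoc]
          have := (hb x hx hx1).1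
          gcongr
      have h6 := integral_mono_unit (intervalIntegrable_div_add hint hy) (hK.const_mul c₂)
        fun x hx hx1 => by
          rw [← mul_div_assoc]
          have := (hb x hx hx1).2
          gcongr
      rw [intervalIntegral.integral_const_mul] at h5 h6
      rw [zeroExp, zeroLog, mul_assoc, mul_assoc]
      exact ⟨(mul_le_mul_of_nonneg_left h3 h1.le).trans h5,
        h6.trans (mul_le_mul_of_nonneg_left h4 h2.le)⟩

/-! ### Cauchy transforms off the axis -/

/-- Splitting the angle φ evenly between x and r gives all denominators a real part proportional to
x + r with the same factor cos(φ/2). When this is positive no cancellation can occur in the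
integral. -/
lemma re_rotate (x r φ : ℝ) : (x * Complex.exp (-(φ / 2 * Complex.I)) +
    r * Complex.exp (φ / 2 * Complex.I)).re = (x + r) * Real.cos (φ / 2) := by
  have e1 : Complex.exp (φ / 2 * Complex.I) = Complex.exp (((φ / 2 : ℝ) : ℂ) * Complex.I) := by
    push_cast; rfl
  have e2 : Complex.exp (-(φ / 2 * Complex.I)) = Complex.exp (((-(φ / 2) : ℝ) : ℂ) * Complex.I) := by
    congr 1; push_cast; ring
  rw [e1, e2, Complex.add_re, Complex.re_ofReal_mul, Complex.re_ofReal_mul,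
    Complex.exp_ofReal_mul_I_re, Complex.exp_ofReal_mul_I_re, Real.cos_neg]
  ring

lemma rotate_mul (x r φ : ℝ) : (x : ℂ) + r * Complex.exp (φ * Complex.I) =
    (x * Complex.exp (-(φ / 2 * Complex.I)) + r * Complex.exp (φ / 2 * Complex.I)) *
      Complex.exp (φ / 2 * Complex.I) := by
  have h1 : Complex.exp (-(φ / 2 * Complex.I)) * Complex.exp (φ / 2 * Complex.I) = 1 := by
    rw [← Complex.exp_add, neg_add_cancel, Complex.exp_zero]
  have h2 : Complex.exp (φ / 2 * Complex.I) * Complex.exp (φ / 2 * Complex.I) =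
      Complex.exp (φ * Complex.I) := by
    rw [← Complex.exp_add]; congr 1; ring
  linear_combination (-(x : ℂ)) * h1 - r * h2

lemma norm_exp_half (φ : ℝ) : ‖Complex.exp (φ / 2 * Complex.I)‖ = 1 := by
  rw [Complex.norm_exp]; simp

/-- A Cauchy transform of a nonnegative function has, off the axis, the order of the Stieltjes
transform. -/
lemma cauchy_bounds {f : ℝ → ℝ} (hf : IntervalIntegrable f volume 0 1)
    (hpos : ∀ x, 0 < x → x ≤ 1 → 0 ≤ f x) {r φ κ : ℝ} (hr : 0 < r) (hκ : 0 < κ)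
    (hφ : κ ≤ Real.cos (φ / 2)) :
    κ * (∫ x in (0 : ℝ)..1, f x / (x + r)) ≤
        ‖∫ x in (0 : ℝ)..1, (f x : ℂ) / (x + r * Complex.exp (φ * Complex.I))‖ ∧
      ‖∫ x in (0 : ℝ)..1, (f x : ℂ) / (x + r * Complex.exp (φ * Complex.I))‖ ≤
        κ⁻¹ * ∫ x in (0 : ℝ)..1, f x / (x + r) := by
  have hint := intervalIntegrable_div_add hf hr
  let D : ℝ → ℂ := fun x =>
    x * Complex.exp (-(φ / 2 * Complex.I)) + r * Complex.exp (φ / 2 * Complex.I)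
  have hDre : ∀ x, (D x).re = (x + r) * Real.cos (φ / 2) := fun x => re_rotate x r φ
  have hDlow : ∀ x, 0 < x → (x + r) * κ ≤ ‖D x‖ := fun x hx => by
    refine le_trans ?_ (Complex.re_le_norm _)
    rw [hDre]
    gcongr
  have hDup : ∀ x, 0 < x → ‖D x‖ ≤ x + r := fun x hx => by
    refine (norm_add_le _ _).trans ?_
    rw [norm_mul, norm_mul, norm_exp_half, Complex.norm_real, Complex.norm_real, Complex.norm_exp,
      Real.norm_of_nonneg hx.le, Real.norm_of_nonneg hr.le]
    simp
  have hDeq : ∀ x : ℝ, (x : ℂ) + r * Complex.exp (φ * Complex.I) =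
      D x * Complex.exp (φ / 2 * Complex.I) := fun x => rotate_mul x r φ
  have hnorm : ∀ x, 0 < x → x ≤ 1 →
      ‖(f x : ℂ) / (x + r * Complex.exp (φ * Complex.I))‖ ≤ κ⁻¹ * (f x / (x + r)) := by
    intro x hx hx1
    rw [hDeq, norm_div, norm_mul, norm_exp_half, mul_one, Complex.norm_real,
      Real.norm_of_nonneg (hpos x hx hx1)]
    have h1 : 0 < (x + r) * κ := by positivity
    calc f x / ‖D x‖ ≤ f x / ((x + r) * κ) := by
          have := hpos x hx hx1
          have := hDlow x hx
          gcongr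
      _ = _ := by field_simp
  have hcint : IntervalIntegrable (fun x : ℝ => (f x : ℂ) / (x + r * Complex.exp (φ * Complex.I)))
      volume 0 1 := by
    refine (hint.const_mul κ⁻¹).mono_fun' ?_ ?_
    · rw [Set.uIoc_of_le zero_le_one]
      simp only [div_eq_mul_inv]
      exact (Complex.continuous_ofReal.comp_aestronglyMeasurable hf.1.aestronglyMeasurable).mul
        ((Complex.measurable_ofReal.add_const _).inv).aestronglyMeasurable
    · rw [Set.uIoc_of_le zero_le_one]
      exact (ae_restrict_mem measurableSet_Ioc).mono fun x hx => hnorm x hx.1 hx.2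
  constructor
  · have h1 := Complex.reCLM.intervalIntegral_comp_comm
      (hcint.const_mul (Complex.exp (φ / 2 * Complex.I)))
    have hlow : ∀ x, 0 < x → x ≤ 1 → κ * (f x / (x + r)) ≤ Complex.reCLM
        (Complex.exp (φ / 2 * Complex.I) * ((f x : ℂ) / (x + r * Complex.exp (φ * Complex.I)))) := by
      intro x hx hx1
      have hD0 : 0 < ‖D x‖ := lt_of_lt_of_le (by positivity) (hDlow x hx)
      have e : Complex.exp (φ / 2 * Complex.I) *
          ((f x : ℂ) / (x + r * Complex.exp (φ * Complex.I))) = (f x : ℂ) * (D x)⁻¹ := by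
        rw [hDeq]
        have := Complex.exp_ne_zero (φ / 2 * Complex.I)
        have : D x ≠ 0 := norm_pos_iff.1 hD0
        field_simp
      rw [e, Complex.reCLM_apply, Complex.re_ofReal_mul, Complex.inv_re, hDre,
        Complex.normSq_eq_norm_sq]
      have h2 : κ / (x + r) ≤ (x + r) * Real.cos (φ / 2) / ‖D x‖ ^ 2 := by
        rw [div_le_div_iff₀ (by positivity) (by positivity)]
        have h3 := hDup x hx
        calc κ * ‖D x‖ ^ 2 ≤ κ * (x + r) ^ 2 := by gcongr
          _ ≤ Real.cos (φ / 2) * (x + r) ^ 2 := by gcongr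
          _ = _ := by ring
      calc κ * (f x / (x + r)) = f x * (κ / (x + r)) := by ring
        _ ≤ _ := mul_le_mul_of_nonneg_left h2 (hpos x hx hx1)
    have hreint : IntervalIntegrable (fun x : ℝ => Complex.reCLM
        (Complex.exp (φ / 2 * Complex.I) * ((f x : ℂ) / (x + r * Complex.exp (φ * Complex.I)))))
        volume 0 1 := by
      have := hcint.const_mul (Complex.exp (φ / 2 * Complex.I))
      exact ⟨Complex.reCLM.integrable_comp this.1, Complex.reCLM.integrable_comp this.2⟩
    have h2 := integral_mono_unit (hint.const_mul κ) hreint hlow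
    rw [intervalIntegral.integral_const_mul, h1, intervalIntegral.integral_const_mul] at h2
    refine h2.trans ((Complex.re_le_norm _).trans_eq ?_)
    rw [norm_mul, norm_exp_half, one_mul]
  · refine (intervalIntegral.norm_integral_le_integral_norm zero_le_one).trans ?_
    rw [← intervalIntegral.integral_const_mul]
    exact integral_mono_unit hcint.norm (hint.const_mul _) hnorm

/-- The union of the two sectors is invariant under ζ ↦ -ζ, so for both parities the angle is at
most 3π/4 in absolute value. -/
lemma topBottom_polar {ζ : ℂ} (hζ : ζ ∈ topBottom) (l : ℕ) : 0 < ‖ζ‖ ∧ ∃ φ : ℝ,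
    (-1) ^ l * ζ = ‖ζ‖ * Complex.exp (φ * Complex.I) ∧
      Real.cos (3 * Real.pi / 8) ≤ Real.cos (φ / 2) := by
  obtain ⟨h1, h2⟩ := hζ
  have hpi := Real.pi_pos
  have h0 : ζ ≠ 0 := fun h => by
    rw [h, Complex.arg_zero, abs_zero] at h1; linarith
  have hcos : ∀ φ : ℝ, |φ| ≤ 3 * Real.pi / 4 →
      Real.cos (3 * Real.pi / 8) ≤ Real.cos (φ / 2) := fun φ hφ => by
    rw [← Real.cos_abs (φ / 2), abs_div, abs_two]
    exact Real.cos_le_cos_of_nonneg_of_le_pi (by positivity) (by linarith) (by linarith)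
  refine ⟨norm_pos_iff.2 h0, ?_⟩
  have hpolar := Complex.norm_mul_exp_arg_mul_I ζ
  rcases Nat.even_or_odd l with hl | hl
  · exact ⟨ζ.arg, by rw [hl.neg_one_pow, one_mul, hpolar], hcos _ h2.le⟩
  · rw [hl.neg_one_pow, neg_one_mul]
    rcases le_total 0 ζ.arg with h | h
    · refine ⟨ζ.arg - Real.pi, ?_, hcos _ ?_⟩
      · have : ((ζ.arg - Real.pi : ℝ) : ℂ) * Complex.I = ζ.arg * Complex.I - Real.pi * Complex.I := by
          push_cast; ring
        rw [this, Complex.exp_sub, Complex.exp_pi_mul_I, div_neg, div_one, mul_neg, hpolar]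
      · rw [abs_of_nonneg h] at h1 h2
        rw [abs_of_nonpos (by linarith)]
        linarith
    · refine ⟨ζ.arg + Real.pi, ?_, hcos _ ?_⟩
      · have : ((ζ.arg + Real.pi : ℝ) : ℂ) * Complex.I = ζ.arg * Complex.I + Real.pi * Complex.I := by
          push_cast; ring
        rw [this, Complex.exp_add, Complex.exp_pi_mul_I, mul_neg_one, mul_neg, hpolar]
      · rw [abs_of_nonpos h] at h1 h2
        rw [abs_of_nonneg (by linarith)]
        linarith

/-- The order of the iterated Cauchy transform at the origin. -/
theorem cauchyTransform_order (ha : ∀ k l : ℕ, 1 ≤ k → k ≤ l → l ≤ p → -1 < partialSum a k l)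
    {l : ℕ} (hl0 : l ≠ 0) (hl : l ≤ p) : ∃ c₁ c₂ : ℝ, 0 < c₁ ∧ 0 < c₂ ∧
      ∀ ζ ∈ topBottom, ‖ζ‖ ≤ 1 →
        c₁ * logRate (zeroExp a l) (zeroLog a l) ‖ζ‖ ≤ ‖cauchyTransform a l ζ‖ ∧
        ‖cauchyTransform a l ζ‖ ≤ c₂ * logRate (zeroExp a l) (zeroLog a l) ‖ζ‖ := by
  obtain ⟨l, rfl⟩ : ∃ l', l = l' + 1 := ⟨l - 1, by omega⟩
  have hpi := Real.pi_pos
  obtain ⟨hint, d₁, d₂, hd1, hd2, hd⟩ := (stieltjesOrder ha l (by omega)).density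
    (neg_one_lt_zeroExp_add ha (by omega))
  obtain ⟨-, c₁, c₂, h1, h2, hb⟩ := stieltjesOrder ha (l + 1) hl
  have hκ : 0 < Real.cos (3 * Real.pi / 8) :=
    Real.cos_pos_of_mem_Ioo ⟨by linarith, by linarith⟩
  refine ⟨Real.cos (3 * Real.pi / 8) * c₁, (Real.cos (3 * Real.pi / 8))⁻¹ * c₂, by positivity,
    by positivity, fun ζ hζ hζ1 => ?_⟩
  obtain ⟨hr, φ, hφ, hcos⟩ := topBottom_polar hζ (l + 1)
  have hc := cauchy_bounds hint (fun x hx hx1 =>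
    (mul_pos hd1 (logRate_pos hx hx1)).le.trans (hd x hx hx1).1) hr hκ hcos
  have e : cauchyTransform a (l + 1) ζ = ∫ x in (0 : ℝ)..1,
      ((x ^ a (l + 1) * stieltjes a l x : ℝ) : ℂ) / (x + ‖ζ‖ * Complex.exp (φ * Complex.I)) := by
    rw [cauchyTransform, hφ, Nat.add_sub_cancel]
  rw [e, mul_assoc, mul_assoc]
  obtain ⟨h3, h4⟩ := hb ‖ζ‖ hr hζ1
  exact ⟨(mul_le_mul_of_nonneg_left h3 hκ.le).trans hc.1,
    hc.2.trans (mul_le_mul_of_nonneg_left h4 (inv_pos.2 hκ).le)⟩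

end CauchyChain
end

noncomputable section
namespace CauchyChain

/-! ### Residues at multiple poles -/

section Rect

variable {a b c d : ℝ}

lemma rectIntegral_deriv {g g' : ℂ → ℂ} (hab : a ≤ b) (hcd : c ≤ d)
    (hg : ∀ s ∈ rectBoundary a b c d, HasDerivAt g (g' s) s)
    (hg' : ContinuousOn g' (rectBoundary a b c d)) : rectIntegral a b c d g' = 0 := by
  obtain ⟨i1, i2⟩ := rectIntegral_integrable hg' hab hcd
  have h1 : ∀ y, y = c ∨ y = d → ∫ x in a..b, g' (x + y * Complex.I) =
      g (b + y * Complex.I) - g (a + y * Complex.I) := fun y hy => by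
    refine intervalIntegral.integral_eq_sub_of_hasDerivAt
      (f := fun x : ℝ => g (x + y * Complex.I)) (fun x hx => ?_) (i1 y hy)
    rw [Set.uIcc_of_le hab] at hx
    have h0 : HasDerivAt (fun x : ℝ => (x : ℂ) + y * Complex.I) 1 x :=
      (hasDerivAt_id x).ofReal_comp.add_const _
    have h2 := HasDerivAt.comp x (hg (x + y * Complex.I)
      (by rcases hy with rfl | rfl <;> simp [rectBoundary, hx.1, hx.2, hcd])) h0
    exact h2.congr_deriv (mul_one _)
  have h2 : ∀ x, x = a ∨ x = b → Complex.I * ∫ y in c..d, g' (x + y * Complex.I) =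
      g (x + d * Complex.I) - g (x + c * Complex.I) := fun x hx => by
    rw [← intervalIntegral.integral_const_mul]
    refine intervalIntegral.integral_eq_sub_of_hasDerivAt
      (f := fun y : ℝ => g (x + y * Complex.I)) (fun y hy => ?_) ((i2 x hx).const_mul _)
    rw [Set.uIcc_of_le hcd] at hy
    have h0 : HasDerivAt (fun y : ℝ => (x : ℂ) + y * Complex.I) Complex.I y := by
      simpa using ((hasDerivAt_id y).ofReal_comp.mul_const Complex.I).const_add (x : ℂ)
    have h2 := HasDerivAt.comp y (hg (x + y * Complex.I)
      (by rcases hx with rfl | rfl <;> simp [rectBoundary, hy.1, hy.2, hab])) h0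
    exact h2.congr_deriv (mul_comm _ _)
  unfold rectIntegral
  rw [h1 c (Or.inl rfl), h1 d (Or.inr rfl), h2 a (Or.inl rfl), h2 b (Or.inr rfl)]
  ring

lemma ne_of_mem_rectBoundary {s₀ : ℝ} (ha : a < s₀) (hb : s₀ < b) (hc : c < 0) (hd : 0 < d) {s : ℂ}
    (hs : s ∈ rectBoundary a b c d) : s - s₀ ≠ 0 := by
  intro h
  have hs' : s = s₀ := sub_eq_zero.1 h
  obtain ⟨-, hs⟩ := hs
  rw [hs', Complex.ofReal_re, Complex.ofReal_im] at hs
  rcases hs with h | h | h | h <;> linarith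

/-- Integration by parts: the boundary integral of the derivative of e^{-sw}(s - s₀)^{-n-1}
vanishes, which is a recursion in n starting from the simple pole. -/
lemma rectIntegral_exp_mul_inv_pow {s₀ : ℝ} (ha : a < s₀) (hb : s₀ < b) (hc : c < 0) (hd : 0 < d)
    (w : ℂ) (n : ℕ) :
    rectIntegral a b c d (fun s => Complex.exp (-(s * w)) * (s - s₀)⁻¹ ^ (n + 1)) =
      2 * Real.pi * Complex.I * (Complex.exp (-(s₀ * w)) * ((-w) ^ n / n.factorial)) := by
  have hab : a ≤ b := by linarith
  have hcd : c ≤ d := by linarith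
  have hexp : ∀ s : ℂ, HasDerivAt (fun s : ℂ => Complex.exp (-(s * w)))
      (Complex.exp (-(s * w)) * -w) s := fun s => by
    simpa using (((hasDerivAt_id s).mul_const w).neg).cexp
  induction n with
  | zero =>
    simp only [zero_add, pow_one]
    rw [rectIntegral_div_sub ha hb hc hd fun s _ _ _ _ => (hexp s).differentiableAt]
    simp
  | succ n ih =>
    have hcont : ∀ m : ℕ, ContinuousOn (fun s : ℂ => Complex.exp (-(s * w)) * (s - s₀)⁻¹ ^ m)
        (rectBoundary a b c d) := fun m =>
      ContinuousOn.mul (by fun_prop) ((ContinuousOn.inv₀ (by fun_prop)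
        fun s hs => ne_of_mem_rectBoundary ha hb hc hd hs).pow m)
    have h0 : rectIntegral a b c d (fun s =>
        -w * (Complex.exp (-(s * w)) * (s - s₀)⁻¹ ^ (n + 1)) +
          -(n + 1) * (Complex.exp (-(s * w)) * (s - s₀)⁻¹ ^ (n + 1 + 1))) = 0 := by
      refine rectIntegral_deriv (g := fun s => Complex.exp (-(s * w)) * (s - s₀)⁻¹ ^ (n + 1)) hab hcd
        (fun s hs => ?_) ((continuousOn_const.mul (hcont _)).add (continuousOn_const.mul (hcont _)))
      have hne := ne_of_mem_rectBoundary ha hb hc hd hs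
      have h1 := (hexp s).mul (((((hasDerivAt_id s).sub_const (s₀ : ℂ)).inv hne).pow (n + 1)))
      refine h1.congr_deriv ?_
      have hx : -1 / (s - (s₀ : ℂ)) ^ 2 = -(s - (s₀ : ℂ))⁻¹ ^ 2 := by
        rw [inv_pow, neg_div, one_div]
      simp only [id, Pi.pow_apply, Pi.inv_apply, Nat.add_sub_cancel, hx]
      push_cast
      ring
    rw [rectIntegral_add (f := fun s => -w * (Complex.exp (-(s * w)) * (s - s₀)⁻¹ ^ (n + 1)))
      (g := fun s => -(n + 1) * (Complex.exp (-(s * w)) * (s - s₀)⁻¹ ^ (n + 1 + 1)))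
      (continuousOn_const.mul (hcont _)) (continuousOn_const.mul (hcont _)) hab hcd,
      rectIntegral_const_mul, rectIntegral_const_mul, ih] at h0
    have hn : (n : ℂ) + 1 ≠ 0 := by exact_mod_cast n.succ_ne_zero
    have hf : (n.factorial : ℂ) ≠ 0 := by exact_mod_cast n.factorial_ne_zero
    refine mul_left_cancel₀ hn ?_
    generalize rectIntegral a b c d
      (fun s => Complex.exp (-(s * w)) * (s - s₀)⁻¹ ^ (n + 1 + 1)) = J at h0 ⊢
    generalize Complex.exp (-(s₀ * w)) = e at h0 ⊢
    rw [Nat.factorial_succ, pow_succ]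
    push_cast
    field_simp
    field_simp at h0
    linear_combination -h0

/-- The residue of `F s * exp (-s w)` at a pole of order `n + 1` is `exp (-s₀ w)` times a polynomial
in `w` with leading coefficient `F s₀`. -/
lemma rectIntegral_pole {s₀ : ℝ} (ha : a < s₀) (hb : s₀ < b) (hc : c < 0) (hd : 0 < d) (n : ℕ) :
    ∀ F : ℂ → ℂ,
    (∀ s : ℂ, a ≤ s.re → s.re ≤ b → c ≤ s.im → s.im ≤ d → DifferentiableAt ℂ F s) →
    ∃ P : ℕ → ℂ, P n = F s₀ ∧ ∀ w : ℂ,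
      rectIntegral a b c d (fun s => F s * Complex.exp (-(s * w)) * (s - s₀)⁻¹ ^ (n + 1)) =
        2 * Real.pi * Complex.I * (Complex.exp (-(s₀ * w)) *
          ∑ j ∈ Finset.range (n + 1), P j * ((-w) ^ j / j.factorial)) := by
  have hab : a ≤ b := by linarith
  have hcd : c ≤ d := by linarith
  induction n with
  | zero =>
    intro F hF
    refine ⟨fun _ => F s₀, rfl, fun w => ?_⟩
    simp only [zero_add, pow_one]
    rw [rectIntegral_div_sub (F := fun s => F s * Complex.exp (-(s * w))) ha hb hc hd
      fun s h1 h2 h3 h4 => (hF s h1 h2 h3 h4).mul (by fun_prop)]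
    simp
    ring
  | succ n ih =>
    intro F hF
    have hnhds : {s : ℂ | a < s.re ∧ s.re < b ∧ c < s.im ∧ s.im < d} ∈ 𝓝 (s₀ : ℂ) := by
      refine IsOpen.mem_nhds ?_ (by simp [ha, hb, hc, hd])
      exact (isOpen_lt continuous_const Complex.continuous_re).inter
        ((isOpen_lt Complex.continuous_re continuous_const).inter
        ((isOpen_lt continuous_const Complex.continuous_im).inter
        (isOpen_lt Complex.continuous_im continuous_const)))
    have hF1 : ∀ s : ℂ, a ≤ s.re → s.re ≤ b → c ≤ s.im → s.im ≤ d →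
        DifferentiableAt ℂ (dslope F s₀) s := fun s h1 h2 h3 h4 => by
      by_cases hs : s = s₀
      · rw [hs]
        refine DifferentiableOn.differentiableAt ?_ hnhds
        rw [Complex.differentiableOn_dslope hnhds]
        exact fun z hz => (hF z hz.1.le hz.2.1.le hz.2.2.1.le hz.2.2.2.le).differentiableWithinAt
      · exact (differentiableAt_dslope_of_ne hs).2 (hF s h1 h2 h3 h4)
    obtain ⟨P, hP, hPw⟩ := ih _ hF1
    refine ⟨Function.update P (n + 1) (F s₀), by simp, fun w => ?_⟩
    have hne : ∀ s ∈ rectBoundary a b c d, s - s₀ ≠ 0 := fun s hs =>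
      ne_of_mem_rectBoundary ha hb hc hd hs
    have hcinv : ContinuousOn (fun s : ℂ => (s - s₀)⁻¹) (rectBoundary a b c d) :=
      ContinuousOn.inv₀ (by fun_prop) hne
    -- From F = F(s₀) + (s - s₀) · `dslope F s₀`: the constant contributes the top power of w, and
    -- the rest has a pole of one order less.
    have e : Set.EqOn (fun s => F s * Complex.exp (-(s * w)) * (s - s₀)⁻¹ ^ (n + 1 + 1))
        (fun s => F s₀ * (Complex.exp (-(s * w)) * (s - s₀)⁻¹ ^ (n + 1 + 1)) +
          dslope F s₀ s * Complex.exp (-(s * w)) * (s - s₀)⁻¹ ^ (n + 1))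
        (rectBoundary a b c d) := fun s hs => by
      have h3 := hne s hs
      simp only [dslope_of_ne _ (sub_ne_zero.1 h3), slope_def_field, div_eq_mul_inv]
      ring
    have hcont1 : ContinuousOn (fun s =>
        F s₀ * (Complex.exp (-(s * w)) * (s - s₀)⁻¹ ^ (n + 1 + 1))) (rectBoundary a b c d) :=
      continuousOn_const.mul (ContinuousOn.mul (by fun_prop) (hcinv.pow _))
    have hcont2 : ContinuousOn (fun s =>
        dslope F s₀ s * Complex.exp (-(s * w)) * (s - s₀)⁻¹ ^ (n + 1)) (rectBoundary a b c d) := by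
      refine ContinuousOn.mul (ContinuousOn.mul (fun s hs => ?_) (by fun_prop)) (hcinv.pow _)
      exact (hF1 s hs.1.1 hs.1.2.1 hs.1.2.2.1 hs.1.2.2.2).continuousAt.continuousWithinAt
    rw [rectIntegral_congr e hab hcd, rectIntegral_add hcont1 hcont2 hab hcd, rectIntegral_const_mul,
      rectIntegral_exp_mul_inv_pow ha hb hc hd, hPw w, Finset.sum_range_succ _ (n + 1),
      Function.update_self]
    have hsum : ∑ j ∈ Finset.range (n + 1), Function.update P (n + 1) (F s₀) j *
        ((-w) ^ j / j.factorial) = ∑ j ∈ Finset.range (n + 1), P j * ((-w) ^ j / j.factorial) :=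
      Finset.sum_congr rfl fun j hj => by
        rw [Function.update_of_ne (by rw [Finset.mem_range] at hj; omega)]
    rw [hsum]
    ring

end Rect

end CauchyChain
end

noncomputable section
namespace CauchyChain

variable {p : ℕ} {a : ℕ → ℝ}

/-! ### The entries at the origin -/

/-- The kernel without the rightmost pole. -/
def poleFactor (p : ℕ) (a : ℕ → ℝ) (k : ℕ) (u : ℂ) : ℂ :=
  Complex.Gamma (u + (zeroExp a k + shiftParam a k : ℝ) + 1) ^ (zeroLog a k + 1) *
    (∏ l ∈ (Finset.range (k + 1)).filter fun l => ¬ shiftParam a l = zeroExp a k + shiftParam a k,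
      Complex.Gamma (u + shiftParam a l)) *
    ∏ l ∈ Finset.Ico (k + 1) (p + 1), (Complex.Gamma (1 - shiftParam a l - u))⁻¹

/-- Each of the gamma factors with the minimal shift β is written as Γ(u + β + 1)/(u + β);
`card_zeroLog` counts them. -/
lemma hankelKernel_eq_poleFactor (k : ℕ) {u : ℂ}
    (hu : u - ((-(zeroExp a k + shiftParam a k) : ℝ) : ℂ) ≠ 0) :
    hankelKernel (p + 1) (shiftParam a) (k + 1) u = poleFactor p a k u *
      (u - ((-(zeroExp a k + shiftParam a k) : ℝ) : ℂ))⁻¹ ^ (zeroLog a k + 1) := by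
  set β : ℝ := zeroExp a k + shiftParam a k with hβ
  have hu' : u - ((-β : ℝ) : ℂ) = u + β := by push_cast; ring
  rw [hu'] at hu ⊢
  have hG : Complex.Gamma (u + β) = Complex.Gamma (u + β + 1) * (u + β)⁻¹ := by
    rw [Complex.Gamma_add_one _ hu]; field_simp
  have hM : ∏ l ∈ (Finset.range (k + 1)).filter (fun l => shiftParam a l = β),
      Complex.Gamma (u + shiftParam a l) = Complex.Gamma (u + β) ^ (zeroLog a k + 1) := by
    rw [← card_zeroLog (a := a) k, ← hβ, ← Finset.prod_const]
    exact Finset.prod_congr rfl fun l hl => by rw [(Finset.mem_filter.1 hl).2]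
  rw [hankelKernel, poleFactor, ← hβ,
    ← Finset.prod_filter_mul_prod_filter_not (Finset.range (k + 1)) (fun l => shiftParam a l = β), hM,
    hG, mul_pow]
  ring

lemma exists_pole_gap (a : ℕ → ℝ) (k : ℕ) : ∃ δ : ℝ, 0 < δ ∧ δ < 1 ∧ ∀ l ≤ k,
    shiftParam a l ≠ zeroExp a k + shiftParam a k →
      δ < shiftParam a l - (zeroExp a k + shiftParam a k) := by
  set S := (Finset.range (k + 1)).filter fun l => ¬ shiftParam a l = zeroExp a k + shiftParam a k
  have hev : ∀ᶠ δ : ℝ in 𝓝[>] 0, δ < 1 ∧ ∀ l ∈ S,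
      δ < shiftParam a l - (zeroExp a k + shiftParam a k) := by
    have h1 : ∀ x : ℝ, 0 < x → ∀ᶠ δ : ℝ in 𝓝[>] 0, δ < x := fun x hx =>
      nhdsWithin_le_nhds (gt_mem_nhds hx)
    refine (h1 1 one_pos).and ((Finset.eventually_all S).2 fun l hl => h1 _ ?_)
    obtain ⟨h2, h3⟩ := Finset.mem_filter.1 hl
    rw [Finset.mem_range] at h2
    have := lt_of_le_of_ne (zeroExp_add_le (a := a) k l (by omega)) (Ne.symm h3)
    linarith
  obtain ⟨δ, ⟨h1, h2⟩, h3⟩ := (hev.and self_mem_nhdsWithin).exists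
  refine ⟨δ, h3, h1, fun l hl hne => h2 l (Finset.mem_filter.2 ⟨Finset.mem_range.2 (by omega), hne⟩)⟩

lemma poleFactor_differentiableAt {k : ℕ} {δ : ℝ} (hδ1 : δ < 1)
    (hδ : ∀ l ≤ k, shiftParam a l ≠ zeroExp a k + shiftParam a k →
      δ < shiftParam a l - (zeroExp a k + shiftParam a k)) {u : ℂ}
    (hu : -(zeroExp a k + shiftParam a k) - δ ≤ u.re) :
    DifferentiableAt ℂ (poleFactor p a k) u := by
  unfold poleFactor
  refine DifferentiableAt.mul (DifferentiableAt.mul (DifferentiableAt.pow ?_ _) ?_) ?_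
  · have h1 : DifferentiableAt ℂ Complex.Gamma (u + (zeroExp a k + shiftParam a k : ℝ) + 1) :=
      differentiableAt_Gamma_of_pos (Or.inl (by
        rw [Complex.add_re, Complex.add_re, Complex.ofReal_re, Complex.one_re]; linarith))
    exact h1.comp u (f := fun u : ℂ => u + (zeroExp a k + shiftParam a k : ℝ) + 1) (by fun_prop)
  · refine DifferentiableAt.fun_finsetProd fun l hl => ?_
    obtain ⟨h2, h3⟩ := Finset.mem_filter.1 hl
    rw [Finset.mem_range] at h2
    have h1 : DifferentiableAt ℂ Complex.Gamma (u + shiftParam a l) :=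
      differentiableAt_Gamma_of_pos (Or.inl (by
        rw [Complex.add_re, Complex.ofReal_re]; linarith [hδ l (by omega) h3]))
    exact h1.comp u (f := fun u : ℂ => u + shiftParam a l) (by fun_prop)
  · exact DifferentiableAt.fun_finsetProd fun l _ => differentiable_inv_Gamma_one_sub _ u

/-- At the pole the remaining numerator factors have positive arguments by minimality. The
reciprocal ones have the arguments 1 + b_j - b_l = 1 + a_{j+1,l} with j ≤ k < l, positive by the
hypothesis on the partial sums; otherwise a zero of 1/Γ could lower the order of the pole. -/
lemma poleFactor_ne_zero (ha : ∀ k l : ℕ, 1 ≤ k → k ≤ l → l ≤ p → -1 < partialSum a k l) (k : ℕ) :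
    poleFactor p a k ((-(zeroExp a k + shiftParam a k) : ℝ) : ℂ) ≠ 0 := by
  have hpos : ∀ x : ℝ, 0 < x → Complex.Gamma (x : ℂ) ≠ 0 := fun x hx =>
    Complex.Gamma_ne_zero_of_re_pos (by simpa using hx)
  unfold poleFactor
  refine mul_ne_zero (mul_ne_zero (pow_ne_zero _ ?_) (Finset.prod_ne_zero_iff.2 fun l hl => ?_))
    (Finset.prod_ne_zero_iff.2 fun l hl => inv_ne_zero ?_)
  · rw [← Complex.ofReal_add, neg_add_cancel]
    simp
  · obtain ⟨h2, h3⟩ := Finset.mem_filter.1 hl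
    rw [Finset.mem_range] at h2
    rw [← Complex.ofReal_add]
    have := lt_of_le_of_ne (zeroExp_add_le (a := a) k l (by omega)) (Ne.symm h3)
    exact hpos _ (by linarith)
  · rw [Finset.mem_Ico] at hl
    obtain ⟨j, hj, h⟩ := exists_zeroExp_add_eq (a := a) k
    have h1 := neg_one_lt_shiftParam_sub ha (by omega : j ≤ l) (by omega)
    have e : (1 : ℂ) - shiftParam a l - ((-(zeroExp a k + shiftParam a k) : ℝ) : ℂ) =
        ((1 - shiftParam a l + (zeroExp a k + shiftParam a k) : ℝ) : ℂ) := by push_cast; ring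
    rw [e]
    exact hpos _ (by linarith)

/-- The expansion of the functions `meijer` at `-∞`. -/
lemma meijer_zero_expansion (ha : ∀ k l : ℕ, 1 ≤ k → k ≤ l → l ≤ p → -1 < partialSum a k l) {k : ℕ}
    (hk : k ≤ p) (i : ℕ) : ∃ P : ℕ → ℂ, (i = 0 → P (zeroLog a k) ≠ 0) ∧ ∃ δ C : ℝ, 0 < δ ∧ 0 ≤ C ∧
      ∀ w : ℂ, w.re ≤ 0 → ‖meijer (p + 1) (shiftParam a) i (k + 1) w -
        Complex.exp ((zeroExp a k + shiftParam a k : ℝ) * w) *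
          ∑ j ∈ Finset.range (zeroLog a k + 1), P j * ((-w) ^ j / j.factorial)‖ ≤
        C * Real.exp |w.im| * Real.exp ((zeroExp a k + shiftParam a k + δ) * w.re) := by
  set β : ℝ := zeroExp a k + shiftParam a k with hβ
  obtain ⟨δ, hδ0, hδ1, hδ⟩ := exists_pole_gap a k
  rw [← hβ] at hδ
  set R : ℝ := radius (p + 1) (shiftParam a) + 1 with hR
  -- The new vertical line lies between the rightmost pole and all others, so exactly one residue is
  -- collected and the rest is smaller by e^{δ Re w}.
  set R' : ℝ := -β - δ with hR'
  have hle : ∀ l < k + 1, -shiftParam a l ≤ radius (p + 1) (shiftParam a) := fun l hl =>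
    neg_le_radius (N := p + 1) (shiftParam a) (by omega)
  have h1 : R' < -β := by linarith
  have h2 : -β < R := by
    obtain ⟨j, hj, h⟩ := exists_zeroExp_add_eq (a := a) k
    rw [hβ, h]
    linarith [hle j (by omega)]
  have hF : ∀ s : ℂ, R' ≤ s.re → DifferentiableAt ℂ (fun u => poleFactor p a k u * (-u) ^ i) s :=
    fun s hs => (poleFactor_differentiableAt hδ1 hδ hs).mul (by fun_prop)
  obtain ⟨P, hP, hPw⟩ := rectIntegral_pole h1 h2 (neg_lt_zero.2 one_pos) one_pos (zeroLog a k)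
    (fun u => poleFactor p a k u * (-u) ^ i) (fun s hs _ _ _ => hF s hs)
  have hH := isHankel_kernel_mul_pow (N := p + 1) (b := shiftParam a) (j := k + 1) (by omega) hle i
  have hvert : Continuous fun y : ℝ =>
      (fun u => hankelKernel (p + 1) (shiftParam a) (k + 1) u * (-u) ^ i) (R' + y * Complex.I) := by
    have hne : ∀ y : ℝ, (R' + y * Complex.I : ℂ) - ((-β : ℝ) : ℂ) ≠ 0 := fun y h => by
      have := congrArg Complex.re h
      simp at this
      linarith
    have e : (fun y : ℝ =>
        (fun u => hankelKernel (p + 1) (shiftParam a) (k + 1) u * (-u) ^ i) (R' + y * Complex.I)) =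
        fun y : ℝ => (fun u => poleFactor p a k u * (-u) ^ i) (R' + y * Complex.I) *
          ((R' + y * Complex.I : ℂ) - ((-β : ℝ) : ℂ))⁻¹ ^ (zeroLog a k + 1) := by
      ext y
      dsimp only
      rw [hankelKernel_eq_poleFactor k (hne y)]
      ring
    rw [e]
    refine Continuous.mul ?_ ((Continuous.inv₀ (by fun_prop) hne).pow _)
    rw [continuous_iff_continuousAt]
    intro y
    exact ContinuousAt.comp (f := fun y : ℝ => (R' + y * Complex.I : ℂ))
      (hF (R' + y * Complex.I) (by simp)).continuousAt (by fun_prop)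
  obtain ⟨C, hC0, hC⟩ := norm_loop_le hH one_pos hvert
  refine ⟨P, fun hi => ?_, δ, ‖(2 * Real.pi * Complex.I : ℂ)⁻¹‖ * C, hδ0, by positivity,
    fun w hw => ?_⟩
  · rw [hP, hi, pow_zero, mul_one]
    exact poleFactor_ne_zero ha k
  · have hpi : (2 * Real.pi * Complex.I : ℂ) ≠ 0 := by simp [Real.pi_ne_zero, Complex.I_ne_zero]
    have h3 := loop_sub_loop (R := R') (R' := R) (hH.mul_exp w) one_pos
    have h4 : rectIntegral R' R (-1) 1 (fun u => hankelKernel (p + 1) (shiftParam a) (k + 1) u *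
        (-u) ^ i * Complex.exp (-(u * w))) = rectIntegral R' R (-1) 1 (fun s =>
        poleFactor p a k s * (-s) ^ i * Complex.exp (-(s * w)) *
          (s - ((-β : ℝ) : ℂ))⁻¹ ^ (zeroLog a k + 1)) := by
      refine rectIntegral_congr (fun s hs => ?_) (by linarith) (by norm_num)
      have hne := ne_of_mem_rectBoundary h1 h2 (neg_lt_zero.2 one_pos) one_pos hs
      rw [hankelKernel_eq_poleFactor k hne]
      ring
    rw [h4, hPw w] at h3
    have h5 : meijer (p + 1) (shiftParam a) i (k + 1) w -
        Complex.exp (β * w) * ∑ j ∈ Finset.range (zeroLog a k + 1), P j * ((-w) ^ j / j.factorial) =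
        (2 * Real.pi * Complex.I)⁻¹ * loop R' 1 1 (fun u =>
          hankelKernel (p + 1) (shiftParam a) (k + 1) u * (-u) ^ i * Complex.exp (-(u * w))) := by
      have e : -(((-β : ℝ) : ℂ) * w) = β * w := by push_cast; ring
      rw [e] at h3
      rw [meijer, ← hR, sub_eq_iff_eq_add.1 h3, mul_add, inv_mul_cancel_left₀ hpi]
      ring
    rw [h5, norm_mul]
    refine (mul_le_mul_of_nonneg_left (hC w hw) (norm_nonneg _)).trans_eq ?_
    have e : -R' * w.re = (β + δ) * w.re := by rw [hR']; ring
    rw [one_mul, e]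
    ring

end CauchyChain
end

noncomputable section
namespace CauchyChain

variable {p : ℕ} {a : ℕ → ℝ}

/-! ### The order of the entries at the origin -/

lemma norm_expSum_le (P : ℕ → ℂ) (n : ℕ) {M : ℝ} (hM : 1 ≤ M) {z : ℂ} (hz : ‖z‖ ≤ M) :
    ‖∑ j ∈ Finset.range (n + 1), P j * ((-z) ^ j / j.factorial)‖ ≤
      (∑ j ∈ Finset.range (n + 1), ‖P j‖) * M ^ n := by
  rw [Finset.sum_mul]
  refine norm_sum_le_of_le _ fun j hj => ?_
  rw [Finset.mem_range] at hj
  rw [norm_mul, norm_div, norm_pow, norm_neg, Complex.norm_natCast]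
  gcongr
  have h1 : (1 : ℝ) ≤ j.factorial := by exact_mod_cast j.factorial_pos
  calc ‖z‖ ^ j / j.factorial ≤ ‖z‖ ^ j := div_le_self (by positivity) h1
    _ ≤ M ^ j := by gcongr
    _ ≤ M ^ n := pow_le_pow_right₀ hM (by omega)

lemma le_norm_expSum (P : ℕ → ℂ) (n : ℕ) (hP : P n ≠ 0) : ∃ c T : ℝ, 0 < c ∧ ∀ z : ℂ, T ≤ ‖z‖ →
    c * ‖z‖ ^ n ≤ ‖∑ j ∈ Finset.range (n + 1), P j * ((-z) ^ j / j.factorial)‖ := by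
  set c : ℝ := ‖P n‖ / n.factorial with hc
  have hc0 : 0 < c := by have := norm_pos_iff.2 hP; positivity
  set B : ℝ := ∑ j ∈ Finset.range n, ‖P j‖ with hB
  refine ⟨c / 2, max 1 (2 * B / c), by positivity, fun z hz => ?_⟩
  have hz1 : 1 ≤ ‖z‖ := (le_max_left _ _).trans hz
  have hz2 : 2 * B / c ≤ ‖z‖ := (le_max_right _ _).trans hz
  have htop : ‖P n * ((-z) ^ n / n.factorial)‖ = c * ‖z‖ ^ n := by
    rw [norm_mul, norm_div, norm_pow, norm_neg, Complex.norm_natCast, hc]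
    ring
  have hlow : ‖∑ j ∈ Finset.range n, P j * ((-z) ^ j / j.factorial)‖ ≤ c / 2 * ‖z‖ ^ n := by
    rcases n with _ | n
    · simp only [Finset.range_zero, Finset.sum_empty, norm_zero]
      positivity
    · refine (norm_expSum_le P n hz1 le_rfl).trans ?_
      rw [← hB, pow_succ', ← mul_assoc]
      rw [div_le_iff₀ hc0] at hz2
      gcongr
      linarith
  rw [Finset.sum_range_succ]
  have := norm_sub_le_norm_add (P n * ((-z) ^ n / n.factorial))
    (∑ j ∈ Finset.range n, P j * ((-z) ^ j / j.factorial))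
  rw [htop, add_comm] at this
  linarith

lemma re_shift (ε : ℝ) (n : ℕ) (w : ℂ) : (w - ε * n * (Real.pi * Complex.I)).re = w.re := by
  rw [← Complex.ofReal_natCast, ← Complex.ofReal_mul, Complex.sub_re, Complex.re_ofReal_mul]
  simp

lemma abs_im_shift {ε : ℝ} (hε : |ε| ≤ 1) {n : ℕ} (hn : n ≤ 1) {w : ℂ} (hw : |w.im| ≤ Real.pi) :
    |(w - ε * n * (Real.pi * Complex.I)).im| ≤ 2 * Real.pi := by
  rw [← Complex.ofReal_natCast, ← Complex.ofReal_mul, Complex.sub_im, Complex.im_ofReal_mul]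
  simp only [Complex.mul_im, Complex.ofReal_re, Complex.I_im, mul_one, Complex.ofReal_im,
    Complex.I_re, mul_zero, add_zero]
  have h1 : |ε * n| ≤ 1 := by
    rw [abs_mul, Nat.abs_cast]
    exact mul_le_one₀ hε (by positivity) (by exact_mod_cast hn)
  have h2 : |ε * n * Real.pi| ≤ Real.pi := by
    rw [abs_mul, abs_of_pos Real.pi_pos]
    exact mul_le_of_le_one_left Real.pi_pos.le h1
  linarith [abs_sub w.im (ε * n * Real.pi)]

lemma entry_zero_expansion (ha : ∀ k l : ℕ, 1 ≤ k → k ≤ l → l ≤ p → -1 < partialSum a k l) {k : ℕ}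
    (hk : k ≤ p) (i : ℕ) : ∃ P : ℕ → ℂ, (i = 0 → P (zeroLog a k) ≠ 0) ∧ ∃ δ C : ℝ, 0 < δ ∧ 0 ≤ C ∧
      ∀ ε : ℝ, |ε| ≤ 1 → ∀ w : ℂ, w.re ≤ 0 → |w.im| ≤ Real.pi → ∃ z : ℂ, z.re = w.re ∧
        |z.im| ≤ 2 * Real.pi ∧ ‖entry p a ε i k w - Complex.exp (zeroExp a k * z) *
          ∑ j ∈ Finset.range (zeroLog a k + 1), P j * ((-z) ^ j / j.factorial)‖ ≤
        C * Real.exp ((zeroExp a k + δ) * w.re) := by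
  obtain ⟨P, hP, δ, C, hδ, hC, h⟩ := meijer_zero_expansion ha hk i
  have hn : normConst p (k + 1) ≠ 0 := by
    refine mul_ne_zero (pow_ne_zero _ ?_) ?_
    · simp [Real.pi_ne_zero, Complex.I_ne_zero]
    · rw [Complex.ofReal_ne_zero]
      positivity
  refine ⟨fun j => normConst p (k + 1) * P j, fun hi => mul_ne_zero hn (hP hi), δ,
    ‖normConst p (k + 1)‖ * (C * Real.exp (2 * Real.pi)), hδ, by positivity,
    fun ε hε w hw hw' => ⟨w - ε * (k % 2 : ℕ) * (Real.pi * Complex.I), re_shift _ _ _,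
      abs_im_shift hε (by omega) hw', ?_⟩⟩
  have hre := re_shift ε (k % 2) w
  have him := abs_im_shift hε (by omega : k % 2 ≤ 1) hw'
  rw [entry]
  generalize w - ε * (k % 2 : ℕ) * (Real.pi * Complex.I) = z at hre him ⊢
  have e : normConst p (k + 1) * Complex.exp (-(shiftParam a k * z)) *
      meijer (p + 1) (shiftParam a) i (k + 1) z - Complex.exp (zeroExp a k * z) *
        ∑ j ∈ Finset.range (zeroLog a k + 1),
          normConst p (k + 1) * P j * ((-z) ^ j / j.factorial) =
      normConst p (k + 1) * (Complex.exp (-(shiftParam a k * z)) *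
        (meijer (p + 1) (shiftParam a) i (k + 1) z -
          Complex.exp ((zeroExp a k + shiftParam a k : ℝ) * z) *
            ∑ j ∈ Finset.range (zeroLog a k + 1), P j * ((-z) ^ j / j.factorial))) := by
    have : Complex.exp (zeroExp a k * z) = Complex.exp (-(shiftParam a k * z)) *
        Complex.exp ((zeroExp a k + shiftParam a k : ℝ) * z) := by
      rw [← Complex.exp_add]
      congr 1
      push_cast
      ring
    rw [this]
    simp only [mul_assoc, ← Finset.mul_sum]
    ring
  have hexp : ‖Complex.exp (-(shiftParam a k * z))‖ = Real.exp (-(shiftParam a k * w.re)) := by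
    rw [Complex.norm_exp, Complex.neg_re, Complex.re_ofReal_mul, hre]
  rw [e, norm_mul, norm_mul, hexp, mul_assoc]
  refine mul_le_mul_of_nonneg_left ?_ (norm_nonneg _)
  calc Real.exp (-(shiftParam a k * w.re)) * _
      ≤ Real.exp (-(shiftParam a k * w.re)) * (C * Real.exp (2 * Real.pi) *
        Real.exp ((zeroExp a k + shiftParam a k + δ) * w.re)) := by
        refine mul_le_mul_of_nonneg_left ((h z (by rw [hre]; exact hw)).trans ?_)
          (Real.exp_pos _).le
        rw [hre]
        gcongr
    _ = C * Real.exp (2 * Real.pi) * (Real.exp (-(shiftParam a k * w.re)) *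
        Real.exp ((zeroExp a k + shiftParam a k + δ) * w.re)) := by ring
    _ = _ := by rw [← Real.exp_add]; ring_nf

lemma norm_exp_ofReal_mul (α : ℝ) (z : ℂ) : ‖Complex.exp (α * z)‖ = Real.exp (α * z.re) := by
  rw [Complex.norm_exp, Complex.re_ofReal_mul]

lemma entry_zero_upper (ha : ∀ k l : ℕ, 1 ≤ k → k ≤ l → l ≤ p → -1 < partialSum a k l) {k : ℕ}
    (hk : k ≤ p) (i : ℕ) : ∃ C : ℝ, 0 ≤ C ∧ ∀ ε : ℝ, |ε| ≤ 1 → ∀ w : ℂ, w.re ≤ 0 →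
      |w.im| ≤ Real.pi →
      ‖entry p a ε i k w‖ ≤ C * (Real.exp (zeroExp a k * w.re) * (1 - w.re) ^ zeroLog a k) := by
  obtain ⟨P, -, δ, C, hδ, hC, h⟩ := entry_zero_expansion ha hk i
  set B := ∑ j ∈ Finset.range (zeroLog a k + 1), ‖P j‖
  have hB : 0 ≤ B := Finset.sum_nonneg fun _ _ => norm_nonneg _
  refine ⟨B * (2 * Real.pi) ^ zeroLog a k + C, by positivity, fun ε hε w hw hw' => ?_⟩
  obtain ⟨z, hre, him, hz⟩ := h ε hε w hw hw'
  have hpi := Real.pi_gt_three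
  have hL : 1 ≤ 1 - w.re := by linarith
  have hzn : ‖z‖ ≤ 2 * Real.pi * (1 - w.re) := by
    have := Complex.norm_le_abs_re_add_abs_im z
    rw [hre, abs_of_nonpos hw] at this
    nlinarith
  have h1 := norm_expSum_le P (zeroLog a k) (by nlinarith) hzn
  have h2 : ‖entry p a ε i k w‖ ≤ _ := norm_le_of_mem_closedBall (mem_closedBall_iff_norm.2 hz)
  have h3 : Real.exp ((zeroExp a k + δ) * w.re) ≤
      Real.exp (zeroExp a k * w.re) * (1 - w.re) ^ zeroLog a k := by
    refine (Real.exp_le_exp.2 ?_).trans (le_mul_of_one_le_right (Real.exp_pos _).le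
      (one_le_pow₀ hL))
    nlinarith [mul_nonneg hδ.le (neg_nonneg.2 hw)]
  rw [norm_mul, norm_exp_ofReal_mul, hre] at h2
  calc ‖entry p a ε i k w‖ ≤ _ := h2
    _ ≤ Real.exp (zeroExp a k * w.re) * (B * (2 * Real.pi * (1 - w.re)) ^ zeroLog a k) +
        C * (Real.exp (zeroExp a k * w.re) * (1 - w.re) ^ zeroLog a k) := by gcongr
    _ = _ := by rw [mul_pow]; ring

/-- Only the first row is bounded below: for i ≥ 1 the factor (-u)^i may vanish at the pole and
destroy the leading term. -/
lemma entry_zero_lower (ha : ∀ k l : ℕ, 1 ≤ k → k ≤ l → l ≤ p → -1 < partialSum a k l) {k : ℕ}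
    (hk : k ≤ p) : ∃ c T : ℝ, 0 < c ∧ ∀ ε : ℝ, |ε| ≤ 1 → ∀ w : ℂ, w.re ≤ -T →
      w.re ≤ 0 → |w.im| ≤ Real.pi →
      c * (Real.exp (zeroExp a k * w.re) * (1 - w.re) ^ zeroLog a k) ≤ ‖entry p a ε 0 k w‖ := by
  obtain ⟨P, hP, δ, C, hδ, hC, h⟩ := entry_zero_expansion ha hk 0
  obtain ⟨c, T, hc, hlow⟩ := le_norm_expSum P _ (hP rfl)
  -- Beyond 2C/(cδ) the error is at most half of the main term, since t e^{-t} ≤ 1. Beyond 1 one has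
  -- 1 - Re w ≤ 2|z|, which explains the power of 1/2.
  refine ⟨c / 2 * (1 / 2) ^ zeroLog a k, max (max 1 T) (2 * C / (c * δ)), by positivity,
    fun ε hε w hT hw hw' => ?_⟩
  obtain ⟨z, hre, him, hz⟩ := h ε hε w hw hw'
  have hm1 := le_max_left (max 1 T) (2 * C / (c * δ))
  have hm2 := le_max_right (max 1 T) (2 * C / (c * δ))
  have hm3 := le_max_left 1 T
  have hm4 := le_max_right 1 T
  have hzn : -w.re ≤ ‖z‖ := by
    have := Complex.abs_re_le_norm z
    rwa [hre, abs_of_nonpos hw] at this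
  have h1 := hlow z (by linarith)
  have h2 : C * Real.exp (δ * w.re) ≤ c / 2 * ‖z‖ ^ zeroLog a k := by
    have h3 : (1 : ℝ) ≤ ‖z‖ ^ zeroLog a k := one_le_pow₀ (by linarith)
    have h4 : 2 * C / (c * δ) ≤ -w.re := by linarith
    rw [div_le_iff₀ (by positivity)] at h4
    have h5 : Real.exp (δ * w.re) * (-(δ * w.re)) ≤ 1 := by
      have := Real.add_one_le_exp (-(δ * w.re))
      calc Real.exp (δ * w.re) * (-(δ * w.re)) ≤
          Real.exp (δ * w.re) * Real.exp (-(δ * w.re)) := by gcongr; linarith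
        _ = 1 := by rw [← Real.exp_add]; simp
    have h6 : C ≤ c / 2 * (-(δ * w.re)) := by nlinarith
    calc C * Real.exp (δ * w.re) ≤ c / 2 * (-(δ * w.re)) * Real.exp (δ * w.re) := by gcongr
      _ = c / 2 * (Real.exp (δ * w.re) * (-(δ * w.re))) := by ring
      _ ≤ c / 2 * 1 := by gcongr
      _ ≤ c / 2 * ‖z‖ ^ zeroLog a k := by gcongr
  have h7 : (1 / 2 : ℝ) ^ zeroLog a k * (1 - w.re) ^ zeroLog a k ≤ ‖z‖ ^ zeroLog a k := by
    rw [← mul_pow]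
    exact pow_le_pow_left₀ (by linarith) (by linarith) _
  have h8 := norm_sub_norm_le (Complex.exp (zeroExp a k * z) *
    ∑ j ∈ Finset.range (zeroLog a k + 1), P j * ((-z) ^ j / j.factorial)) (entry p a ε 0 k w)
  rw [norm_sub_rev, norm_mul, norm_exp_ofReal_mul, hre] at h8
  have h9 : Real.exp ((zeroExp a k + δ) * w.re) =
      Real.exp (zeroExp a k * w.re) * Real.exp (δ * w.re) := by
    rw [← Real.exp_add]; ring_nf
  rw [h9] at hz
  have he := Real.exp_pos (zeroExp a k * w.re)
  calc _ = Real.exp (zeroExp a k * w.re) *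
        (c / 2 * ((1 / 2 : ℝ) ^ zeroLog a k * (1 - w.re) ^ zeroLog a k)) := by ring
    _ ≤ Real.exp (zeroExp a k * w.re) * (c / 2 * ‖z‖ ^ zeroLog a k) := by gcongr
    _ = Real.exp (zeroExp a k * w.re) * (c * ‖z‖ ^ zeroLog a k) -
        Real.exp (zeroExp a k * w.re) * (c / 2 * ‖z‖ ^ zeroLog a k) := by ring
    _ ≤ Real.exp (zeroExp a k * w.re) *
          ‖∑ j ∈ Finset.range (zeroLog a k + 1), P j * ((-z) ^ j / j.factorial)‖ -
        Real.exp (zeroExp a k * w.re) * (C * Real.exp (δ * w.re)) := by gcongr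
    _ ≤ ‖entry p a ε 0 k w‖ := by linarith

/-! ### The columns at the origin -/

lemma bareParametrix_topBottom {R h : ℝ} (hR : 0 < R) (hh : 0 < h)
    (hL : ∀ k l : ℕ, 1 ≤ k → k ≤ l → l ≤ p → -partialSum a k l < R) {ζ : ℂ}
    (hζ : ζ ∈ topBottom) : ∃ ε : ℝ, |ε| ≤ 1 ∧ ∀ i k : Fin (p + 1),
      bareParametrix p a R h ζ i k = entry p a ε i k (Complex.log ζ) := by
  obtain ⟨h1, h2⟩ := hζ
  rcases le_total 0 ζ.arg with h0 | h0
  · rw [abs_of_nonneg h0] at h1 h2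
    refine ⟨1, by simp, fun i k => ?_⟩
    rw [bareParametrix_sector_top hR hh hL h1 h2 1]
    exact sectorEntry_zero
  · rw [abs_of_nonpos h0] at h1 h2
    refine ⟨-1, by simp, fun i k => ?_⟩
    rw [bareParametrix_sector_bottom hR hh hL (by linarith) (by linarith) 1]
    exact sectorEntry_zero

lemma logRate_norm (c : ℝ) (n : ℕ) {ζ : ℂ} (hζ : ζ ≠ 0) : logRate c n ‖ζ‖ =
    Real.exp (c * (Complex.log ζ).re) * (1 - (Complex.log ζ).re) ^ n := by
  rw [logRate, Complex.log_re, Real.rpow_def_of_pos (norm_pos_iff.2 hζ), mul_comm c]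

lemma eventually_topBottom {T : ℝ} : ∀ᶠ ζ in 𝓝[topBottom] (0 : ℂ), ζ ∈ topBottom ∧ ζ ≠ 0 ∧
    ‖ζ‖ ≤ 1 ∧ (Complex.log ζ).re ≤ 0 ∧ (Complex.log ζ).re ≤ -T := by
  have h1 : ∀ᶠ ζ in 𝓝 (0 : ℂ), ‖ζ‖ < min 1 (Real.exp (-T)) := by
    filter_upwards [Metric.ball_mem_nhds (0 : ℂ) (lt_min one_pos (Real.exp_pos (-T)))] with ζ hζ
    rwa [mem_ball_zero_iff] at hζ
  filter_upwards [self_mem_nhdsWithin, nhdsWithin_le_nhds h1] with ζ hζ hn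
  have h0 : ζ ≠ 0 := by
    rintro rfl
    have := hζ.1
    rw [Complex.arg_zero, abs_zero] at this
    linarith [Real.pi_pos]
  have hp := norm_pos_iff.2 h0
  rw [lt_min_iff] at hn
  refine ⟨hζ, h0, hn.1.le, ?_, ?_⟩
  · rw [Complex.log_re]
    exact Real.log_nonpos hp.le hn.1.le
  · rw [Complex.log_re, Real.log_le_iff_le_exp hp]
    exact hn.2.le

lemma col_isBigO (ha : ∀ k l : ℕ, 1 ≤ k → k ≤ l → l ≤ p → -1 < partialSum a k l) {R h : ℝ}
    (hR : 0 < R) (hh : 0 < h) (hL : ∀ k l : ℕ, 1 ≤ k → k ≤ l → l ≤ p → -partialSum a k l < R)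
    (k : Fin (p + 1)) : (fun ζ => (bareParametrix p a R h ζ).col k) =O[𝓝[topBottom] 0]
      fun ζ => logRate (zeroExp a k) (zeroLog a k) ‖ζ‖ := by
  rw [isBigO_pi]
  intro i
  obtain ⟨C, -, hC⟩ := entry_zero_upper ha (by omega : (k : ℕ) ≤ p) i
  refine IsBigO.of_bound C ?_
  filter_upwards [eventually_topBottom (T := 0)] with ζ ⟨hζ, h0, h1, h2, _⟩
  obtain ⟨ε, hε, he⟩ := bareParametrix_topBottom hR hh hL hζ
  rw [Real.norm_of_nonneg (logRate_pos (norm_pos_iff.2 h0) h1).le, logRate_norm _ _ h0,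
    Matrix.col_apply, he]
  exact hC ε hε _ h2 (by rw [Complex.log_im]; exact Complex.abs_arg_le_pi ζ)

lemma isBigO_col (ha : ∀ k l : ℕ, 1 ≤ k → k ≤ l → l ≤ p → -1 < partialSum a k l) {R h : ℝ}
    (hR : 0 < R) (hh : 0 < h) (hL : ∀ k l : ℕ, 1 ≤ k → k ≤ l → l ≤ p → -partialSum a k l < R)
    (k : Fin (p + 1)) : (fun ζ : ℂ => logRate (zeroExp a k) (zeroLog a k) ‖ζ‖) =O[𝓝[topBottom] 0]
      fun ζ => (bareParametrix p a R h ζ).col k := by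
  obtain ⟨c, T, hc, hlow⟩ := entry_zero_lower ha (by omega : (k : ℕ) ≤ p)
  refine IsBigO.of_bound c⁻¹ ?_
  filter_upwards [eventually_topBottom (T := T)] with ζ ⟨hζ, h0, h1, h2, h3⟩
  obtain ⟨ε, hε, he⟩ := bareParametrix_topBottom hR hh hL hζ
  rw [Real.norm_of_nonneg (logRate_pos (norm_pos_iff.2 h0) h1).le, logRate_norm _ _ h0,
    le_inv_mul_iff₀ hc]
  refine (hlow ε hε _ h3 h2 (by rw [Complex.log_im]; exact Complex.abs_arg_le_pi ζ)).trans ?_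
  -- The norm of a column is at least that of its first entry, the only one with a lower bound.
  have := norm_le_pi_norm ((bareParametrix p a R h ζ).col k) 0
  rwa [Matrix.col_apply, he] at this

lemma cauchyTransform_isTheta (ha : ∀ k l : ℕ, 1 ≤ k → k ≤ l → l ≤ p → -1 < partialSum a k l)
    {l : ℕ} (hl0 : l ≠ 0) (hl : l ≤ p) : cauchyTransform a l =Θ[𝓝[topBottom] 0]
      fun ζ : ℂ => logRate (zeroExp a l) (zeroLog a l) ‖ζ‖ := by
  obtain ⟨c₁, c₂, h1, h2, hb⟩ := cauchyTransform_order ha hl0 hl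
  constructor
  · refine IsBigO.of_bound c₂ ?_
    filter_upwards [eventually_topBottom (T := 0)] with ζ ⟨hζ, h0, h3, _⟩
    rw [Real.norm_of_nonneg (logRate_pos (norm_pos_iff.2 h0) h3).le]
    exact (hb ζ hζ h3).2
  · refine IsBigO.of_bound c₁⁻¹ ?_
    filter_upwards [eventually_topBottom (T := 0)] with ζ ⟨hζ, h0, h3, _⟩
    rw [Real.norm_of_nonneg (logRate_pos (norm_pos_iff.2 h0) h3).le, le_inv_mul_iff₀ h1]
    exact (hb ζ hζ h3).1

theorem bareParametrix_zero_first
    (ha : ∀ k l : ℕ, 1 ≤ k → k ≤ l → l ≤ p → -1 < partialSum a k l) {R h : ℝ}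
    (hR : 0 < R) (hh : 0 < h) (hL : ∀ k l : ℕ, 1 ≤ k → k ≤ l → l ≤ p → -partialSum a k l < R) :
    (fun ζ => (bareParametrix p a R h ζ).col 0) =O[𝓝[topBottom] 0] fun _ => (1 : ℝ) := by
  refine (col_isBigO ha hR hh hL 0).congr_right fun ζ => ?_
  rw [Fin.val_zero, zeroExp, zeroLog, logRate, Real.rpow_zero, pow_zero, mul_one]

theorem bareParametrix_zero_other
    (ha : ∀ k l : ℕ, 1 ≤ k → k ≤ l → l ≤ p → -1 < partialSum a k l) {R h : ℝ}
    (hR : 0 < R) (hh : 0 < h) (hL : ∀ k l : ℕ, 1 ≤ k → k ≤ l → l ≤ p → -partialSum a k l < R)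
    (k : Fin (p + 1)) (hk : k ≠ 0) :
    (fun ζ => (bareParametrix p a R h ζ).col k) =Θ[𝓝[topBottom] 0] cauchyTransform a k :=
  IsTheta.trans ⟨col_isBigO ha hR hh hL k, isBigO_col ha hR hh hL k⟩
    (cauchyTransform_isTheta ha (Fin.val_ne_zero_iff.2 hk) (by omega)).symm

end CauchyChain
end

/-! ### Assembly of the theorem -/

theorem mainTheorem4 (p : ℕ) (hp : 2 ≤ p) (a A : ℕ → ℝ)
    (ha : ∀ k l : ℕ, 1 ≤ k → k ≤ l → l ≤ p → -1 < CauchyChain.partialSum a k l)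
    (hA : ∀ j : ℕ, 1 ≤ j → j ≤ p → A (j + 1) - A j = (p + 1) * a j)
    (hA0 : ∑ j ∈ Finset.Icc 1 (p + 1), A j = 0)
    (R h : ℝ) (hR : 0 < R) (hh : 0 < h)
    (hL : ∀ k l : ℕ, 1 ≤ k → k ≤ l → l ≤ p → -CauchyChain.partialSum a k l < R) :
    (∀ j : ℕ, 1 ≤ j → j ≤ p + 1 → ∀ ε : ℝ, ε = 1 ∨ ε = -1 →
      (∀ ζ ∈ Complex.slitPlane, CauchyChain.LoopIntegrable R h (CauchyChain.kernel p a j ε ζ)) ∧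
      DifferentiableOn ℂ (CauchyChain.gFun p a R h j ε) Complex.slitPlane) ∧
    CauchyChain.IsBareSolution p a A (CauchyChain.bareParametrix p a R h) := by
  have hp0 : p ≠ 0 := by omega
  have hA' : ∀ k ≤ p, A (k + 1) = ∑ l ∈ Finset.range (p + 1), CauchyChain.shiftParam a l -
      (p + 1) * CauchyChain.shiftParam a k := fun k hk => CauchyChain.exponent_eq hA hA0 hk
  refine ⟨fun j hj hjp ε _ => ?_, ?_⟩
  · obtain ⟨k, rfl⟩ : ∃ k, j = k + 1 := ⟨j - 1, by omega⟩
    have hk : k ≤ p := by omega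
    refine ⟨fun ζ hζ => ?_, fun ζ hζ => ?_⟩
    · obtain ⟨R₀, h1, h2⟩ := CauchyChain.kernel_isHankel hR hL hk ε (Complex.slitPlane_ne_zero hζ)
      exact h2.loopIntegrable h1 hh
    · have h1 : DifferentiableAt ℂ (fun z => CauchyChain.entry p a ε 0 k (Complex.log z)) ζ :=
        (CauchyChain.entry_differentiable hk ε 0).differentiableAt.comp ζ
          (Complex.differentiableAt_log hζ)
      refine h1.differentiableWithinAt.congr (fun z hz => ?_) ?_
      · exact CauchyChain.gFun_eq hR hh hL hk ε (Complex.slitPlane_ne_zero hz)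
      · exact CauchyChain.gFun_eq hR hh hL hk ε (Complex.slitPlane_ne_zero hζ)
  · exact
      { analytic := CauchyChain.bareParametrix_differentiableOn hR hh hL
        jump := CauchyChain.bareParametrix_hasJump hR hh hL
        zero_first := CauchyChain.bareParametrix_zero_first ha hR hh hL
        zero_other := CauchyChain.bareParametrix_zero_other ha hR hh hL
        infinity_plus := CauchyChain.hasAsymptotics_plus hp0 hR hh hL hA'
        infinity_minus := CauchyChain.hasAsymptotics_minus hp0 hR hh hL hA' }
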